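/- Let $s>\frac12$, $0<\gamma<1$, and fix a sign $\pm$; all signs $\pm,\mp$ below correspond to this choice. Write $\|\{a_k\}\|_{l^{2,s}}^2=\sum_{k\in\mathbb Z}(1+|k|)^{2s}|a_k|^2$, and, for $t>0$, $e^{it\Delta}\delta_k(x)=\frac{e^{i(x-k)^2/4t}}{\sqrt{4\pi i t}}$. (i) Let $\{\alpha_k\}\in l^{2,s}$ and $M=\sum_{k\in\mathbb Z}|\alpha_k|^2$. There is $T>0$ such that the equation $$i\partial_t u+\Delta u\pm\tfrac12\Big(|u|^2-\frac{M}{2\pi t}\Big)u=0$$ has, in the sense of distributions on $(0,T)\times\mathbb R$, a unique solution of the form $$u(t,x)=\sum_{k\in\mathbb Z}e^{\mp i\frac{|\alpha_k|^2}{4\pi}\log\sqrt t}\,(\alpha_k+R_k(t))\,e^{it\Delta}\delta_k(x)$$ with $\{R_k\}\in C^1((0,T),l^{2,s})$ and $$\sup_{0<t<T}\Big(t^{-\gamma}\|\{R_k(t)\}\|_{l^{2,s}}+t\,\|\{\partial_tR_k(t)\}\|_{l^{2,s}}\Big)<\infty .$$ Uniqueness (of $u$ and of $\{R_k\}$) holds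 on $(0,T)$ for every $T>0$. If $s\ge1$ the solution is global: there is such a solution $u$ on $(0,\infty)$, the supremum over $(0,T)$ being finite for every $T<\infty$. (ii) Denote by $H^s_{pF}$ the space of the $v\in\mathcal S'(\mathbb R)$ whose Fourier transform $\hat v(\xi)=\int e^{-ix\xi}v(x)\,dx$ is a $2\pi$-periodic function of class $H^s(\mathbb R/2\pi\mathbb Z)$, that is, $\hat v(\xi)=\sum_k c_ke^{-ik\xi}$ with $\{c_k\}\in l^{2,s}$, and let $\|v\|_{H^s_{pF}}=\|\{c_k\}\|_{l^{2,s}}$. Let $u_0=\sum_{k\in S}\alpha_k\delta_k$ with $S\subset\mathbb Z$ finite, $N=|S|$, $|\alpha_k|=a$ for all $k\in S$, and let $M=(N-\frac12)a^2$. There are $T>0$ and a unique $u:(-T,T)\to\mathcal S'(\mathbb R)$ such that $\widehat{e^{-it\Delta}u(t)}$ belongs to $C((-T,T),H^s(\mathbb R/2\pi\mathbb Z))\cap C^1((-T,T)\setminus\{0\},H^s(\mathbb R/2\pi\mathbb Z))$ (so that $u(t)$ is a bounded continuous function for $t\ne0$) and, for all $t\in(-T,T)$, $$u(t)=e^{it\Delta}u_0\pm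 i\,e^{it\Delta}\int_0^te^{-i\tau\Delta}\Big(\Big(|u(\tau)|^2-\frac{M}{2\pi|\tau|}\Big)u(\tau)\Big)\frac{d\tau}2 ,$$ where the integral is improper at $\tau=0$ and converges in $\mathcal S'(\mathbb R)$. Moreover there is $C$ with $$\|e^{-it\Delta}u(t)-u_0\|_{H^s_{pF}}\le C|t|^\gamma\qquad\text{for all } t\in(-T,T).$$ Uniqueness holds on $(-T,T)$ for every $T>0$. If $s\ge1$ the solution is global: there is such a $u$ on $\mathbb R$, the last bound holding on $(-T,T)$ for every $T<\infty$ with a constant $C=C_T$. -/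

import Mathlib

open scoped SchwartzMap FourierTransform ContDiff
open Set Filter Topology MeasureTheory

noncomputable section

namespace DiracNLS

/-! ### Weighted sequence spaces -/

/-- `a ∈ l^{2,s}`, i.e. `∑ₖ (1 + |k|)^{2s} |aₖ|² < ∞`. -/
def MemL2s (s : ℝ) (a : ℤ → ℂ) : Prop :=
  Summable fun k : ℤ => (1 + |(k : ℝ)|) ^ (2 * s) * ‖a k‖ ^ 2

/-- The norm of `l^{2,s}`: `(∑ₖ (1 + |k|)^{2s} |aₖ|²)^{1/2}`. -/
def l2sNorm (s : ℝ) (a : ℤ → ℂ) : ℝ :=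
  √(∑' k : ℤ, (1 + |(k : ℝ)|) ^ (2 * s) * ‖a k‖ ^ 2)

/-- The curve of sequences `t ↦ R t` is of class `C^n` on `I` with values in `l^{2,s}`.
The map `(aₖ) ↦ ((1 + |k|)^s aₖ)` is an isometric isomorphism of `l^{2,s}` onto `l²`. -/
def IsL2sCurve (n : ℕ) (s : ℝ) (R : ℝ → ℤ → ℂ) (I : Set ℝ) : Prop :=
  ∃ r : ℝ → lp (fun _ : ℤ => ℂ) 2, ContDiffOn ℝ (n : ℕ∞) r I ∧
    ∀ t ∈ I, ∀ k : ℤ, r t k = (((1 + |(k : ℝ)|) ^ s : ℝ) : ℂ) * R t k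

/-! ### The ansatz for general coefficients -/

/-- The function `e^{itΔ}δ_k (x) = e^{i (x - k)² / (4t)} / √(4 π i t)`, `t > 0`. -/
def diracEvolution (k : ℤ) (t x : ℝ) : ℂ :=
  Complex.exp (Complex.I * (x - k) ^ 2 / (4 * t)) /
    (4 * Real.pi * Complex.I * t : ℂ) ^ (1 / 2 : ℂ)

/-- The ansatz `∑ₖ e^{-iσ (|αₖ|²/4π) log √t} (αₖ + Rₖ(t)) e^{itΔ}δ_k (x)`. -/
def ansatz (σ : ℝ) (α : ℤ → ℂ) (R : ℝ → ℤ → ℂ) (t x : ℝ) : ℂ :=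
  ∑' k : ℤ, Complex.exp (-(σ * Complex.I * (‖α k‖ ^ 2 / (4 * Real.pi)) * Real.log √t)) *
    (α k + R t k) * diracEvolution k t x

/-- `u`, continuous on `(0,T) × ℝ`, solves `i ∂ₜu + Δu + (σ/2) (|u|² - M/(2πt)) u = 0` on
`(0,T) × ℝ` in the sense of distributions. -/
def IsDistributionalSolution (σ M T : ℝ) (u : ℝ → ℝ → ℂ) : Prop :=
  ContinuousOn (Function.uncurry u) (Ioo 0 T ×ˢ univ) ∧
  ∀ φ : ℝ → ℝ → ℂ, ContDiff ℝ ∞ (Function.uncurry φ) →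
    HasCompactSupport (Function.uncurry φ) →
    tsupport (Function.uncurry φ) ⊆ Ioo 0 T ×ˢ univ →
    ∫ p : ℝ × ℝ,
      (u p.1 p.2 * (-(Complex.I * deriv (fun t => φ t p.2) p.1) + iteratedDeriv 2 (φ p.1) p.2) +
        (σ / 2) * (‖u p.1 p.2‖ ^ 2 - M / (2 * Real.pi * p.1)) * u p.1 p.2 * φ p.1 p.2) = 0

/-- `u` solves the equation with `M = ∑ₖ |αₖ|²` on `(0,T)`, and has there the form of the
ansatz, with remainder `R ∈ C¹((0,T); l^{2,s})` such that
`t^{-γ} ‖R(t)‖_{l^{2,s}} + t ‖∂ₜR(t)‖_{l^{2,s}}` is bounded on `(0,T)`. -/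
structure IsAnsatzSolution (s γ σ : ℝ) (α : ℤ → ℂ) (T : ℝ) (u : ℝ → ℝ → ℂ) (R : ℝ → ℤ → ℂ) :
    Prop where
  solves : IsDistributionalSolution σ (∑' k : ℤ, ‖α k‖ ^ 2) T u
  eq_ansatz : ∀ t ∈ Ioo 0 T, ∀ x, u t x = ansatz σ α R t x
  regular : IsL2sCurve 1 s R (Ioo 0 T)
  bounded : ∃ C : ℝ, ∀ t ∈ Ioo 0 T,
    t ^ (-γ) * l2sNorm s (R t) + t * l2sNorm s (fun k => deriv (fun τ => R τ k) t) ≤ C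

/-! ### The Schrödinger group and the space `H^s_{pF}` -/

/-- The symbol of `e^{itΔ}` in the normalization `𝓕 f (ξ) = ∫ e^{-2πixξ} f(x) dx`, in which `Δ`
is the multiplier `-(2πξ)²`. -/
def schrodingerSymbol (t ξ : ℝ) : ℂ :=
  Complex.exp (((-(t * (2 * Real.pi * ξ) ^ 2) : ℝ) : ℂ) * Complex.I)

/-- The symbol and all its derivatives grow at most polynomially, so that it is a Fourier
multiplier on tempered distributions. -/
theorem schrodingerSymbol_hasTemperateGrowth (t : ℝ) :
    (schrodingerSymbol t).HasTemperateGrowth := by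
  have key : Function.HasTemperateGrowth
      (fun x : ℝ => Complex.exp ((x : ℂ) * Complex.I)) := by
    have hit : ∀ n : ℕ, iteratedDeriv n (fun x : ℝ => Complex.exp ((x : ℂ) * Complex.I)) =
        fun x : ℝ => Complex.I ^ n * Complex.exp ((x : ℂ) * Complex.I) := by
      intro n
      induction n with
      | zero => simp
      | succ n ih =>
        rw [iteratedDeriv_succ, ih]
        funext x
        have h1 : HasDerivAt (fun x : ℝ => (x : ℂ) * Complex.I) (1 * Complex.I) x :=
          (Complex.ofRealCLM.hasDerivAt (x := x)).mul_const Complex.I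
        have h2 := (h1.cexp).const_mul (Complex.I ^ n)
        rw [h2.deriv]
        ring
    refine ⟨?_, fun n => ⟨0, 1, fun x => ?_⟩⟩
    · exact (Complex.ofRealCLM.contDiff.mul contDiff_const).cexp
    · rw [norm_iteratedFDeriv_eq_norm_iteratedDeriv, hit]
      simp [Complex.norm_exp_ofReal_mul_I]
  have hp : Function.HasTemperateGrowth
      (fun ξ : ℝ => -(t * (2 * Real.pi * ξ) ^ 2)) := by
    have hid : Function.HasTemperateGrowth (fun ξ : ℝ => ξ) := Function.HasTemperateGrowth.id'
    exact ((Function.HasTemperateGrowth.const t).mul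
      (((Function.HasTemperateGrowth.const (2 * Real.pi)).mul hid).pow 2)).neg
  exact key.comp hp

/-- The Schrödinger group `e^{itΔ}` on tempered distributions. -/
def schrodingerGroup (t : ℝ) : 𝓢'(ℝ, ℂ) →L[ℂ] 𝓢'(ℝ, ℂ) :=
  TemperedDistribution.fourierMultiplierCLM ℂ (schrodingerSymbol t)

/-- The Fourier coefficient `cₖ = (1/2π) ∫₀^{2π} g(ξ) e^{ikξ} dξ` of a `2π`-periodic function,
with the sign for which `g(ξ) = ∑ₖ cₖ e^{-ikξ}`. -/
def coeff (g : ℝ → ℂ) (k : ℤ) : ℂ :=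
  (1 / (2 * Real.pi)) * ∫ ξ in (0 : ℝ)..2 * Real.pi, g ξ * Complex.exp (Complex.I * k * ξ)

/-- `v ∈ H^s_{pF}`, and `g` is its Fourier transform `v̂(ξ) = ∫ e^{-ixξ} v(x) dx`: it is a
`2π`-periodic function in `L²(0,2π)` whose Fourier coefficients belong to `l^{2,s}`. As
`v̂(2πξ)` is the Fourier transform with kernel `e^{-2πixξ}`, the latter appears in `fourier_eq`.
The norm of `v` in `H^s_{pF}` is `l2sNorm s (coeff g)`. -/
structure IsHsPF (s : ℝ) (v : 𝓢'(ℝ, ℂ)) (g : ℝ → ℂ) : Prop where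
  periodic : Function.Periodic g (2 * Real.pi)
  memLp : MemLp g 2 (volume.restrict (Ioc 0 (2 * Real.pi)))
  memL2s : MemL2s s (coeff g)
  fourier_eq : ∀ φ : 𝓢(ℝ, ℂ), (𝓕 v) φ = ∫ ξ : ℝ, g (2 * Real.pi * ξ) * φ ξ

/-- `v ∈ H^s_{pF}` with `‖v‖_{H^s_{pF}} ≤ c`. -/
def HsPFNormLE (s : ℝ) (v : 𝓢'(ℝ, ℂ)) (c : ℝ) : Prop :=
  ∃ g : ℝ → ℂ, IsHsPF s v g ∧ l2sNorm s (coeff g) ≤ c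

/-! ### The Duhamel formulation -/

/-- The tempered distribution `v` is given by the bounded continuous function `f`. -/
def IsGivenBy (v : 𝓢'(ℝ, ℂ)) (f : ℝ → ℂ) : Prop :=
  Continuous f ∧ (∃ B : ℝ, ∀ x, ‖f x‖ ≤ B) ∧ ∀ φ : 𝓢(ℝ, ℂ), v φ = ∫ x : ℝ, f x * φ x

/-- `D = ∫₀ᵗ F(τ) dτ`, as an integral of tempered distributions that is improper at `τ = 0`:
the limit of `∫_{εt}^t F(τ) dτ` as `ε → 0⁺`, tested against Schwartz functions. -/
def IsImproperIntegral (F : ℝ → 𝓢'(ℝ, ℂ)) (t : ℝ) (D : 𝓢'(ℝ, ℂ)) : Prop :=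
  ∀ φ : 𝓢(ℝ, ℂ),
    (∀ ε ∈ Ioo (0 : ℝ) 1, IntervalIntegrable (fun τ => F τ φ) volume (ε * t) t) ∧
    Tendsto (fun ε : ℝ => ∫ τ in (ε * t)..t, F τ φ) (𝓝[>] 0) (𝓝 (D φ))

/-- `u` is a solution on `(-T,T)` of
`u(t) = e^{itΔ}u₀ + σ i e^{itΔ} ∫₀ᵗ e^{-iτΔ} ((|u(τ)|² - M/(2π|τ|)) u(τ)) dτ/2`,
such that the Fourier transform of `e^{-itΔ}u(t)` is a continuous curve on `(-T,T)`, and a `C¹`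
curve on `(-T,T) \ {0}`, in the space of `2π`-periodic `H^s` functions. Here `U τ` is the function
that gives `u τ`, and `G τ` is the distribution `(|u(τ)|² - M/(2π|τ|)) u(τ)`. -/
structure IsDuhamelSolution (s σ M T : ℝ) (u₀ : 𝓢'(ℝ, ℂ)) (u : ℝ → 𝓢'(ℝ, ℂ)) : Prop where
  duhamel : ∃ (U : ℝ → ℝ → ℂ) (G D : ℝ → 𝓢'(ℝ, ℂ)),
    (∀ τ ∈ Ioo (-T) T \ {0}, IsGivenBy (u τ) (U τ) ∧
      IsGivenBy (G τ) fun x => (‖U τ x‖ ^ 2 - M / (2 * Real.pi * |τ|)) * U τ x) ∧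
    ∀ t ∈ Ioo (-T) T,
      IsImproperIntegral (fun τ => schrodingerGroup (-τ) (G τ)) t (D t) ∧
      u t = schrodingerGroup t u₀ + (σ * Complex.I / 2) • schrodingerGroup t (D t)
  regular : ∃ g : ℝ → ℝ → ℂ,
    (∀ t ∈ Ioo (-T) T, IsHsPF s (schrodingerGroup (-t) (u t)) (g t)) ∧
    IsL2sCurve 0 s (fun t => coeff (g t)) (Ioo (-T) T) ∧
    IsL2sCurve 1 s (fun t => coeff (g t)) (Ioo (-T) T \ {0})

/-- The finite sum of Dirac masses `∑_{k ∈ S} αₖ δ_k`. -/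
def diracSum (S : Finset ℤ) (α : ℤ → ℂ) : 𝓢'(ℝ, ℂ) :=
  ∑ k ∈ S, α k • TemperedDistribution.delta (k : ℝ)

end DiracNLS

end

/-! Write `u(t) = ∑ A_k(t) e^{itΔ}δ_k`. A product of two such waves and one conjugate wave is again
such a wave times `e^{iω/4t}/(4π|t|)`, where `ω = i² - l² + j² - k²` and `k = i - l + j`. The
equation is therefore equivalent to an ordinary differential equation for the sequence `A` in
`l^{2,s}`, namely `A' = (ic/|t|)(T_t(A,A,A) - 2MA)` with `c = σ/(8π)`. For `s > 1/2` one has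
`l^{2,s} ⊂ l¹`, so `T_t` is bounded by Young's inequality. The whole difficulty is the
non-integrable factor `1/t` at the initial time.

The resonant interactions `ω = 0` are those with `i = k` or `j = k`, and they add up to `(2 mass -
|A_k|²) A_k`. The mass is conserved. With `M = mass` there remains `-|A_k|² A_k`, which makes `A_k`
rotate like `e^{-ic|α_k|² log t}`; this is the logarithmic phase of the ansatz. In the gauge that
removes it, the unknown `a` satisfies `t a_k' = ic(nonresonant sum - (|a_k|² - |α_k|²) a_k)`.
Nonresonant integer frequencies have `|ω| ≥ 2`, so integration by parts in time (the normal form `b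
= a - ict ν(t,a)`) removes their `1/t`. The remaining singular term is a real multiple of `i a_k`:
it rotates `a_k` without changing its modulus to leading order. So `|b_k|²` has bounded derivative,
`|a_k|² - |α_k|² = O(t)`, and the singular term is bounded as well. Hence `a - α = O(t)`; this is
`exists_gauge_estimate`.

For the difference of two solutions the same argument loses only a factor `1 + log(t/t₀)`
(`exists_stability_estimate`). Solutions started from `α` at times `t₀ → 0` differ from one another
by `O(t₀)` at the starting time, and `t₀ log(1/t₀) → 0`: they form a Cauchy sequence, whose limit
solves the singular problem, and the same comparison gives uniqueness.

For `s ≥ 1` the energy `∑ k²|A_k|² - 2ct Q_t(A)`, with `Q_t` the quartic form of `T_t`, has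
derivative `-2cQ_t(A)`. As `Q_t` is controlled by the mass and a small multiple of the kinetic term,
Gronwall bounds the kinetic energy, hence the `l¹` norm. The trilinear estimate is linear in the
`l^{2,s}` norm once the `l¹` norm is known, so all `l^{2,s}` norms stay finite and the solution is
global.

Part (i) follows once distributional solutions of the given form are identified with solutions of
the coefficient equation. In part (ii) all nonzero moduli equal `a`, so the logarithmic phase does
not depend on `k` and can be traded for a shift of `M` by `a²/2`. This explains `M = (N - 1/2)a²`
and makes `A` itself continuous at `t = 0`. Negative times are reached by complex conjugation. -/

noncomputable section

/-! ### Multilinear analysis in `l^{2,s}`. -/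

namespace DiracNLS

open scoped ENNReal

/-! ### Convolution estimates -/

/-- Jensen's inequality for weighted sums of extended nonnegative reals, up to a constant. -/
theorem sq_tsum_mul_le {ι : Type*} (w f : ι → ℝ≥0∞) :
    (∑' p, w p * f p) ^ 2 ≤ 2 * ((∑' p, w p) * ∑' p, w p * f p ^ 2) := by
  have key : ∀ x y : ℝ≥0∞, x * y ≤ x ^ 2 + y ^ 2 := by
    intro x y
    rcases le_total x y with h | h
    · calc x * y ≤ y * y := by gcongr
        _ = y ^ 2 := (sq y).symm
        _ ≤ _ := le_add_self
    · calc x * y ≤ x * x := by gcongr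
        _ = x ^ 2 := (sq x).symm
        _ ≤ _ := le_self_add
  calc (∑' p, w p * f p) ^ 2 = ∑' p, ∑' q, (w p * f p) * (w q * f q) := by
        rw [sq, ← ENNReal.tsum_mul_right]
        simp_rw [ENNReal.tsum_mul_left]
    _ ≤ ∑' p, ∑' q, (w q * (w p * f p ^ 2) + w p * (w q * f q ^ 2)) := by
        refine ENNReal.tsum_le_tsum fun p => ENNReal.tsum_le_tsum fun q => ?_
        calc (w p * f p) * (w q * f q) = w p * w q * (f p * f q) := by ring
          _ ≤ w p * w q * (f p ^ 2 + f q ^ 2) := by gcongr; exact key _ _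
          _ = _ := by ring
    _ = 2 * ((∑' p, w p) * ∑' p, w p * f p ^ 2) := by
        simp_rw [ENNReal.tsum_add, ENNReal.tsum_mul_right, ENNReal.tsum_mul_left,
          ENNReal.tsum_mul_right]
        ring

/-- `∑_{i - l + j = k} F i G l H j`. -/
def conv3 (F G H : ℤ → ℝ≥0∞) (k : ℤ) : ℝ≥0∞ :=
  ∑' p : ℤ × ℤ, F p.1 * G (p.1 + p.2 - k) * H p.2

theorem tsum_shift (G : ℤ → ℝ≥0∞) (a : ℤ) : ∑' k, G (a - k) = ∑' k, G k :=
  (Equiv.subLeft a).tsum_eq G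

theorem tsum_shift_add (G : ℤ → ℝ≥0∞) (a : ℤ) : ∑' k, G (k + a) = ∑' k, G k :=
  (Equiv.addRight a).tsum_eq G

theorem tsum_conv3 (F G H : ℤ → ℝ≥0∞) :
    ∑' k, conv3 F G H k = (∑' k, F k) * (∑' k, G k) * ∑' k, H k := by
  unfold conv3
  rw [ENNReal.tsum_comm]
  have : ∀ p : ℤ × ℤ, ∑' k, F p.1 * G (p.1 + p.2 - k) * H p.2 =
      F p.1 * (∑' k, G k) * H p.2 := by
    intro p
    rw [ENNReal.tsum_mul_right, ENNReal.tsum_mul_left, tsum_shift]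
  simp_rw [this]
  rw [ENNReal.tsum_prod']
  simp_rw [ENNReal.tsum_mul_left, ENNReal.tsum_mul_right]

theorem conv3_comm (F G H : ℤ → ℝ≥0∞) (k : ℤ) : conv3 F G H k = conv3 H G F k := by
  unfold conv3
  rw [← (Equiv.prodComm ℤ ℤ).tsum_eq]
  refine tsum_congr fun p => ?_
  simp only [Equiv.prodComm_apply, Prod.fst_swap, Prod.snd_swap]
  rw [add_comm p.2 p.1]; ring

/-- Young's inequality `l² * l¹ * l¹ → l²`. For fixed `k` the weights `G(p.1 + p.2 - k) H(p.2)` have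
total mass `‖G‖₁‖H‖₁`, whatever `k` is, so Jensen moves the square onto `F`. -/
theorem sq_conv3_le_left (F G H : ℤ → ℝ≥0∞) :
    ∑' k, conv3 F G H k ^ 2 ≤ 2 * ((∑' k, G k) ^ 2 * (∑' k, H k) ^ 2 * ∑' k, F k ^ 2) := by
  have h1 : ∀ k, conv3 F G H k ^ 2 ≤
      2 * (((∑' k, G k) * ∑' k, H k) * conv3 (fun i => F i ^ 2) G H k) := by
    intro k
    have := sq_tsum_mul_le (fun p : ℤ × ℤ => G (p.1 + p.2 - k) * H p.2) (fun p => F p.1)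
    have e : ∑' p : ℤ × ℤ, G (p.1 + p.2 - k) * H p.2 = (∑' k, G k) * ∑' k, H k := by
      rw [ENNReal.tsum_prod', ENNReal.tsum_comm]
      simp_rw [ENNReal.tsum_mul_right, add_sub_assoc, tsum_shift_add, ENNReal.tsum_mul_left]
    rw [e] at this
    calc conv3 F G H k ^ 2 = (∑' p : ℤ × ℤ, G (p.1 + p.2 - k) * H p.2 * F p.1) ^ 2 := by
          unfold conv3; congr 1; exact tsum_congr fun p => by ring
      _ ≤ _ := this
      _ = _ := by
          unfold conv3; congr 2; exact tsum_congr fun p => by ring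
  calc ∑' k, conv3 F G H k ^ 2
      ≤ ∑' k, 2 * (((∑' k, G k) * ∑' k, H k) * conv3 (fun i => F i ^ 2) G H k) :=
        ENNReal.tsum_le_tsum h1
    _ = _ := by
        rw [ENNReal.tsum_mul_left, ENNReal.tsum_mul_left, tsum_conv3]; ring

theorem sq_conv3_le_right (F G H : ℤ → ℝ≥0∞) :
    ∑' k, conv3 F G H k ^ 2 ≤ 2 * ((∑' k, F k) ^ 2 * (∑' k, G k) ^ 2 * ∑' k, H k ^ 2) := by
  simp_rw [conv3_comm F G H]
  refine (sq_conv3_le_left H G F).trans (le_of_eq ?_)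
  ring

/-- The same argument with the weights `F(p.1) H(p.2)`, whose total mass is visibly independent of
`k`; the square falls on the conjugated slot. -/
theorem sq_conv3_le_mid (F G H : ℤ → ℝ≥0∞) :
    ∑' k, conv3 F G H k ^ 2 ≤ 2 * ((∑' k, F k) ^ 2 * (∑' k, H k) ^ 2 * ∑' k, G k ^ 2) := by
  have h1 : ∀ k, conv3 F G H k ^ 2 ≤
      2 * (((∑' k, F k) * ∑' k, H k) * conv3 F (fun i => G i ^ 2) H k) := by
    intro k
    have := sq_tsum_mul_le (fun p : ℤ × ℤ => F p.1 * H p.2) (fun p => G (p.1 + p.2 - k))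
    have e : ∑' p : ℤ × ℤ, F p.1 * H p.2 = (∑' k, F k) * ∑' k, H k := by
      rw [ENNReal.tsum_prod']
      simp_rw [ENNReal.tsum_mul_left, ENNReal.tsum_mul_right]
    rw [e] at this
    calc conv3 F G H k ^ 2 = (∑' p : ℤ × ℤ, F p.1 * H p.2 * G (p.1 + p.2 - k)) ^ 2 := by
          unfold conv3; congr 1; exact tsum_congr fun p => by ring
      _ ≤ _ := this
      _ = _ := by
          unfold conv3; congr 2; exact tsum_congr fun p => by ring
  calc ∑' k, conv3 F G H k ^ 2
      ≤ ∑' k, 2 * (((∑' k, F k) * ∑' k, H k) * conv3 F (fun i => G i ^ 2) H k) :=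
        ENNReal.tsum_le_tsum h1
    _ = _ := by
        rw [ENNReal.tsum_mul_left, ENNReal.tsum_mul_left, tsum_conv3]; ring

/-! ### Weights -/

/-- The weight `(1 + |k|)^s`. -/
def wt (s : ℝ) (k : ℤ) : ℝ := (1 + |(k : ℝ)|) ^ s

theorem wt_pos (s : ℝ) (k : ℤ) : 0 < wt s k := by unfold wt; positivity

theorem one_le_wt {s : ℝ} (hs : 0 ≤ s) (k : ℤ) : 1 ≤ wt s k :=
  Real.one_le_rpow (by linarith [abs_nonneg (k : ℝ)]) hs

theorem wt_le_wt {s s' : ℝ} (h : s ≤ s') (k : ℤ) : wt s k ≤ wt s' k :=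
  Real.rpow_le_rpow_of_exponent_le (by linarith [abs_nonneg (k : ℝ)]) h

theorem wt_sq (s : ℝ) (k : ℤ) : wt s k ^ 2 = (1 + |(k : ℝ)|) ^ (2 * s) := by
  unfold wt
  rw [← Real.rpow_natCast, ← Real.rpow_mul (by positivity)]
  congr 1; push_cast; ring

/-- As `k = i - l + j`, the largest of `1 + |i|`, `1 + |l|`, `1 + |j|` is at least a third of `1 +
|k|`. This lets the output weight be carried by a single factor of a trilinear sum, the other two
being measured in `l¹`. -/
theorem wt_le_add {s : ℝ} (hs : 0 ≤ s) (k i j : ℤ) :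
    wt s k ≤ 3 ^ s * (wt s i + wt s (i + j - k) + wt s j) := by
  have hk : (1 + |(k : ℝ)|) ≤
      3 * max (1 + |(i : ℝ)|) (max (1 + |((i + j - k : ℤ) : ℝ)|) (1 + |(j : ℝ)|)) := by
    have h1 := le_max_left (1 + |(i : ℝ)|) (max (1 + |((i + j - k : ℤ) : ℝ)|) (1 + |(j : ℝ)|))
    have h2 := (le_max_left (1 + |((i + j - k : ℤ) : ℝ)|) (1 + |(j : ℝ)|)).trans
      (le_max_right (1 + |(i : ℝ)|) _)
    have h3 := (le_max_right (1 + |((i + j - k : ℤ) : ℝ)|) (1 + |(j : ℝ)|)).trans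
      (le_max_right (1 + |(i : ℝ)|) _)
    have : (k : ℝ) = i - (i + j - k : ℤ) + j := by push_cast; ring
    have h4 : |(k : ℝ)| ≤ |(i : ℝ)| + |((i + j - k : ℤ) : ℝ)| + |(j : ℝ)| := by
      conv_lhs => rw [this]
      exact (abs_add_le _ _).trans (by gcongr; exact abs_sub _ _)
    linarith
  have h0 : ∀ n : ℤ, 0 ≤ 1 + |(n : ℝ)| := fun n => by positivity
  calc wt s k ≤ (3 * max (1 + |(i : ℝ)|)
        (max (1 + |((i + j - k : ℤ) : ℝ)|) (1 + |(j : ℝ)|))) ^ s :=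
        Real.rpow_le_rpow (h0 k) hk hs
    _ = 3 ^ s * (max (1 + |(i : ℝ)|)
        (max (1 + |((i + j - k : ℤ) : ℝ)|) (1 + |(j : ℝ)|))) ^ s :=
        Real.mul_rpow (by norm_num) (le_max_of_le_left (h0 i))
    _ ≤ _ := by
        gcongr
        have p1 := wt_pos s i
        have p2 := wt_pos s (i + j - k)
        have p3 := wt_pos s j
        rcases max_choice (1 + |(i : ℝ)|)
          (max (1 + |((i + j - k : ℤ) : ℝ)|) (1 + |(j : ℝ)|)) with h | h <;> rw [h]
        · change wt s i ≤ _; linarith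
        · rcases max_choice (1 + |((i + j - k : ℤ) : ℝ)|) (1 + |(j : ℝ)|) with h | h <;> rw [h]
          · change wt s (i + j - k) ≤ _; linarith
          · change wt s j ≤ _; linarith

/-- This is the source of the condition `s > 1/2`: it gives `l^{2,s} ⊂ l¹`. -/
theorem summable_wt_neg {s : ℝ} (hs : 1 / 2 < s) : Summable fun k : ℤ => (wt s k ^ 2)⁻¹ := by
  have h : Summable fun n : ℕ => ((n + 1 : ℕ) : ℝ) ^ (-(2 * s)) :=
    (summable_nat_add_iff 1).2 (Real.summable_nat_rpow.2 (by linarith))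
  have e : ∀ n : ℕ, (wt s (n : ℤ) ^ 2)⁻¹ = ((n + 1 : ℕ) : ℝ) ^ (-(2 * s)) := by
    intro n
    rw [wt_sq, Real.rpow_neg (by positivity)]
    congr 2
    push_cast
    rw [abs_of_nonneg (by positivity)]; ring
  have e' : ∀ n : ℕ, (wt s (-(n : ℤ)) ^ 2)⁻¹ = ((n + 1 : ℕ) : ℝ) ^ (-(2 * s)) := by
    intro n; rw [← e]; simp [wt]
  refine Summable.of_nat_of_neg ?_ ?_
  · simpa only [e] using h
  · simpa only [e'] using h

end DiracNLS

end

noncomputable section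

namespace DiracNLS

open scoped ENNReal ComplexConjugate

/-! ### The space `l²` and its weighted coordinates -/

/-- The Hilbert space `l²(ℤ)`. A sequence `a ∈ l^{2,s}` is represented by `(1 + |k|)^s aₖ`. -/
abbrev L2 : Type := lp (fun _ : ℤ => ℂ) 2

/-- The sequence of `l^{2,s}` represented by `x`. -/
def seq (s : ℝ) (x : L2) (k : ℤ) : ℂ := x k / (wt s k : ℂ)

/-- The `l¹` norm of the sequence represented by `x`. -/
def l1 (s : ℝ) (x : L2) : ℝ := ∑' k, ‖seq s x k‖

theorem memℓp_two_iff {f : ℤ → ℂ} : Memℓp f 2 ↔ Summable fun k => ‖f k‖ ^ 2 := by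
  rw [memℓp_gen_iff (by norm_num)]
  simp

theorem L2.summable_sq (x : L2) : Summable fun k => ‖x k‖ ^ 2 := memℓp_two_iff.1 (lp.memℓp x)

theorem L2.norm_sq (x : L2) : ‖x‖ ^ 2 = ∑' k, ‖x k‖ ^ 2 := by
  have := lp.norm_rpow_eq_tsum (p := 2) (by norm_num) x
  simpa using this

theorem L2.enorm_sq (x : L2) : ‖x‖ₑ ^ 2 = ∑' k, ‖x k‖ₑ ^ 2 := by
  have h := L2.norm_sq x
  rw [← ofReal_norm, ← ENNReal.ofReal_pow (norm_nonneg _), h,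
    ENNReal.ofReal_tsum_of_nonneg (fun _ => by positivity) x.summable_sq]
  refine tsum_congr fun k => ?_
  rw [ENNReal.ofReal_pow (norm_nonneg _), ofReal_norm]

theorem L2.norm_apply_le (x : L2) (k : ℤ) : ‖x k‖ ≤ ‖x‖ :=
  lp.norm_apply_le_norm (by norm_num) x k

theorem memℓp_two_of_enorm {f : ℤ → ℂ} (h : ∑' k, ‖f k‖ₑ ^ 2 ≠ ⊤) : Memℓp f 2 := by
  rw [memℓp_two_iff]
  have : ∑' k, ‖‖f k‖ ^ 2‖ₑ ≠ ⊤ := by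
    simpa [enorm_pow] using h
  have := tsum_enorm_ne_top_iff_summable_norm.1 this
  simpa using this

@[simp] theorem seq_add (s : ℝ) (x y : L2) (k : ℤ) :
    seq s (x + y) k = seq s x k + seq s y k := by
  simp [seq, add_div]

@[simp] theorem seq_sub (s : ℝ) (x y : L2) (k : ℤ) :
    seq s (x - y) k = seq s x k - seq s y k := by
  simp [seq, sub_div]

@[simp] theorem seq_smul (s : ℝ) (c : ℂ) (x : L2) (k : ℤ) :
    seq s (c • x) k = c * seq s x k := by
  simp [seq, mul_div_assoc]

@[simp] theorem seq_zero (s : ℝ) (k : ℤ) : seq s 0 k = 0 := by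
  simp [seq]

theorem seq_real_smul (s : ℝ) (c : ℝ) (x : L2) (k : ℤ) :
    seq s (c • x) k = c * seq s x k := by
  simp [seq, mul_div_assoc]

theorem L2.coe_smul (c : ℝ) (x : L2) : (c : ℂ) • x = c • x := by
  apply lp.ext
  funext k
  rw [lp.coeFn_smul, lp.coeFn_smul, Pi.smul_apply, Pi.smul_apply, Complex.real_smul, smul_eq_mul]

theorem wt_mul_seq (s : ℝ) (x : L2) (k : ℤ) : (wt s k : ℂ) * seq s x k = x k := by
  have : (wt s k : ℂ) ≠ 0 := by exact_mod_cast (wt_pos s k).ne'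
  unfold seq; field_simp

theorem seq_injective (s : ℝ) {x y : L2} (h : ∀ k, seq s x k = seq s y k) : x = y := by
  apply lp.ext
  funext k
  rw [← wt_mul_seq s x, ← wt_mul_seq s y, h]

theorem norm_seq (s : ℝ) (x : L2) (k : ℤ) : ‖seq s x k‖ = ‖x k‖ / wt s k := by
  simp [seq, abs_of_pos (wt_pos s k)]

theorem norm_apply_eq (s : ℝ) (x : L2) (k : ℤ) : ‖x k‖ = wt s k * ‖seq s x k‖ := by
  rw [norm_seq]; field_simp [(wt_pos s k).ne']

theorem norm_seq_le_apply {s : ℝ} (hs : 0 ≤ s) (x : L2) (k : ℤ) : ‖seq s x k‖ ≤ ‖x k‖ := by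
  rw [norm_seq]; exact div_le_self (norm_nonneg _) (one_le_wt hs k)

theorem norm_seq_le {s : ℝ} (hs : 0 ≤ s) (x : L2) (k : ℤ) : ‖seq s x k‖ ≤ ‖x‖ :=
  (norm_seq_le_apply hs x k).trans (x.norm_apply_le k)

theorem enorm_apply_eq (s : ℝ) (x : L2) (k : ℤ) :
    ‖x k‖ₑ = ENNReal.ofReal (wt s k) * ‖seq s x k‖ₑ := by
  rw [← ofReal_norm, ← ofReal_norm, ← ENNReal.ofReal_mul (wt_pos s k).le,
    norm_apply_eq s]

/-- The sum of the inverse squared weights. -/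
def wtConst (s : ℝ) : ℝ := ∑' k : ℤ, (wt s k ^ 2)⁻¹

theorem wtConst_nonneg (s : ℝ) : 0 ≤ wtConst s := tsum_nonneg fun k => by positivity

/-- Cauchy–Schwarz, in the form of the weighted Jensen inequality with weights `wt⁻²` applied to `wt
· |x_k|`. -/
theorem sq_tsum_enorm_seq_le {s : ℝ} (hs : 1 / 2 < s) (x : L2) :
    (∑' k, ‖seq s x k‖ₑ) ^ 2 ≤ 2 * (ENNReal.ofReal (wtConst s) * ‖x‖ₑ ^ 2) := by
  have h := sq_tsum_mul_le (fun k : ℤ => ENNReal.ofReal (wt s k ^ 2)⁻¹)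
    (fun k => ENNReal.ofReal (wt s k) * ‖x k‖ₑ)
  have e1 : ∀ k, ENNReal.ofReal (wt s k ^ 2)⁻¹ * (ENNReal.ofReal (wt s k) * ‖x k‖ₑ) =
      ‖seq s x k‖ₑ := by
    intro k
    have hp := wt_pos s k
    rw [← ofReal_norm, ← ofReal_norm, ← ENNReal.ofReal_mul hp.le,
      ← ENNReal.ofReal_mul (by positivity), norm_seq]
    congr 1; field_simp
  have e2 : ∀ k, ENNReal.ofReal (wt s k ^ 2)⁻¹ * (ENNReal.ofReal (wt s k) * ‖x k‖ₑ) ^ 2 =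
      ‖x k‖ₑ ^ 2 := by
    intro k
    have hp := wt_pos s k
    rw [← ofReal_norm, ← ENNReal.ofReal_mul hp.le, ← ENNReal.ofReal_pow (by positivity),
      ← ENNReal.ofReal_mul (by positivity), ← ENNReal.ofReal_pow (by positivity)]
    congr 1; field_simp
  simp_rw [e1, e2] at h
  rwa [← L2.enorm_sq, ← ENNReal.ofReal_tsum_of_nonneg (fun k => by positivity)
    (summable_wt_neg hs)] at h

theorem tsum_enorm_seq_ne_top {s : ℝ} (hs : 1 / 2 < s) (x : L2) : ∑' k, ‖seq s x k‖ₑ ≠ ⊤ := by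
  intro h
  have := sq_tsum_enorm_seq_le hs x
  rw [h] at this
  have h2 : 2 * (ENNReal.ofReal (wtConst s) * ‖x‖ₑ ^ 2) < ⊤ := by
    refine ENNReal.mul_lt_top (by simp) (ENNReal.mul_lt_top (by simp) (by simp))
  simp at this
  exact absurd this h2.ne

theorem summable_norm_seq {s : ℝ} (hs : 1 / 2 < s) (x : L2) : Summable fun k => ‖seq s x k‖ :=
  tsum_enorm_ne_top_iff_summable_norm.1 (tsum_enorm_seq_ne_top hs x)

theorem l1_nonneg (s : ℝ) (x : L2) : 0 ≤ l1 s x := tsum_nonneg fun _ => norm_nonneg _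

theorem ofReal_l1 {s : ℝ} (hs : 1 / 2 < s) (x : L2) :
    ENNReal.ofReal (l1 s x) = ∑' k, ‖seq s x k‖ₑ := by
  unfold l1
  rw [ENNReal.ofReal_tsum_of_nonneg (fun _ => norm_nonneg _) (summable_norm_seq hs x)]
  simp

theorem l1_le {s : ℝ} (hs : 1 / 2 < s) (x : L2) : l1 s x ≤ √(2 * wtConst s) * ‖x‖ := by
  have h := sq_tsum_enorm_seq_le hs x
  have h0 := l1_nonneg s x
  have hw := wtConst_nonneg s
  rw [← ofReal_l1 hs, ← ofReal_norm, ← ENNReal.ofReal_pow h0,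
    ← ENNReal.ofReal_pow (norm_nonneg _), ← ENNReal.ofReal_mul hw] at h
  have e : 2 * ENNReal.ofReal (wtConst s * ‖x‖ ^ 2) =
      ENNReal.ofReal (2 * (wtConst s * ‖x‖ ^ 2)) := by
    rw [ENNReal.ofReal_mul (p := 2) (by norm_num), ENNReal.ofReal_ofNat]
  rw [e, ENNReal.ofReal_le_ofReal_iff (by positivity)] at h
  refine abs_le_of_sq_le_sq' ?_ (by positivity) |>.2
  rw [mul_pow, Real.sq_sqrt (by positivity)]
  linarith

/-- Tannery's theorem in `l²`. -/
theorem tendsto_L2_of_dominated {ι : Type*} {l : Filter ι} {f : ι → L2} {f₀ : L2} {g : ℤ → ℝ}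
    (hg : Summable fun k => g k ^ 2) (hfg : ∀ᶠ i in l, ∀ k, ‖f i k‖ ≤ g k)
    (hf : ∀ k, Tendsto (fun i => f i k) l (𝓝 (f₀ k))) : Tendsto f l (𝓝 f₀) := by
  rcases l.eq_or_neBot with rfl | hl
  · simp
  have hg0 : ∀ k, ‖f₀ k‖ ≤ g k := fun k =>
    le_of_tendsto (hf k).norm (hfg.mono fun i h => h k)
  rw [tendsto_iff_norm_sub_tendsto_zero]
  have h2 : Tendsto (fun i => ∑' k, ‖f i k - f₀ k‖ ^ 2) l (𝓝 (∑' _ : ℤ, (0 : ℝ))) := by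
    refine tendsto_tsum_of_dominated_convergence (bound := fun k => 4 * g k ^ 2)
      (hg.mul_left 4) (fun k => ?_) ?_
    · have := ((hf k).sub_const (f₀ k)).norm.pow 2
      simpa using this
    · filter_upwards [hfg] with i hi k
      rw [Real.norm_of_nonneg (by positivity)]
      have h1 : ‖f i k - f₀ k‖ ≤ 2 * g k := by
        linarith [norm_sub_le (f i k) (f₀ k), hi k, hg0 k]
      calc ‖f i k - f₀ k‖ ^ 2 ≤ (2 * g k) ^ 2 := by gcongr
        _ = _ := by ring
  have h3 : Tendsto (fun i => √(∑' k, ‖f i k - f₀ k‖ ^ 2)) l (𝓝 √(∑' _ : ℤ, (0 : ℝ))) :=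
    (Real.continuous_sqrt.tendsto _).comp h2
  simp only [tsum_zero, Real.sqrt_zero] at h3
  refine h3.congr fun i => ?_
  have : ∑' k, ‖f i k - f₀ k‖ ^ 2 = ‖f i - f₀‖ ^ 2 := by
    rw [L2.norm_sq]; simp
  rw [this, Real.sqrt_sq (norm_nonneg _)]

/-! ### Diagonal operators -/

/-- The operator of multiplication by a bounded sequence; zero if the sequence is unbounded. -/
def diag (d : ℤ → ℂ) (x : L2) : L2 :=
  open Classical in if h : Memℓp (fun k => d k * x k) 2 then ⟨fun k => d k * x k, h⟩ else 0

theorem diag_apply {d : ℤ → ℂ} {B : ℝ} (hd : ∀ k, ‖d k‖ ≤ B) (x : L2) (k : ℤ) :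
    diag d x k = d k * x k := by
  have h : Memℓp (fun k => d k * x k) 2 := by
    rw [memℓp_two_iff]
    refine Summable.of_nonneg_of_le (fun _ => by positivity) (fun k => ?_)
      (x.summable_sq.mul_left (B ^ 2))
    rw [norm_mul, mul_pow]
    gcongr
    exact hd k
  rw [diag, dif_pos h]

theorem seq_diag {s : ℝ} {d : ℤ → ℂ} {B : ℝ} (hd : ∀ k, ‖d k‖ ≤ B) (x : L2) (k : ℤ) :
    seq s (diag d x) k = d k * seq s x k := by
  rw [seq, diag_apply hd, seq, mul_div_assoc]

theorem norm_diag_le {d : ℤ → ℂ} {B : ℝ} (hd : ∀ k, ‖d k‖ ≤ B) (x : L2) :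
    ‖diag d x‖ ≤ B * ‖x‖ := by
  have hB : 0 ≤ B := (norm_nonneg _).trans (hd 0)
  refine abs_le_of_sq_le_sq' ?_ (by positivity) |>.2
  rw [mul_pow, L2.norm_sq, L2.norm_sq, ← tsum_mul_left]
  refine Summable.tsum_le_tsum (fun k => ?_) (diag d x).summable_sq
    (x.summable_sq.mul_left _)
  rw [diag_apply hd, norm_mul, mul_pow]
  gcongr
  exact hd k

theorem norm_diag_eq {d : ℤ → ℂ} (hd : ∀ k, ‖d k‖ = 1) (x : L2) : ‖diag d x‖ = ‖x‖ := by
  rw [← sq_eq_sq₀ (norm_nonneg _) (norm_nonneg _), L2.norm_sq, L2.norm_sq]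
  refine tsum_congr fun k => ?_
  rw [diag_apply (fun k => (hd k).le), norm_mul, hd, one_mul]

/-- The bounded operator of multiplication by a bounded sequence. -/
def diagL (d : ℤ → ℂ) {B : ℝ} (hd : ∀ k, ‖d k‖ ≤ B) : L2 →L[ℂ] L2 :=
  LinearMap.mkContinuous
    { toFun := diag d
      map_add' := fun x y => by
        apply lp.ext; funext k
        simp only [lp.coeFn_add, Pi.add_apply, diag_apply hd]; ring
      map_smul' := fun c x => by
        apply lp.ext; funext k
        simp only [lp.coeFn_smul, Pi.smul_apply, diag_apply hd, smul_eq_mul, RingHom.id_apply]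
        ring } B (norm_diag_le hd)

theorem diag_sub {d : ℤ → ℂ} {B : ℝ} (hd : ∀ k, ‖d k‖ ≤ B) (x y : L2) :
    diag d (x - y) = diag d x - diag d y := map_sub (diagL d hd) x y

/-- The multipliers converge only coordinatewise, so the operators converge strongly and in general
not in norm. Tannery handles the fixed vector, and the uniform bound handles the motion of the
vector. -/
theorem tendsto_diag {ι : Type*} {l : Filter ι} {d : ι → ℤ → ℂ} {d₀ : ℤ → ℂ} {B : ℝ}
    {x : ι → L2} {x₀ : L2} (hd : ∀ᶠ i in l, ∀ k, ‖d i k‖ ≤ B) (hd₀ : ∀ k, ‖d₀ k‖ ≤ B)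
    (hl : ∀ k, Tendsto (fun i => d i k) l (𝓝 (d₀ k))) (hx : Tendsto x l (𝓝 x₀)) :
    Tendsto (fun i => diag (d i) (x i)) l (𝓝 (diag d₀ x₀)) := by
  have h1 : Tendsto (fun i => diag (d i) x₀) l (𝓝 (diag d₀ x₀)) := by
    refine tendsto_L2_of_dominated (g := fun k => B * ‖x₀ k‖) ?_ ?_ ?_
    · simp_rw [mul_pow]; exact x₀.summable_sq.mul_left _
    · filter_upwards [hd] with i hi k
      rw [diag_apply hi, norm_mul]
      gcongr
      exact hi k
    · intro k
      rw [diag_apply hd₀]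
      refine Tendsto.congr' ?_ ((hl k).mul_const (x₀ k))
      filter_upwards [hd] with i hi
      rw [diag_apply hi]
  have h2 : Tendsto (fun i => diag (d i) (x i) - diag (d i) x₀) l (𝓝 0) := by
    refine squeeze_zero_norm' (a := fun i => B * ‖x i - x₀‖) ?_ ?_
    · filter_upwards [hd] with i hi
      rw [← diag_sub hi]
      exact norm_diag_le hi _
    · have := (tendsto_iff_norm_sub_tendsto_zero.1 hx).const_mul B
      simpa using this
  simpa using h2.add h1

end DiracNLS

end

noncomputable section

namespace DiracNLS

open scoped ENNReal ComplexConjugate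

/-! ### Trilinear operators with bounded multipliers -/

/-- The multiplier `m` is bounded by `B`. -/
def MulBound (m : ℤ → ℤ → ℤ → ℂ) (B : ℝ) : Prop := ∀ k i j, ‖m k i j‖ ≤ B

theorem MulBound.nonneg {m : ℤ → ℤ → ℤ → ℂ} {B : ℝ} (h : MulBound m B) : 0 ≤ B :=
  (norm_nonneg _).trans (h 0 0 0)

/-- The summand of the trilinear sum at frequency `k`. -/
def triTerm (s : ℝ) (m : ℤ → ℤ → ℤ → ℂ) (x y z : L2) (k : ℤ) (p : ℤ × ℤ) : ℂ :=
  m k p.1 p.2 * (seq s x p.1 * conj (seq s y (p.1 + p.2 - k)) * seq s z p.2)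

/-- `(1 + |k|)^s ∑_{i - l + j = k} m(k, i, j) xᵢ conj(yₗ) zⱼ`. -/
def triFun (s : ℝ) (m : ℤ → ℤ → ℤ → ℂ) (x y z : L2) (k : ℤ) : ℂ :=
  wt s k * ∑' p : ℤ × ℤ, triTerm s m x y z k p

/-- The trilinear operator with multiplier `m`, in weighted coordinates. -/
def trilin (s : ℝ) (m : ℤ → ℤ → ℤ → ℂ) (x y z : L2) : L2 :=
  open Classical in if h : Memℓp (triFun s m x y z) 2 then ⟨triFun s m x y z, h⟩ else 0

variable {s : ℝ} {m m' : ℤ → ℤ → ℤ → ℂ} {B B' : ℝ}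

/-- The positive majorant of the trilinear sum. -/
def triMaj (s : ℝ) (x y z : L2) (k : ℤ) : ℝ≥0∞ :=
  conv3 (fun k => ‖seq s x k‖ₑ) (fun k => ‖seq s y k‖ₑ) (fun k => ‖seq s z k‖ₑ) k

theorem tsum_enorm_triTerm_le (hm : MulBound m B) (x y z : L2) (k : ℤ) :
    ∑' p, ‖triTerm s m x y z k p‖ₑ ≤ ENNReal.ofReal B * triMaj s x y z k := by
  rw [triMaj, conv3, ← ENNReal.tsum_mul_left]
  refine ENNReal.tsum_le_tsum fun p => ?_
  rw [triTerm, enorm_mul, enorm_mul, enorm_mul, RCLike.enorm_conj]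
  gcongr
  rw [← ofReal_norm]
  exact ENNReal.ofReal_le_ofReal (hm _ _ _)

theorem triMaj_ne_top (hs : 1 / 2 < s) (x y z : L2) (k : ℤ) : triMaj s x y z k ≠ ⊤ := by
  have h := tsum_conv3 (fun k => ‖seq s x k‖ₑ) (fun k => ‖seq s y k‖ₑ) (fun k => ‖seq s z k‖ₑ)
  have h2 : triMaj s x y z k ≤ _ := ENNReal.le_tsum (f := triMaj s x y z) k
  have h3 : ∑' k, triMaj s x y z k ≠ ⊤ := by
    unfold triMaj
    rw [h]
    exact ENNReal.mul_ne_top (ENNReal.mul_ne_top (tsum_enorm_seq_ne_top hs x)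
      (tsum_enorm_seq_ne_top hs y)) (tsum_enorm_seq_ne_top hs z)
  exact ne_top_of_le_ne_top h3 h2

theorem summable_norm_triTerm (hs : 1 / 2 < s) (hm : MulBound m B) (x y z : L2) (k : ℤ) :
    Summable fun p => ‖triTerm s m x y z k p‖ := by
  rw [← tsum_enorm_ne_top_iff_summable_norm]
  exact ne_top_of_le_ne_top (ENNReal.mul_ne_top (by simp) (triMaj_ne_top hs x y z k))
    (tsum_enorm_triTerm_le hm x y z k)

theorem summable_triTerm (hs : 1 / 2 < s) (hm : MulBound m B) (x y z : L2) (k : ℤ) :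
    Summable (triTerm s m x y z k) := (summable_norm_triTerm hs hm x y z k).of_norm

theorem enorm_triFun_le (hm : MulBound m B) (x y z : L2) (k : ℤ) :
    ‖triFun s m x y z k‖ₑ ≤
      ENNReal.ofReal B * (ENNReal.ofReal (wt s k) * triMaj s x y z k) := by
  rw [triFun, enorm_mul]
  have h1 : ‖(wt s k : ℂ)‖ₑ = ENNReal.ofReal (wt s k) := by
    rw [← ofReal_norm, Complex.norm_real, Real.norm_of_nonneg (wt_pos s k).le]
  rw [h1]
  calc ENNReal.ofReal (wt s k) * ‖∑' p, triTerm s m x y z k p‖ₑ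
      ≤ ENNReal.ofReal (wt s k) * (ENNReal.ofReal B * triMaj s x y z k) := by
        gcongr
        exact enorm_tsum_le_tsum_enorm.trans (tsum_enorm_triTerm_le hm x y z k)
    _ = _ := by ring

theorem wt_mul_triMaj_le (hs : 0 ≤ s) (x y z : L2) (k : ℤ) :
    ENNReal.ofReal (wt s k) * triMaj s x y z k ≤ ENNReal.ofReal (3 ^ s) *
      (conv3 (fun k => ‖x k‖ₑ) (fun k => ‖seq s y k‖ₑ) (fun k => ‖seq s z k‖ₑ) k +
       conv3 (fun k => ‖seq s x k‖ₑ) (fun k => ‖y k‖ₑ) (fun k => ‖seq s z k‖ₑ) k +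
       conv3 (fun k => ‖seq s x k‖ₑ) (fun k => ‖seq s y k‖ₑ) (fun k => ‖z k‖ₑ) k) := by
  unfold triMaj conv3
  rw [← ENNReal.tsum_add, ← ENNReal.tsum_add, ← ENNReal.tsum_mul_left, ← ENNReal.tsum_mul_left]
  refine ENNReal.tsum_le_tsum fun p => ?_
  have h := ENNReal.ofReal_le_ofReal (wt_le_add hs k p.1 p.2)
  have p1 := (wt_pos s p.1).le
  have p2 := (wt_pos s (p.1 + p.2 - k)).le
  have p3 := (wt_pos s p.2).le
  rw [ENNReal.ofReal_mul (by positivity), ENNReal.ofReal_add (by positivity) p3,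
    ENNReal.ofReal_add p1 p2] at h
  dsimp only
  rw [enorm_apply_eq s x, enorm_apply_eq s y, enorm_apply_eq s z]
  refine (mul_le_mul_left h _).trans (le_of_eq ?_)
  ring

theorem ENNReal_sq_add_three_le (a b c : ℝ≥0∞) :
    (a + b + c) ^ 2 ≤ 9 * (a ^ 2 + b ^ 2 + c ^ 2) := by
  have key : ∀ m : ℝ≥0∞, a ≤ m → b ≤ m → c ≤ m → m ^ 2 ≤ a ^ 2 + b ^ 2 + c ^ 2 →
      (a + b + c) ^ 2 ≤ 9 * (a ^ 2 + b ^ 2 + c ^ 2) := by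
    intro m ha hb hc h
    calc (a + b + c) ^ 2 ≤ (m + m + m) ^ 2 := by gcongr
      _ = 9 * m ^ 2 := by ring
      _ ≤ _ := by gcongr
  rcases le_total a b with h1 | h1
  · rcases le_total b c with h2 | h2
    · exact key c (h1.trans h2) h2 le_rfl le_add_self
    · exact key b h1 le_rfl h2 (le_add_self.trans le_self_add)
  · rcases le_total a c with h2 | h2
    · exact key c h2 (h1.trans h2) le_rfl le_add_self
    · exact key a le_rfl h1 h2 (le_self_add.trans le_self_add)

/-- A tame estimate: each term on the right contains one `l^{2,s}` norm and two `l¹` norms. The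
linearity in the strong norm is what later turns an `l¹` bound into a bound in `l^{2,s}` by
Gronwall. The constant is `18 = 9 · 2`: the square of a sum of three terms, then Young. -/
theorem tsum_sq_wt_mul_triMaj_le (hs : 1 / 2 < s) (x y z : L2) :
    ∑' k, (ENNReal.ofReal (wt s k) * triMaj s x y z k) ^ 2 ≤
      ENNReal.ofReal (18 * (3 ^ s) ^ 2 * ((‖x‖ * l1 s y * l1 s z) ^ 2 +
        (l1 s x * ‖y‖ * l1 s z) ^ 2 + (l1 s x * l1 s y * ‖z‖) ^ 2)) := by
  have hx := l1_nonneg s x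
  have hy := l1_nonneg s y
  have hz := l1_nonneg s z
  have nx := norm_nonneg x
  have ny := norm_nonneg y
  have nz := norm_nonneg z
  calc ∑' k, (ENNReal.ofReal (wt s k) * triMaj s x y z k) ^ 2
      ≤ ∑' k, ENNReal.ofReal (3 ^ s) ^ 2 * (9 *
      (conv3 (fun k => ‖x k‖ₑ) (fun k => ‖seq s y k‖ₑ) (fun k => ‖seq s z k‖ₑ) k ^ 2 +
       conv3 (fun k => ‖seq s x k‖ₑ) (fun k => ‖y k‖ₑ) (fun k => ‖seq s z k‖ₑ) k ^ 2 +
       conv3 (fun k => ‖seq s x k‖ₑ) (fun k => ‖seq s y k‖ₑ) (fun k => ‖z k‖ₑ) k ^ 2)) := by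
        refine ENNReal.tsum_le_tsum fun k => ?_
        refine (pow_le_pow_left₀ (zero_le) (wt_mul_triMaj_le (by linarith) x y z k) 2).trans ?_
        rw [mul_pow]
        gcongr
        exact ENNReal_sq_add_three_le _ _ _
    _ ≤ ENNReal.ofReal (3 ^ s) ^ 2 * (9 *
        (2 * ((ENNReal.ofReal (l1 s y)) ^ 2 * (ENNReal.ofReal (l1 s z)) ^ 2 * ‖x‖ₑ ^ 2) +
         2 * ((ENNReal.ofReal (l1 s x)) ^ 2 * (ENNReal.ofReal (l1 s z)) ^ 2 * ‖y‖ₑ ^ 2) +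
         2 * ((ENNReal.ofReal (l1 s x)) ^ 2 * (ENNReal.ofReal (l1 s y)) ^ 2 * ‖z‖ₑ ^ 2))) := by
        rw [ENNReal.tsum_mul_left, ENNReal.tsum_mul_left, ENNReal.tsum_add, ENNReal.tsum_add,
          ofReal_l1 hs, ofReal_l1 hs, ofReal_l1 hs, L2.enorm_sq, L2.enorm_sq, L2.enorm_sq]
        gcongr
        · exact sq_conv3_le_left _ _ _
        · exact sq_conv3_le_mid _ _ _
        · exact sq_conv3_le_right _ _ _
    _ = _ := by
        rw [← ofReal_norm, ← ofReal_norm, ← ofReal_norm]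
        have e' : ∀ a b c : ℝ, 0 ≤ a → 0 ≤ b → 0 ≤ c → ENNReal.ofReal ((a * b * c) ^ 2) =
            ENNReal.ofReal a ^ 2 * ENNReal.ofReal b ^ 2 * ENNReal.ofReal c ^ 2 := by
          intro a b c ha hb hc
          rw [ENNReal.ofReal_pow (by positivity), ENNReal.ofReal_mul (by positivity),
            ENNReal.ofReal_mul ha, mul_pow, mul_pow]
        have e18 : (9 : ℝ≥0∞) * 2 = ENNReal.ofReal 18 := by
          rw [ENNReal.ofReal_ofNat]; norm_num
        rw [ENNReal.ofReal_mul (by positivity), ENNReal.ofReal_mul (by positivity),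
          ENNReal.ofReal_add (by positivity) (by positivity),
          ENNReal.ofReal_add (by positivity) (by positivity), ← e18, e' _ _ _ nx hy hz,
          e' _ _ _ hx ny hz, e' _ _ _ hx hy nz, ENNReal.ofReal_pow (by positivity)]
        ring

theorem tsum_sq_enorm_triFun_le (hs : 1 / 2 < s) (hm : MulBound m B) (x y z : L2) :
    ∑' k, ‖triFun s m x y z k‖ₑ ^ 2 ≤
      ENNReal.ofReal (B ^ 2 * (18 * (3 ^ s) ^ 2 * ((‖x‖ * l1 s y * l1 s z) ^ 2 +
        (l1 s x * ‖y‖ * l1 s z) ^ 2 + (l1 s x * l1 s y * ‖z‖) ^ 2))) := by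
  have hB := hm.nonneg
  calc ∑' k, ‖triFun s m x y z k‖ₑ ^ 2
      ≤ ∑' k, ENNReal.ofReal B ^ 2 * (ENNReal.ofReal (wt s k) * triMaj s x y z k) ^ 2 := by
        refine ENNReal.tsum_le_tsum fun k => ?_
        rw [← mul_pow]
        exact pow_le_pow_left₀ zero_le (enorm_triFun_le hm x y z k) 2
    _ ≤ _ := by
        rw [ENNReal.tsum_mul_left, ENNReal.ofReal_mul (by positivity),
          ENNReal.ofReal_pow hB]
        gcongr
        exact tsum_sq_wt_mul_triMaj_le hs x y z

theorem memℓp_triFun (hs : 1 / 2 < s) (hm : MulBound m B) (x y z : L2) :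
    Memℓp (triFun s m x y z) 2 :=
  memℓp_two_of_enorm (ne_top_of_le_ne_top (by simp) (tsum_sq_enorm_triFun_le hs hm x y z))

theorem trilin_apply (hs : 1 / 2 < s) (hm : MulBound m B) (x y z : L2) (k : ℤ) :
    trilin s m x y z k = triFun s m x y z k := by
  rw [trilin, dif_pos (memℓp_triFun hs hm x y z)]

theorem seq_trilin (hs : 1 / 2 < s) (hm : MulBound m B) (x y z : L2) (k : ℤ) :
    seq s (trilin s m x y z) k = ∑' p : ℤ × ℤ, triTerm s m x y z k p := by
  have : (wt s k : ℂ) ≠ 0 := by exact_mod_cast (wt_pos s k).ne'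
  rw [seq, trilin_apply hs hm, triFun, mul_div_cancel_left₀ _ this]

/-- The constant of the trilinear estimate. -/
def triConst (s : ℝ) : ℝ := √18 * 3 ^ s

theorem triConst_nonneg (s : ℝ) : 0 ≤ triConst s := by unfold triConst; positivity

theorem norm_trilin_le_l1 (hs : 1 / 2 < s) (hm : MulBound m B) (x y z : L2) :
    ‖trilin s m x y z‖ ≤ B * (triConst s * (‖x‖ * l1 s y * l1 s z + l1 s x * ‖y‖ * l1 s z +
      l1 s x * l1 s y * ‖z‖)) := by
  have hB := hm.nonneg
  have hC := triConst_nonneg s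
  have hx := l1_nonneg s x
  have hy := l1_nonneg s y
  have hz := l1_nonneg s z
  have h1 : ‖trilin s m x y z‖ ^ 2 ≤ B ^ 2 * (18 * (3 ^ s) ^ 2 * ((‖x‖ * l1 s y * l1 s z) ^ 2 +
        (l1 s x * ‖y‖ * l1 s z) ^ 2 + (l1 s x * l1 s y * ‖z‖) ^ 2)) := by
    have := tsum_sq_enorm_triFun_le hs hm x y z
    simp_rw [← trilin_apply hs hm] at this
    rw [← L2.enorm_sq, ← ofReal_norm, ← ENNReal.ofReal_pow (norm_nonneg _)] at this
    exact (ENNReal.ofReal_le_ofReal_iff (by positivity)).1 this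
  refine abs_le_of_sq_le_sq' (h1.trans ?_) (by positivity) |>.2
  rw [mul_pow B, mul_pow (triConst s), triConst, mul_pow √18, Real.sq_sqrt (by norm_num)]
  gcongr
  have a1 : 0 ≤ ‖x‖ * l1 s y * l1 s z := by positivity
  have a2 : 0 ≤ l1 s x * ‖y‖ * l1 s z := by positivity
  have a3 : 0 ≤ l1 s x * l1 s y * ‖z‖ := by positivity
  nlinarith [mul_nonneg a1 a2, mul_nonneg a1 a3, mul_nonneg a2 a3]

/-- The constant of the trilinear estimate in `l^{2,s}`. -/
def triC (s : ℝ) : ℝ := triConst s * (3 * (2 * wtConst s))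

theorem triC_nonneg (s : ℝ) : 0 ≤ triC s := by
  have := triConst_nonneg s
  have := wtConst_nonneg s
  unfold triC; positivity

theorem norm_trilin_le (hs : 1 / 2 < s) (hm : MulBound m B) (x y z : L2) :
    ‖trilin s m x y z‖ ≤ B * triC s * (‖x‖ * ‖y‖ * ‖z‖) := by
  have hB := hm.nonneg
  have hC := triConst_nonneg s
  have hx := l1_nonneg s x
  have hy := l1_nonneg s y
  have hz := l1_nonneg s z
  have gx := l1_le hs x
  have gy := l1_le hs y
  have gz := l1_le hs z
  have hw := wtConst_nonneg s
  have e : √(2 * wtConst s) * √(2 * wtConst s) = 2 * wtConst s :=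
    Real.mul_self_sqrt (by positivity)
  set w := √(2 * wtConst s)
  have hw0 : 0 ≤ w := Real.sqrt_nonneg _
  calc ‖trilin s m x y z‖ ≤ B * (triConst s * (‖x‖ * l1 s y * l1 s z + l1 s x * ‖y‖ * l1 s z +
      l1 s x * l1 s y * ‖z‖)) := norm_trilin_le_l1 hs hm x y z
    _ ≤ B * (triConst s * (‖x‖ * (w * ‖y‖) * (w * ‖z‖) + (w * ‖x‖) * ‖y‖ * (w * ‖z‖) +
      (w * ‖x‖) * (w * ‖y‖) * ‖z‖)) := by gcongr
    _ = B * (triConst s * (3 * (w * w))) * (‖x‖ * ‖y‖ * ‖z‖) := by ring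
    _ = _ := by rw [e, triC]

/-! ### Multilinearity -/

theorem trilin_ext (hs : 1 / 2 < s) (hm : MulBound m B) {x y z w : L2}
    (h : ∀ k, ∑' p, triTerm s m x y z k p = seq s w k) : trilin s m x y z = w :=
  seq_injective s fun k => by rw [seq_trilin hs hm, h]

theorem trilin_sub_left (hs : 1 / 2 < s) (hm : MulBound m B) (x x' y z : L2) :
    trilin s m (x - x') y z = trilin s m x y z - trilin s m x' y z := by
  refine trilin_ext hs hm fun k => ?_
  rw [seq_sub, seq_trilin hs hm, seq_trilin hs hm, ← Summable.tsum_sub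
    (summable_triTerm hs hm _ _ _ _) (summable_triTerm hs hm _ _ _ _)]
  refine tsum_congr fun p => ?_
  simp only [triTerm, seq_sub]; ring

theorem trilin_sub_mid (hs : 1 / 2 < s) (hm : MulBound m B) (x y y' z : L2) :
    trilin s m x (y - y') z = trilin s m x y z - trilin s m x y' z := by
  refine trilin_ext hs hm fun k => ?_
  rw [seq_sub, seq_trilin hs hm, seq_trilin hs hm, ← Summable.tsum_sub
    (summable_triTerm hs hm _ _ _ _) (summable_triTerm hs hm _ _ _ _)]
  refine tsum_congr fun p => ?_
  simp only [triTerm, seq_sub, map_sub]; ring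

theorem trilin_sub_right (hs : 1 / 2 < s) (hm : MulBound m B) (x y z z' : L2) :
    trilin s m x y (z - z') = trilin s m x y z - trilin s m x y z' := by
  refine trilin_ext hs hm fun k => ?_
  rw [seq_sub, seq_trilin hs hm, seq_trilin hs hm, ← Summable.tsum_sub
    (summable_triTerm hs hm _ _ _ _) (summable_triTerm hs hm _ _ _ _)]
  refine tsum_congr fun p => ?_
  simp only [triTerm, seq_sub]; ring

/-- Real scalars suffice for difference quotients, and they are the ones that pass through all three
slots alike, since the middle slot is conjugate linear. -/
theorem trilin_smul_left (hs : 1 / 2 < s) (hm : MulBound m B) (c : ℝ) (x y z : L2) :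
    trilin s m (c • x) y z = c • trilin s m x y z := by
  refine trilin_ext hs hm fun k => ?_
  rw [seq_real_smul, seq_trilin hs hm, ← tsum_mul_left]
  refine tsum_congr fun p => ?_
  simp only [triTerm, seq_real_smul]; ring

theorem trilin_smul_mid (hs : 1 / 2 < s) (hm : MulBound m B) (c : ℝ) (x y z : L2) :
    trilin s m x (c • y) z = c • trilin s m x y z := by
  refine trilin_ext hs hm fun k => ?_
  rw [seq_real_smul, seq_trilin hs hm, ← tsum_mul_left]
  refine tsum_congr fun p => ?_
  simp only [triTerm, seq_real_smul, map_mul, Complex.conj_ofReal]; ring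

theorem trilin_smul_right (hs : 1 / 2 < s) (hm : MulBound m B) (c : ℝ) (x y z : L2) :
    trilin s m x y (c • z) = c • trilin s m x y z := by
  refine trilin_ext hs hm fun k => ?_
  rw [seq_real_smul, seq_trilin hs hm, ← tsum_mul_left]
  refine tsum_congr fun p => ?_
  simp only [triTerm, seq_real_smul]; ring

theorem MulBound.sub (hm : MulBound m B) (hm' : MulBound m' B') :
    MulBound (fun k i j => m k i j - m' k i j) (B + B') := fun k i j =>
  (norm_sub_le _ _).trans (add_le_add (hm k i j) (hm' k i j))

theorem MulBound.add (hm : MulBound m B) (hm' : MulBound m' B') :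
    MulBound (fun k i j => m k i j + m' k i j) (B + B') := fun k i j =>
  (norm_add_le _ _).trans (add_le_add (hm k i j) (hm' k i j))

theorem MulBound.smul (hm : MulBound m B) (c : ℂ) :
    MulBound (fun k i j => c * m k i j) (‖c‖ * B) := fun k i j => by
  rw [norm_mul]; exact mul_le_mul_of_nonneg_left (hm k i j) (norm_nonneg _)

theorem trilin_mul_sub (hs : 1 / 2 < s) (hm : MulBound m B) (hm' : MulBound m' B') (x y z : L2) :
    trilin s (fun k i j => m k i j - m' k i j) x y z = trilin s m x y z - trilin s m' x y z := by
  refine trilin_ext hs (hm.sub hm') fun k => ?_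
  rw [seq_sub, seq_trilin hs hm, seq_trilin hs hm', ← Summable.tsum_sub
    (summable_triTerm hs hm _ _ _ _) (summable_triTerm hs hm' _ _ _ _)]
  refine tsum_congr fun p => ?_
  simp only [triTerm]; ring

theorem trilin_mul_add (hs : 1 / 2 < s) (hm : MulBound m B) (hm' : MulBound m' B') (x y z : L2) :
    trilin s (fun k i j => m k i j + m' k i j) x y z = trilin s m x y z + trilin s m' x y z := by
  refine trilin_ext hs (hm.add hm') fun k => ?_
  rw [seq_add, seq_trilin hs hm, seq_trilin hs hm', ← Summable.tsum_add
    (summable_triTerm hs hm _ _ _ _) (summable_triTerm hs hm' _ _ _ _)]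
  refine tsum_congr fun p => ?_
  simp only [triTerm]; ring

theorem trilin_mul_smul (hs : 1 / 2 < s) (hm : MulBound m B) (c : ℂ) (x y z : L2) :
    trilin s (fun k i j => c * m k i j) x y z = c • trilin s m x y z := by
  refine trilin_ext hs (hm.smul c) fun k => ?_
  rw [seq_smul, seq_trilin hs hm, ← tsum_mul_left]
  refine tsum_congr fun p => ?_
  simp only [triTerm]; ring

/-! ### Strong continuity -/

/-- The oscillating multipliers depend on time continuously for each fixed triple, but not
uniformly, since `ω` is unbounded. Strong convergence still holds: the positive majorant dominates
both the inner sums and the resulting sequence. -/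
theorem tendsto_trilin_mul {ι : Type*} {l : Filter ι} (hs : 1 / 2 < s)
    {M : ι → ℤ → ℤ → ℤ → ℂ} (hM : ∀ᶠ i in l, MulBound (M i) B) (hm : MulBound m B)
    (hl : ∀ k i j, Tendsto (fun n => M n k i j) l (𝓝 (m k i j))) (x y z : L2) :
    Tendsto (fun n => trilin s (M n) x y z) l (𝓝 (trilin s m x y z)) := by
  refine tendsto_L2_of_dominated
    (g := fun k => B * (ENNReal.ofReal (wt s k) * triMaj s x y z k).toReal) ?_ ?_ ?_
  · simp_rw [mul_pow]
    refine Summable.mul_left _ ?_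
    have h : ∑' k, (ENNReal.ofReal (wt s k) * triMaj s x y z k) ^ 2 ≠ ⊤ :=
      ne_top_of_le_ne_top (by simp) (tsum_sq_wt_mul_triMaj_le hs x y z)
    simpa using ENNReal.summable_toReal h
  · filter_upwards [hM] with n hn k
    rw [trilin_apply hs hn]
    have hfin : ENNReal.ofReal (wt s k) * triMaj s x y z k ≠ ⊤ :=
      ENNReal.mul_ne_top (by simp) (triMaj_ne_top hs x y z k)
    have h := enorm_triFun_le (s := s) hn x y z k
    have h2 := ENNReal.toReal_mono (ENNReal.mul_ne_top (by simp) hfin) h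
    rwa [ENNReal.toReal_mul (a := ENNReal.ofReal B), ENNReal.toReal_ofReal hm.nonneg,
      toReal_enorm] at h2
  · intro k
    rw [trilin_apply hs hm]
    have : Tendsto (fun n => triFun s (M n) x y z k) l (𝓝 (triFun s m x y z k)) := by
      refine Tendsto.const_mul _ ?_
      have hone : MulBound (fun _ _ _ => (B : ℂ)) B := fun _ _ _ => by
        simp [abs_of_nonneg hm.nonneg]
      refine tendsto_tsum_of_dominated_convergence
        (bound := fun p => ‖triTerm s (fun _ _ _ => (B : ℂ)) x y z k p‖)
        (summable_norm_triTerm hs hone x y z k) (fun p => ?_) ?_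
      · exact (hl _ _ _).mul_const _
      · filter_upwards [hM] with n hn p
        unfold triTerm
        rw [norm_mul, norm_mul (B : ℂ)]
        gcongr
        simpa [abs_of_nonneg hm.nonneg] using hn k p.1 p.2
    refine this.congr' ?_
    filter_upwards [hM] with n hn
    rw [trilin_apply hs hn]

theorem trilin_sub_telescope (hs : 1 / 2 < s) (hm : MulBound m B) (x x' y y' z z' : L2) :
    trilin s m x y z - trilin s m x' y' z' =
      trilin s m (x - x') y z + trilin s m x' (y - y') z + trilin s m x' y' (z - z') := by
  rw [trilin_sub_left hs hm, trilin_sub_mid hs hm, trilin_sub_right hs hm]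
  abel

theorem tendsto_trilin {ι : Type*} {l : Filter ι} (hs : 1 / 2 < s)
    {M : ι → ℤ → ℤ → ℤ → ℂ} (hM : ∀ᶠ i in l, MulBound (M i) B) (hm : MulBound m B)
    (hl : ∀ k i j, Tendsto (fun n => M n k i j) l (𝓝 (m k i j))) {x y z : ι → L2} {x₀ y₀ z₀ : L2}
    (hx : Tendsto x l (𝓝 x₀)) (hy : Tendsto y l (𝓝 y₀)) (hz : Tendsto z l (𝓝 z₀)) :
    Tendsto (fun n => trilin s (M n) (x n) (y n) (z n)) l (𝓝 (trilin s m x₀ y₀ z₀)) := by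
  have h1 := tendsto_trilin_mul hs hM hm hl x₀ y₀ z₀
  have h2 : Tendsto (fun n => trilin s (M n) (x n) (y n) (z n) - trilin s (M n) x₀ y₀ z₀) l
      (𝓝 0) := by
    refine squeeze_zero_norm' (a := fun n => B * triC s * (‖x n - x₀‖ * ‖y n‖ * ‖z n‖) +
      B * triC s * (‖x₀‖ * ‖y n - y₀‖ * ‖z n‖) + B * triC s * (‖x₀‖ * ‖y₀‖ * ‖z n - z₀‖)) ?_ ?_
    · filter_upwards [hM] with n hn
      rw [trilin_sub_telescope hs hn]
      exact norm_add₃_le.trans (add_le_add (add_le_add (norm_trilin_le hs hn _ _ _)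
        (norm_trilin_le hs hn _ _ _)) (norm_trilin_le hs hn _ _ _))
    · have ex := tendsto_iff_norm_sub_tendsto_zero.1 hx
      have ey := tendsto_iff_norm_sub_tendsto_zero.1 hy
      have ez := tendsto_iff_norm_sub_tendsto_zero.1 hz
      have := ((((ex.mul hy.norm).mul hz.norm).const_mul (B * triC s)).add
        (((ey.const_mul ‖x₀‖).mul hz.norm).const_mul (B * triC s))).add
        ((ez.const_mul (‖x₀‖ * ‖y₀‖)).const_mul (B * triC s))
      simpa using this
  simpa using h2.add h1

/-- The product rule for trilinear operators with a time dependent multiplier. -/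
theorem hasDerivAt_trilin (hs : 1 / 2 < s) {M : ℝ → ℤ → ℤ → ℤ → ℂ} {M' : ℤ → ℤ → ℤ → ℂ}
    {t : ℝ} (hM : ∀ᶠ τ in 𝓝 t, MulBound (M τ) B) (hM' : MulBound M' B')
    (hderiv : ∀ k i j, HasDerivAt (fun τ => M τ k i j) (M' k i j) t)
    (hlip : ∀ᶠ τ in 𝓝 t, ∀ k i j, ‖M τ k i j - M t k i j‖ ≤ B' * |τ - t|)
    {x y z : ℝ → L2} {x' y' z' : L2} (hx : HasDerivAt x x' t) (hy : HasDerivAt y y' t)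
    (hz : HasDerivAt z z' t) :
    HasDerivAt (fun τ => trilin s (M τ) (x τ) (y τ) (z τ))
      (trilin s M' (x t) (y t) (z t) + trilin s (M t) x' (y t) (z t) +
        trilin s (M t) (x t) y' (z t) + trilin s (M t) (x t) (y t) z') t := by
  have hMt : MulBound (M t) B := hM.self_of_nhds
  rw [hasDerivAt_iff_tendsto_slope]
  have hle : 𝓝[≠] t ≤ 𝓝 t := nhdsWithin_le_nhds
  have hMc : ∀ k i j, Tendsto (fun τ => M τ k i j) (𝓝[≠] t) (𝓝 (M t k i j)) := fun k i j =>
    (hderiv k i j).continuousAt.tendsto.mono_left hle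
  -- The difference quotients of the multiplier are uniformly bounded by the Lipschitz hypothesis
  -- and converge pointwise, which is all that strong convergence needs.
  have c1 : Tendsto (fun τ => trilin s (fun k i j => ((τ - t)⁻¹ : ℝ) * (M τ k i j - M t k i j))
      (x t) (y t) (z t)) (𝓝[≠] t) (𝓝 (trilin s M' (x t) (y t) (z t))) := by
    refine tendsto_trilin_mul hs ?_ hM' ?_ _ _ _
    · filter_upwards [hle hlip, self_mem_nhdsWithin] with τ hτ hne k i j
      have hne' : 0 < |τ - t| := abs_pos.2 (sub_ne_zero.2 hne)
      rw [norm_mul, Complex.norm_real, norm_inv, Real.norm_eq_abs, inv_mul_le_iff₀ hne']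
      linarith [hτ k i j]
    · intro k i j
      have := hasDerivAt_iff_tendsto_slope.1 (hderiv k i j)
      refine this.congr fun τ => ?_
      rw [slope_def_module]; simp
  have hxs := hasDerivAt_iff_tendsto_slope.1 hx
  have hys := hasDerivAt_iff_tendsto_slope.1 hy
  have hzs := hasDerivAt_iff_tendsto_slope.1 hz
  have cx := hx.continuousAt.tendsto.mono_left hle
  have cy := hy.continuousAt.tendsto.mono_left hle
  have c2 := tendsto_trilin hs (hle hM) hMt hMc hxs cy (z := z) (hz.continuousAt.tendsto.mono_left hle)
  have c3 := tendsto_trilin hs (hle hM) hMt hMc (x := fun _ => x t) tendsto_const_nhds hys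
    (z := z) (hz.continuousAt.tendsto.mono_left hle)
  have c4 := tendsto_trilin hs (hle hM) hMt hMc (x := fun _ => x t) tendsto_const_nhds
    (y := fun _ => y t) tendsto_const_nhds hzs
  refine (((c1.add c2).add c3).add c4).congr' ?_
  filter_upwards [hle hM, self_mem_nhdsWithin] with τ hτ hne
  simp only [slope_def_module, trilin_smul_left hs hτ, trilin_smul_mid hs hτ,
    trilin_smul_right hs hτ]
  rw [trilin_mul_smul hs (hτ.sub hMt), trilin_mul_sub hs hτ hMt, trilin_sub_left hs hτ,
    trilin_sub_mid hs hτ, trilin_sub_right hs hτ, L2.coe_smul, ← smul_add, ← smul_add,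
    ← smul_add]
  congr 1
  abel

end DiracNLS

end

/-! ### The coefficient equation: mass conservation, gauge and normal form. -/

noncomputable section

namespace DiracNLS

open scoped ENNReal ComplexConjugate

variable {s : ℝ}

theorem norm_exp_I_mul_ofReal (x : ℝ) : ‖Complex.exp (Complex.I * x)‖ = 1 := by
  rw [mul_comm]; exact Complex.norm_exp_ofReal_mul_I x

theorem conj_exp_I_mul_ofReal (x : ℝ) :
    conj (Complex.exp (Complex.I * x)) = Complex.exp (Complex.I * ((-x : ℝ) : ℂ)) := by
  rw [← Complex.exp_conj]; simp

/-! ### Derivatives of diagonal operators -/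

/-- Product rule for a diagonal operator that is differentiable only strongly; the Lipschitz bound
uniform in `k` dominates the difference quotients of the multiplier. -/
theorem hasDerivAt_diag {d : ℝ → ℤ → ℂ} {d' : ℤ → ℂ} {B B' t : ℝ}
    (hd : ∀ᶠ τ in 𝓝 t, ∀ k, ‖d τ k‖ ≤ B) (hd' : ∀ k, ‖d' k‖ ≤ B')
    (hderiv : ∀ k, HasDerivAt (fun τ => d τ k) (d' k) t)
    (hlip : ∀ᶠ τ in 𝓝 t, ∀ k, ‖d τ k - d t k‖ ≤ B' * |τ - t|)
    {x : ℝ → L2} {x' : L2} (hx : HasDerivAt x x' t) :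
    HasDerivAt (fun τ => diag (d τ) (x τ)) (diag d' (x t) + diag (d t) x') t := by
  have hdt := hd.self_of_nhds
  rw [hasDerivAt_iff_tendsto_slope]
  have hle : 𝓝[≠] t ≤ 𝓝 t := nhdsWithin_le_nhds
  have c1 : Tendsto (fun τ => diag (fun k => ((τ - t)⁻¹ : ℝ) * (d τ k - d t k)) (x t))
      (𝓝[≠] t) (𝓝 (diag d' (x t))) := by
    refine tendsto_diag ?_ hd' ?_ tendsto_const_nhds
    · filter_upwards [hle hlip, self_mem_nhdsWithin] with τ hτ hne k
      have hne' : 0 < |τ - t| := abs_pos.2 (sub_ne_zero.2 hne)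
      rw [norm_mul, Complex.norm_real, norm_inv, Real.norm_eq_abs, inv_mul_le_iff₀ hne']
      linarith [hτ k]
    · intro k
      refine (hasDerivAt_iff_tendsto_slope.1 (hderiv k)).congr fun τ => ?_
      rw [slope_def_module]; simp
  have c2 := tendsto_diag (hle hd) hdt
    (fun k => (hderiv k).continuousAt.tendsto.mono_left hle) (hasDerivAt_iff_tendsto_slope.1 hx)
  refine (c1.add c2).congr' ?_
  filter_upwards [hle hd, self_mem_nhdsWithin] with τ hτ hne
  have hbd : ∀ k, ‖((τ - t)⁻¹ : ℝ) * (d τ k - d t k)‖ ≤ |(τ - t)⁻¹| * (B + B) := fun k => by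
    rw [norm_mul, Complex.norm_real, Real.norm_eq_abs]
    gcongr
    exact (norm_sub_le _ _).trans (add_le_add (hτ k) (hdt k))
  apply lp.ext
  funext k
  simp only [slope_def_module, lp.coeFn_add, Pi.add_apply, diag_apply hbd, diag_apply hτ,
    lp.coeFn_smul, Pi.smul_apply, lp.coeFn_sub, Pi.sub_apply, Complex.real_smul, diag_apply hdt]
  push_cast
  ring

/-- The phases `e^{i θₖ r}`. -/
def phase (θ : ℤ → ℝ) (r : ℝ) (k : ℤ) : ℂ := Complex.exp (Complex.I * ((θ k * r : ℝ) : ℂ))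

theorem norm_phase (θ : ℤ → ℝ) (r : ℝ) (k : ℤ) : ‖phase θ r k‖ = 1 := norm_exp_I_mul_ofReal _

theorem norm_phase_le (θ : ℤ → ℝ) (r : ℝ) (k : ℤ) : ‖phase θ r k‖ ≤ 1 := (norm_phase θ r k).le

theorem phase_neg_mul (θ : ℤ → ℝ) (r : ℝ) (k : ℤ) : phase θ (-r) k * phase θ r k = 1 := by
  rw [phase, phase, ← Complex.exp_add]
  simp

theorem hasDerivAt_phase (θ : ℤ → ℝ) {r : ℝ → ℝ} {r' t : ℝ} (hr : HasDerivAt r r' t) (k : ℤ) :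
    HasDerivAt (fun τ => phase θ (r τ) k) (((r' * θ k : ℝ) : ℂ) * Complex.I * phase θ (r t) k)
      t := by
  have h1 : HasDerivAt (fun τ => ((θ k * r τ : ℝ) : ℂ)) ((θ k * r' : ℝ) : ℂ) t :=
    (hr.const_mul (θ k)).ofReal_comp
  have h2 := (h1.const_mul Complex.I).cexp
  refine h2.congr_deriv ?_
  simp only [phase]
  push_cast
  ring

theorem norm_exp_I_sub_le (x y : ℝ) :
    ‖Complex.exp (Complex.I * x) - Complex.exp (Complex.I * y)‖ ≤ |x - y| := by
  have hderiv : ∀ r ∈ (univ : Set ℝ), HasDerivWithinAt (fun r : ℝ => Complex.exp (Complex.I * r))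
      (Complex.exp (Complex.I * r) * Complex.I) univ r := fun r _ => by
    have h1 : HasDerivAt (fun r : ℝ => (r : ℂ)) 1 r := Complex.ofRealCLM.hasDerivAt
    have h2 := (h1.const_mul Complex.I).cexp
    simpa using h2
  have h := convex_univ.norm_image_sub_le_of_norm_hasDerivWithin_le (C := 1) hderiv
    (fun r _ => by rw [norm_mul, norm_exp_I_mul_ofReal]; simp) (mem_univ y) (mem_univ x)
  simpa using h

theorem norm_phase_sub_le {θ : ℤ → ℝ} {Θ : ℝ} (hθ : ∀ k, |θ k| ≤ Θ) (r r' : ℝ) (k : ℤ) :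
    ‖phase θ r k - phase θ r' k‖ ≤ Θ * |r - r'| := by
  refine (norm_exp_I_sub_le _ _).trans ?_
  rw [← mul_sub, abs_mul]
  gcongr
  exact hθ k

/-- A function differentiable at a point is Lipschitz there. -/
theorem eventually_abs_sub_le {r : ℝ → ℝ} {r' t : ℝ} (hr : HasDerivAt r r' t) :
    ∀ᶠ τ in 𝓝 t, |r τ - r t| ≤ (|r'| + 1) * |τ - t| := by
  have h := hr.isLittleO.def (c := 1) one_pos
  filter_upwards [h] with τ hτ
  have h1 : |r τ - r t - (τ - t) * r'| ≤ |τ - t| := by simpa using hτ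
  calc |r τ - r t| = |(r τ - r t - (τ - t) * r') + (τ - t) * r'| := by ring_nf
    _ ≤ |τ - t| + |τ - t| * |r'| := (abs_add_le _ _).trans (by rw [abs_mul]; linarith)
    _ = _ := by ring

theorem hasDerivAt_diag_phase {θ : ℤ → ℝ} {Θ : ℝ} (hθ : ∀ k, |θ k| ≤ Θ) {r : ℝ → ℝ} {r' t : ℝ}
    (hr : HasDerivAt r r' t) {x : ℝ → L2} {x' : L2} (hx : HasDerivAt x x' t) :
    HasDerivAt (fun τ => diag (phase θ (r τ)) (x τ))
      (((r' : ℂ) * Complex.I) • diag (fun k => (θ k : ℂ)) (diag (phase θ (r t)) (x t)) +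
        diag (phase θ (r t)) x') t := by
  have hΘ : 0 ≤ Θ := (abs_nonneg _).trans (hθ 0)
  have hbd' : ∀ k, ‖((r' * θ k : ℝ) : ℂ) * Complex.I * phase θ (r t) k‖ ≤ Θ * (|r'| + 1) := by
    intro k
    rw [norm_mul, norm_mul, norm_phase, Complex.norm_real, Complex.norm_I, Real.norm_eq_abs,
      abs_mul]
    nlinarith [abs_nonneg r', hθ k, abs_nonneg (θ k)]
  have hθ' : ∀ k, ‖((θ k : ℝ) : ℂ)‖ ≤ Θ := fun k => by simpa using hθ k
  have h := hasDerivAt_diag (d := fun τ => phase θ (r τ)) (B := 1)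
    (Eventually.of_forall fun τ k => norm_phase_le θ _ k) hbd'
    (fun k => hasDerivAt_phase θ hr k) ?_ hx
  · convert h using 2
    apply lp.ext
    funext k
    rw [diag_apply hbd', lp.coeFn_smul, Pi.smul_apply, diag_apply hθ',
      diag_apply (norm_phase_le θ _)]
    push_cast
    rw [smul_eq_mul]
    ring
  · filter_upwards [eventually_abs_sub_le hr] with τ hτ k
    refine (norm_phase_sub_le hθ _ _ k).trans ?_
    rw [mul_assoc]
    gcongr

/-! ### Quadrilinear sums -/

/-- The summand of the quadrilinear sum. -/
def quartTerm (s : ℝ) (m : ℤ → ℤ → ℤ → ℂ) (h x y z : L2) (q : ℤ × ℤ × ℤ) : ℂ :=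
  conj (seq s h q.1) * triTerm s m x y z q.1 q.2

/-- The summand of the quadrilinear sum on the diagonal. -/
def quadTerm (s : ℝ) (m : ℤ → ℤ → ℤ → ℂ) (x : L2) (q : ℤ × ℤ × ℤ) : ℂ :=
  quartTerm s m x x x x q

theorem summable_norm_tsum_triTerm (hs : 1 / 2 < s) {m : ℤ → ℤ → ℤ → ℂ} {B : ℝ}
    (hm : MulBound m B) (x y z : L2) :
    Summable fun k => (wt s k * ∑' p, ‖triTerm s m x y z k p‖) ^ 2 := by
  have hB := hm.nonneg
  have h : ∑' k, (ENNReal.ofReal (wt s k) * triMaj s x y z k) ^ 2 ≠ ⊤ :=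
    ne_top_of_le_ne_top (by simp) (tsum_sq_wt_mul_triMaj_le hs x y z)
  have h2 := (ENNReal.summable_toReal h).mul_left (B ^ 2)
  refine Summable.of_nonneg_of_le (fun k => by positivity) (fun k => ?_) h2
  rw [ENNReal.toReal_pow, ← mul_pow]
  have hp := wt_pos s k
  refine pow_le_pow_left₀ (mul_nonneg hp.le (tsum_nonneg fun _ => norm_nonneg _)) ?_ 2
  have h3 := ENNReal.toReal_mono (ENNReal.mul_ne_top (by simp) (triMaj_ne_top hs x y z k))
    (tsum_enorm_triTerm_le hm x y z k)
  rw [ENNReal.tsum_toReal_eq (fun _ => by simp), ENNReal.toReal_mul,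
    ENNReal.toReal_ofReal hB] at h3
  simp only [toReal_enorm] at h3
  rw [ENNReal.toReal_mul, ENNReal.toReal_ofReal hp.le]
  nlinarith

/-- A factor `κ_k ≤ wt²` is split evenly: one `wt` goes to `h` and one to the trilinear sum, both of
which are then square summable. -/
theorem summable_quartTerm (hs : 1 / 2 < s) {m : ℤ → ℤ → ℤ → ℂ} {B : ℝ}
    (hm : MulBound m B) (h x y z : L2) {κ : ℤ → ℝ} (hκ : ∀ k, |κ k| ≤ wt s k ^ 2) :
    Summable fun q : ℤ × ℤ × ℤ => |κ q.1| * ‖quartTerm s m h x y z q‖ := by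
  refine (summable_prod_of_nonneg (fun q => by positivity)).2 ⟨fun k => ?_, ?_⟩
  · simp only [quartTerm, norm_mul]
    exact ((summable_norm_triTerm hs hm x y z k).mul_left _).mul_left _
  · have e : ∀ k, ∑' p, |κ k| * ‖quartTerm s m h x y z (k, p)‖ =
        |κ k| * ‖seq s h k‖ * ∑' p, ‖triTerm s m x y z k p‖ := by
      intro k
      simp only [quartTerm, norm_mul, RCLike.norm_conj, ← mul_assoc]
      rw [tsum_mul_left]
    simp only [e]
    have h1 := h.summable_sq
    have h2 := summable_norm_tsum_triTerm hs hm x y z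
    refine Summable.of_nonneg_of_le (fun k => ?_) (fun k => ?_) (h1.add h2)
    · exact mul_nonneg (by positivity) (tsum_nonneg fun _ => norm_nonneg _)
    · set S := ∑' p, ‖triTerm s m x y z k p‖
      have hS : 0 ≤ S := tsum_nonneg fun _ => norm_nonneg _
      have hw := wt_pos s k
      rw [norm_apply_eq s]
      have h3 : |κ k| * ‖seq s h k‖ * S ≤ wt s k ^ 2 * ‖seq s h k‖ * S := by
        gcongr
        exact hκ k
      nlinarith [sq_nonneg (wt s k * ‖seq s h k‖ - wt s k * S), mul_nonneg hw.le hS,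
        mul_nonneg hw.le (norm_nonneg (seq s h k)), sq_nonneg (wt s k * ‖seq s h k‖),
        sq_nonneg (wt s k * S)]

theorem summable_quadTerm (hs : 1 / 2 < s) {m : ℤ → ℤ → ℤ → ℂ} {B : ℝ}
    (hm : MulBound m B) (x : L2) {κ : ℤ → ℝ} (hκ : ∀ k, |κ k| ≤ wt s k ^ 2) :
    Summable fun q : ℤ × ℤ × ℤ => |κ q.1| * ‖quadTerm s m x q‖ :=
  summable_quartTerm hs hm x x x x hκ

/-- The weighted pairing `∑ₖ κₖ conj(aₖ) bₖ` of sequences of `l^{2,s}`, as a sum of coordinates. -/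
theorem inner_diag_eq_tsum {κ : ℤ → ℝ} (hκ : ∀ k, |κ k| ≤ wt s k ^ 2) (x y : L2) :
    inner ℂ x (diag (fun k => ((κ k / wt s k ^ 2 : ℝ) : ℂ)) y) =
      ∑' k, (κ k : ℂ) * (conj (seq s x k) * seq s y k) := by
  have hb : ∀ k, ‖((κ k / wt s k ^ 2 : ℝ) : ℂ)‖ ≤ 1 := fun k => by
    rw [Complex.norm_real, norm_div, Real.norm_eq_abs, Real.norm_of_nonneg (sq_nonneg _)]
    exact (div_le_one (pow_pos (wt_pos s k) 2)).2 (hκ k)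
  rw [lp.inner_eq_tsum]
  refine tsum_congr fun k => ?_
  rw [diag_apply hb, ← wt_mul_seq s x, ← wt_mul_seq s y]
  have : (wt s k : ℂ) ≠ 0 := by exact_mod_cast (wt_pos s k).ne'
  simp only [RCLike.inner_apply, map_mul, Complex.conj_ofReal]
  push_cast
  field_simp

theorem tsum_pair_trilin (hs : 1 / 2 < s) {m : ℤ → ℤ → ℤ → ℂ} {B : ℝ}
    (hm : MulBound m B) (h x y z : L2) {κ : ℤ → ℝ} (hκ : ∀ k, |κ k| ≤ wt s k ^ 2) :
    ∑' k, (κ k : ℂ) * (conj (seq s h k) * seq s (trilin s m x y z) k) =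
      ∑' q : ℤ × ℤ × ℤ, (κ q.1 : ℂ) * quartTerm s m h x y z q := by
  have hsum : Summable fun q : ℤ × ℤ × ℤ => (κ q.1 : ℂ) * quartTerm s m h x y z q := by
    refine Summable.of_norm ?_
    simpa using summable_quartTerm hs hm h x y z hκ
  rw [hsum.tsum_prod]
  refine tsum_congr fun k => ?_
  rw [seq_trilin hs hm]
  simp only [quartTerm]
  rw [tsum_mul_left, tsum_mul_left]

/-- The involution of index quadruples `(k, i, l, j) ↦ (i, k, j, l)`. -/
def quadSwap : ℤ × ℤ × ℤ ≃ ℤ × ℤ × ℤ where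
  toFun q := (q.2.1, q.1, q.2.1 + q.2.2 - q.1)
  invFun q := (q.2.1, q.1, q.2.1 + q.2.2 - q.1)
  left_inv q := by ext <;> simp
  right_inv q := by ext <;> simp

/-! ### The equation for the coefficients -/

/-- The resonance function `i² - l² + j² - k²` with `l = i + j - k`. -/
def omega (k i j : ℤ) : ℝ := -2 * ((k : ℝ) - i) * (k - j)

/-- The oscillating factor `e^{i ω / 4t}`. -/
def osc (t : ℝ) (k i j : ℤ) : ℂ := Complex.exp (Complex.I * ((omega k i j / (4 * t) : ℝ) : ℂ))

theorem norm_osc (t : ℝ) (k i j : ℤ) : ‖osc t k i j‖ = 1 := norm_exp_I_mul_ofReal _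

theorem osc_bound (t : ℝ) : MulBound (osc t) 1 := fun k i j => (norm_osc t k i j).le

/-- Exchanging the conjugated pair `(k, l)` with the unconjugated pair `(i, j)` reverses the sign of
`ω`. This symmetry is the Hamiltonian structure behind conservation of mass. -/
theorem quadTerm_osc_swap (x : L2) (t : ℝ) (q : ℤ × ℤ × ℤ) :
    quadTerm s (osc t) x (quadSwap q) = conj (quadTerm s (osc t) x q) := by
  obtain ⟨k, i, j⟩ := q
  have h : omega i k (i + j - k) = -omega k i j := by
    simp only [omega]; push_cast; ring
  simp only [quadTerm, quartTerm, quadSwap, Equiv.coe_fn_mk, triTerm, osc, map_mul, Complex.conj_conj,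
    conj_exp_I_mul_ofReal, h]
  rw [show k + (i + j - k) - i = j by ring, neg_div]
  ring

/-- The mass `∑ₖ |aₖ|²`. -/
def mass (s : ℝ) (x : L2) : ℝ := ∑' k, ‖seq s x k‖ ^ 2

theorem tsum_conj_mul_self (κ : ℤ → ℝ) (x : L2) :
    ∑' k, (κ k : ℂ) * (conj (seq s x k) * seq s x k) =
      ((∑' k, κ k * ‖seq s x k‖ ^ 2 : ℝ) : ℂ) := by
  rw [Complex.ofReal_tsum]
  refine tsum_congr fun k => ?_
  rw [← Complex.normSq_eq_conj_mul_self, Complex.normSq_eq_norm_sq]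
  push_cast; rfl

/-- The right-hand side `T(A, A, A) - 2 M A` of the equation for the coefficients. -/
def nonlin (s M t : ℝ) (x : L2) : L2 := trilin s (osc t) x x x - ((2 * M : ℝ) : ℂ) • x

/-- The vector field `(i c / |t|) (T(A, A, A) - 2 M A)`. -/
def field (s c M t : ℝ) (x : L2) : L2 := (((c / |t| : ℝ) : ℂ) * Complex.I) • nonlin s M t x

theorem one_le_wt_sq (hs : 0 ≤ s) (k : ℤ) : |(1 : ℝ)| ≤ wt s k ^ 2 := by
  rw [abs_one]; exact one_le_pow₀ (one_le_wt hs k)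

/-- The sum equals its own conjugate after the reindexing by `quadSwap`. -/
theorem im_quad_eq_zero (x : L2) (t : ℝ) :
    (∑' q : ℤ × ℤ × ℤ, quadTerm s (osc t) x q).im = 0 := by
  rw [← Complex.conj_eq_iff_im, Complex.conj_tsum, ← quadSwap.tsum_eq]
  refine tsum_congr fun q => ?_
  rw [quadTerm_osc_swap, Complex.conj_conj]

theorem summable_pair {κ : ℤ → ℝ} (hκ : ∀ k, |κ k| ≤ wt s k ^ 2) (x y : L2) :
    Summable fun k => (κ k : ℂ) * (conj (seq s x k) * seq s y k) := by
  refine Summable.of_norm_bounded (x.summable_sq.add y.summable_sq) fun k => ?_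
  rw [norm_mul, norm_mul, RCLike.norm_conj, Complex.norm_real, Real.norm_eq_abs,
    norm_apply_eq s x, norm_apply_eq s y]
  have hw := wt_pos s k
  have h1 : |κ k| * (‖seq s x k‖ * ‖seq s y k‖) ≤ wt s k ^ 2 * (‖seq s x k‖ * ‖seq s y k‖) := by
    gcongr
    exact hκ k
  nlinarith [sq_nonneg (wt s k * ‖seq s x k‖ - wt s k * ‖seq s y k‖),
    sq_nonneg (wt s k * ‖seq s x k‖), sq_nonneg (wt s k * ‖seq s y k‖)]

/-- The evolution of a weighted square sum along the equation. -/
theorem hasDerivAt_weighted_sq (hs : 1 / 2 < s) {c M t : ℝ} {A : ℝ → L2}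
    (hA : HasDerivAt A (field s c M t (A t)) t) {κ : ℤ → ℝ} (hκ : ∀ k, |κ k| ≤ wt s k ^ 2) :
    HasDerivAt (fun τ => ∑' k, κ k * ‖seq s (A τ) k‖ ^ 2)
      (-(2 * (c / |t|) * (∑' q : ℤ × ℤ × ℤ, (κ q.1 : ℂ) * quadTerm s (osc t) (A t) q).im)) t := by
  set e : ℤ → ℂ := fun k => ((κ k / wt s k ^ 2 : ℝ) : ℂ)
  have hb : ∀ k, ‖e k‖ ≤ 1 := fun k => by
    rw [Complex.norm_real, norm_div, Real.norm_eq_abs, Real.norm_of_nonneg (sq_nonneg _)]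
    exact (div_le_one (pow_pos (wt_pos s k) 2)).2 (hκ k)
  have h1 : HasDerivAt (fun τ => diag e (A τ)) (diag e (field s c M t (A t))) t :=
    ((diagL e hb).hasFDerivAt.restrictScalars ℝ).comp_hasDerivAt t hA
  have h2 := hA.inner ℂ h1
  have h3 := Complex.reCLM.hasFDerivAt.comp_hasDerivAt t h2
  have e1 : ∀ τ, inner ℂ (A τ) (diag e (A τ)) =
      ((∑' k, κ k * ‖seq s (A τ) k‖ ^ 2 : ℝ) : ℂ) := fun τ => by
    rw [inner_diag_eq_tsum hκ, tsum_conj_mul_self]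
  have hfun : (fun τ => ∑' k, κ k * ‖seq s (A τ) k‖ ^ 2) =
      Complex.reCLM ∘ fun τ => inner ℂ (A τ) (diag e (A τ)) := by
    funext τ
    simp only [Function.comp, e1, Complex.reCLM_apply, Complex.ofReal_re]
  rw [hfun]
  refine h3.congr_deriv ?_
  have e2 : inner ℂ (field s c M t (A t)) (diag e (A t)) =
      conj (inner ℂ (A t) (diag e (field s c M t (A t)))) := by
    rw [inner_diag_eq_tsum hκ, inner_diag_eq_tsum hκ, Complex.conj_tsum]
    refine tsum_congr fun k => ?_
    simp only [map_mul, Complex.conj_ofReal, Complex.conj_conj]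
    ring
  have e3 : inner ℂ (A t) (diag e (field s c M t (A t))) = ((c / |t| : ℝ) : ℂ) * Complex.I *
      ((∑' q : ℤ × ℤ × ℤ, (κ q.1 : ℂ) * quadTerm s (osc t) (A t) q) -
        ((2 * M * ∑' k, κ k * ‖seq s (A t) k‖ ^ 2 : ℝ) : ℂ)) := by
    rw [inner_diag_eq_tsum hκ, Complex.ofReal_mul, ← tsum_conj_mul_self,
      show (∑' q : ℤ × ℤ × ℤ, (κ q.1 : ℂ) * quadTerm s (osc t) (A t) q) =
        ∑' q : ℤ × ℤ × ℤ, (κ q.1 : ℂ) * quartTerm s (osc t) (A t) (A t) (A t) (A t) q from rfl,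
      ← tsum_pair_trilin hs (osc_bound t) _ _ _ _ hκ, ← tsum_mul_left,
      ← Summable.tsum_sub (summable_pair hκ _ _) ((summable_pair hκ _ _).mul_left _),
      ← tsum_mul_left]
    refine tsum_congr fun k => ?_
    simp only [field, nonlin, seq_smul, seq_sub]
    ring
  -- The derivative is a pairing plus its conjugate, hence twice a real part. The factor `i` of the
  -- field turns it into minus an imaginary part, and the term with `M`, being `i` times a real
  -- number, drops out.
  rw [e2, e3]
  simp only [Complex.reCLM_apply, Complex.add_re, Complex.conj_re, Complex.mul_re, Complex.mul_im,
    Complex.sub_re, Complex.sub_im, Complex.ofReal_re, Complex.ofReal_im, Complex.I_re,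
    Complex.I_im]
  ring

/-- The parameter `M` is arbitrary here and does not affect the mass. This allows the mass to be
identified before `M` is known to be constant. -/
theorem hasDerivAt_mass (hs : 1 / 2 < s) {c M t : ℝ} {A : ℝ → L2}
    (hA : HasDerivAt A (field s c M t (A t)) t) :
    HasDerivAt (fun τ => mass s (A τ)) 0 t := by
  have h := hasDerivAt_weighted_sq hs hA (κ := fun _ => 1)
    (one_le_wt_sq (by linarith))
  simpa [mass, im_quad_eq_zero] using h

end DiracNLS

end

noncomputable section

namespace DiracNLS

open scoped ENNReal ComplexConjugate

variable {s c : ℝ} {θ : ℤ → ℝ} {Θ : ℝ}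

/-! ### Gauge transformation -/

/-- The phase mismatch `θₖ - θᵢ + θₗ - θⱼ`. -/
def mismatch (θ : ℤ → ℝ) (k i j : ℤ) : ℝ := θ k - θ i + θ (i + j - k) - θ j

theorem abs_mismatch_le (hθ : ∀ k, |θ k| ≤ Θ) (k i j : ℤ) : |mismatch θ k i j| ≤ 4 * Θ := by
  have h1 := abs_le.1 (hθ k)
  have h2 := abs_le.1 (hθ i)
  have h3 := abs_le.1 (hθ (i + j - k))
  have h4 := abs_le.1 (hθ j)
  unfold mismatch
  rw [abs_le]
  constructor <;> linarith [h1.1, h1.2, h2.1, h2.2, h3.1, h3.2, h4.1, h4.2]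

/-- The phase of the gauged oscillating factor. -/
def gphase (c : ℝ) (θ : ℤ → ℝ) (t : ℝ) (k i j : ℤ) : ℝ :=
  omega k i j / (4 * t) + mismatch θ k i j * (c * Real.log t)

open Classical in
/-- The nonresonant oscillating factor after the gauge transformation. -/
def gosc (c : ℝ) (θ : ℤ → ℝ) (t : ℝ) (k i j : ℤ) : ℂ :=
  if i ≠ k ∧ j ≠ k then Complex.exp (Complex.I * (gphase c θ t k i j : ℂ)) else 0

open Classical in
/-- The multiplier of the cubic term `|aₖ|² aₖ`. -/
def coinc (k i j : ℤ) : ℂ := if i = k ∧ j = k then 1 else 0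

theorem gosc_bound (c : ℝ) (θ : ℤ → ℝ) (t : ℝ) : MulBound (gosc c θ t) 1 := fun k i j => by
  unfold gosc
  split_ifs
  · exact (norm_exp_I_mul_ofReal _).le
  · simp

theorem coinc_bound : MulBound coinc 1 := fun k i j => by
  unfold coinc
  split_ifs <;> simp

/-- `(|aₖ|² - θₖ) aₖ`. -/
def resid (s : ℝ) (θ : ℤ → ℝ) (x : L2) : L2 :=
  trilin s coinc x x x - diag (fun k => (θ k : ℂ)) x

/-- The vector field of the gauged equation `t a' = V(t, a)`. -/
def gfield (s c : ℝ) (θ : ℤ → ℝ) (t : ℝ) (x : L2) : L2 :=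
  ((c : ℂ) * Complex.I) • (trilin s (gosc c θ t) x x x - resid s θ x)

theorem tsum_triTerm_coinc (x : L2) (k : ℤ) :
    ∑' p, triTerm s coinc x x x k p = (‖seq s x k‖ ^ 2 : ℝ) * seq s x k := by
  rw [tsum_eq_single (k, k)]
  · simp only [triTerm, coinc, and_self, if_true, one_mul]
    rw [show k + k - k = k by ring, Complex.mul_conj, Complex.normSq_eq_norm_sq]
  · rintro ⟨i, j⟩ h
    have : ¬ (i = k ∧ j = k) := fun h' => h (by rw [h'.1, h'.2])
    simp [triTerm, coinc, this]

theorem norm_ofReal_le (hθ : ∀ k, |θ k| ≤ Θ) (k : ℤ) : ‖(θ k : ℂ)‖ ≤ Θ := by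
  simpa using hθ k

/-- `|aₖ|² - θₖ`. -/
def rho (s : ℝ) (θ : ℤ → ℝ) (x : L2) (k : ℤ) : ℝ := ‖seq s x k‖ ^ 2 - θ k

/-- The factor `rho` is real. In the equation this term appears multiplied by `i`, so it rotates the
coefficient and leaves its modulus alone; the control of the singular term rests on this. -/
theorem seq_resid (hs : 1 / 2 < s) (hθ : ∀ k, |θ k| ≤ Θ) (x : L2) (k : ℤ) :
    seq s (resid s θ x) k = (rho s θ x k : ℂ) * seq s x k := by
  rw [resid, seq_sub, seq_trilin hs coinc_bound, tsum_triTerm_coinc,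
    seq_diag (norm_ofReal_le hθ), rho]
  push_cast
  ring

open Classical in
/-- The multiplier of the interactions with `i = k`. -/
def rowMul (k i _j : ℤ) : ℂ := if i = k then 1 else 0

open Classical in
/-- The multiplier of the interactions with `j = k`. -/
def colMul (k _i j : ℤ) : ℂ := if j = k then 1 else 0

theorem rowMul_bound : MulBound rowMul 1 := fun k i j => by
  unfold rowMul
  split_ifs <;> simp

theorem colMul_bound : MulBound colMul 1 := fun k i j => by
  unfold colMul
  split_ifs <;> simp

theorem summable_seq_sq (hs : 0 ≤ s) (x : L2) : Summable fun k => ‖seq s x k‖ ^ 2 :=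
  Summable.of_nonneg_of_le (fun _ => by positivity)
    (fun k => pow_le_pow_left₀ (norm_nonneg _) (norm_seq_le_apply hs x k) 2) x.summable_sq

/-- If `i = k` then `l = j`, so the sum over `j` is the mass. -/
theorem tsum_triTerm_rowMul (hs : 1 / 2 < s) (x : L2) (k : ℤ) :
    ∑' p, triTerm s rowMul x x x k p = mass s x * seq s x k := by
  rw [(summable_triTerm hs rowMul_bound x x x k).tsum_prod, tsum_eq_single k]
  · rw [mass, Complex.ofReal_tsum, ← tsum_mul_right]
    refine tsum_congr fun j => ?_
    simp only [triTerm, rowMul, if_true, one_mul]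
    rw [show k + j - k = j by ring, ← Complex.normSq_eq_norm_sq, mul_assoc,
      Complex.normSq_eq_conj_mul_self, mul_comm]
  · intro i hi
    simp [triTerm, rowMul, hi]

theorem tsum_triTerm_colMul (hs : 1 / 2 < s) (x : L2) (k : ℤ) :
    ∑' p, triTerm s colMul x x x k p = mass s x * seq s x k := by
  rw [← tsum_triTerm_rowMul hs, ← (Equiv.prodComm ℤ ℤ).tsum_eq]
  refine tsum_congr fun p => ?_
  simp only [triTerm, Equiv.prodComm_apply, Prod.fst_swap, Prod.snd_swap]
  rw [add_comm p.2 p.1, show colMul k p.2 p.1 = rowMul k p.1 p.2 from rfl]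
  ring

/-- Since `ω = -2(k - i)(k - j)`, the resonant set is `{i = k} ∪ {j = k}`, and inclusion and
exclusion gives the three last terms. With `θ = 0` the mismatch vanishes, so the value of `c` is
immaterial. -/
theorem osc_eq (c t : ℝ) (k i j : ℤ) :
    osc t k i j = gosc c 0 t k i j + rowMul k i j + colMul k i j - coinc k i j := by
  by_cases hi : i = k
  · subst hi
    by_cases hj : j = i <;> simp [gosc, rowMul, colMul, coinc, hj, osc, omega]
  · by_cases hj : j = k
    · subst hj
      simp [gosc, rowMul, colMul, coinc, hi, osc, omega]
    · simp [gosc, rowMul, colMul, coinc, hi, hj, osc, gphase, mismatch]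

/-- The term `2 mass` is what the renormalization `2M` cancels when `M` is the mass. What survives
of the resonances is `-|a_k|² a_k`, the cause of the logarithmic phases. -/
theorem tsum_triTerm_osc (hs : 1 / 2 < s) (c t : ℝ) (x : L2) (k : ℤ) :
    ∑' p, triTerm s (osc t) x x x k p = ∑' p, triTerm s (gosc c 0 t) x x x k p +
      2 * mass s x * seq s x k - (‖seq s x k‖ ^ 2 : ℝ) * seq s x k := by
  have h1 := summable_triTerm hs (gosc_bound c 0 t) x x x k
  have h2 := summable_triTerm hs rowMul_bound x x x k
  have h3 := summable_triTerm hs colMul_bound x x x k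
  have h4 := summable_triTerm hs coinc_bound x x x k
  have e : ∀ p, triTerm s (osc t) x x x k p = triTerm s (gosc c 0 t) x x x k p +
      triTerm s rowMul x x x k p + triTerm s colMul x x x k p - triTerm s coinc x x x k p := by
    intro p
    simp only [triTerm]
    rw [osc_eq c]
    ring
  rw [tsum_congr e, ((h1.add h2).add h3).tsum_sub h4, (h1.add h2).tsum_add h3, h1.tsum_add h2,
    tsum_triTerm_rowMul hs, tsum_triTerm_colMul hs, tsum_triTerm_coinc]
  ring

/-- The phases of the three inputs, compared with that of the output, produce exactly the
logarithmic mismatch contained in `gphase`. -/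
theorem triTerm_gosc_gauge (c t : ℝ) (θ : ℤ → ℝ) (x : L2) (k : ℤ) (p : ℤ × ℤ) :
    triTerm s (gosc c θ t) (diag (phase θ (c * Real.log t)) x)
      (diag (phase θ (c * Real.log t)) x) (diag (phase θ (c * Real.log t)) x) k p =
      phase θ (c * Real.log t) k * triTerm s (gosc c 0 t) x x x k p := by
  simp only [triTerm, seq_diag (norm_phase_le θ _), map_mul, gosc]
  split_ifs with h
  · have : Complex.exp (Complex.I * (gphase c θ t k p.1 p.2 : ℂ)) *
        (phase θ (c * Real.log t) p.1 * conj (phase θ (c * Real.log t) (p.1 + p.2 - k)) *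
          phase θ (c * Real.log t) p.2) =
        phase θ (c * Real.log t) k * Complex.exp (Complex.I * (gphase c 0 t k p.1 p.2 : ℂ)) := by
      simp only [phase, conj_exp_I_mul_ofReal, ← Complex.exp_add]
      congr 1
      simp only [gphase, mismatch, Pi.zero_apply]
      push_cast
      ring
    linear_combination (seq s x p.1 * conj (seq s x (p.1 + p.2 - k)) * seq s x p.2) * this
  · ring

/-- The coefficients in the gauge adapted to `θ` solve the gauged equation. -/
theorem hasDerivAt_gauge (hs : 1 / 2 < s) (hθ : ∀ k, |θ k| ≤ Θ) {t : ℝ} (ht : 0 < t)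
    {A : ℝ → L2} (hA : HasDerivAt A (field s c (mass s (A t)) t (A t)) t) :
    HasDerivAt (fun τ => diag (phase θ (c * Real.log τ)) (A τ))
      (t⁻¹ • gfield s c θ t (diag (phase θ (c * Real.log t)) (A t))) t := by
  have h1 := hasDerivAt_diag_phase hθ ((Real.hasDerivAt_log ht.ne').const_mul c) hA
  refine h1.congr_deriv ?_
  refine seq_injective s fun k => ?_
  have e := tsum_triTerm_osc hs c t (A t) k
  have e2 : ∑' p, triTerm s (gosc c θ t) (diag (phase θ (c * Real.log t)) (A t))
      (diag (phase θ (c * Real.log t)) (A t)) (diag (phase θ (c * Real.log t)) (A t)) k p =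
      phase θ (c * Real.log t) k * ∑' p, triTerm s (gosc c 0 t) (A t) (A t) (A t) k p := by
    rw [← tsum_mul_left]
    exact tsum_congr fun p => triTerm_gosc_gauge c t θ (A t) k p
  have hn : ‖phase θ (c * Real.log t) k * seq s (A t) k‖ = ‖seq s (A t) k‖ := by
    rw [norm_mul, norm_phase, one_mul]
  rw [seq_add, seq_smul, seq_diag (norm_ofReal_le hθ), seq_diag (norm_phase_le θ _),
    seq_diag (norm_phase_le θ _), seq_real_smul, gfield, seq_smul, seq_sub,
    seq_trilin hs (gosc_bound c θ t), seq_resid hs hθ, e2, rho, seq_diag (norm_phase_le θ _), hn,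
    field, seq_smul, nonlin, seq_sub, seq_trilin hs (osc_bound t), e, seq_smul, abs_of_pos ht]
  push_cast
  have : (t : ℂ) ≠ 0 := by exact_mod_cast ht.ne'
  field_simp
  ring

/-! ### Normal form -/

/-- The primitive of the oscillating factor. -/
def gprim (c : ℝ) (θ : ℤ → ℝ) (t : ℝ) (k i j : ℤ) : ℂ :=
  4 * Complex.I / omega k i j * gosc c θ t k i j

/-- The remainder of the integration by parts. -/
def grem (c : ℝ) (θ : ℤ → ℝ) (t : ℝ) (k i j : ℤ) : ℂ :=
  (1 + Complex.I * (c * mismatch θ k i j)) * gprim c θ t k i j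

/-- The time derivative of `gprim`. -/
def gprimDeriv (c : ℝ) (θ : ℤ → ℝ) (t : ℝ) (k i j : ℤ) : ℂ :=
  ((t ^ 2)⁻¹ : ℝ) * gosc c θ t k i j +
    Complex.I * (c * mismatch θ k i j / t) * gprim c θ t k i j

/-- Integer frequencies leave no small divisors: `(k - i)(k - j)` is a nonzero integer. -/
theorem two_le_abs_omega {k i j : ℤ} (hi : i ≠ k) (hj : j ≠ k) : 2 ≤ |omega k i j| := by
  have h1 : (1 : ℤ) ≤ |(k - i) * (k - j)| :=
    Int.one_le_abs (mul_ne_zero (sub_ne_zero.2 hi.symm) (sub_ne_zero.2 hj.symm))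
  have h2 : (1 : ℝ) ≤ |((k : ℝ) - i) * (k - j)| := by exact_mod_cast h1
  rw [omega, mul_assoc, abs_mul]
  rw [abs_neg, abs_two]
  linarith

theorem gprim_bound (c : ℝ) (θ : ℤ → ℝ) (t : ℝ) : MulBound (gprim c θ t) 2 := fun k i j => by
  unfold gprim gosc
  split_ifs with h
  · have h2 := two_le_abs_omega h.1 h.2
    rw [norm_mul, norm_exp_I_mul_ofReal, norm_div, norm_mul, Complex.norm_I, Complex.norm_real,
      Real.norm_eq_abs, mul_one, mul_one, div_le_iff₀ (by linarith)]
    simp only [Complex.norm_ofNat]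
    linarith
  · simp

theorem norm_I_mul_le (hθ : ∀ k, |θ k| ≤ Θ) (k i j : ℤ) :
    ‖Complex.I * ((c : ℂ) * mismatch θ k i j)‖ ≤ |c| * (4 * Θ) := by
  rw [norm_mul, norm_mul, Complex.norm_I, Complex.norm_real, Complex.norm_real, one_mul,
    Real.norm_eq_abs, Real.norm_eq_abs]
  gcongr
  exact abs_mismatch_le hθ k i j

theorem grem_bound (hθ : ∀ k, |θ k| ≤ Θ) (t : ℝ) :
    MulBound (grem c θ t) ((1 + |c| * (4 * Θ)) * 2) := fun k i j => by
  have hΘ : 0 ≤ Θ := (abs_nonneg _).trans (hθ 0)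
  unfold grem
  rw [norm_mul]
  refine mul_le_mul ((norm_add_le _ _).trans ?_) (gprim_bound c θ t k i j) (norm_nonneg _)
    (by positivity)
  rw [norm_one]
  gcongr
  exact norm_I_mul_le hθ k i j

/-- The derivative of `e^{iω/4t}` is `-(iω/4t²) e^{iω/4t}`. The prefactor `4i/ω` turns this into
`t⁻²` times the oscillating factor; the logarithmic part of the phase contributes the second, less
singular term of `gprimDeriv`. -/
theorem hasDerivAt_gprim {t : ℝ} (ht : 0 < t) (k i j : ℤ) :
    HasDerivAt (fun τ => gprim c θ τ k i j) (gprimDeriv c θ t k i j) t := by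
  unfold gprimDeriv gprim gosc
  split_ifs with h
  · have h2 := two_le_abs_omega h.1 h.2
    have hω : (omega k i j : ℂ) ≠ 0 := by
      intro h0
      rw [Complex.ofReal_eq_zero] at h0
      rw [h0] at h2; norm_num at h2
    have htc : (t : ℂ) ≠ 0 := by exact_mod_cast ht.ne'
    have h1 : HasDerivAt (fun τ => gphase c θ τ k i j)
        (omega k i j / 4 * (-(t ^ 2)⁻¹) + mismatch θ k i j * (c * t⁻¹)) t := by
      have e : (fun τ => gphase c θ τ k i j) = fun τ =>
          omega k i j / 4 * τ⁻¹ + mismatch θ k i j * (c * Real.log τ) := by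
        funext τ; unfold gphase; rw [← div_div]; rfl
      rw [e]
      exact ((hasDerivAt_inv ht.ne').const_mul _).add
        (((Real.hasDerivAt_log ht.ne').const_mul c).const_mul _)
    have h3 := ((h1.ofReal_comp.const_mul Complex.I).cexp).const_mul
      (4 * Complex.I / (omega k i j : ℂ))
    refine h3.congr_deriv ?_
    push_cast
    field_simp
    ring_nf
    simp only [Complex.I_sq]
    ring
  · simpa using hasDerivAt_const t (0 : ℂ)

/-- The oscillating factor has no Lipschitz bound in time that is uniform in the frequencies, but
its primitive has one, because the factor `ω` produced by differentiation is divided out. This makes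
`nu` differentiable in `l^{2,s}` without loss of derivatives. -/
theorem gprim_sub_le (hθ : ∀ k, |θ k| ≤ Θ) (t τ : ℝ) (k i j : ℤ) :
    ‖gprim c θ τ k i j - gprim c θ t k i j‖ ≤
      |τ⁻¹ - t⁻¹| + |c| * (8 * Θ) * |Real.log τ - Real.log t| := by
  have hΘ : 0 ≤ Θ := (abs_nonneg _).trans (hθ 0)
  unfold gprim gosc
  split_ifs with h
  · have h2 := two_le_abs_omega h.1 h.2
    have hpos : 0 < |omega k i j| := by linarith
    rw [← mul_sub, norm_mul, norm_div, norm_mul, Complex.norm_I, Complex.norm_real,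
      Real.norm_eq_abs, mul_one, Complex.norm_ofNat]
    have h3 : |gphase c θ τ k i j - gphase c θ t k i j| ≤
        |omega k i j| / 4 * |τ⁻¹ - t⁻¹| + 4 * Θ * (|c| * |Real.log τ - Real.log t|) := by
      have e : gphase c θ τ k i j - gphase c θ t k i j = omega k i j / 4 * (τ⁻¹ - t⁻¹) +
          mismatch θ k i j * (c * (Real.log τ - Real.log t)) := by
        unfold gphase; rw [← div_div, ← div_div]; simp only [div_eq_mul_inv]; ring
      rw [e]
      refine (abs_add_le _ _).trans ?_
      rw [abs_mul, abs_mul, abs_mul, abs_div]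
      norm_num
      gcongr
      exact abs_mismatch_le hθ k i j
    calc 4 / |omega k i j| * _ ≤ 4 / |omega k i j| * (|omega k i j| / 4 * |τ⁻¹ - t⁻¹| +
          4 * Θ * (|c| * |Real.log τ - Real.log t|)) := by
          gcongr
          exact (norm_exp_I_sub_le _ _).trans h3
      _ = |τ⁻¹ - t⁻¹| + 2 / |omega k i j| * (|c| * (8 * Θ) * |Real.log τ - Real.log t|) := by
          field_simp; ring
      _ ≤ |τ⁻¹ - t⁻¹| + 1 * (|c| * (8 * Θ) * |Real.log τ - Real.log t|) := by
          gcongr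
          exact (div_le_one hpos).2 h2
      _ = _ := by ring
  · simp only [mul_zero, sub_zero, norm_zero]
    positivity

/-- The cubic term of the normal form transformation. -/
def nu (s c : ℝ) (θ : ℤ → ℝ) (t : ℝ) (x : L2) : L2 := trilin s (gprim c θ t) x x x

/-- The bounded remainder of the normal form transformation. -/
def grest (s c : ℝ) (θ : ℤ → ℝ) (t : ℝ) (x : L2) : L2 :=
  trilin s (grem c θ t) x x x + trilin s (gprim c θ t) (gfield s c θ t x) x x +
    trilin s (gprim c θ t) x (gfield s c θ t x) x + trilin s (gprim c θ t) x x (gfield s c θ t x)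

/-- The normal form variable. -/
def nform (s c : ℝ) (θ : ℤ → ℝ) (t : ℝ) (x : L2) : L2 :=
  x - (((c * t : ℝ) : ℂ) * Complex.I) • nu s c θ t x

/-- The time derivative of the normal form variable. -/
def nfield (s c : ℝ) (θ : ℤ → ℝ) (t : ℝ) (x : L2) : L2 :=
  (-((c : ℂ) * Complex.I)) • (t⁻¹ • resid s θ x + grest s c θ t x)

/-- The multiplier contributes `t⁻²` times the nonresonant sum; the derivative of `a`, itself of
size `1/t`, contributes the other terms of `grest`. The term `-nu` is split off, with the `1` in
`grem` compensating it, because it cancels against the derivative of the factor `t` in `nform`. -/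
theorem hasDerivAt_nu (hs : 1 / 2 < s) (hθ : ∀ k, |θ k| ≤ Θ) {t : ℝ} (ht : 0 < t)
    {a : ℝ → L2} (ha : HasDerivAt a (t⁻¹ • gfield s c θ t (a t)) t) :
    HasDerivAt (fun τ => nu s c θ τ (a τ))
      (t⁻¹ • (t⁻¹ • trilin s (gosc c θ t) (a t) (a t) (a t) +
        grest s c θ t (a t) - nu s c θ t (a t))) t := by
  have hΘ : 0 ≤ Θ := (abs_nonneg _).trans (hθ 0)
  -- One constant must serve as bound of the derived multiplier and as local Lipschitz constant. The
  -- summands `+ 1` are the slack in `eventually_abs_sub_le` for the inverse and the logarithm.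
  set L := (|-(t ^ 2)⁻¹| + 1) + |c| * (8 * Θ) * (|t⁻¹| + 1)
  have hb : MulBound (gprimDeriv c θ t) L := fun k i j => by
    unfold gprimDeriv
    refine (norm_add_le _ _).trans ?_
    have e1 : ‖(((t ^ 2)⁻¹ : ℝ) : ℂ) * gosc c θ t k i j‖ ≤ |-(t ^ 2)⁻¹| + 1 := by
      rw [norm_mul, Complex.norm_real, Real.norm_eq_abs, abs_neg]
      nlinarith [gosc_bound c θ t k i j, norm_nonneg (gosc c θ t k i j),
        abs_nonneg ((t ^ 2)⁻¹)]
    have e2 : ‖Complex.I * (c * mismatch θ k i j / t) * gprim c θ t k i j‖ ≤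
        |c| * (8 * Θ) * (|t⁻¹| + 1) := by
      have : Complex.I * (c * mismatch θ k i j / t) * gprim c θ t k i j =
          ((t⁻¹ : ℝ) : ℂ) * (Complex.I * (c * mismatch θ k i j) * gprim c θ t k i j) := by
        push_cast; ring
      rw [this, norm_mul, norm_mul, Complex.norm_real, Real.norm_eq_abs]
      calc |t⁻¹| * (‖Complex.I * (c * mismatch θ k i j : ℂ)‖ * ‖gprim c θ t k i j‖)
          ≤ |t⁻¹| * (|c| * (4 * Θ) * 2) := by
            gcongr
            · exact norm_I_mul_le hθ k i j
            · exact gprim_bound c θ t k i j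
        _ ≤ _ := by nlinarith [mul_nonneg (abs_nonneg c) hΘ]
    exact add_le_add e1 e2
  have h := hasDerivAt_trilin hs (M := fun τ => gprim c θ τ) (B := 2)
    (Eventually.of_forall fun τ => gprim_bound c θ τ) hb
    (fun k i j => hasDerivAt_gprim ht k i j) ?_ ha ha ha
  · refine h.congr_deriv ?_
    have hp := gprim_bound c θ t
    rw [trilin_smul_left hs hp, trilin_smul_mid hs hp, trilin_smul_right hs hp]
    have key : trilin s (gprimDeriv c θ t) (a t) (a t) (a t) =
        t⁻¹ • (t⁻¹ • trilin s (gosc c θ t) (a t) (a t) (a t) +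
          trilin s (grem c θ t) (a t) (a t) (a t) - nu s c θ t (a t)) := by
      have hg := gosc_bound c θ t
      have hr := grem_bound (c := c) hθ t
      have e : gprimDeriv c θ t = fun k i j => ((t⁻¹ : ℝ) : ℂ) * ((((t⁻¹ : ℝ) : ℂ) *
          gosc c θ t k i j + grem c θ t k i j) - gprim c θ t k i j) := by
        funext k i j
        unfold gprimDeriv grem
        push_cast
        ring
      rw [e, trilin_mul_smul hs (((hg.smul _).add hr).sub hp),
        trilin_mul_sub hs ((hg.smul _).add hr) hp, trilin_mul_add hs (hg.smul _) hr,
        trilin_mul_smul hs hg, L2.coe_smul, L2.coe_smul, nu]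
    rw [key, grest, ← smul_add, ← smul_add, ← smul_add]
    congr 1
    abel
  · filter_upwards [eventually_abs_sub_le (hasDerivAt_inv ht.ne'),
      eventually_abs_sub_le (Real.hasDerivAt_log ht.ne')] with τ h1 h2 k i j
    refine (gprim_sub_le hθ t τ k i j).trans ?_
    calc _ ≤ (|-(t ^ 2)⁻¹| + 1) * |τ - t| + |c| * (8 * Θ) * ((|t⁻¹| + 1) * |τ - t|) := by
          gcongr
      _ = _ := by ring

/-- In the normal form variable the oscillating singular terms have disappeared. -/
theorem hasDerivAt_nform (hs : 1 / 2 < s) (hθ : ∀ k, |θ k| ≤ Θ) {t : ℝ} (ht : 0 < t)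
    {a : ℝ → L2} (ha : HasDerivAt a (t⁻¹ • gfield s c θ t (a t)) t) :
    HasDerivAt (fun τ => nform s c θ τ (a τ)) (nfield s c θ t (a t)) t := by
  have h1 : HasDerivAt (fun τ : ℝ => ((c * τ : ℝ) : ℂ) * Complex.I) ((c : ℂ) * Complex.I) t := by
    have := ((hasDerivAt_id t).const_mul c).ofReal_comp.mul_const Complex.I
    simpa using this
  have h2 := ha.sub (h1.smul (hasDerivAt_nu hs hθ ht ha))
  refine h2.congr_deriv ?_
  -- The product rule for `ct · nu` yields `c nu + c(t⁻¹ T + grest - nu)`: both occurrences of `nu`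
  -- cancel, and `t⁻¹ T` cancels the nonresonant part of `a'`.
  refine seq_injective s fun k => ?_
  have : (t : ℂ) ≠ 0 := by exact_mod_cast ht.ne'
  simp only [nfield, gfield, seq_sub, seq_add, seq_smul, seq_real_smul]
  push_cast
  field_simp
  ring

end DiracNLS

end

/-! ### The Cauchy problem at the singular time in the gauge variables. -/

noncomputable section

namespace DiracNLS

open scoped ENNReal ComplexConjugate

/-! ### Bounded Lipschitz maps on balls -/

/-- `f` is bounded by `C` and `C`-Lipschitz on the ball of radius `K`. -/
structure BddLip {E : Type*} [SeminormedAddCommGroup E] (K : ℝ) (f : L2 → E) (C : ℝ) : Prop where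
  bound : ∀ x, ‖x‖ ≤ K → ‖f x‖ ≤ C
  lip : ∀ x y, ‖x‖ ≤ K → ‖y‖ ≤ K → ‖f x - f y‖ ≤ C * ‖x - y‖

namespace BddLip

variable {E : Type*} [NormedAddCommGroup E] {K C C₁ C₂ C₃ s : ℝ} {f g : L2 → E}

theorem nonneg (h : BddLip K f C) (hK : 0 ≤ K) : 0 ≤ C :=
  (norm_nonneg _).trans (h.bound 0 (by simpa using hK))

theorem mono (h : BddLip K f C) (hC : C ≤ C₁) : BddLip K f C₁ :=
  ⟨fun x hx => (h.bound x hx).trans hC, fun x y hx hy => (h.lip x y hx hy).trans (by gcongr)⟩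

/-- The bound is `K` and the Lipschitz constant is `1`; as one constant plays both roles, `K ≥ 1` is
required. -/
theorem id (hK : 1 ≤ K) : BddLip K (fun x : L2 => x) K :=
  ⟨fun _ hx => hx, fun _ _ _ _ => le_mul_of_one_le_left (norm_nonneg _) hK⟩

theorem add (hf : BddLip K f C₁) (hg : BddLip K g C₂) :
    BddLip K (fun x => f x + g x) (C₁ + C₂) :=
  ⟨fun x hx => (norm_add_le _ _).trans (add_le_add (hf.bound x hx) (hg.bound x hx)),
    fun x y hx hy => by
      rw [add_sub_add_comm, add_mul]
      exact (norm_add_le _ _).trans (add_le_add (hf.lip x y hx hy) (hg.lip x y hx hy))⟩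

theorem sub (hf : BddLip K f C₁) (hg : BddLip K g C₂) :
    BddLip K (fun x => f x - g x) (C₁ + C₂) :=
  ⟨fun x hx => (norm_sub_le _ _).trans (add_le_add (hf.bound x hx) (hg.bound x hx)),
    fun x y hx hy => by
      rw [sub_sub_sub_comm, add_mul]
      exact (norm_sub_le _ _).trans (add_le_add (hf.lip x y hx hy) (hg.lip x y hx hy))⟩

theorem comp_le {F : Type*} [NormedAddCommGroup F] {L : E → F} {B : ℝ}
    (hL0 : ∀ v, ‖L v‖ ≤ B * ‖v‖) (hL : ∀ v w, ‖L v - L w‖ ≤ B * ‖v - w‖) (hB : 0 ≤ B)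
    (hf : BddLip K f C) : BddLip K (fun x => L (f x)) (B * C) :=
  ⟨fun x hx => (hL0 _).trans (by gcongr; exact hf.bound x hx),
    fun x y hx hy => (hL _ _).trans (by rw [mul_assoc]; gcongr; exact hf.lip x y hx hy)⟩

theorem smul {E : Type*} [NormedAddCommGroup E] [NormedSpace ℂ E] {f : L2 → E}
    (hf : BddLip K f C) (z : ℂ) : BddLip K (fun x => z • f x) (‖z‖ * C) :=
  comp_le (L := fun v => z • v) (fun v => (norm_smul z v).le)
    (fun v w => by rw [← smul_sub, norm_smul]) (norm_nonneg z) hf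

theorem mul {f g : L2 → ℂ} (hf : BddLip K f C₁) (hg : BddLip K g C₂) (hK : 0 ≤ K) :
    BddLip K (fun x => f x * g x) (2 * (C₁ * C₂)) := by
  have h1 := hf.nonneg hK
  have h2 := hg.nonneg hK
  refine ⟨fun x hx => ?_, fun x y hx hy => ?_⟩
  · rw [norm_mul]
    have := mul_le_mul (hf.bound x hx) (hg.bound x hx) (norm_nonneg _) h1
    have := mul_nonneg h1 h2
    linarith
  · have e : f x * g x - f y * g y = (f x - f y) * g x + f y * (g x - g y) := by ring
    rw [e]
    refine (norm_add_le _ _).trans ?_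
    rw [norm_mul, norm_mul]
    have a1 := mul_le_mul (hf.lip x y hx hy) (hg.bound x hx) (norm_nonneg _)
      (mul_nonneg h1 (norm_nonneg _))
    have a2 := mul_le_mul (hf.bound y hy) (hg.lip x y hx hy) (norm_nonneg _) h1
    linarith

theorem star {f : L2 → ℂ} (hf : BddLip K f C) : BddLip K (fun x => conj (f x)) C :=
  ⟨fun x hx => by rw [RCLike.norm_conj]; exact hf.bound x hx,
    fun x y hx hy => by rw [← map_sub, RCLike.norm_conj]; exact hf.lip x y hx hy⟩

theorem re {f : L2 → ℂ} (hf : BddLip K f C) : BddLip K (fun x => (f x).re) C :=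
  ⟨fun x hx => (Complex.abs_re_le_norm _).trans (hf.bound x hx),
    fun x y hx hy => by
      rw [← Complex.sub_re]
      exact (Complex.abs_re_le_norm _).trans (hf.lip x y hx hy)⟩

theorem seq {f : L2 → L2} (hf : BddLip K f C) (hs : 0 ≤ s) (k : ℤ) :
    BddLip K (fun x => seq s (f x) k) C :=
  ⟨fun x hx => (norm_seq_le hs _ k).trans (hf.bound x hx),
    fun x y hx hy => by
      rw [← seq_sub]
      exact (norm_seq_le hs _ k).trans (hf.lip x y hx hy)⟩

theorem trilin {m : ℤ → ℤ → ℤ → ℂ} {B : ℝ} {f g h : L2 → L2} (hs : 1 / 2 < s)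
    (hm : MulBound m B) (hK : 0 ≤ K) (hf : BddLip K f C₁) (hg : BddLip K g C₂)
    (hh : BddLip K h C₃) :
    BddLip K (fun x => trilin s m (f x) (g x) (h x)) (B * triC s * (3 * (C₁ * C₂ * C₃))) := by
  have h1 := hf.nonneg hK
  have h2 := hg.nonneg hK
  have h3 := hh.nonneg hK
  have hB : 0 ≤ B * triC s := mul_nonneg hm.nonneg (triC_nonneg s)
  have h123 : 0 ≤ C₁ * C₂ * C₃ := by positivity
  refine ⟨fun x hx => ?_, fun x y hx hy => ?_⟩
  · refine (norm_trilin_le hs hm _ _ _).trans (mul_le_mul_of_nonneg_left ?_ hB)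
    have : ‖f x‖ * ‖g x‖ * ‖h x‖ ≤ C₁ * C₂ * C₃ := by
      gcongr
      exacts [hf.bound x hx, hg.bound x hx, hh.bound x hx]
    linarith
  · rw [trilin_sub_telescope hs hm]
    refine norm_add₃_le.trans ?_
    have a1 : ‖f x - f y‖ * ‖g x‖ * ‖h x‖ ≤ C₁ * ‖x - y‖ * C₂ * C₃ := by
      gcongr
      exacts [hf.lip x y hx hy, hg.bound x hx, hh.bound x hx]
    have a2 : ‖f y‖ * ‖g x - g y‖ * ‖h x‖ ≤ C₁ * (C₂ * ‖x - y‖) * C₃ := by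
      gcongr
      exacts [hf.bound y hy, hg.lip x y hx hy, hh.bound x hx]
    have a3 : ‖f y‖ * ‖g y‖ * ‖h x - h y‖ ≤ C₁ * C₂ * (C₃ * ‖x - y‖) := by
      gcongr
      exacts [hf.bound y hy, hg.bound y hy, hh.lip x y hx hy]
    have b1 := (norm_trilin_le hs hm (f x - f y) (g x) (h x)).trans
      (mul_le_mul_of_nonneg_left a1 hB)
    have b2 := (norm_trilin_le hs hm (f y) (g x - g y) (h x)).trans
      (mul_le_mul_of_nonneg_left a2 hB)
    have b3 := (norm_trilin_le hs hm (f y) (g y) (h x - h y)).trans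
      (mul_le_mul_of_nonneg_left a3 hB)
    linarith

end BddLip

/-! ### Uniform bounds for the normal form -/

variable {s c : ℝ} {θ : ℤ → ℝ} {Θ : ℝ}

/-- The time derivative of the squared moduli of the normal form variable. -/
def sqRate (s c : ℝ) (θ : ℤ → ℝ) (t : ℝ) (x : L2) (k : ℤ) : ℝ :=
  ((2 * c ^ 2 : ℂ) * (conj (seq s (nu s c θ t x) k) * seq s (resid s θ x) k) -
    (2 * c * Complex.I : ℂ) * (conj (seq s (nform s c θ t x) k) * seq s (grest s c θ t x) k)).re

/-- The correction of the squared moduli by the normal form transformation, divided by `t`. -/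
def sqCorr (s c : ℝ) (θ : ℤ → ℝ) (t : ℝ) (x : L2) (k : ℤ) : ℝ :=
  ((2 * c * Complex.I : ℂ) * (conj (seq s x k) * seq s (nu s c θ t x) k) -
    ((c ^ 2 * t : ℝ) : ℂ) * (conj (seq s (nu s c θ t x) k) * seq s (nu s c θ t x) k)).re

/-- The normal form changes the coefficient by `O(t)`, so the squared modulus changes by `t` times a
quantity that is bounded on balls uniformly in `k`. -/
theorem sq_norm_sub_sq_nform (t : ℝ) (x : L2) (k : ℤ) :
    ‖seq s x k‖ ^ 2 - ‖seq s (nform s c θ t x) k‖ ^ 2 = t * sqCorr s c θ t x k := by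
  rw [← Complex.normSq_eq_norm_sq, ← Complex.normSq_eq_norm_sq, sqCorr, nform, seq_sub, seq_smul]
  simp only [Complex.normSq_apply, Complex.sub_re, Complex.sub_im, Complex.mul_re, Complex.mul_im,
    Complex.ofReal_re, Complex.ofReal_im, Complex.I_re, Complex.I_im, Complex.conj_re,
    Complex.conj_im, Complex.re_ofNat, Complex.im_ofNat]
  ring

/-- The key cancellation. The singular term of `b'` is `-(ic/t) ρ_k a_k` with `ρ_k` real. Paired
with the part `a_k` of `b_k` it is purely imaginary and disappears; paired with the part `-ict ν_k`
the factor `t` cancels `1/t`. No singularity is left in the derivative of `|b_k|²`. -/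
theorem hasDerivAt_sq_nform (hs : 1 / 2 < s) (hθ : ∀ k, |θ k| ≤ Θ) {t : ℝ} (ht : 0 < t)
    {a : ℝ → L2} (ha : HasDerivAt a (t⁻¹ • gfield s c θ t (a t)) t) (k : ℤ) :
    HasDerivAt (fun τ => ‖seq s (nform s c θ τ (a τ)) k‖ ^ 2) (sqRate s c θ t (a t) k) t := by
  have h1 := hasDerivAt_nform hs hθ ht ha
  have h2 : HasDerivAt (fun τ => nform s c θ τ (a τ) k) (nfield s c θ t (a t) k) t :=
    ((lp.evalCLM (𝕜 := ℂ) (fun _ : ℤ => ℂ) (p := 2) k).hasFDerivAt.restrictScalars ℝ).comp_hasDerivAt t h1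
  have h3 : HasDerivAt (fun τ => seq s (nform s c θ τ (a τ)) k) (seq s (nfield s c θ t (a t)) k)
      t := h2.div_const _
  refine h3.norm_sq.congr_deriv ?_
  rw [Complex.inner, sqRate, nfield, seq_smul, seq_add, seq_real_smul, seq_resid hs hθ, nform,
    seq_sub, seq_smul]
  simp only [Complex.sub_re, Complex.sub_im, Complex.mul_re, Complex.mul_im, Complex.neg_re,
    Complex.neg_im, Complex.add_re, Complex.add_im, ← Complex.ofReal_pow,
    Complex.ofReal_re, Complex.ofReal_im, Complex.I_re, Complex.I_im, Complex.conj_re,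
    Complex.conj_im, Complex.re_ofNat, Complex.im_ofNat]
  field_simp
  ring

theorem norm_coe_ofReal (x : ℝ) : ‖(x : ℂ)‖ = |x| := by
  rw [Complex.norm_real, Real.norm_eq_abs]

/-- All these maps are polynomial expressions in operators whose multipliers are bounded
independently of `t`, so one constant works for all `t` and `k`. The restriction `t ≤ 1` only tames
the explicit factors `t` in `nform` and `sqCorr`. -/
theorem exists_bddLip (hs : 1 / 2 < s) (c : ℝ) (hθ : ∀ k, |θ k| ≤ Θ) {K : ℝ} (hK : 1 ≤ K) :
    ∃ C, 1 ≤ C ∧ ∀ t, 0 < t → t ≤ 1 → BddLip K (nu s c θ t) C ∧ BddLip K (grest s c θ t) C ∧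
      BddLip K (gfield s c θ t) C ∧ (∀ k, BddLip K (fun x => sqRate s c θ t x k) C) ∧
      ∀ k, BddLip K (fun x => sqCorr s c θ t x k) C := by
  have hK0 : 0 ≤ K := by linarith
  have hs0 : 0 ≤ s := by linarith
  have hid := BddLip.id hK
  have hcoinc := hid.trilin hs coinc_bound hK0 hid hid
  have hdiag : BddLip K (fun x => diag (fun k => (θ k : ℂ)) x) (Θ * K) :=
    BddLip.comp_le (norm_diag_le (norm_ofReal_le hθ))
      (fun v w => by
        rw [← diag_sub (norm_ofReal_le hθ)]; exact norm_diag_le (norm_ofReal_le hθ) _)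
      ((abs_nonneg _).trans (hθ 0)) hid
  have hres : BddLip K (resid s θ) _ := hcoinc.sub hdiag
  set C₁ := 1 * triC s * (3 * (K * K * K)) + Θ * K
  have hV : ∀ t, BddLip K (gfield s c θ t) _ := fun t =>
    ((hid.trilin hs (gosc_bound c θ t) hK0 hid hid).sub hres).smul ((c : ℂ) * Complex.I)
  set C₂ := ‖(c : ℂ) * Complex.I‖ * (1 * triC s * (3 * (K * K * K)) + C₁)
  have hnu : ∀ t, BddLip K (nu s c θ t) _ := fun t =>
    hid.trilin hs (gprim_bound c θ t) hK0 hid hid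
  set C₃ := 2 * triC s * (3 * (K * K * K))
  have hg : ∀ t, BddLip K (grest s c θ t) _ := fun t =>
    (((hid.trilin hs (grem_bound (c := c) hθ t) hK0 hid hid).add
      ((hV t).trilin hs (gprim_bound c θ t) hK0 hid hid)).add
      (hid.trilin hs (gprim_bound c θ t) hK0 (hV t) hid)).add
      (hid.trilin hs (gprim_bound c θ t) hK0 hid (hV t))
  set C₄ := (1 + |c| * (4 * Θ)) * 2 * triC s * (3 * (K * K * K)) +
    2 * triC s * (3 * (C₂ * K * K)) + 2 * triC s * (3 * (K * C₂ * K)) +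
    2 * triC s * (3 * (K * K * C₂))
  have hC₃ : 0 ≤ C₃ := (hnu 0).nonneg hK0
  have hC₄ : 0 ≤ C₄ := (hg 0).nonneg hK0
  have hb : ∀ t, 0 < t → t ≤ 1 → BddLip K (nform s c θ t) (K + |c| * C₃) := fun t h0 h1 =>
    (hid.sub ((hnu t).smul (((c * t : ℝ) : ℂ) * Complex.I))).mono <| by
      rw [norm_mul, Complex.norm_I, mul_one, norm_coe_ofReal, abs_mul, abs_of_pos h0]
      have := mul_nonneg (abs_nonneg c) hC₃
      nlinarith
  set C₅ := K + |c| * C₃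
  have hrate : ∀ t, 0 < t → t ≤ 1 → ∀ k, BddLip K (fun x => sqRate s c θ t x k) _ :=
    fun t h0 h1 k => (((((hnu t).seq hs0 k).star.mul (hres.seq hs0 k) hK0).smul
      (2 * c ^ 2 : ℂ)).sub ((((hb t h0 h1).seq hs0 k).star.mul ((hg t).seq hs0 k) hK0).smul
      (2 * c * Complex.I : ℂ))).re
  set C₆ := ‖(2 * c ^ 2 : ℂ)‖ * (2 * (C₃ * C₁)) + ‖(2 * c * Complex.I : ℂ)‖ * (2 * (C₅ * C₄))
  have hcorr : ∀ t, 0 < t → t ≤ 1 → ∀ k, BddLip K (fun x => sqCorr s c θ t x k)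
      (‖(2 * c * Complex.I : ℂ)‖ * (2 * (K * C₃)) + c ^ 2 * (2 * (C₃ * C₃))) :=
    fun t h0 h1 k => ((((hid.seq hs0 k).star.mul ((hnu t).seq hs0 k) hK0).smul
      (2 * c * Complex.I : ℂ)).sub ((((hnu t).seq hs0 k).star.mul ((hnu t).seq hs0 k) hK0).smul
      ((c ^ 2 * t : ℝ) : ℂ))).re.mono <| by
      have e : ‖((c ^ 2 * t : ℝ) : ℂ)‖ ≤ c ^ 2 := by
        rw [norm_coe_ofReal, abs_of_nonneg (by positivity)]
        nlinarith [sq_nonneg c]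
      gcongr
  set C₇ := ‖(2 * c * Complex.I : ℂ)‖ * (2 * (K * C₃)) + c ^ 2 * (2 * (C₃ * C₃))
  refine ⟨1 + |C₂| + |C₃| + |C₄| + |C₆| + |C₇|, ?_, fun t h0 h1 => ⟨(hnu t).mono ?_,
    (hg t).mono ?_, (hV t).mono ?_, fun k => (hrate t h0 h1 k).mono ?_,
    fun k => (hcorr t h0 h1 k).mono ?_⟩⟩
  all_goals linarith [le_abs_self C₂, le_abs_self C₃, le_abs_self C₄, le_abs_self C₆,
    le_abs_self C₇, abs_nonneg C₂, abs_nonneg C₃, abs_nonneg C₄, abs_nonneg C₆, abs_nonneg C₇]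

theorem norm_resid_le (hs : 1 / 2 < s) (hθ : ∀ k, |θ k| ≤ Θ) {x : L2} {r : ℝ}
    (hr : ∀ k, |rho s θ x k| ≤ r) : ‖resid s θ x‖ ≤ r * ‖x‖ := by
  have e : resid s θ x = diag (fun k => (rho s θ x k : ℂ)) x := seq_injective s fun k => by
    rw [seq_resid hs hθ, seq_diag (norm_ofReal_le hr)]
  rw [e]
  exact norm_diag_le (norm_ofReal_le hr) x

/-- The difference of the moduli enters through the separate bound `e` rather than through `‖x -
y‖`, since along solutions it is better controlled than the difference of the coefficients. Only `x`
needs small `rho`. -/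
theorem norm_resid_sub_le (hs : 1 / 2 < s) (hθ : ∀ k, |θ k| ≤ Θ) {x y : L2} {r e : ℝ}
    (hr : ∀ k, |rho s θ x k| ≤ r) (he : ∀ k, |rho s θ x k - rho s θ y k| ≤ e) :
    ‖resid s θ x - resid s θ y‖ ≤ r * ‖x - y‖ + e * ‖y‖ := by
  have h : resid s θ x - resid s θ y = diag (fun k => (rho s θ x k : ℂ)) (x - y) +
      diag (fun k => ((rho s θ x k - rho s θ y k : ℝ) : ℂ)) y := seq_injective s fun k => by
    rw [seq_sub, seq_add, seq_resid hs hθ, seq_resid hs hθ, seq_diag (norm_ofReal_le hr),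
      seq_diag (norm_ofReal_le he), seq_sub]
    push_cast
    ring
  rw [h]
  exact (norm_add_le _ _).trans (add_le_add (norm_diag_le (norm_ofReal_le hr) _)
    (norm_diag_le (norm_ofReal_le he) _))

end DiracNLS

end

noncomputable section

namespace DiracNLS

open scoped ENNReal ComplexConjugate

variable {s c : ℝ} {θ : ℤ → ℝ} {Θ : ℝ}

/-! ### Estimates near the singular time -/

/-- `a` solves the gauged equation on `[t₀, t₁]` and stays in the ball of radius `K`. -/
structure IsGaugeSol (s c : ℝ) (θ : ℤ → ℝ) (K t₀ t₁ : ℝ) (a : ℝ → L2) : Prop where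
  deriv : ∀ t ∈ Icc t₀ t₁, HasDerivAt a (t⁻¹ • gfield s c θ t (a t)) t
  bound : ∀ t ∈ Icc t₀ t₁, ‖a t‖ ≤ K

theorem IsGaugeSol.mono {K t₀ t₁ t₀' t₁' : ℝ} {a : ℝ → L2} (h : IsGaugeSol s c θ K t₀ t₁ a)
    (h0 : t₀ ≤ t₀') (h1 : t₁' ≤ t₁) : IsGaugeSol s c θ K t₀' t₁' a :=
  ⟨fun t ht => h.deriv t (Icc_subset_Icc h0 h1 ht), fun t ht => h.bound t (Icc_subset_Icc h0 h1 ht)⟩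

theorem norm_sub_le_of_deriv_le {E : Type*} [NormedAddCommGroup E] [NormedSpace ℝ E]
    {f f' : ℝ → E} {t₀ t₁ C : ℝ} (h : ∀ t ∈ Icc t₀ t₁, HasDerivAt f (f' t) t)
    (hC : ∀ t ∈ Icc t₀ t₁, ‖f' t‖ ≤ C) {t : ℝ} (ht : t ∈ Icc t₀ t₁) :
    ‖f t - f t₀‖ ≤ C * (t - t₀) :=
  norm_image_sub_le_of_norm_deriv_le_segment' (fun τ hτ => (h τ hτ).hasDerivWithinAt)
    (fun τ hτ => hC τ (Ico_subset_Icc_self hτ)) t ht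

/-- A part `D/t` of the derivative integrates to `D log(t/t₀)`. This is the origin of the
logarithmic loss in the stability estimate. -/
theorem norm_sub_le_of_deriv_le_log {E : Type*} [NormedAddCommGroup E] [NormedSpace ℝ E]
    {f f' : ℝ → E} {t₀ t₁ C D : ℝ} (ht₀ : 0 < t₀)
    (h : ∀ t ∈ Icc t₀ t₁, HasDerivAt f (f' t) t)
    (hC : ∀ t ∈ Icc t₀ t₁, ‖f' t‖ ≤ C + D * t⁻¹) {t : ℝ} (ht : t ∈ Icc t₀ t₁) :
    ‖f t‖ ≤ ‖f t₀‖ + C * (t - t₀) + D * Real.log (t / t₀) := by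
  have hB : ∀ τ ∈ Icc t₀ t₁, HasDerivAt (fun τ => ‖f t₀‖ + C * (τ - t₀) + D * Real.log (τ / t₀))
      (C + D * τ⁻¹) τ := by
    intro τ hτ
    have hτ0 : 0 < τ := ht₀.trans_le hτ.1
    have h1 : HasDerivAt (fun τ => Real.log (τ / t₀)) τ⁻¹ τ := by
      have := ((hasDerivAt_id τ).div_const t₀).log (by simp only [id]; positivity)
      refine this.congr_deriv ?_
      simp only [id]; field_simp
    have h2 := ((hasDerivAt_id τ).sub_const t₀).const_mul C
    refine ((h2.const_add ‖f t₀‖).add (h1.const_mul D)).congr_deriv (by ring)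
  refine image_norm_le_of_norm_deriv_right_le_deriv_boundary'
    (fun τ hτ => (h τ hτ).continuousAt.continuousWithinAt)
    (fun τ hτ => (h τ (Ico_subset_Icc_self hτ)).hasDerivWithinAt) ?_
    (fun τ hτ => (hB τ hτ).continuousAt.continuousWithinAt)
    (fun τ hτ => (hB τ (Ico_subset_Icc_self hτ)).hasDerivWithinAt)
    (fun τ hτ => hC τ (Ico_subset_Icc_self hτ)) ht
  simp [div_self ht₀.ne']

theorem rho_eq (t : ℝ) (x : L2) (k : ℤ) : rho s θ x k =
    ‖seq s (nform s c θ t x) k‖ ^ 2 + t * sqCorr s c θ t x k - θ k := by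
  have := sq_norm_sub_sq_nform (s := s) (c := c) (θ := θ) t x k
  rw [rho]; linarith

theorem sub_nform (t : ℝ) (x : L2) :
    x - nform s c θ t x = (((c * t : ℝ) : ℂ) * Complex.I) • nu s c θ t x := by
  rw [nform]; abel

theorem norm_smul_mul_I {t : ℝ} (ht : 0 ≤ t) (x : L2) :
    ‖(((c * t : ℝ) : ℂ) * Complex.I) • x‖ = |c| * t * ‖x‖ := by
  rw [norm_smul, norm_mul, Complex.norm_I, mul_one, norm_coe_ofReal, abs_mul, abs_of_nonneg ht]

/-- Along a bounded solution the moduli of the coefficients vary slowly, and the solution varies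
slowly if the moduli are initially close to the values prescribed by the gauge. -/
theorem exists_gauge_estimate (hs : 1 / 2 < s) (c : ℝ) (hθ : ∀ k, |θ k| ≤ Θ) {K : ℝ}
    (hK : 1 ≤ K) : ∃ C, 1 ≤ C ∧ ∀ t₀ t₁ a, 0 < t₀ → t₁ ≤ 1 → IsGaugeSol s c θ K t₀ t₁ a →
      ∀ t ∈ Icc t₀ t₁, (∀ k, |rho s θ (a t) k - rho s θ (a t₀) k| ≤ C * t) ∧
        ∀ R, (∀ k, |rho s θ (a t₀) k| ≤ R * t₀) → ‖a t - a t₀‖ ≤ C * (R + 1) * t := by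
  obtain ⟨C, hC1, hC⟩ := exists_bddLip hs c hθ hK
  have hC0 : 0 ≤ C := by linarith
  have hK0 : 0 ≤ K := by linarith
  -- The moduli of the normal form variable move by at most `C(t - t₀)`, and the corrections at the
  -- two ends cost `Ct` and `Ct₀`; the sum is `2Ct`.
  have hrho : ∀ t₀ t₁ a, 0 < t₀ → t₁ ≤ 1 → IsGaugeSol s c θ K t₀ t₁ a →
      ∀ t ∈ Icc t₀ t₁, ∀ k, |rho s θ (a t) k - rho s θ (a t₀) k| ≤ 2 * C * t := by
    intro t₀ t₁ a ht₀ ht₁ ha t ht k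
    have hpos : ∀ τ ∈ Icc t₀ t₁, 0 < τ := fun τ hτ => ht₀.trans_le hτ.1
    have hle : ∀ τ ∈ Icc t₀ t₁, τ ≤ 1 := fun τ hτ => hτ.2.trans ht₁
    have h1 := norm_sub_le_of_deriv_le (fun τ hτ =>
      hasDerivAt_sq_nform hs hθ (hpos τ hτ) (ha.deriv τ hτ) k)
      (fun τ hτ => ((hC τ (hpos τ hτ) (hle τ hτ)).2.2.2.1 k).bound _ (ha.bound τ hτ)) ht
    have ht0 : t₀ ∈ Icc t₀ t₁ := ⟨le_rfl, ht.1.trans ht.2⟩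
    have h2 := ((hC t (hpos t ht) (hle t ht)).2.2.2.2 k).bound _ (ha.bound t ht)
    have h3 := ((hC t₀ ht₀ (hle t₀ ht0)).2.2.2.2 k).bound _ (ha.bound t₀ ht0)
    rw [Real.norm_eq_abs] at h1 h2 h3
    rw [rho_eq (c := c) t, rho_eq (c := c) t₀]
    have h4 : |t * sqCorr s c θ t (a t) k| ≤ t * C := by
      rw [abs_mul, abs_of_pos (hpos t ht)]
      exact mul_le_mul_of_nonneg_left h2 (hpos t ht).le
    have h5 : |t₀ * sqCorr s c θ t₀ (a t₀) k| ≤ t₀ * C := by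
      rw [abs_mul, abs_of_pos ht₀]
      exact mul_le_mul_of_nonneg_left h3 ht₀.le
    rw [abs_le] at *
    constructor <;> linarith [h1.1, h1.2, h4.1, h4.2, h5.1, h5.2]
  have hone : 0 ≤ 2 * |c| * (2 * C * K + K + 2 * C) := by positivity
  refine ⟨2 * C + 2 * |c| * (2 * C * K + K + 2 * C), by linarith,
    fun t₀ t₁ a ht₀ ht₁ ha t ht => ⟨fun k => ?_, fun R hR => ?_⟩⟩
  · refine (hrho t₀ t₁ a ht₀ ht₁ ha t ht k).trans ?_
    have : 0 < t := ht₀.trans_le ht.1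
    gcongr
    linarith
  · have hpos : ∀ τ ∈ Icc t₀ t₁, 0 < τ := fun τ hτ => ht₀.trans_le hτ.1
    have hle : ∀ τ ∈ Icc t₀ t₁, τ ≤ 1 := fun τ hτ => hτ.2.trans ht₁
    have hR0 : 0 ≤ R := nonneg_of_mul_nonneg_left ((abs_nonneg _).trans (hR 0)) ht₀
    have ht0 : t₀ ∈ Icc t₀ t₁ := ⟨le_rfl, ht.1.trans ht.2⟩
    -- The moduli stay within `(R + 2C)τ` of the values `θ`, which compensates the factor `1/τ` in
    -- front of the residual term.
    have hb : ∀ τ ∈ Icc t₀ t₁, ‖nfield s c θ τ (a τ)‖ ≤ |c| * ((R + 2 * C) * K + C) := by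
      intro τ hτ
      have hr : ∀ k, |rho s θ (a τ) k| ≤ (R + 2 * C) * τ := fun k => by
        have e1 := hrho t₀ t₁ a ht₀ ht₁ ha τ hτ k
        have e2 := hR k
        have e3 : R * t₀ ≤ R * τ := by gcongr; exact hτ.1
        rw [abs_le] at *
        constructor <;> linarith [e1.1, e1.2, e2.1, e2.2]
      have h1 := norm_resid_le hs hθ hr
      have h2 := (hC τ (hpos τ hτ) (hle τ hτ)).2.1.bound _ (ha.bound τ hτ)
      rw [nfield, norm_smul, norm_neg, norm_mul, Complex.norm_I, mul_one, norm_coe_ofReal]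
      gcongr
      refine (norm_add_le _ _).trans (add_le_add ?_ h2)
      rw [norm_smul, norm_inv, Real.norm_of_nonneg (hpos τ hτ).le, inv_mul_le_iff₀ (hpos τ hτ)]
      calc _ ≤ (R + 2 * C) * τ * ‖a τ‖ := h1
        _ ≤ (R + 2 * C) * τ * K := by
            have := hpos τ hτ
            gcongr
            exact ha.bound τ hτ
        _ = _ := by ring
    have h1 := norm_sub_le_of_deriv_le (fun τ hτ =>
      hasDerivAt_nform hs hθ (hpos τ hτ) (ha.deriv τ hτ)) hb ht
    have hd : ∀ τ ∈ Icc t₀ t₁, ‖a τ - nform s c θ τ (a τ)‖ ≤ |c| * τ * C := by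
      intro τ hτ
      have := hpos τ hτ
      rw [sub_nform, norm_smul_mul_I this.le]
      gcongr
      exact (hC τ (hpos τ hτ) (hle τ hτ)).1.bound _ (ha.bound τ hτ)
    have h2 := hd t ht
    have h3 := hd t₀ ht0
    have e : a t - a t₀ = (a t - nform s c θ t (a t)) +
        (nform s c θ t (a t) - nform s c θ t₀ (a t₀)) - (a t₀ - nform s c θ t₀ (a t₀)) := by abel
    have hc := abs_nonneg c
    have hpt := hpos t ht
    have h0t := ht.1
    calc ‖a t - a t₀‖ ≤ |c| * t * C + |c| * ((R + 2 * C) * K + C) * (t - t₀) + |c| * t₀ * C := by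
          rw [e]
          exact (norm_sub_le _ _).trans (add_le_add ((norm_add_le _ _).trans (add_le_add h2 h1)) h3)
      _ ≤ |c| * t * C + |c| * ((R + 2 * C) * K + C) * t + |c| * t * C := by
          gcongr
          linarith
      _ = (|c| * (2 * C * K + R * K + 3 * C)) * t := by ring
      _ ≤ _ := by
          refine mul_le_mul_of_nonneg_right ?_ hpt.le
          have hcK : 0 ≤ |c| * K := by positivity
          have hcC : 0 ≤ |c| * C := by positivity
          have hcCK : 0 ≤ |c| * C * K := by positivity
          nlinarith [mul_nonneg hR0 hcK, mul_nonneg hR0 hcC, mul_nonneg hR0 hcCK,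
            mul_nonneg hR0 hC0]

/-- Stability of the gauged equation near the singular time. -/
theorem exists_stability_estimate (hs : 1 / 2 < s) (c : ℝ) (hθ : ∀ k, |θ k| ≤ Θ) {K R : ℝ}
    (hK : 1 ≤ K) (hR : 0 ≤ R) : ∃ C T, 0 < C ∧ 0 < T ∧ T ≤ 1 ∧ ∀ t₀ t₁ a b, 0 < t₀ → t₁ ≤ T →
      IsGaugeSol s c θ K t₀ t₁ a → IsGaugeSol s c θ K t₀ t₁ b →
      (∀ k, |rho s θ (a t₀) k| ≤ R * t₀) →
      ∀ t ∈ Icc t₀ t₁, ‖a t - b t‖ ≤ C * (1 + Real.log (t / t₀)) * ‖a t₀ - b t₀‖ := by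
  obtain ⟨C, hC1, hC⟩ := exists_bddLip hs c hθ hK
  obtain ⟨C', hC'1, hC'⟩ := exists_gauge_estimate hs c hθ hK
  have hC0 : 0 ≤ C := by linarith
  have hC'0 : 0 ≤ C' := by linarith
  have hK0 : 0 ≤ K := by linarith
  have hc := abs_nonneg c
  set r := R + C'
  have hr0 : 0 ≤ r := by positivity
  set Q := |c| * (r + 2 * C * K + C) + 2 * |c| * C
  have hQ : 0 ≤ Q := by positivity
  -- With `D` the maximal and `δ` the initial distance, the estimate reads `D ≤ δ + QtD + 2K²|c|
  -- log(t/t₀) δ`. The time is chosen so that `Qt ≤ 1/2`, and absorbing `D/2` doubles the remaining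
  -- terms.
  refine ⟨2 * (1 + |c| * (2 * K ^ 2)), min 1 (1 / (2 * (Q + 1))), by positivity, by positivity,
    min_le_left _ _, ?_⟩
  intro t₀ t₁ a b ht₀ ht₁ ha hb hRa t ht
  have ht₁1 : t₁ ≤ 1 := ht₁.trans (min_le_left _ _)
  have hpos : ∀ τ ∈ Icc t₀ t, 0 < τ := fun τ hτ => ht₀.trans_le hτ.1
  have hmem : ∀ τ ∈ Icc t₀ t, τ ∈ Icc t₀ t₁ := fun τ hτ => ⟨hτ.1, hτ.2.trans ht.2⟩
  have hle : ∀ τ ∈ Icc t₀ t, τ ≤ 1 := fun τ hτ => (hmem τ hτ).2.trans ht₁1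
  have ht0 : t₀ ∈ Icc t₀ t := ⟨le_rfl, ht.1⟩
  have htt : t ∈ Icc t₀ t := ⟨ht.1, le_rfl⟩
  -- Estimating by the maximum `D` of the distance replaces a Gronwall argument: Lipschitz errors
  -- become constants times `D` and are absorbed for short times.
  obtain ⟨τ₀, hτ₀, hmax⟩ := (isCompact_Icc (a := t₀) (b := t)).exists_isMaxOn ⟨t₀, ht0⟩
    (f := fun τ => ‖a τ - b τ‖) (fun τ hτ => ((ha.deriv τ (hmem τ hτ)).sub
      (hb.deriv τ (hmem τ hτ))).continuousAt.norm.continuousWithinAt)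
  set D := ‖a τ₀ - b τ₀‖
  have hD : ∀ τ ∈ Icc t₀ t, ‖a τ - b τ‖ ≤ D := fun τ hτ => hmax hτ
  have hD0 : 0 ≤ D := norm_nonneg _
  set δ := ‖a t₀ - b t₀‖
  have hδ0 : 0 ≤ δ := norm_nonneg _
  have hba : ∀ τ ∈ Icc t₀ t, ‖a τ‖ ≤ K := fun τ hτ => ha.bound τ (hmem τ hτ)
  have hbb : ∀ τ ∈ Icc t₀ t, ‖b τ‖ ≤ K := fun τ hτ => hb.bound τ (hmem τ hτ)
  set E₀ := 2 * K * δ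
  have hE₀ : ∀ k, |‖seq s (a t₀) k‖ ^ 2 - ‖seq s (b t₀) k‖ ^ 2| ≤ E₀ := by
    intro k
    have h1 : |‖seq s (a t₀) k‖ - ‖seq s (b t₀) k‖| ≤ δ := by
      refine (abs_norm_sub_norm_le _ _).trans ?_
      rw [← seq_sub]
      exact norm_seq_le (by linarith) _ k
    have h2 : ‖seq s (a t₀) k‖ ≤ K := (norm_seq_le (by linarith) _ k).trans (hba t₀ ht0)
    have h3 : ‖seq s (b t₀) k‖ ≤ K := (norm_seq_le (by linarith) _ k).trans (hbb t₀ ht0)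
    rw [sq_sub_sq, abs_mul, abs_of_nonneg (by positivity : 0 ≤ ‖seq s (a t₀) k‖ + ‖seq s (b t₀) k‖)]
    calc _ ≤ (K + K) * δ := by gcongr
      _ = _ := by simp only [E₀]; ring
  have hlip : ∀ τ ∈ Icc t₀ t, ∀ (f : L2 → ℝ), BddLip K f C → |f (a τ) - f (b τ)| ≤ C * D :=
    fun τ hτ f hf => (hf.lip _ _ (hba τ hτ) (hbb τ hτ)).trans (by gcongr; exact hD τ hτ)
  -- The moduli of the two solutions separate at a bounded rate: `CD(τ - t₀)` from the derivative
  -- and `CDτ + CDt₀` from the normal form corrections. Only their initial discrepancy `E₀` is not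
  -- proportional to `τ`.
  have he : ∀ τ ∈ Icc t₀ t, ∀ k, |rho s θ (a τ) k - rho s θ (b τ) k| ≤ E₀ + 2 * C * D * τ := by
    intro τ hτ k
    have h1 := norm_sub_le_of_deriv_le (t₀ := t₀) (t₁ := t) (fun σ hσ =>
      (hasDerivAt_sq_nform hs hθ (hpos σ hσ) (ha.deriv σ (hmem σ hσ)) k).sub
        (hasDerivAt_sq_nform hs hθ (hpos σ hσ) (hb.deriv σ (hmem σ hσ)) k)) (C := C * D)
      (fun σ hσ => hlip σ hσ _ ((hC σ (hpos σ hσ) (hle σ hσ)).2.2.2.1 k)) hτ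
    have h2 := hlip τ hτ _ ((hC τ (hpos τ hτ) (hle τ hτ)).2.2.2.2 k)
    have h3 := hlip t₀ ht0 _ ((hC t₀ ht₀ (hle t₀ ht0)).2.2.2.2 k)
    have h4 := hE₀ k
    have a1 := sq_norm_sub_sq_nform (s := s) (c := c) (θ := θ) t₀ (a t₀) k
    have a2 := sq_norm_sub_sq_nform (s := s) (c := c) (θ := θ) t₀ (b t₀) k
    have h2' : |τ * sqCorr s c θ τ (a τ) k - τ * sqCorr s c θ τ (b τ) k| ≤ τ * (C * D) := by
      rw [← mul_sub, abs_mul, abs_of_pos (hpos τ hτ)]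
      exact mul_le_mul_of_nonneg_left h2 (hpos τ hτ).le
    have h3' : |t₀ * sqCorr s c θ t₀ (a t₀) k - t₀ * sqCorr s c θ t₀ (b t₀) k| ≤ t₀ * (C * D) := by
      rw [← mul_sub, abs_mul, abs_of_pos ht₀]
      exact mul_le_mul_of_nonneg_left h3 ht₀.le
    rw [Real.norm_eq_abs] at h1
    rw [rho_eq (c := c) τ (a τ), rho_eq (c := c) τ (b τ)]
    simp only [Pi.sub_apply] at h1
    rw [abs_le] at *
    constructor <;> linarith [h1.1, h1.2, h2'.1, h2'.2, h3'.1, h3'.2, h4.1, h4.2]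
  have hrho : ∀ τ ∈ Icc t₀ t, ∀ k, |rho s θ (a τ) k| ≤ r * τ := by
    intro τ hτ k
    have e1 := (hC' t₀ t₁ a ht₀ ht₁1 ha τ (hmem τ hτ)).1 k
    have e2 := hRa k
    have e3 : R * t₀ ≤ R * τ := by gcongr; exact hτ.1
    have e4 : r * τ = R * τ + C' * τ := by simp only [r]; ring
    rw [abs_le] at *
    constructor <;> linarith [e1.1, e1.2, e2.1, e2.2]
  -- After division by `τ` all contributions are bounded except that of `E₀`, which leaves the
  -- single term in `τ⁻¹`.
  have hnf : ∀ τ ∈ Icc t₀ t, ‖nfield s c θ τ (a τ) - nfield s c θ τ (b τ)‖ ≤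
      |c| * (r + 2 * C * K + C) * D + |c| * (E₀ * K) * τ⁻¹ := by
    intro τ hτ
    have hτ0 := hpos τ hτ
    have h1 := norm_resid_sub_le hs hθ (hrho τ hτ) (he τ hτ)
    have h2 := (hC τ (hpos τ hτ) (hle τ hτ)).2.1.lip _ _ (hba τ hτ) (hbb τ hτ)
    have hE : 0 ≤ E₀ := by positivity
    have e : nfield s c θ τ (a τ) - nfield s c θ τ (b τ) = (-((c : ℂ) * Complex.I)) •
        (τ⁻¹ • (resid s θ (a τ) - resid s θ (b τ)) +
          (grest s c θ τ (a τ) - grest s c θ τ (b τ))) := by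
      rw [nfield, nfield, ← smul_sub, smul_sub τ⁻¹]
      congr 1
      abel
    rw [e, norm_smul, norm_neg, norm_mul, Complex.norm_I, mul_one, norm_coe_ofReal]
    calc _ ≤ |c| * (τ⁻¹ * (r * τ * D + (E₀ + 2 * C * D * τ) * K) + C * D) := by
          gcongr
          refine (norm_add_le _ _).trans (add_le_add ?_ (h2.trans ?_))
          · rw [norm_smul, norm_inv, Real.norm_of_nonneg hτ0.le]
            gcongr
            refine h1.trans ?_
            gcongr
            exacts [hD τ hτ, hbb τ hτ]
          · gcongr
            exact hD τ hτ
      _ = _ := by field_simp; ring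
  have hlog : ∀ τ ∈ Icc t₀ t, ‖nform s c θ τ (a τ) - nform s c θ τ (b τ)‖ ≤
      ‖nform s c θ t₀ (a t₀) - nform s c θ t₀ (b t₀)‖ +
        |c| * (r + 2 * C * K + C) * D * (τ - t₀) + |c| * (E₀ * K) * Real.log (τ / t₀) :=
    fun τ hτ => norm_sub_le_of_deriv_le_log ht₀ (fun σ hσ =>
      (hasDerivAt_nform hs hθ (hpos σ hσ) (ha.deriv σ (hmem σ hσ))).sub
        (hasDerivAt_nform hs hθ (hpos σ hσ) (hb.deriv σ (hmem σ hσ)))) hnf hτ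
  have hd : ∀ τ ∈ Icc t₀ t, ‖(a τ - b τ) - (nform s c θ τ (a τ) - nform s c θ τ (b τ))‖ ≤
      |c| * τ * (C * D) := by
    intro τ hτ
    have := hpos τ hτ
    rw [sub_sub_sub_comm, sub_nform, sub_nform, ← smul_sub, norm_smul_mul_I this.le]
    gcongr
    exact ((hC τ (hpos τ hτ) (hle τ hτ)).1.lip _ _ (hba τ hτ) (hbb τ hτ)).trans
      (by gcongr; exact hD τ hτ)
  have hlogmono : ∀ τ ∈ Icc t₀ t, Real.log (τ / t₀) ≤ Real.log (t / t₀) := fun τ hτ =>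
    Real.log_le_log (div_pos (hpos τ hτ) ht₀) (by gcongr; exact hτ.2)
  have hmain : D ≤ δ + Q * D * t + |c| * (E₀ * K) * Real.log (t / t₀) := by
    have h1 := hlog τ₀ hτ₀
    have h2 := hd τ₀ hτ₀
    have h3 := hd t₀ ht0
    have h4 := norm_sub_norm_le (a τ₀ - b τ₀) (nform s c θ τ₀ (a τ₀) - nform s c θ τ₀ (b τ₀))
    have h5 := norm_sub_norm_le (nform s c θ t₀ (a t₀) - nform s c θ t₀ (b t₀)) (a t₀ - b t₀)
    rw [norm_sub_rev _ (a t₀ - b t₀)] at h5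
    have h6 : |c| * (E₀ * K) * Real.log (τ₀ / t₀) ≤ |c| * (E₀ * K) * Real.log (t / t₀) :=
      mul_le_mul_of_nonneg_left (hlogmono τ₀ hτ₀) (by positivity)
    have h7 : |c| * τ₀ * (C * D) ≤ |c| * t * (C * D) := by gcongr; exact hτ₀.2
    have h8 : |c| * t₀ * (C * D) ≤ |c| * t * (C * D) := by gcongr; exact ht.1
    have h9 : |c| * (r + 2 * C * K + C) * D * (τ₀ - t₀) ≤ |c| * (r + 2 * C * K + C) * D * t := by
      gcongr
      linarith [hτ₀.2]
    have e : Q * D * t = |c| * (r + 2 * C * K + C) * D * t + 2 * (|c| * t * (C * D)) := by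
      simp only [Q]; ring
    linarith
  have hQt : Q * t ≤ 1 / 2 := by
    have h1 : t ≤ 1 / (2 * (Q + 1)) := ht.2.trans (ht₁.trans (min_le_right _ _))
    calc Q * t ≤ Q * (1 / (2 * (Q + 1))) := by gcongr
      _ ≤ 1 / 2 := by
        rw [mul_one_div, div_le_div_iff₀ (by positivity) (by norm_num)]
        linarith
  have hL : 0 ≤ Real.log (t / t₀) := Real.log_nonneg ((one_le_div ht₀).2 ht.1)
  have h10 : Q * D * t ≤ D / 2 := by nlinarith
  refine (hD t htt).trans ?_
  have e : |c| * (E₀ * K) * Real.log (t / t₀) = |c| * (2 * K ^ 2) * Real.log (t / t₀) * δ := by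
    simp only [E₀]; ring
  have h11 : 0 ≤ |c| * (2 * K ^ 2) * δ := by positivity
  have h12 : 0 ≤ Real.log (t / t₀) * δ := by positivity
  nlinarith

end DiracNLS

end

noncomputable section

namespace DiracNLS

open scoped ENNReal ComplexConjugate

/-! ### Ordinary differential equations with an a priori bound -/

/-- The retraction onto the ball of radius `K`. -/
def retract (K : ℝ) (x : L2) : L2 := (K / max K ‖x‖) • x

theorem retract_eq {K : ℝ} (hK : 0 < K) {x : L2} (hx : ‖x‖ ≤ K) : retract K x = x := by
  rw [retract, max_eq_left hx, div_self hK.ne', one_smul]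

theorem norm_retract_le {K : ℝ} (hK : 0 < K) (x : L2) : ‖retract K x‖ ≤ K := by
  have hm : 0 < max K ‖x‖ := hK.trans_le (le_max_left _ _)
  rw [retract, norm_smul, Real.norm_of_nonneg (by positivity), div_mul_eq_mul_div,
    div_le_iff₀ hm]
  gcongr
  exact le_max_right _ _

/-- The constant `2` comes from the triangle inequality; any Lipschitz constant serves the
truncation of the vector field. -/
theorem norm_retract_sub_le {K : ℝ} (hK : 0 < K) (x y : L2) :
    ‖retract K x - retract K y‖ ≤ 2 * ‖x - y‖ := by
  have hmx : 0 < max K ‖x‖ := hK.trans_le (le_max_left _ _)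
  have hmy : 0 < max K ‖y‖ := hK.trans_le (le_max_left _ _)
  have e : retract K x - retract K y =
      (K / max K ‖x‖) • (x - y) + (K / max K ‖x‖ - K / max K ‖y‖) • y := by
    rw [retract, retract, smul_sub, sub_smul]; abel
  have h1 : K / max K ‖x‖ ≤ 1 := (div_le_one hmx).2 (le_max_left _ _)
  have h2 : |max K ‖y‖ - max K ‖x‖| ≤ ‖x - y‖ := by
    refine (abs_max_sub_max_le_max K ‖y‖ K ‖x‖).trans (max_le (by simp) ?_)
    rw [norm_sub_rev]
    exact abs_norm_sub_norm_le _ _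
  have h3 : |K / max K ‖x‖ - K / max K ‖y‖| * ‖y‖ ≤ ‖x - y‖ := by
    have e2 : K / max K ‖x‖ - K / max K ‖y‖ =
        (K / max K ‖x‖) * ((max K ‖y‖ - max K ‖x‖) / max K ‖y‖) := by
      field_simp
    rw [e2, abs_mul, abs_of_pos (by positivity : 0 < K / max K ‖x‖), abs_div, abs_of_pos hmy]
    calc _ ≤ 1 * (‖x - y‖ / max K ‖y‖) * max K ‖y‖ := by
          gcongr
          exact le_max_right _ _
      _ = ‖x - y‖ := by field_simp
  rw [e]
  refine (norm_add_le _ _).trans ?_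
  rw [norm_smul, norm_smul, Real.norm_of_nonneg (by positivity), Real.norm_eq_abs]
  nlinarith [norm_nonneg (x - y)]

/-- Composed with the retraction, the field is globally bounded and Lipschitz, so its solution
exists on all of `[p, q]`. The a priori bound forbids the solution to reach norm `K`, hence the
truncation is never active. The margins `p < t₀` and `t₁ < q` provide two-sided derivatives at the
endpoints. -/
theorem exists_solution_of_apriori {f : ℝ → L2 → L2} {p q t₀ t₁ K L : ℝ} {x₀ : L2}
    (hp : p < t₀) (h01 : t₀ ≤ t₁) (hq : t₁ < q) (hf : ∀ t ∈ Icc p q, BddLip K (f t) L)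
    (hc : ∀ x, ContinuousOn (fun t => f t x) (Icc p q)) (hx₀ : ‖x₀‖ < K)
    (hap : ∀ A : ℝ → L2, ∀ τ ∈ Icc t₀ t₁, A t₀ = x₀ →
      (∀ t ∈ Icc t₀ τ, HasDerivAt A (f t (A t)) t ∧ ‖A t‖ ≤ K) → ‖A τ‖ < K) :
    ∃ A : ℝ → L2, A t₀ = x₀ ∧ ∀ t ∈ Icc t₀ t₁, HasDerivAt A (f t (A t)) t ∧ ‖A t‖ ≤ K := by
  have hK : 0 < K := (norm_nonneg _).trans_lt hx₀
  have ht₀ : t₀ ∈ Icc p q := ⟨hp.le, h01.trans hq.le⟩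
  have hL : 0 ≤ L := (hf t₀ ht₀).nonneg hK.le
  have hpq : 0 ≤ q - p := by linarith
  -- As the truncated field is bounded by `L` everywhere, a ball of radius `L(q - p)` cannot be
  -- left, and a single application covers the whole interval.
  have hPL : IsPicardLindelof (fun t x => f t (retract K x)) (⟨t₀, ht₀⟩ : Icc p q) x₀
      (NNReal.mk (L * (q - p)) (by positivity)) 0 (NNReal.mk L hL)
      (NNReal.mk (L * 2) (by positivity)) := by
    refine ⟨fun t ht => LipschitzOnWith.of_dist_le_mul fun x _ y _ => ?_, fun x _ => hc _,
      fun t ht x _ => (hf t ht).bound _ (norm_retract_le hK x), ?_⟩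
    · rw [dist_eq_norm, dist_eq_norm]
      refine ((hf t ht).lip _ _ (norm_retract_le hK x) (norm_retract_le hK y)).trans ?_
      rw [NNReal.coe_mk, mul_assoc]
      gcongr
      exact norm_retract_sub_le hK x y
    · simp only [NNReal.coe_mk, NNReal.coe_zero, sub_zero]
      gcongr
      exact max_le (by linarith) (by linarith)
  obtain ⟨A, hA0, hA⟩ := hPL.exists_eq_forall_mem_Icc_hasDerivWithinAt₀
  have hA' : ∀ t ∈ Icc t₀ t₁, HasDerivAt A (f t (retract K (A t))) t := fun t ht =>
    (hA t ⟨hp.le.trans ht.1, ht.2.trans hq.le⟩).hasDerivAt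
      (Icc_mem_nhds (hp.trans_le ht.1) (ht.2.trans_lt hq))
  have hcont : ContinuousOn (fun t => ‖A t‖) (Icc t₀ t₁) := fun t ht =>
    (hA' t ht).continuousAt.norm.continuousWithinAt
  have key : ∀ t ∈ Icc t₀ t₁, ‖A t‖ ≤ K := by
    by_contra! hcon
    obtain ⟨t, ht, hKt⟩ := hcon
    have hne : ({τ ∈ Icc t₀ t₁ | ‖A τ‖ = K}).Nonempty := by
      obtain ⟨τ, hτ, hτK⟩ := intermediate_value_Icc ht.1
        (hcont.mono (Icc_subset_Icc_right ht.2)) (show K ∈ Icc ‖A t₀‖ ‖A t‖ by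
          rw [hA0]; exact ⟨hx₀.le, hKt.le⟩)
      exact ⟨τ, ⟨hτ.1, hτ.2.trans ht.2⟩, hτK⟩
    have hcl : IsCompact {τ ∈ Icc t₀ t₁ | ‖A τ‖ = K} := by
      refine isCompact_Icc.of_isClosed_subset ?_ (sep_subset _ _)
      exact hcont.preimage_isClosed_of_isClosed isClosed_Icc isClosed_singleton
    -- At the first time with norm `K`, the solution has stayed in the ball until then, so it solves
    -- the original equation and the a priori bound is contradicted.
    obtain ⟨τ, hτ, hmin⟩ := hcl.exists_isLeast hne
    have hle : ∀ t ∈ Icc t₀ τ, ‖A t‖ ≤ K := by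
      intro t ht'
      by_contra! hKt'
      obtain ⟨τ', hτ', hτK'⟩ := intermediate_value_Icc ht'.1
        (hcont.mono (Icc_subset_Icc_right (ht'.2.trans hτ.1.2)))
        (show K ∈ Icc ‖A t₀‖ ‖A t‖ by rw [hA0]; exact ⟨hx₀.le, hKt'.le⟩)
      have h1 := hmin ⟨⟨hτ'.1, hτ'.2.trans (ht'.2.trans hτ.1.2)⟩, hτK'⟩
      have h2 : t = τ' := le_antisymm (ht'.2.trans h1) hτ'.2
      rw [h2] at hKt'
      simp only at hτK'
      linarith
    have := hap A τ hτ.1 hA0 fun t ht' => ⟨by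
      have := hA' t ⟨ht'.1, ht'.2.trans hτ.1.2⟩
      rwa [retract_eq hK (hle t ht')] at this, hle t ht'⟩
    exact this.ne hτ.2
  refine ⟨A, hA0, fun t ht => ⟨?_, key t ht⟩⟩
  have := hA' t ht
  rwa [retract_eq hK (key t ht)] at this

/-! ### Regularity of the vector fields -/

variable {s c : ℝ} {θ : ℤ → ℝ} {Θ : ℝ}

theorem continuousAt_trilin_self (hs : 1 / 2 < s) {m : ℝ → ℤ → ℤ → ℤ → ℂ} {B t : ℝ}
    (hm : ∀ τ, MulBound (m τ) B) (hc : ∀ k i j, ContinuousAt (fun τ => m τ k i j) t)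
    {x : ℝ → L2} (hx : ContinuousAt x t) :
    ContinuousAt (fun τ => trilin s (m τ) (x τ) (x τ) (x τ)) t :=
  tendsto_trilin hs (Eventually.of_forall hm) (hm t) hc hx hx hx

theorem continuousAt_osc {t : ℝ} (ht : t ≠ 0) (k i j : ℤ) :
    ContinuousAt (fun τ => osc τ k i j) t := by
  unfold osc
  have : ContinuousAt (fun τ : ℝ => omega k i j / (4 * τ)) t :=
    continuousAt_const.div (by fun_prop) (by positivity)
  fun_prop

theorem continuousAt_gosc (c : ℝ) (θ : ℤ → ℝ) {t : ℝ} (ht : t ≠ 0) (k i j : ℤ) :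
    ContinuousAt (fun τ => gosc c θ τ k i j) t := by
  unfold gosc gphase
  split_ifs
  · have h1 : ContinuousAt (fun τ : ℝ => omega k i j / (4 * τ)) t :=
      continuousAt_const.div (by fun_prop) (by positivity)
    have h2 : ContinuousAt Real.log t := Real.continuousAt_log ht
    fun_prop
  · exact continuousAt_const

theorem continuousAt_field (hs : 1 / 2 < s) (c M : ℝ) {t : ℝ} (ht : t ≠ 0) {x : ℝ → L2}
    (hx : ContinuousAt x t) : ContinuousAt (fun τ => field s c M τ (x τ)) t := by
  unfold field nonlin
  have h1 := continuousAt_trilin_self hs osc_bound (continuousAt_osc ht) hx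
  have h2 : ContinuousAt (fun τ : ℝ => c / |τ|) t :=
    continuousAt_const.div (by fun_prop) (by positivity)
  fun_prop

theorem continuousAt_resid (hs : 1 / 2 < s) (hθ : ∀ k, |θ k| ≤ Θ) {t : ℝ} {x : ℝ → L2}
    (hx : ContinuousAt x t) : ContinuousAt (fun τ => resid s θ (x τ)) t :=
  (continuousAt_trilin_self hs (fun _ => coinc_bound) (fun _ _ _ => continuousAt_const) hx).sub
    ((diagL _ (norm_ofReal_le hθ)).continuous.continuousAt.comp hx)

theorem continuousAt_gfield (hs : 1 / 2 < s) (c : ℝ) (hθ : ∀ k, |θ k| ≤ Θ) {t : ℝ} (ht : t ≠ 0)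
    {x : ℝ → L2} (hx : ContinuousAt x t) :
    ContinuousAt (fun τ => gfield s c θ τ (x τ)) t := by
  unfold gfield
  have h1 := continuousAt_trilin_self hs (gosc_bound c θ) (continuousAt_gosc c θ ht) hx
  have h2 := continuousAt_resid hs hθ hx
  fun_prop

theorem exists_bddLip_field (hs : 1 / 2 < s) (c M : ℝ) {K p : ℝ} (hK : 1 ≤ K) (hp : 0 < p) :
    ∃ L, ∀ t, p ≤ |t| → BddLip K (field s c M t) L := by
  have hK0 : 0 ≤ K := by linarith
  have hid := BddLip.id hK
  refine ⟨|c| / p * (1 * triC s * (3 * (K * K * K)) + 2 * |M| * K), fun t ht => ?_⟩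
  have h1 := ((hid.trilin hs (osc_bound t) hK0 hid hid).sub
    (hid.smul ((2 * M : ℝ) : ℂ))).smul (((c / |t| : ℝ) : ℂ) * Complex.I)
  refine h1.mono ?_
  have h0 := triC_nonneg s
  rw [norm_mul, Complex.norm_I, norm_coe_ofReal, norm_coe_ofReal, mul_one, abs_mul, abs_two,
    abs_div, abs_abs]
  gcongr

/-- The gauge transformation is inverted by the opposite phase. -/
theorem hasDerivAt_gauge_symm (hs : 1 / 2 < s) (hθ : ∀ k, |θ k| ≤ Θ) {t : ℝ} (ht : 0 < t)
    {a : ℝ → L2} (ha : HasDerivAt a (t⁻¹ • gfield s c θ t (a t)) t) :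
    HasDerivAt (fun τ => diag (phase θ (-(c * Real.log τ))) (a τ))
      (field s c (mass s (diag (phase θ (-(c * Real.log t))) (a t))) t
        (diag (phase θ (-(c * Real.log t))) (a t))) t := by
  have h0 : HasDerivAt (fun τ => -(c * Real.log τ)) (-(c * t⁻¹)) t :=
    ((Real.hasDerivAt_log ht.ne').const_mul c).neg
  have h1 := hasDerivAt_diag_phase hθ h0 ha
  refine h1.congr_deriv ?_
  set A := diag (phase θ (-(c * Real.log t))) (a t)
  have haA : a t = diag (phase θ (c * Real.log t)) A := by
    refine seq_injective s fun k => ?_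
    simp only [A]
    rw [seq_diag (norm_phase_le θ _), seq_diag (norm_phase_le θ _), ← mul_assoc,
      mul_comm (phase θ _ k), phase_neg_mul, one_mul]
  refine seq_injective s fun k => ?_
  have e := tsum_triTerm_osc hs c t A k
  have e2 : ∑' p, triTerm s (gosc c θ t) (a t) (a t) (a t) k p =
      phase θ (c * Real.log t) k * ∑' p, triTerm s (gosc c 0 t) A A A k p := by
    rw [haA, ← tsum_mul_left]
    exact tsum_congr fun p => triTerm_gosc_gauge c t θ A k p
  have e3 : seq s (a t) k = phase θ (c * Real.log t) k * seq s A k := by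
    rw [haA, seq_diag (norm_phase_le θ _)]
  have e4 : rho s θ (a t) k = ‖seq s A k‖ ^ 2 - θ k := by
    rw [rho, e3, norm_mul, norm_phase, one_mul]
  have e5 := phase_neg_mul θ (c * Real.log t) k
  rw [seq_add, seq_smul, seq_diag (norm_ofReal_le hθ), seq_diag (norm_phase_le θ _),
    seq_diag (norm_phase_le θ _), seq_real_smul, gfield, seq_smul, seq_sub, seq_trilin hs (gosc_bound c θ t), seq_resid hs hθ,
    field, nonlin, seq_smul, seq_sub, seq_smul, seq_trilin hs (osc_bound t), e, e2, e3, e4,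
    abs_of_pos ht]
  push_cast
  have ht' : (t : ℂ) ≠ 0 := by exact_mod_cast ht.ne'
  field_simp
  linear_combination ((c : ℂ) * (∑' p, triTerm s (gosc c 0 t) A A A k p -
    (‖seq s A k‖ : ℂ) ^ 2 * seq s A k)) * e5

end DiracNLS

end

noncomputable section

namespace DiracNLS

open scoped ENNReal ComplexConjugate

variable {s c : ℝ} {θ : ℤ → ℝ} {Θ : ℝ}

/-! ### The limit at the singular time -/

theorem exists_bddLip_gfield (hs : 1 / 2 < s) (c : ℝ) (hθ : ∀ k, |θ k| ≤ Θ) {K : ℝ}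
    (hK : 1 ≤ K) : ∃ C, ∀ t, BddLip K (gfield s c θ t) C := by
  have hK0 : 0 ≤ K := by linarith
  have hid := BddLip.id hK
  have hcoinc := hid.trilin hs coinc_bound hK0 hid hid
  have hdiag : BddLip K (fun x => diag (fun k => (θ k : ℂ)) x) (Θ * K) :=
    BddLip.comp_le (norm_diag_le (norm_ofReal_le hθ))
      (fun v w => by
        rw [← diag_sub (norm_ofReal_le hθ)]; exact norm_diag_le (norm_ofReal_le hθ) _)
      ((abs_nonneg _).trans (hθ 0)) hid
  exact ⟨_, fun t => ((hid.trilin hs (gosc_bound c θ t) hK0 hid hid).sub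
    (hcoinc.sub hdiag)).smul ((c : ℂ) * Complex.I)⟩

theorem BddLip.inv_smul {K C p t : ℝ} {f : L2 → L2} (hK : 0 ≤ K) (hf : BddLip K f C) (hp : 0 < p)
    (ht : p ≤ t) : BddLip K (fun x => t⁻¹ • f x) (p⁻¹ * C) := by
  have h0 := hf.nonneg hK
  have ht0 : 0 < t := hp.trans_le ht
  have hle : t⁻¹ ≤ p⁻¹ := inv_anti₀ hp ht
  refine ⟨fun x hx => ?_, fun x y hx hy => ?_⟩
  · rw [norm_smul, Real.norm_of_nonneg (by positivity)]
    gcongr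
    exact hf.bound x hx
  · rw [← smul_sub, norm_smul, Real.norm_of_nonneg (by positivity), mul_assoc]
    gcongr
    exact hf.lip x y hx hy

/-- Solutions of an equation with a locally Lipschitz right-hand side that agree at a time agree
afterwards. -/
theorem eq_of_hasDerivAt {f : ℝ → L2 → L2} {p q : ℝ}
    (hf : ∀ K, 1 ≤ K → ∃ L, ∀ t ∈ Icc p q, BddLip K (f t) L) {A B : ℝ → L2}
    (hA : ∀ t ∈ Icc p q, HasDerivAt A (f t (A t)) t)
    (hB : ∀ t ∈ Icc p q, HasDerivAt B (f t (B t)) t) (h : A p = B p) {t : ℝ} (ht : t ∈ Icc p q) :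
    A t = B t := by
  have cA : ContinuousOn A (Icc p q) := fun t ht => (hA t ht).continuousAt.continuousWithinAt
  have cB : ContinuousOn B (Icc p q) := fun t ht => (hB t ht).continuousAt.continuousWithinAt
  obtain ⟨K₁, hK₁⟩ := isCompact_Icc.exists_bound_of_continuousOn cA
  obtain ⟨K₂, hK₂⟩ := isCompact_Icc.exists_bound_of_continuousOn cB
  set K := max 1 (max K₁ K₂)
  obtain ⟨L, hL⟩ := hf K (le_max_left _ _)
  have hA' : ∀ t ∈ Icc p q, ‖A t‖ ≤ K := fun t ht =>
    (hK₁ t ht).trans ((le_max_left _ _).trans (le_max_right _ _))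
  have hB' : ∀ t ∈ Icc p q, ‖B t‖ ≤ K := fun t ht =>
    (hK₂ t ht).trans ((le_max_right _ _).trans (le_max_right _ _))
  refine ODE_solution_unique_of_mem_Icc_right (v := f) (s := fun _ => Metric.closedBall 0 K)
    (K := L.toNNReal) (a := p) (b := q) (fun t ht => ?_) cA
    (fun t ht => (hA t (Ico_subset_Icc_self ht)).hasDerivWithinAt)
    (fun t ht => by simpa using hA' t (Ico_subset_Icc_self ht)) cB
    (fun t ht => (hB t (Ico_subset_Icc_self ht)).hasDerivWithinAt)
    (fun t ht => by simpa using hB' t (Ico_subset_Icc_self ht)) h ht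
  refine LipschitzOnWith.of_dist_le_mul fun x hx y hy => ?_
  have h1 := hL t (Ico_subset_Icc_self ht)
  rw [dist_eq_norm, dist_eq_norm, Real.coe_toNNReal _ (h1.nonneg (by positivity))]
  exact h1.lip x y (by simpa using hx) (by simpa using hy)

/-- The squared moduli of the coefficients. -/
def modSq (s : ℝ) (α : L2) (k : ℤ) : ℝ := ‖seq s α k‖ ^ 2

theorem abs_modSq_le (hs : 0 ≤ s) (α : L2) (k : ℤ) : |modSq s α k| ≤ ‖α‖ ^ 2 := by
  rw [modSq, abs_of_nonneg (by positivity)]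
  exact pow_le_pow_left₀ (norm_nonneg _) (norm_seq_le hs α k) 2

theorem rho_modSq (α : L2) (k : ℤ) : rho s (modSq s α) α k = 0 := by simp [rho, modSq]

/-- Approximation from regular times: `a n` starts from `α` at time `u n → 0`. With `θ = |α|²` the
defect `rho` vanishes initially, so `a n - α = O(t)` uniformly in `n`. At time `u n` any later
approximation is within `C · u n` of `α`, and the logarithmic loss of stability does not spoil the
convergence. -/
theorem exists_gauge_solution (hs : 1 / 2 < s) (c : ℝ) (α : L2) :
    ∃ T C, 0 < T ∧ ∃ a : ℝ → L2, ∀ t ∈ Ioo 0 T,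
      HasDerivAt a (t⁻¹ • gfield s c (modSq s α) t (a t)) t ∧ ‖a t - α‖ ≤ C * t := by
  have hθ := abs_modSq_le (by linarith : 0 ≤ s) α
  set θ := modSq s α
  set K := ‖α‖ + 1
  have hK : 1 ≤ K := by simp [K]
  have hK0 : 0 ≤ K := by linarith
  obtain ⟨C, hC1, hC⟩ := exists_gauge_estimate hs c hθ hK
  obtain ⟨C', T', hC'0, hT'0, hT'1, hC'⟩ := exists_stability_estimate hs c hθ hK le_rfl
  obtain ⟨L, hL⟩ := exists_bddLip_gfield hs c hθ hK
  have hL0 : 0 ≤ L := (hL 0).nonneg hK0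
  -- This keeps `‖a t - α‖ ≤ CT ≤ 1/2`, strictly inside the ball of radius `K = ‖α‖ + 1`; it is the
  -- a priori bound for existence up to `T`.
  set T := min T' (1 / (2 * C)) with hT
  have hT0 : 0 < T := by positivity
  have hTT' : T ≤ T' := min_le_left _ _
  have hT1 : T ≤ 1 := hTT'.trans hT'1
  have hCT : C * T ≤ 1 / 2 := by
    calc C * T ≤ C * (1 / (2 * C)) := by gcongr; exact min_le_right _ _
      _ = 1 / 2 := by field_simp
  set u : ℕ → ℝ := fun n => T * ((n : ℝ) + 1)⁻¹
  have hu0 : ∀ n, 0 < u n := fun n => by positivity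
  have huT : ∀ n, u n ≤ T := fun n => mul_le_of_le_one_right hT0.le
    (inv_le_one_of_one_le₀ (by linarith [(Nat.cast_nonneg n : (0 : ℝ) ≤ n)]))
  have hu : Tendsto u atTop (𝓝 0) := by
    have := tendsto_one_div_add_atTop_nhds_zero_nat (𝕜 := ℝ)
    simpa [u] using this.const_mul T
  have hanti : Antitone u := fun m n hmn => by
    simp only [u]
    gcongr
  have hρ : ∀ n k, |rho s θ α k| ≤ 0 * u n := fun n k => by
    rw [rho_modSq]; simp
  have hex : ∀ n, ∃ a : ℝ → L2, a (u n) = α ∧ IsGaugeSol s c θ K (u n) T a := by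
    intro n
    have hnear : ∀ A : ℝ → L2, A (u n) = α → ∀ τ ∈ Icc (u n) T, IsGaugeSol s c θ K (u n) τ A →
        ‖A τ‖ < K := by
      intro A hA0 τ hτ hA
      have h1 := (hC (u n) τ A (hu0 n) (hτ.2.trans hT1) hA τ ⟨hτ.1, le_rfl⟩).2 0
        (by rw [hA0]; exact hρ n)
      have h2 : C * (0 + 1) * τ ≤ 1 / 2 := by
        rw [zero_add, mul_one]
        exact (mul_le_mul_of_nonneg_left hτ.2 (by linarith)).trans hCT
      rw [hA0] at h1
      have h3 := norm_sub_norm_le (A τ) α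
      simp only [K]
      linarith
    obtain ⟨a, ha0, ha⟩ := exists_solution_of_apriori (f := fun t x => t⁻¹ • gfield s c θ t x)
      (p := u n / 2) (q := T + 1) (t₀ := u n) (t₁ := T) (K := K) (x₀ := α)
      (by linarith [hu0 n]) (huT n) (by linarith)
      (fun t ht => (hL t).inv_smul hK0 (half_pos (hu0 n)) ht.1)
      (fun x t ht => by
        have ht0 : t ≠ 0 := ((half_pos (hu0 n)).trans_le ht.1).ne'
        exact ((continuousAt_inv₀ ht0).smul
          (continuousAt_gfield hs c hθ ht0 continuousAt_const)).continuousWithinAt)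
      (by simp [K])
      (fun A τ hτ hA0 hA => hnear A hA0 τ hτ ⟨fun t ht => (hA t ht).1, fun t ht => (hA t ht).2⟩)
    exact ⟨a, ha0, ⟨fun t ht => (ha t ht).1, fun t ht => (ha t ht).2⟩⟩
  choose a ha0 ha using hex
  have hae : ∀ n, ∀ t ∈ Icc (u n) T, ‖a n t - α‖ ≤ C * t := by
    intro n t ht
    have h1 := (hC (u n) T (a n) (hu0 n) hT1 (ha n) t ht).2 0 (by rw [ha0]; exact hρ n)
    rwa [ha0, zero_add, mul_one] at h1
  -- The stability factor up to time `T` times the distance `C · u n` at the starting time; it tends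
  -- to zero because `r log r` does.
  set ε : ℕ → ℝ := fun n => C' * (1 + Real.log (T / u n)) * (C * u n) with hε
  have hεt : Tendsto ε atTop (𝓝 0) := by
    have h1 : Tendsto u atTop (𝓝[>] 0) :=
      tendsto_nhdsWithin_iff.2 ⟨hu, Eventually.of_forall hu0⟩
    have h2 : Tendsto (fun n => Real.log (u n) * u n) atTop (𝓝 0) := by
      have := (tendsto_log_mul_rpow_nhdsGT_zero one_pos).comp h1
      simpa [Function.comp_def] using this
    have e : ε = fun n => C' * C * ((1 + Real.log T) * u n - Real.log (u n) * u n) := by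
      funext n
      simp only [hε]
      rw [Real.log_div hT0.ne' (hu0 n).ne']
      ring
    rw [e]
    simpa using ((hu.const_mul (1 + Real.log T)).sub h2).const_mul (C' * C)
  -- Stability is applied with `a n` as reference solution, since it equals `α` at `u n` and thus
  -- has zero defect there, so `R = 0` is allowed.
  have hdiff : ∀ n m, n ≤ m → ∀ t ∈ Icc (u n) T, ‖a m t - a n t‖ ≤ ε n := by
    intro n m hnm t ht
    have hmem : u n ∈ Icc (u m) T := ⟨hanti hnm, huT n⟩
    have h1 := hC' (u n) T (a n) (a m) (hu0 n) hTT' (ha n) ((ha m).mono (hanti hnm) le_rfl)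
      (by rw [ha0]; exact hρ n) t ht
    rw [norm_sub_rev] at h1
    refine h1.trans ?_
    rw [ha0, norm_sub_rev α]
    have hlog : Real.log (t / u n) ≤ Real.log (T / u n) :=
      Real.log_le_log (div_pos ((hu0 n).trans_le ht.1) (hu0 n)) (by
        have := hu0 n
        gcongr
        exact ht.2)
    have hlog0 : 0 ≤ Real.log (t / u n) := Real.log_nonneg ((one_le_div (hu0 n)).2 ht.1)
    have h2 := hae m (u n) hmem
    have h3 := hu0 n
    have h4 := hlog0.trans hlog
    have h5 : 0 ≤ C' * (1 + Real.log (T / u n)) := by positivity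
    simp only [hε]
    gcongr
  have hcauchy : ∀ t ∈ Ioc 0 T, ∃ x, Tendsto (fun n => a n t) atTop (𝓝 x) := by
    intro t ht
    refine cauchySeq_tendsto_of_complete (Metric.cauchySeq_iff'.2 fun δ hδ => ?_)
    obtain ⟨N, hN1, hN2⟩ := ((hu.eventually_lt_const ht.1).and (hεt.eventually_lt_const hδ)).exists
    refine ⟨N, fun n hn => ?_⟩
    rw [dist_eq_norm]
    exact (hdiff N n hn t ⟨hN1.le, ht.2⟩).trans_lt hN2
  choose! b hb using hcauchy
  have hbn : ∀ n, ∀ t ∈ Icc (u n) T, ‖b t - a n t‖ ≤ ε n := by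
    intro n t ht
    have ht' : t ∈ Ioc 0 T := ⟨(hu0 n).trans_le ht.1, ht.2⟩
    refine le_of_tendsto ((hb t ht').sub_const _).norm ?_
    filter_upwards [eventually_ge_atTop n] with m hm
    exact hdiff n m hm t ht
  have hbα : ∀ t ∈ Ioc 0 T, ‖b t - α‖ ≤ C * t := by
    intro t ht
    refine le_of_tendsto ((hb t ht).sub_const _).norm ?_
    filter_upwards [hu.eventually_lt_const ht.1] with m hm
    exact hae m t ⟨hm.le, ht.2⟩
  have hbK : ∀ t ∈ Ioc 0 T, ‖b t‖ ≤ K := fun t ht => by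
    have h1 := hbα t ht
    have h3 := norm_sub_norm_le (b t) α
    have h2 : C * t ≤ 1 / 2 := (mul_le_mul_of_nonneg_left ht.2 (by linarith)).trans hCT
    simp only [K]
    linarith
  refine ⟨T, C, hT0, b, fun t ht => ⟨?_, hbα t ⟨ht.1, ht.2.le⟩⟩⟩
  have hmemIoo : ∀ τ ∈ Ioo (t / 2) T, τ ∈ Ioc 0 T := fun τ hτ =>
    ⟨(half_pos ht.1).trans hτ.1, hτ.2.le⟩
  have hev : ∀ᶠ n in atTop, u n < t / 2 := hu.eventually_lt_const (half_pos ht.1)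
  -- Away from time zero the field is Lipschitz on the ball, so the derivatives converge uniformly
  -- near `t` and the limit solves the equation.
  have hunif : TendstoUniformlyOn (fun n τ => τ⁻¹ • gfield s c θ τ (a n τ))
      (fun τ => τ⁻¹ • gfield s c θ τ (b τ)) atTop (Ioo (t / 2) T) := by
    rw [Metric.tendstoUniformlyOn_iff]
    intro δ hδ
    have h1 : Tendsto (fun n => (t / 2)⁻¹ * L * ε n) atTop (𝓝 0) := by
      simpa using hεt.const_mul ((t / 2)⁻¹ * L)
    filter_upwards [h1.eventually_lt_const hδ, hev] with n hn hn2 τ hτ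
    have hτ' : τ ∈ Icc (u n) T := ⟨(hn2.trans hτ.1).le, hτ.2.le⟩
    rw [dist_eq_norm]
    refine lt_of_le_of_lt ?_ hn
    have ht2 := half_pos ht.1
    refine (((hL τ).inv_smul hK0 ht2 hτ.1.le).lip _ _ (hbK τ (hmemIoo τ hτ))
      ((ha n).bound τ hτ')).trans ?_
    gcongr
    exact hbn n τ hτ'
  refine hasDerivAt_of_tendstoLocallyUniformlyOn (isOpen_Ioo (a := t / 2) (b := T))
    hunif.tendstoLocallyUniformlyOn ?_ (fun τ hτ => hb τ (hmemIoo τ hτ))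
    ⟨by linarith [ht.1], ht.2⟩
  filter_upwards [hev] with n hn τ hτ
  exact (ha n).deriv τ ⟨(hn.trans hτ.1).le, hτ.2.le⟩

theorem continuous_rho (hs : 0 ≤ s) (θ : ℤ → ℝ) (k : ℤ) :
    Continuous fun x : L2 => rho s θ x k := by
  unfold rho
  have : LipschitzWith 1 fun x : L2 => seq s x k := LipschitzWith.of_dist_le_mul fun x y => by
    rw [dist_eq_norm, dist_eq_norm, ← seq_sub, NNReal.coe_one, one_mul]
    exact norm_seq_le hs _ k
  exact (this.continuous.norm.pow 2).sub continuous_const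

/-- Convergence to `α` without any rate is enough: the gauge estimate upgrades it to `O(t)`,
stability then yields equality at a small positive time, and ordinary uniqueness takes over from
there. -/
theorem gauge_solution_unique (hs : 1 / 2 < s) (c : ℝ) (α : L2) {T : ℝ} {a b : ℝ → L2}
    (ha : ∀ t ∈ Ioo 0 T, HasDerivAt a (t⁻¹ • gfield s c (modSq s α) t (a t)) t)
    (hb : ∀ t ∈ Ioo 0 T, HasDerivAt b (t⁻¹ • gfield s c (modSq s α) t (b t)) t)
    (ha0 : Tendsto a (𝓝[>] 0) (𝓝 α)) (hb0 : Tendsto b (𝓝[>] 0) (𝓝 α)) {t : ℝ}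
    (ht : t ∈ Ioo 0 T) : a t = b t := by
  have hs0 : 0 ≤ s := by linarith
  have hθ := abs_modSq_le hs0 α
  set θ := modSq s α
  set K := ‖α‖ + 1
  have hK : 1 ≤ K := by simp [K]
  obtain ⟨C, hC1, hC⟩ := exists_gauge_estimate hs c hθ hK
  obtain ⟨C', T', hC'0, hT'0, hT'1, hC'⟩ := exists_stability_estimate hs c hθ hK
    (by linarith : 0 ≤ C)
  have hnear : ∀ x : ℝ → L2, Tendsto x (𝓝[>] 0) (𝓝 α) → ∀ᶠ τ in 𝓝[>] (0 : ℝ), ‖x τ‖ ≤ K :=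
    fun x hx => (hx.norm.eventually_lt_const (by simp [K])).mono fun τ h => le_of_lt h
  obtain ⟨r, hr0, hr⟩ : ∃ r : ℝ, 0 < r ∧ ∀ τ ∈ Ioc 0 r, ‖a τ‖ ≤ K ∧ ‖b τ‖ ≤ K := by
    obtain ⟨r, hr0, hr⟩ := mem_nhdsGT_iff_exists_Ioc_subset.1 ((hnear a ha0).and (hnear b hb0))
    exact ⟨r, hr0, fun τ hτ => hr hτ⟩
  set t₁ := min r (min t T')
  have ht₁0 : 0 < t₁ := lt_min hr0 (lt_min ht.1 hT'0)
  have ht₁r : t₁ ≤ r := min_le_left _ _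
  have ht₁t : t₁ ≤ t := (min_le_right _ _).trans (min_le_left _ _)
  have ht₁T' : t₁ ≤ T' := (min_le_right _ _).trans (min_le_right _ _)
  have hgs : ∀ x : ℝ → L2,
      (∀ t ∈ Ioo 0 T, HasDerivAt x (t⁻¹ • gfield s c θ t (x t)) t) →
      (∀ τ ∈ Ioc 0 r, ‖x τ‖ ≤ K) → ∀ t₀, 0 < t₀ → IsGaugeSol s c θ K t₀ t₁ x := by
    intro x hx hxK t₀ ht₀
    exact ⟨fun τ hτ => hx τ ⟨ht₀.trans_le hτ.1, (hτ.2.trans ht₁t).trans_lt ht.2⟩,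
      fun τ hτ => hxK τ ⟨ht₀.trans_le hτ.1, hτ.2.trans ht₁r⟩⟩
  have hga := hgs a ha fun τ hτ => (hr τ hτ).1
  have hgb := hgs b hb fun τ hτ => (hr τ hτ).2
  -- Letting the initial time tend to zero, where `rho` vanishes, gives `|rho| ≤ Cτ`. This in turn
  -- allows the second half of the gauge estimate with `R = C`.
  have hρ : ∀ x : ℝ → L2, Tendsto x (𝓝[>] 0) (𝓝 α) →
      (∀ t₀, 0 < t₀ → IsGaugeSol s c θ K t₀ t₁ x) →
      (∀ τ ∈ Ioc 0 t₁, ∀ k, |rho s θ (x τ) k| ≤ C * τ) ∧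
        ∀ τ ∈ Ioc 0 t₁, ‖x τ - α‖ ≤ C * (C + 1) * τ := by
    intro x hx0 hx
    have h1 : ∀ τ ∈ Ioc 0 t₁, ∀ k, |rho s θ (x τ) k| ≤ C * τ := by
      intro τ hτ k
      have hlim : Tendsto (fun t₀ => |rho s θ (x τ) k - rho s θ (x t₀) k|) (𝓝[>] 0)
          (𝓝 |rho s θ (x τ) k - rho s θ α k|) :=
        ((((continuous_rho hs0 θ k).tendsto α).comp hx0).const_sub _).abs
      rw [rho_modSq, sub_zero] at hlim
      refine le_of_tendsto hlim ?_
      filter_upwards [Ioc_mem_nhdsGT hτ.1] with t₀ ht₀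
      exact (hC t₀ t₁ x ht₀.1 (ht₁T'.trans hT'1) (hx t₀ ht₀.1) τ ⟨ht₀.2, hτ.2⟩).1 k
    refine ⟨h1, fun τ hτ => ?_⟩
    refine le_of_tendsto (hx0.const_sub _).norm ?_
    filter_upwards [Ioc_mem_nhdsGT hτ.1] with t₀ ht₀
    exact (hC t₀ t₁ x ht₀.1 (ht₁T'.trans hT'1) (hx t₀ ht₀.1) τ ⟨ht₀.2, hτ.2⟩).2 C
      (h1 t₀ ⟨ht₀.1, ht₀.2.trans hτ.2⟩)
  obtain ⟨hρa, hea⟩ := hρ a ha0 hga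
  obtain ⟨-, heb⟩ := hρ b hb0 hgb
  have heq : a t₁ = b t₁ := by
    -- Two solutions are `2C(C + 1)t₀` apart at time `t₀`, and this beats the logarithmic loss.
    have hlim : Tendsto (fun t₀ => C' * (1 + Real.log (t₁ / t₀)) * (2 * (C * (C + 1)) * t₀))
        (𝓝[>] 0) (𝓝 0) := by
      have h2 : Tendsto (fun t₀ => Real.log t₀ * t₀) (𝓝[>] 0) (𝓝 0) := by
        simpa using tendsto_log_mul_rpow_nhdsGT_zero one_pos
      have h3 : Tendsto (fun t₀ : ℝ => t₀) (𝓝[>] 0) (𝓝 0) := tendsto_nhdsWithin_of_tendsto_nhds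
        tendsto_id
      have h4 := ((h3.const_mul (1 + Real.log t₁)).sub h2).const_mul (C' * (2 * (C * (C + 1))))
      simp only [mul_zero, sub_zero] at h4
      refine h4.congr' ?_
      filter_upwards [self_mem_nhdsWithin] with t₀ ht₀
      rw [Real.log_div ht₁0.ne' (ne_of_gt ht₀)]
      ring
    have : ‖a t₁ - b t₁‖ ≤ 0 := by
      refine ge_of_tendsto hlim ?_
      filter_upwards [Ioc_mem_nhdsGT ht₁0] with t₀ ht₀
      refine (hC' t₀ t₁ a b ht₀.1 ht₁T' (hga t₀ ht₀.1) (hgb t₀ ht₀.1) (hρa t₀ ht₀) t₁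
        ⟨ht₀.2, le_rfl⟩).trans ?_
      have hlog0 : 0 ≤ Real.log (t₁ / t₀) := Real.log_nonneg ((one_le_div ht₀.1).2 ht₀.2)
      gcongr
      have e : a t₀ - b t₀ = (a t₀ - α) - (b t₀ - α) := by abel
      rw [e]
      refine (norm_sub_le _ _).trans ?_
      linarith [hea t₀ ht₀, heb t₀ ht₀]
    exact sub_eq_zero.1 (norm_le_zero_iff.1 this)
  refine eq_of_hasDerivAt (f := fun t x => t⁻¹ • gfield s c θ t x) (p := t₁) (q := t) ?_ ?_ ?_ heq
    ⟨ht₁t, le_rfl⟩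
  · intro K' hK'
    obtain ⟨L, hL⟩ := exists_bddLip_gfield hs c hθ hK'
    exact ⟨_, fun τ hτ => (hL τ).inv_smul (by linarith) ht₁0 hτ.1⟩
  · exact fun τ hτ => ha τ ⟨ht₁0.trans_le hτ.1, hτ.2.trans_lt ht.2⟩
  · exact fun τ hτ => hb τ ⟨ht₁0.trans_le hτ.1, hτ.2.trans_lt ht.2⟩

end DiracNLS

end

/-! ### The coefficient equation from time zero, energy and global existence. -/

noncomputable section

namespace DiracNLS

open scoped ENNReal ComplexConjugate

variable {s c : ℝ} {θ : ℤ → ℝ}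

/-! ### Solutions of the coefficient equation -/

theorem mass_eq_norm_diag (hs : 0 ≤ s) (x : L2) :
    mass s x = ‖diag (fun k => ((wt s k)⁻¹ : ℂ)) x‖ ^ 2 := by
  have hb : ∀ k, ‖((wt s k)⁻¹ : ℂ)‖ ≤ 1 := fun k => by
    rw [norm_inv, Complex.norm_real, Real.norm_of_nonneg (wt_pos s k).le]
    exact inv_le_one_of_one_le₀ (one_le_wt hs k)
  rw [L2.norm_sq, mass]
  refine tsum_congr fun k => ?_
  rw [diag_apply hb, seq, div_eq_inv_mul]

theorem continuous_mass (hs : 0 ≤ s) : Continuous (mass s) := by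
  have hb : ∀ k, ‖((wt s k)⁻¹ : ℂ)‖ ≤ 1 := fun k => by
    rw [norm_inv, Complex.norm_real, Real.norm_of_nonneg (wt_pos s k).le]
    exact inv_le_one_of_one_le₀ (one_le_wt hs k)
  have e : mass s = fun x => ‖diagL _ hb x‖ ^ 2 := funext fun x => mass_eq_norm_diag hs x
  rw [e]
  exact (diagL _ hb).continuous.norm.pow 2

theorem mass_nonneg (s : ℝ) (x : L2) : 0 ≤ mass s x := tsum_nonneg fun _ => by positivity

theorem mass_diag_phase (s : ℝ) (θ : ℤ → ℝ) (r : ℝ) (x : L2) :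
    mass s (diag (phase θ r) x) = mass s x := by
  refine tsum_congr fun k => ?_
  rw [seq_diag (norm_phase_le θ r), norm_mul, norm_phase, one_mul]

/-- The parameter may vary with time: inverting the gauge produces the equation with the current
mass of the solution in place of a constant, and that this is a constant is what has to be shown. -/
theorem mass_eq_of_mem_Icc (hs : 1 / 2 < s) {M : ℝ → ℝ} {t₀ t₁ : ℝ} {A : ℝ → L2}
    (hA : ∀ t ∈ Icc t₀ t₁, HasDerivAt A (field s c (M t) t (A t)) t) {t : ℝ}
    (ht : t ∈ Icc t₀ t₁) : mass s (A t) = mass s (A t₀) := by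
  have h := norm_sub_le_of_deriv_le (C := 0) (fun τ hτ => hasDerivAt_mass hs (hA τ hτ))
    (fun τ _ => by simp) ht
  rw [zero_mul] at h
  exact sub_eq_zero.1 (norm_le_zero_iff.1 h)

theorem mass_eq_of_tendsto (hs : 1 / 2 < s) {M : ℝ → ℝ} {T m : ℝ} {A : ℝ → L2}
    (hA : ∀ t ∈ Ioo 0 T, HasDerivAt A (field s c (M t) t (A t)) t)
    (hm : Tendsto (fun t => mass s (A t)) (𝓝[>] 0) (𝓝 m)) {t : ℝ} (ht : t ∈ Ioo 0 T) :
    mass s (A t) = m := by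
  refine tendsto_nhds_unique (tendsto_const_nhds.congr' ?_) hm
  filter_upwards [Ioc_mem_nhdsGT ht.1] with t₀ ht₀
  exact mass_eq_of_mem_Icc hs (t₁ := t) (fun τ hτ => hA τ ⟨ht₀.1.trans_le hτ.1,
    hτ.2.trans_lt ht.2⟩) ⟨ht₀.2, le_rfl⟩

/-- The gauge transformation that removes the logarithmic phases prescribed by `α`. -/
def gauge (s c : ℝ) (α : L2) (t : ℝ) (x : L2) : L2 := diag (phase (modSq s α) (c * Real.log t)) x

theorem seq_gauge (s c : ℝ) (α : L2) (t : ℝ) (x : L2) (k : ℤ) :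
    seq s (gauge s c α t x) k = phase (modSq s α) (c * Real.log t) k * seq s x k :=
  seq_diag (norm_phase_le _ _) x k

theorem gauge_symm (s c : ℝ) (α : L2) (t : ℝ) (x : L2) :
    gauge s c α t (diag (phase (modSq s α) (-(c * Real.log t))) x) = x := by
  refine seq_injective s fun k => ?_
  rw [seq_gauge, seq_diag (norm_phase_le _ _), ← mul_assoc, mul_comm (phase _ _ k), phase_neg_mul,
    one_mul]

theorem gauge_injective (s c : ℝ) (α : L2) (t : ℝ) {x y : L2}
    (h : gauge s c α t x = gauge s c α t y) : x = y := by
  refine seq_injective s fun k => ?_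
  have := congrArg (fun z => phase (modSq s α) (-(c * Real.log t)) k * seq s z k) h
  simpa only [seq_gauge, ← mul_assoc, phase_neg_mul, one_mul] using this

theorem norm_gauge (s c : ℝ) (α : L2) (t : ℝ) (x : L2) : ‖gauge s c α t x‖ = ‖x‖ :=
  norm_diag_eq (norm_phase _ _) x

theorem mass_gauge (s c : ℝ) (α : L2) (t : ℝ) (x : L2) : mass s (gauge s c α t x) = mass s x :=
  mass_diag_phase _ _ _ _

theorem tendsto_of_norm_sub_le {a : ℝ → L2} {α : L2} {T C : ℝ} (hT : 0 < T)
    (h : ∀ t ∈ Ioo 0 T, ‖a t - α‖ ≤ C * t) : Tendsto a (𝓝[>] 0) (𝓝 α) := by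
  rw [tendsto_iff_norm_sub_tendsto_zero]
  have h1 : Tendsto (fun t => C * t) (𝓝[>] 0) (𝓝 0) := by
    have : Tendsto (fun t : ℝ => C * t) (𝓝 0) (𝓝 (C * 0)) := (continuous_const_mul C).tendsto 0
    rw [mul_zero] at this
    exact tendsto_nhdsWithin_of_tendsto_nhds this
  exact squeeze_zero' (Eventually.of_forall fun _ => norm_nonneg _)
    (by filter_upwards [Ioo_mem_nhdsGT hT] with t ht using h t ht) h1

/-- Inverting the gauge gives a solution whose parameter is its own mass. The mass is conserved and
invariant under phases, and tends to that of `α` at time zero, so the parameter is `mass s α`. -/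
theorem exists_field_solution (hs : 1 / 2 < s) (c : ℝ) (α : L2) :
    ∃ T C, 0 < T ∧ ∃ A : ℝ → L2, ∀ t ∈ Ioo 0 T,
      HasDerivAt A (field s c (mass s α) t (A t)) t ∧ ‖gauge s c α t (A t) - α‖ ≤ C * t := by
  have hs0 : 0 ≤ s := by linarith
  obtain ⟨T, C, hT, a, ha⟩ := exists_gauge_solution hs c α
  have hderiv := fun t (ht : t ∈ Ioo 0 T) =>
    hasDerivAt_gauge_symm (c := c) hs (abs_modSq_le hs0 α) ht.1 (ha t ht).1
  refine ⟨T, C, hT, fun t => diag (phase (modSq s α) (-(c * Real.log t))) (a t), fun t ht =>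
    ⟨?_, by rw [gauge_symm]; exact (ha t ht).2⟩⟩
  have ha0 := tendsto_of_norm_sub_le hT fun t ht => (ha t ht).2
  have hm := mass_eq_of_tendsto hs (M := fun t => _) hderiv (m := mass s α)
    (by simpa only [mass_diag_phase, Function.comp_def] using
      ((continuous_mass hs0).tendsto α).comp ha0) ht
  have := hderiv t ht
  rwa [hm] at this

theorem hasDerivAt_gauge_of_tendsto (hs : 1 / 2 < s) {α : L2} {T : ℝ} {A : ℝ → L2}
    (hA : ∀ t ∈ Ioo 0 T, HasDerivAt A (field s c (mass s α) t (A t)) t)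
    (hA0 : Tendsto (fun t => gauge s c α t (A t)) (𝓝[>] 0) (𝓝 α)) {t : ℝ} (ht : t ∈ Ioo 0 T) :
    HasDerivAt (fun τ => gauge s c α τ (A τ))
      (t⁻¹ • gfield s c (modSq s α) t (gauge s c α t (A t))) t := by
  have hs0 : 0 ≤ s := by linarith
  refine hasDerivAt_gauge hs (abs_modSq_le hs0 α) ht.1 ?_
  rw [mass_eq_of_tendsto hs hA (m := mass s α) ?_ ht]
  · exact hA t ht
  · simpa only [mass_gauge, Function.comp_def] using ((continuous_mass hs0).tendsto α).comp hA0

theorem field_solution_unique (hs : 1 / 2 < s) {α : L2} {T : ℝ} {A B : ℝ → L2}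
    (hA : ∀ t ∈ Ioo 0 T, HasDerivAt A (field s c (mass s α) t (A t)) t)
    (hB : ∀ t ∈ Ioo 0 T, HasDerivAt B (field s c (mass s α) t (B t)) t)
    (hA0 : Tendsto (fun t => gauge s c α t (A t)) (𝓝[>] 0) (𝓝 α))
    (hB0 : Tendsto (fun t => gauge s c α t (B t)) (𝓝[>] 0) (𝓝 α)) {t : ℝ} (ht : t ∈ Ioo 0 T) :
    A t = B t :=
  gauge_injective s c α t (gauge_solution_unique hs c α
    (fun _ hτ => hasDerivAt_gauge_of_tendsto hs hA hA0 hτ)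
    (fun _ hτ => hasDerivAt_gauge_of_tendsto hs hB hB0 hτ) hA0 hB0 ht)

/-! ### The energy -/

/-- The permutation `(k, i, l, j) ↦ (l, i, k, j)` of index quadruples. -/
def quadSwapConj : ℤ × ℤ × ℤ ≃ ℤ × ℤ × ℤ where
  toFun q := (q.2.1 + q.2.2 - q.1, q.2.1, q.2.2)
  invFun q := (q.2.1 + q.2.2 - q.1, q.2.1, q.2.2)
  left_inv q := by ext <;> simp
  right_inv q := by ext <;> simp

/-- The permutation `(k, i, l, j) ↦ (k, j, l, i)` of index quadruples. -/
def quadSwapRight : ℤ × ℤ × ℤ ≃ ℤ × ℤ × ℤ where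
  toFun q := (q.1, q.2.2, q.2.1)
  invFun q := (q.1, q.2.2, q.2.1)
  left_inv q := by ext <;> simp
  right_inv q := by ext <;> simp

theorem quartTerm_swap (h x y z : L2) (t : ℝ) (q : ℤ × ℤ × ℤ) :
    quartTerm s (osc t) h x y z (quadSwap q) = conj (quartTerm s (osc t) x h z y q) := by
  obtain ⟨k, i, j⟩ := q
  have h : omega i k (i + j - k) = -omega k i j := by
    simp only [omega]; push_cast; ring
  simp only [quartTerm, quadSwap, Equiv.coe_fn_mk, triTerm, osc, map_mul, Complex.conj_conj,
    conj_exp_I_mul_ofReal, h]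
  rw [show k + (i + j - k) - i = j by ring, neg_div]
  ring

theorem quartTerm_swapConj (h x y z : L2) (t : ℝ) (q : ℤ × ℤ × ℤ) :
    quartTerm s (osc t) h x y z (quadSwapConj q) = quartTerm s (osc t) y x h z q := by
  obtain ⟨k, i, j⟩ := q
  have h : omega (i + j - k) i j = omega k i j := by
    simp only [omega]; push_cast; ring
  simp only [quartTerm, quadSwapConj, Equiv.coe_fn_mk, triTerm, osc, h]
  rw [show i + j - (i + j - k) = k by ring]
  ring

theorem quartTerm_swapRight (h x y z : L2) (t : ℝ) (q : ℤ × ℤ × ℤ) :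
    quartTerm s (osc t) h x y z (quadSwapRight q) = quartTerm s (osc t) h z y x q := by
  obtain ⟨k, i, j⟩ := q
  have h : omega k j i = omega k i j := by
    simp only [omega]; ring
  simp only [quartTerm, quadSwapRight, Equiv.coe_fn_mk, triTerm, osc, h]
  rw [show j + i - k = i + j - k by ring]
  ring

/-- The quadrilinear form `∑ₖ conj(hₖ) T(x, y, z)ₖ`. -/
def quart (s t : ℝ) (h x y z : L2) : ℂ := ∑' q, quartTerm s (osc t) h x y z q

theorem quart_swap (s t : ℝ) (h x y z : L2) : quart s t h x y z = conj (quart s t x h z y) := by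
  rw [quart, quart, Complex.conj_tsum, ← quadSwap.tsum_eq]
  exact tsum_congr fun q => quartTerm_swap h x y z t q

theorem quart_swapConj (s t : ℝ) (h x y z : L2) : quart s t h x y z = quart s t y x h z := by
  rw [quart, quart, ← quadSwapConj.tsum_eq]
  exact tsum_congr fun q => quartTerm_swapConj h x y z t q

theorem quart_swapRight (s t : ℝ) (h x y z : L2) : quart s t h x y z = quart s t h z y x := by
  rw [quart, quart, ← quadSwapRight.tsum_eq]
  exact tsum_congr fun q => quartTerm_swapRight h x y z t q

/-- The multiplier that turns the inner product of weighted coordinates into that of `l²`. -/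
def unwt (s : ℝ) (k : ℤ) : ℂ := ((1 / wt s k ^ 2 : ℝ) : ℂ)

theorem norm_unwt_le (hs : 0 ≤ s) (k : ℤ) : ‖unwt s k‖ ≤ 1 := by
  rw [unwt, Complex.norm_real, Real.norm_of_nonneg (by positivity)]
  exact (div_le_one (pow_pos (wt_pos s k) 2)).2 (one_le_pow₀ (one_le_wt hs k))

theorem inner_unwt (hs : 0 ≤ s) (x y : L2) :
    inner ℂ x (diag (unwt s) y) = ∑' k, conj (seq s x k) * seq s y k := by
  have := inner_diag_eq_tsum (s := s) (κ := fun _ => 1) (one_le_wt_sq hs) x y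
  simp only [Complex.ofReal_one, one_mul] at this
  exact this

theorem quart_eq_inner (hs : 1 / 2 < s) (t : ℝ) (h x y z : L2) :
    quart s t h x y z = inner ℂ h (diag (unwt s) (trilin s (osc t) x y z)) := by
  rw [inner_unwt (by linarith), quart]
  have := tsum_pair_trilin hs (osc_bound t) h x y z (κ := fun _ => 1) (one_le_wt_sq (by linarith))
  simpa using this.symm

theorem tendsto_quart (hs : 1 / 2 < s) {t : ℝ} (ht : t ≠ 0) {l : Filter ℝ} (hl : l ≤ 𝓝 t)
    {h x y z : ℝ → L2} {h₀ x₀ y₀ z₀ : L2} (hh : Tendsto h l (𝓝 h₀)) (hx : Tendsto x l (𝓝 x₀))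
    (hy : Tendsto y l (𝓝 y₀)) (hz : Tendsto z l (𝓝 z₀)) :
    Tendsto (fun τ => quart s τ (h τ) (x τ) (y τ) (z τ)) l (𝓝 (quart s t h₀ x₀ y₀ z₀)) := by
  simp only [quart_eq_inner hs]
  refine hh.inner (((diagL _ (norm_unwt_le (by linarith))).continuous.tendsto _).comp ?_)
  exact tendsto_trilin hs (Eventually.of_forall osc_bound) (osc_bound t)
    (fun k i j => (continuousAt_osc ht k i j).tendsto.mono_left hl) hx hy hz

/-- Each summand has the increment in one slot. The symmetries above move it to the first slot, up
to conjugation, so one limit computation handles all four. -/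
theorem quart_sub_telescope (hs : 1 / 2 < s) (t : ℝ) (x x' : L2) :
    quart s t x' x' x' x' - quart s t x x x x = quart s t (x' - x) x' x' x' +
      quart s t x (x' - x) x' x' + quart s t x x (x' - x) x' + quart s t x x x (x' - x) := by
  simp only [quart_eq_inner hs, trilin_sub_left hs (osc_bound t), trilin_sub_mid hs (osc_bound t),
    trilin_sub_right hs (osc_bound t), diag_sub (norm_unwt_le (by linarith : 0 ≤ s)),
    inner_sub_left, inner_sub_right]
  ring

theorem quart_smul (hs : 1 / 2 < s) (t r : ℝ) (h x y z : L2) :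
    quart s t (r • h) x y z = r * quart s t h x y z := by
  rw [quart_eq_inner hs, quart_eq_inner hs, ← L2.coe_smul, inner_smul_left, Complex.conj_ofReal]

end DiracNLS

end

noncomputable section

namespace DiracNLS

open scoped ENNReal ComplexConjugate

variable {s c : ℝ}

/-! ### Conservation of energy -/

/-- The kinetic energy `∑ₖ k² |aₖ|²`. -/
def kinetic (s : ℝ) (x : L2) : ℝ := ∑' k : ℤ, (k : ℝ) ^ 2 * ‖seq s x k‖ ^ 2

theorem abs_sq_le_wt_sq (hs : 1 ≤ s) (k : ℤ) : |(k : ℝ) ^ 2| ≤ wt s k ^ 2 := by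
  rw [abs_of_nonneg (sq_nonneg _), ← sq_abs]
  have h := wt_le_wt hs k
  have h1 : wt 1 k = 1 + |(k : ℝ)| := by simp [wt]
  have h0 := abs_nonneg (k : ℝ)
  refine pow_le_pow_left₀ h0 ?_ 2
  linarith

theorem kinetic_nonneg (s : ℝ) (x : L2) : 0 ≤ kinetic s x := tsum_nonneg fun _ => by positivity

/-- The weight `k²` is admissible because `s ≥ 1`; the index permutations, which preserve the moduli
of the terms, carry it to the other three indices. -/
theorem summable_sq_quadTerm (hs : 1 ≤ s) (t : ℝ) (x : L2) :
    (Summable fun q : ℤ × ℤ × ℤ => (q.1 : ℝ) ^ 2 * ‖quadTerm s (osc t) x q‖) ∧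
    (Summable fun q : ℤ × ℤ × ℤ => (q.2.1 : ℝ) ^ 2 * ‖quadTerm s (osc t) x q‖) ∧
    (Summable fun q : ℤ × ℤ × ℤ => ((q.2.1 + q.2.2 - q.1 : ℤ) : ℝ) ^ 2 *
      ‖quadTerm s (osc t) x q‖) ∧
    Summable fun q : ℤ × ℤ × ℤ => (q.2.2 : ℝ) ^ 2 * ‖quadTerm s (osc t) x q‖ := by
  have h1 : Summable fun q : ℤ × ℤ × ℤ => (q.1 : ℝ) ^ 2 * ‖quadTerm s (osc t) x q‖ := by
    have := summable_quadTerm (by linarith) (osc_bound t) x (κ := fun k => (k : ℝ) ^ 2)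
      (abs_sq_le_wt_sq hs)
    refine this.congr fun q => ?_
    rw [abs_of_nonneg (sq_nonneg _)]
  have h2 := (quadSwap.summable_iff (f := fun q : ℤ × ℤ × ℤ =>
    (q.1 : ℝ) ^ 2 * ‖quadTerm s (osc t) x q‖)).2 h1
  have h3 := (quadSwapConj.summable_iff (f := fun q : ℤ × ℤ × ℤ =>
    (q.1 : ℝ) ^ 2 * ‖quadTerm s (osc t) x q‖)).2 h1
  have h4 := ((quadSwapRight.trans quadSwap).summable_iff (f := fun q : ℤ × ℤ × ℤ =>
    (q.1 : ℝ) ^ 2 * ‖quadTerm s (osc t) x q‖)).2 h1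
  refine ⟨h1, h2.congr fun q => ?_, h3.congr fun q => ?_, h4.congr fun q => ?_⟩
  · simp only [Function.comp, quadTerm, quartTerm_swap, RCLike.norm_conj]
    rfl
  · simp only [Function.comp, quadTerm, quartTerm_swapConj]
    rfl
  · simp only [Function.comp, quadTerm, Equiv.trans_apply, quartTerm_swap, RCLike.norm_conj,
      quartTerm_swapRight]
    rfl

theorem omega_eq (k i j : ℤ) : omega k i j =
    (i : ℝ) ^ 2 - ((i + j - k : ℤ) : ℝ) ^ 2 + (j : ℝ) ^ 2 - (k : ℝ) ^ 2 := by
  simp only [omega]; push_cast; ring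

theorem summable_omega_quadTerm (hs : 1 ≤ s) (t : ℝ) (x : L2) :
    Summable fun q : ℤ × ℤ × ℤ => |omega q.1 q.2.1 q.2.2| * ‖quadTerm s (osc t) x q‖ := by
  obtain ⟨h1, h2, h3, h4⟩ := summable_sq_quadTerm hs t x
  refine Summable.of_nonneg_of_le (fun _ => by positivity) (fun q => ?_) (((h1.add h2).add h3).add h4)
  rw [← add_mul, ← add_mul, ← add_mul]
  gcongr
  rw [omega_eq, abs_le]
  constructor <;> nlinarith [sq_nonneg (q.1 : ℝ), sq_nonneg (q.2.1 : ℝ), sq_nonneg (q.2.2 : ℝ),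
    sq_nonneg ((q.2.1 + q.2.2 - q.1 : ℤ) : ℝ)]

/-- With `S` the sum weighted by `k²`, the symmetries give `S` for the weight `l²` and the conjugate
of `S` for `i²` and `j²`. Hence `ω = i² - l² + j² - k²` produces `2(conj S - S)`. -/
theorem im_tsum_omega (hs : 1 ≤ s) (t : ℝ) (x : L2) :
    (∑' q : ℤ × ℤ × ℤ, (omega q.1 q.2.1 q.2.2 : ℂ) * quadTerm s (osc t) x q).im =
      -4 * (∑' q : ℤ × ℤ × ℤ, (((q.1 : ℝ) ^ 2 : ℝ) : ℂ) * quadTerm s (osc t) x q).im := by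
  obtain ⟨h1, h2, h3, h4⟩ := summable_sq_quadTerm hs t x
  have hc : ∀ κ : ℤ × ℤ × ℤ → ℤ, (Summable fun q => (κ q : ℝ) ^ 2 * ‖quadTerm s (osc t) x q‖) →
      Summable fun q => (((κ q : ℝ) ^ 2 : ℝ) : ℂ) * quadTerm s (osc t) x q := fun κ h => by
    refine Summable.of_norm (h.congr fun q => ?_)
    rw [norm_mul, Complex.norm_real, Real.norm_of_nonneg (sq_nonneg _)]
  set S := ∑' q : ℤ × ℤ × ℤ, (((q.1 : ℝ) ^ 2 : ℝ) : ℂ) * quadTerm s (osc t) x q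
  have e2 : ∑' q : ℤ × ℤ × ℤ, (((q.2.1 : ℝ) ^ 2 : ℝ) : ℂ) * quadTerm s (osc t) x q = conj S := by
    rw [Complex.conj_tsum, ← quadSwap.tsum_eq]
    refine tsum_congr fun q => ?_
    rw [quadTerm_osc_swap]
    simp [quadSwap]
  have e3 : ∑' q : ℤ × ℤ × ℤ, ((((q.2.1 + q.2.2 - q.1 : ℤ) : ℝ) ^ 2 : ℝ) : ℂ) *
      quadTerm s (osc t) x q = S := by
    simp only [S]
    rw [← quadSwapConj.tsum_eq (fun q : ℤ × ℤ × ℤ => (((q.1 : ℝ) ^ 2 : ℝ) : ℂ) *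
      quadTerm s (osc t) x q)]
    refine tsum_congr fun q => ?_
    simp only [quadTerm, quartTerm_swapConj]
    rfl
  have e4 : ∑' q : ℤ × ℤ × ℤ, (((q.2.2 : ℝ) ^ 2 : ℝ) : ℂ) * quadTerm s (osc t) x q = conj S := by
    rw [← e2, ← quadSwapRight.tsum_eq]
    refine tsum_congr fun q => ?_
    simp only [quadTerm, quartTerm_swapRight]
    rfl
  have e : ∀ q : ℤ × ℤ × ℤ, (omega q.1 q.2.1 q.2.2 : ℂ) * quadTerm s (osc t) x q =
      (((q.2.1 : ℝ) ^ 2 : ℝ) : ℂ) * quadTerm s (osc t) x q -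
      ((((q.2.1 + q.2.2 - q.1 : ℤ) : ℝ) ^ 2 : ℝ) : ℂ) * quadTerm s (osc t) x q +
      (((q.2.2 : ℝ) ^ 2 : ℝ) : ℂ) * quadTerm s (osc t) x q -
      (((q.1 : ℝ) ^ 2 : ℝ) : ℂ) * quadTerm s (osc t) x q := fun q => by
    rw [omega_eq]
    push_cast
    ring
  have c1 := hc _ h1
  have c2 := hc _ h2
  have c3 := hc _ h3
  have c4 := hc _ h4
  rw [tsum_congr e, ((c2.sub c3).add c4).tsum_sub c1, (c2.sub c3).tsum_add c4, c2.tsum_sub c3,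
    e2, e3, e4]
  simp only [Complex.sub_im, Complex.add_im, Complex.conj_im]
  ring

theorem hasDerivAt_kinetic (hs : 1 ≤ s) {M t : ℝ} (ht : 0 < t) {A : ℝ → L2}
    (hA : HasDerivAt A (field s c M t (A t)) t) :
    HasDerivAt (fun τ => kinetic s (A τ)) (c / (2 * t) *
      (∑' q : ℤ × ℤ × ℤ, (omega q.1 q.2.1 q.2.2 : ℂ) * quadTerm s (osc t) (A t) q).im) t := by
  refine (hasDerivAt_weighted_sq (by linarith) hA (κ := fun k => (k : ℝ) ^ 2)
    (abs_sq_le_wt_sq hs)).congr_deriv ?_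
  rw [im_tsum_omega hs, abs_of_pos ht]
  field_simp
  ring

/-- Termwise differentiation in the explicit time dependence brings down `ω`, and the differentiated
series is dominated because `s ≥ 1`. On `(t/2, 2t)` one has `4τ² ≥ t²`, whence the factor `1/t²` in
the majorant. -/
theorem hasDerivAt_quart_time (hs : 1 ≤ s) {t : ℝ} (ht : 0 < t) (x : L2) :
    HasDerivAt (fun τ => (quart s τ x x x x).re) (1 / (4 * t ^ 2) *
      (∑' q : ℤ × ℤ × ℤ, (omega q.1 q.2.1 q.2.2 : ℂ) * quadTerm s (osc t) x q).im) t := by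
  have hn : ∀ τ q, ‖quadTerm s (osc τ) x q‖ = ‖quadTerm s (osc t) x q‖ := fun τ q => by
    simp only [quadTerm, quartTerm, triTerm, norm_mul, norm_osc]
  have hd : ∀ (q : ℤ × ℤ × ℤ) (τ : ℝ), τ ∈ Ioo (t / 2) (2 * t) →
      HasDerivAt (fun τ => quadTerm s (osc τ) x q)
        (-(Complex.I * (omega q.1 q.2.1 q.2.2 : ℂ) / (4 * (τ : ℂ) ^ 2)) *
          quadTerm s (osc τ) x q) τ := by
    intro q τ hτ
    have hτ0 : 0 < τ := (half_pos ht).trans hτ.1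
    have h1 : HasDerivAt (fun τ : ℝ => omega q.1 q.2.1 q.2.2 / (4 * τ))
        (-(omega q.1 q.2.1 q.2.2 / (4 * τ ^ 2))) τ := by
      have := (hasDerivAt_inv hτ0.ne').const_mul (omega q.1 q.2.1 q.2.2 / 4)
      refine (this.congr_of_eventuallyEq ?_).congr_deriv ?_
      · filter_upwards [lt_mem_nhds hτ0] with r hr
        field_simp
      · field_simp
    have h2 := ((h1.ofReal_comp.const_mul Complex.I).cexp.mul_const
      (seq s x q.2.1 * conj (seq s x (q.2.1 + q.2.2 - q.1)) * seq s x q.2.2)).const_mul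
      (conj (seq s x q.1))
    refine h2.congr_deriv ?_
    simp only [quadTerm, quartTerm, triTerm, osc]
    have : (τ : ℂ) ≠ 0 := by exact_mod_cast hτ0.ne'
    push_cast
    field_simp
  have hsum := summable_omega_quadTerm hs t x
  have hmem : t ∈ Ioo (t / 2) (2 * t) := ⟨by linarith, by linarith⟩
  have h := hasDerivAt_tsum_of_isPreconnected (hsum.mul_left (1 / t ^ 2))
    (isOpen_Ioo (a := t / 2) (b := 2 * t)) isPreconnected_Ioo hd (fun q τ hτ => by
      have hτ0 : 0 < τ := (half_pos ht).trans hτ.1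
      rw [norm_mul, norm_neg, hn, norm_div, norm_mul, Complex.norm_I, one_mul, Complex.norm_real,
        norm_mul, norm_pow, Complex.norm_real, Real.norm_eq_abs, Real.norm_of_nonneg hτ0.le,
        ← mul_assoc]
      gcongr
      rw [Complex.norm_ofNat, div_eq_inv_mul, ← one_div]
      gcongr
      nlinarith [hτ.1]) hmem (by
      have := summable_quadTerm (s := s) (by linarith) (osc_bound t) x (κ := fun _ => 1)
        (one_le_wt_sq (by linarith))
      exact Summable.of_norm (by simpa using this)) hmem
  have h3 := Complex.reCLM.hasFDerivAt.comp_hasDerivAt t h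
  refine h3.congr_deriv ?_
  have e : ∑' q : ℤ × ℤ × ℤ, -(Complex.I * (omega q.1 q.2.1 q.2.2 : ℂ) / (4 * (t : ℂ) ^ 2)) *
      quadTerm s (osc t) x q = -(Complex.I * ((1 / (4 * t ^ 2) : ℝ) : ℂ)) *
      ∑' q : ℤ × ℤ × ℤ, (omega q.1 q.2.1 q.2.2 : ℂ) * quadTerm s (osc t) x q := by
    rw [← tsum_mul_left]
    refine tsum_congr fun q => ?_
    push_cast
    ring
  rw [e]
  simp only [Complex.reCLM_apply, Complex.mul_re, Complex.neg_re, Complex.neg_im, Complex.mul_im,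
    Complex.I_re, Complex.I_im, Complex.ofReal_re, Complex.ofReal_im]
  ring

theorem quart_self_im (x : L2) (t : ℝ) : (quart s t x x x x).im = 0 := im_quad_eq_zero x t

/-- The quartic form is stationary along the vector field. -/
theorem quart_field_re (hs : 1 / 2 < s) (M t : ℝ) (x : L2) :
    (quart s t (field s c M t x) x x x).re = 0 := by
  have h1 : inner ℂ (trilin s (osc t) x x x) (diag (unwt s) (trilin s (osc t) x x x)) =
      ((∑' k, ‖seq s (trilin s (osc t) x x x) k‖ ^ 2 : ℝ) : ℂ) := by
    rw [inner_unwt (by linarith)]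
    simpa using tsum_conj_mul_self (s := s) (fun _ => 1) (trilin s (osc t) x x x)
  have h2 := quart_self_im (s := s) x t
  rw [quart_eq_inner hs] at h2
  rw [quart_eq_inner hs, field, nonlin, inner_smul_left, inner_sub_left, inner_smul_left, h1]
  simp only [map_mul, Complex.conj_ofReal, Complex.conj_I, Complex.mul_re, Complex.mul_im,
    Complex.sub_re, Complex.sub_im, Complex.ofReal_re, Complex.ofReal_im, Complex.neg_re,
    Complex.neg_im, Complex.I_re, Complex.I_im, h2]
  ring

/-- The difference quotient splits into the change of the form at fixed argument and four
telescoping terms. The latter all tend to the real part of the form with the vector field in the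
first slot, which is zero. -/
theorem hasDerivAt_quart (hs : 1 ≤ s) {M t : ℝ} (ht : 0 < t) {A : ℝ → L2}
    (hA : HasDerivAt A (field s c M t (A t)) t) :
    HasDerivAt (fun τ => (quart s τ (A τ) (A τ) (A τ) (A τ)).re) (1 / (4 * t ^ 2) *
      (∑' q : ℤ × ℤ × ℤ, (omega q.1 q.2.1 q.2.2 : ℂ) * quadTerm s (osc t) (A t) q).im) t := by
  have hs' : 1 / 2 < s := by linarith
  have h1 := hasDerivAt_iff_tendsto_slope.1 (hasDerivAt_quart_time hs ht (A t))
  have hsl := hasDerivAt_iff_tendsto_slope.1 hA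
  have hle : 𝓝[≠] t ≤ 𝓝 t := nhdsWithin_le_nhds
  have hAc : Tendsto A (𝓝[≠] t) (𝓝 (A t)) := hA.continuousAt.tendsto.mono_left hle
  have hx : Tendsto (fun _ : ℝ => A t) (𝓝[≠] t) (𝓝 (A t)) := tendsto_const_nhds
  have hq := fun {x y z : ℝ → L2} (hx : Tendsto x (𝓝[≠] t) (𝓝 (A t)))
      (hy : Tendsto y (𝓝[≠] t) (𝓝 (A t))) (hz : Tendsto z (𝓝[≠] t) (𝓝 (A t))) =>
    (Complex.continuous_re.tendsto _).comp (tendsto_quart hs' ht.ne' hle hsl hx hy hz)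
  have h2 := (((hq hAc hAc hAc).add (hq hx hAc hAc)).add (hq hx hx hAc)).add (hq hx hx hx)
  rw [quart_field_re hs', add_zero, add_zero, add_zero] at h2
  rw [hasDerivAt_iff_tendsto_slope]
  have h3 := h1.add h2
  rw [add_zero] at h3
  refine h3.congr' ?_
  filter_upwards [self_mem_nhdsWithin] with τ hτ
  simp only [Function.comp, slope, vsub_eq_sub, quart_smul hs', smul_eq_mul]
  have e := congrArg Complex.re (quart_sub_telescope hs' τ (A t) (A τ))
  rw [quart_swap s τ (A t) (A τ - A t) (A τ) (A τ), quart_swapConj s τ (A t) (A t) (A τ - A t),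
    quart_swapRight s τ (A t) (A t) (A t) (A τ - A t),
    quart_swap s τ (A t) (A τ - A t) (A t) (A t)] at e
  simp only [Complex.sub_re, Complex.add_re, Complex.conj_re] at e
  simp only [Complex.re_ofReal_mul]
  linear_combination -(τ - t)⁻¹ * e

end DiracNLS

end

noncomputable section

namespace DiracNLS

open scoped ENNReal ComplexConjugate

variable {s c : ℝ}

/-! ### Global bounds -/

theorem ofReal_mass (hs : 0 ≤ s) (x : L2) :
    ENNReal.ofReal (mass s x) = ∑' k, ‖seq s x k‖ₑ ^ 2 := by
  rw [mass, ENNReal.ofReal_tsum_of_nonneg (fun _ => by positivity) (summable_seq_sq hs x)]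
  refine tsum_congr fun k => ?_
  rw [ENNReal.ofReal_pow (norm_nonneg _), ofReal_norm]

theorem mass_trilin_le (hs : 1 / 2 < s) {m : ℤ → ℤ → ℤ → ℂ} (hm : MulBound m 1) (x : L2) :
    mass s (trilin s m x x x) ≤ 2 * (l1 s x ^ 4 * mass s x) := by
  have hs0 : 0 ≤ s := by linarith
  have h1 := l1_nonneg s x
  have h2 := mass_nonneg s x
  rw [← ENNReal.ofReal_le_ofReal_iff (by positivity), ofReal_mass hs0]
  calc _ ≤ ∑' k, triMaj s x x x k ^ 2 := by
        refine ENNReal.tsum_le_tsum fun k => ?_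
        gcongr
        rw [seq_trilin hs hm]
        refine (enorm_tsum_le_tsum_enorm (f := triTerm s m x x x k)).trans ?_
        simpa using tsum_enorm_triTerm_le hm x x x k
    _ ≤ _ := sq_conv3_le_left _ _ _
    _ = _ := by
        rw [← ofReal_l1 hs, ← ofReal_mass hs0, ← ENNReal.ofReal_pow h1,
          ← ENNReal.ofReal_mul (by positivity), ← ENNReal.ofReal_mul (by positivity),
          show (2 : ℝ≥0∞) = ENNReal.ofReal 2 by simp, ← ENNReal.ofReal_mul (by norm_num)]
        congr 1
        ring

theorem norm_inner_unwt_sq_le (hs : 0 ≤ s) (x y : L2) :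
    ‖inner ℂ x (diag (unwt s) y)‖ ^ 2 ≤ mass s x * mass s y := by
  have hb : ∀ k, ‖((wt s k)⁻¹ : ℂ)‖ ≤ 1 := fun k => by
    rw [norm_inv, Complex.norm_real, Real.norm_of_nonneg (wt_pos s k).le]
    exact inv_le_one_of_one_le₀ (one_le_wt hs k)
  have e : inner ℂ x (diag (unwt s) y) =
      inner ℂ (diag (fun k => ((wt s k)⁻¹ : ℂ)) x) (diag (fun k => ((wt s k)⁻¹ : ℂ)) y) := by
    rw [lp.inner_eq_tsum, lp.inner_eq_tsum]
    refine tsum_congr fun k => ?_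
    rw [diag_apply (norm_unwt_le hs), diag_apply hb, diag_apply hb]
    simp only [RCLike.inner_apply, map_mul, map_inv₀, Complex.conj_ofReal, unwt]
    push_cast
    ring
  rw [e, mass_eq_norm_diag hs, mass_eq_norm_diag hs, ← mul_pow]
  exact pow_le_pow_left₀ (norm_nonneg _) (norm_inner_le_norm _ _) 2

theorem abs_quart_le (hs : 1 / 2 < s) (t : ℝ) (x : L2) :
    |(quart s t x x x x).re| ≤ 2 * (l1 s x ^ 2 * mass s x) := by
  have h0 := mass_nonneg s x
  refine (Complex.abs_re_le_norm _).trans ?_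
  rw [quart_eq_inner hs]
  refine abs_le_of_sq_le_sq' ?_ (by positivity) |>.2
  refine (norm_inner_unwt_sq_le (by linarith) _ _).trans ?_
  have := mul_le_mul_of_nonneg_left (mass_trilin_le hs (osc_bound t) x) h0
  nlinarith [mul_nonneg (pow_nonneg (l1_nonneg s x) 4) (mul_nonneg h0 h0)]

/-- The `l¹` norm is controlled by a small multiple of the kinetic energy and by the mass. -/
theorem exists_l1_sq_le (hs : 1 ≤ s) {ε : ℝ} (hε : 0 < ε) :
    ∃ C, 0 ≤ C ∧ ∀ x : L2, l1 s x ^ 2 ≤ ε * kinetic s x + C * mass s x := by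
  have hs0 : 0 ≤ s := by linarith
  have hs' : 1 / 2 < s := by linarith
  have hw : Summable fun k : ℤ => (1 + (k : ℝ) ^ 2)⁻¹ := by
    refine Summable.of_nonneg_of_le (fun k => by positivity) (fun k => ?_)
      ((summable_wt_neg (s := 1) (by norm_num)).mul_left 2)
    have h1 : wt 1 k = 1 + |(k : ℝ)| := by simp [wt]
    rw [h1, ← div_eq_mul_inv, inv_eq_one_div, div_le_div_iff₀ (by positivity) (by positivity)]
    nlinarith [sq_abs (k : ℝ), sq_nonneg (1 - |(k : ℝ)|)]
  -- Frequencies in `F` are bounded by the mass through Cauchy–Schwarz. For the others the tail of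
  -- `∑ (1 + k²)⁻¹` supplies the small factor, and squaring the sum of the two parts doubles it to
  -- `ε`.
  obtain ⟨F, hF⟩ := summable_iff_vanishing_norm.1 hw (ε / 2) (by positivity)
  refine ⟨2 * F.card + ε, by positivity, fun x => ?_⟩
  set f : ℤ → ℝ := fun k => ‖seq s x k‖
  have hf0 : ∀ k, 0 ≤ f k := fun k => norm_nonneg _
  have hM0 := mass_nonneg s x
  have hH0 := kinetic_nonneg s x
  have hfs : Summable fun k => f k ^ 2 := summable_seq_sq hs0 x
  have hks : Summable fun k : ℤ => (k : ℝ) ^ 2 * f k ^ 2 := by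
    refine Summable.of_nonneg_of_le (fun k => by positivity) (fun k => ?_) x.summable_sq
    rw [norm_apply_eq s, mul_pow]
    have := abs_sq_le_wt_sq hs k
    rw [abs_of_nonneg (sq_nonneg _)] at this
    gcongr
  have h1 : (∑ k ∈ F, f k) ^ 2 ≤ F.card * mass s x := by
    refine sq_sum_le_card_mul_sum_sq.trans ?_
    gcongr
    exact hfs.sum_le_tsum F (fun k _ => by positivity)
  have h2 : ∀ G : Finset ℤ, Disjoint G F →
      (∑ k ∈ G, f k) ^ 2 ≤ ε / 2 * (mass s x + kinetic s x) := by
    intro G hG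
    refine (Finset.sum_sq_le_sum_mul_sum_of_sq_le_mul G (f := fun k : ℤ => (1 + (k : ℝ) ^ 2)⁻¹)
      (g := fun k : ℤ => f k ^ 2 + (k : ℝ) ^ 2 * f k ^ 2) (fun k _ => by positivity)
      (fun k _ => by positivity) (fun k _ => by
        have : (1 + (k : ℝ) ^ 2) ≠ 0 := by positivity
        exact le_of_eq (by field_simp))).trans ?_
    have a1 := (le_abs_self _).trans (hF G hG).le
    have a2 := (hfs.add hks).sum_le_tsum G (fun k _ => by positivity)
    rw [hfs.tsum_add hks] at a2
    exact mul_le_mul a1 a2 (Finset.sum_nonneg fun k _ => by positivity) (by positivity)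
  have h3 : l1 s x ≤ √(F.card * mass s x) + √(ε / 2 * (mass s x + kinetic s x)) := by
    refine Real.tsum_le_of_sum_le hf0 fun G => ?_
    rw [← Finset.sum_filter_add_sum_filter_not G (· ∈ F)]
    refine add_le_add ?_ (Real.le_sqrt_of_sq_le (h2 _ ?_))
    · refine (Finset.sum_le_sum_of_subset_of_nonneg (t := F) (fun k hk => ?_)
        (fun k _ _ => hf0 k)).trans (Real.le_sqrt_of_sq_le h1)
      exact (Finset.mem_filter.1 hk).2
    · exact Finset.disjoint_left.2 fun k hk => (Finset.mem_filter.1 hk).2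
  have h4 := Real.sq_sqrt (show 0 ≤ F.card * mass s x by positivity)
  have h5 := Real.sq_sqrt (show 0 ≤ ε / 2 * (mass s x + kinetic s x) by positivity)
  have h6 := pow_le_pow_left₀ (l1_nonneg s x) h3 2
  nlinarith [sq_nonneg (√(F.card * mass s x) - √(ε / 2 * (mass s x + kinetic s x)))]

/-- The growth is linear in the `l^{2,s}` norm with a coefficient depending only on the `l¹` norm,
so an `l¹` bound excludes blow-up. -/
theorem norm_field_le (hs : 1 / 2 < s) (c M t : ℝ) (x : L2) :
    ‖field s c M t x‖ ≤ |c| / |t| * (3 * triConst s * l1 s x ^ 2 + 2 * |M|) * ‖x‖ := by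
  have h := norm_trilin_le_l1 hs (osc_bound t) x x x
  rw [field, nonlin, norm_smul, norm_mul, Complex.norm_I, norm_coe_ofReal, mul_one, abs_div,
    abs_abs, mul_assoc]
  gcongr
  refine (norm_sub_le _ _).trans ?_
  rw [norm_smul, norm_coe_ofReal, abs_mul, abs_two]
  linarith

/-- The energy `kinetic - 2ct Q` dominates half the kinetic energy up to a constant, whatever the
sign of `c`, since `Q` is at most a small multiple of the kinetic energy plus a constant. Its
derivative `-2cQ` is then controlled by the energy itself, and Gronwall applies. -/
theorem exists_kinetic_bound (hs : 1 ≤ s) (c : ℝ) (x₀ : L2) {t₀ t₁ : ℝ} (ht₀ : 0 < t₀) :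
    ∃ K, ∀ (A : ℝ → L2) (τ : ℝ), τ ∈ Icc t₀ t₁ → A t₀ = x₀ →
      (∀ t ∈ Icc t₀ τ, HasDerivAt A (field s c (mass s x₀) t (A t)) t) →
      ∀ t ∈ Icc t₀ τ, kinetic s (A t) ≤ K := by
  by_cases h01 : t₀ ≤ t₁
  swap
  · exact ⟨0, fun A τ hτ => absurd (hτ.1.trans hτ.2) h01⟩
  have hs' : 1 / 2 < s := by linarith
  have hc := abs_nonneg c
  set M := mass s x₀
  have hM0 : 0 ≤ M := mass_nonneg s x₀
  have ht₁ : 0 < t₁ := ht₀.trans_le h01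
  -- Chosen so that `2|c| t₁ · 2Mε ≤ 1/2`: the quartic part of the energy then takes away at most
  -- half of the kinetic energy. The `+ 1` covers a zero denominator.
  set ε := 1 / (8 * |c| * t₁ * M + 1)
  have hε : 0 < ε := by positivity
  have hε1 : 2 * |c| * t₁ * (2 * M * ε) ≤ 1 / 2 := by
    have : 8 * |c| * t₁ * M * ε ≤ 1 := by
      simp only [ε]
      rw [mul_one_div, div_le_one (by positivity)]
      linarith
    linarith
  obtain ⟨C, hC0, hC⟩ := exists_l1_sq_le hs hε
  set D := 2 * |c| * t₁ * (2 * M * (C * M))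
  have hD : 0 ≤ D := by positivity
  set q₁ := 2 * |c| * (2 * M * (ε * 2))
  set q₂ := 2 * |c| * (2 * M * (ε * (2 * D) + C * M))
  have hq₁ : 0 ≤ q₁ := by positivity
  have hq₂ : 0 ≤ q₂ := by positivity
  set E₀ := |kinetic s x₀ - 2 * c * t₀ * (quart s t₀ x₀ x₀ x₀ x₀).re|
  refine ⟨2 * gronwallBound E₀ q₁ q₂ (t₁ - t₀) + 2 * D, fun A τ hτ hA0 hA => ?_⟩
  set Q : ℝ → ℝ := fun t => (quart s t (A t) (A t) (A t) (A t)).re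
  set E : ℝ → ℝ := fun t => kinetic s (A t) - 2 * c * t * Q t
  have hmass : ∀ t ∈ Icc t₀ τ, mass s (A t) = M := fun t ht => by
    rw [mass_eq_of_mem_Icc hs' hA ht, hA0]
  have hpos : ∀ t ∈ Icc t₀ τ, 0 < t := fun t ht => ht₀.trans_le ht.1
  have hQ : ∀ t ∈ Icc t₀ τ, |Q t| ≤ 2 * M * (ε * kinetic s (A t) + C * M) := by
    intro t ht
    have h1 := abs_quart_le hs' t (A t)
    have h2 := hC (A t)
    rw [hmass t ht] at h1 h2
    have h3 := mul_le_mul_of_nonneg_left h2 hM0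
    refine h1.trans ?_
    linarith
  have hEk : ∀ t ∈ Icc t₀ τ, kinetic s (A t) ≤ 2 * E t + 2 * D := by
    intro t ht
    have h1 := hQ t ht
    have h0 := kinetic_nonneg s (A t)
    have h2 : |2 * c * t * Q t| ≤ 2 * |c| * t₁ * (2 * M * (ε * kinetic s (A t) + C * M)) := by
      rw [abs_mul, abs_mul, abs_mul, abs_two, abs_of_pos (hpos t ht)]
      gcongr
      exact ht.2.trans hτ.2
    have h3 := (le_abs_self _).trans h2
    have h4 := mul_le_mul_of_nonneg_right hε1 h0
    simp only [E, D]
    nlinarith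
  -- The derivative of the kinetic energy is `c/(2t)` times the sum weighted by `ω`, and `2ct ·
  -- 1/(4t²)` is the same factor, so these terms cancel. Only the derivative of the explicit factor
  -- `t` survives.
  have hE' : ∀ t ∈ Icc t₀ τ, HasDerivAt E (-(2 * c * Q t)) t := by
    intro t ht
    have ht0 := hpos t ht
    have h1 := hasDerivAt_kinetic hs ht0 (hA t ht)
    have h2 := (((hasDerivAt_id t).const_mul (2 * c)).mul (hasDerivAt_quart hs ht0 (hA t ht)))
    refine (h1.sub h2).congr_deriv ?_
    simp only [id, Q]
    field_simp
    ring
  have hEb : ∀ t ∈ Icc t₀ τ, ‖-(2 * c * Q t)‖ ≤ q₁ * ‖E t‖ + q₂ := by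
    intro t ht
    have h1 := hQ t ht
    have h2 := hEk t ht
    have h3 : kinetic s (A t) ≤ 2 * |E t| + 2 * D := by linarith [le_abs_self (E t)]
    rw [norm_neg, Real.norm_eq_abs, Real.norm_eq_abs, abs_mul, abs_mul, abs_two]
    calc 2 * |c| * |Q t| ≤ 2 * |c| * (2 * M * (ε * (2 * |E t| + 2 * D) + C * M)) := by
          gcongr
          exact h1.trans (by gcongr)
      _ = _ := by simp only [q₁, q₂]; ring
  intro t ht
  have h1 := norm_le_gronwallBound_of_norm_deriv_right_le (f := E) (δ := E₀)
    (fun t ht => (hE' t ht).continuousAt.continuousWithinAt)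
    (fun t ht => (hE' t (Ico_subset_Icc_self ht)).hasDerivWithinAt)
    (by simp only [E, Q, hA0, E₀]; exact le_rfl)
    (fun t ht => hEb t (Ico_subset_Icc_self ht)) t ht
  have h2 := gronwallBound_mono (δ := E₀) (K := q₁) (ε := q₂) (abs_nonneg _) hq₂ hq₁
    (show t - t₀ ≤ t₁ - t₀ by linarith [ht.2, hτ.2])
  have h3 := hEk t ht
  have h4 := le_abs_self (E t)
  rw [Real.norm_eq_abs] at h1
  linarith

/-- Kinetic energy and mass bound the `l¹` norm, and the tame bound on the field then gives
exponential control of the `l^{2,s}` norm for every `s ≥ 1`. -/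
theorem exists_apriori_bound (hs : 1 ≤ s) (c : ℝ) (x₀ : L2) {t₀ t₁ : ℝ} (ht₀ : 0 < t₀) :
    ∃ K, ‖x₀‖ < K ∧ ∀ (A : ℝ → L2) (τ : ℝ), τ ∈ Icc t₀ t₁ → A t₀ = x₀ →
      (∀ t ∈ Icc t₀ τ, HasDerivAt A (field s c (mass s x₀) t (A t)) t) → ‖A τ‖ < K := by
  have hs' : 1 / 2 < s := by linarith
  obtain ⟨K, hK⟩ := exists_kinetic_bound hs c x₀ (t₁ := t₁) ht₀
  obtain ⟨C, hC0, hC⟩ := exists_l1_sq_le hs one_pos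
  set M := mass s x₀
  have hM0 : 0 ≤ M := mass_nonneg s x₀
  have hT := triConst_nonneg s
  set L := |c| / t₀ * (3 * triConst s * (|K| + C * M) + 2 * |M|)
  have hL : 0 ≤ L := by positivity
  have hg : 0 ≤ gronwallBound ‖x₀‖ L 0 |t₁ - t₀| := by
    rw [gronwallBound_ε0]; positivity
  refine ⟨max ‖x₀‖ (gronwallBound ‖x₀‖ L 0 |t₁ - t₀|) + 1,
    by linarith [le_max_left ‖x₀‖ (gronwallBound ‖x₀‖ L 0 |t₁ - t₀|)], fun A τ hτ hA0 hA => ?_⟩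
  have h1 := norm_le_gronwallBound_of_norm_deriv_right_le (f := A) (δ := ‖x₀‖) (K := L) (ε := 0)
    (fun t ht => (hA t ht).continuousAt.continuousWithinAt)
    (fun t ht => (hA t (Ico_subset_Icc_self ht)).hasDerivWithinAt) (by rw [hA0])
    (fun t ht => by
      have ht' := Ico_subset_Icc_self ht
      have ht0 : 0 < t := ht₀.trans_le ht.1
      have a1 := hC (A t)
      have a2 := hK A τ hτ hA0 hA t ht'
      have a3 : mass s (A t) = M := by rw [mass_eq_of_mem_Icc hs' hA ht', hA0]
      have a4 := norm_field_le hs' c M t (A t)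
      rw [add_zero]
      refine a4.trans ?_
      rw [abs_of_pos ht0]
      simp only [L]
      gcongr
      · exact ht.1
      · rw [a3] at a1
        linarith [le_abs_self K]) τ ⟨hτ.1, le_rfl⟩
  have h2 := gronwallBound_mono (norm_nonneg x₀) le_rfl hL
    (show τ - t₀ ≤ |t₁ - t₀| by
      rw [abs_of_nonneg (by linarith [hτ.1, hτ.2])]; linarith [hτ.2])
  linarith [le_max_right ‖x₀‖ (gronwallBound ‖x₀‖ L 0 |t₁ - t₀|)]

theorem exists_field_solution_Icc (hs : 1 ≤ s) (c : ℝ) (x₀ : L2) {t₀ t₁ : ℝ} (ht₀ : 0 < t₀)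
    (h01 : t₀ ≤ t₁) : ∃ A : ℝ → L2, A t₀ = x₀ ∧
      ∀ t ∈ Icc t₀ t₁, HasDerivAt A (field s c (mass s x₀) t (A t)) t := by
  have hs' : 1 / 2 < s := by linarith
  obtain ⟨K, hK0, hK⟩ := exists_apriori_bound hs c x₀ (t₁ := t₁) ht₀
  set K' := max 1 K
  obtain ⟨L, hL⟩ := exists_bddLip_field hs' c (mass s x₀) (le_max_left 1 K) (half_pos ht₀)
  obtain ⟨A, hA0, hA⟩ := exists_solution_of_apriori (f := field s c (mass s x₀)) (p := t₀ / 2)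
    (q := t₁ + 1) (K := K') (by linarith) h01 (by linarith)
    (fun t ht => hL t (ht.1.trans (le_abs_self t)))
    (fun x t ht => (continuousAt_field hs' c _ ((half_pos ht₀).trans_le ht.1).ne'
      continuousAt_const).continuousWithinAt)
    (hK0.trans_le (le_max_right _ _))
    (fun A τ hτ hA0 hA => (hK A τ hτ hA0 fun t ht => (hA t ht).1).trans_le (le_max_right _ _))
  exact ⟨A, hA0, fun t ht => (hA t ht).1⟩

/-! ### Global solutions -/

theorem hasDerivAt_of_glue {E : Type*} [NormedAddCommGroup E] [NormedSpace ℝ E]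
    {P A B : ℝ → E} {t₀ : ℝ} {v : E} (hA : HasDerivAt A v t₀) (hB : HasDerivAt B v t₀)
    (h : A t₀ = B t₀) (hPA : ∀ t ≤ t₀, P t = A t) (hPB : ∀ t, t₀ < t → P t = B t) :
    HasDerivAt P v t₀ := by
  have h1 : HasDerivWithinAt P v (Iic t₀) t₀ :=
    hA.hasDerivWithinAt.congr hPA (hPA t₀ le_rfl)
  have h2 : HasDerivWithinAt P v (Ici t₀) t₀ := by
    refine hB.hasDerivWithinAt.congr (fun t ht => ?_) (by rw [hPA t₀ le_rfl, h])
    rcases (show t₀ ≤ t from ht).eq_or_lt with rfl | h'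
    · rw [hPA t₀ le_rfl, h]
    · exact hPB t h'
  have := h1.union h2
  rwa [Iic_union_Ici, hasDerivWithinAt_univ] at this

theorem exists_field_solution_of_lt (hs : 1 ≤ s) (c : ℝ) (α : L2) (T : ℝ) :
    ∃ T₀ C, 0 < T₀ ∧ ∃ A : ℝ → L2,
      (∀ t ∈ Ioo 0 T, HasDerivAt A (field s c (mass s α) t (A t)) t) ∧
      ∀ t ∈ Ioo 0 T₀, ‖gauge s c α t (A t) - α‖ ≤ C * t := by
  have hs' : 1 / 2 < s := by linarith
  obtain ⟨T₀, C, hT₀, A, hA⟩ := exists_field_solution hs' c α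
  set t₀ := T₀ / 2
  have ht₀ : t₀ ∈ Ioo 0 T₀ := ⟨half_pos hT₀, half_lt_self hT₀⟩
  have hA0 : Tendsto (fun t => gauge s c α t (A t)) (𝓝[>] 0) (𝓝 α) :=
    tendsto_of_norm_sub_le hT₀ fun t ht => (hA t ht).2
  have hm : Tendsto (fun t => mass s (A t)) (𝓝[>] 0) (𝓝 (mass s α)) := by
    have := ((continuous_mass (by linarith : 0 ≤ s)).tendsto α).comp hA0
    simpa only [mass_gauge, Function.comp_def] using this
  have hmass : mass s (A t₀) = mass s α :=
    mass_eq_of_tendsto (c := c) (A := A) hs' (M := fun _ => mass s α) (fun t ht => (hA t ht).1) hm ht₀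
  obtain ⟨B, hB0, hB⟩ := exists_field_solution_Icc hs c (A t₀) (t₁ := max t₀ T) ht₀.1
    (le_max_left _ _)
  rw [hmass] at hB
  obtain ⟨P, hPA, hPB⟩ : ∃ P : ℝ → L2, (∀ t ≤ t₀, P t = A t) ∧ ∀ t, t₀ < t → P t = B t :=
    ⟨fun t => if t ≤ t₀ then A t else B t, fun t ht => if_pos ht, fun t ht => if_neg (not_le.2 ht)⟩
  refine ⟨t₀, C, ht₀.1, P, fun t ht => ?_, fun t ht => ?_⟩
  · rcases lt_trichotomy t t₀ with h | h | h
    · have e : P =ᶠ[𝓝 t] A := by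
        filter_upwards [gt_mem_nhds h] with r hr using hPA r (le_of_lt hr)
      rw [hPA t h.le]
      exact (hA t ⟨ht.1, h.trans ht₀.2⟩).1.congr_of_eventuallyEq e
    · rw [h, hPA t₀ le_rfl]
      refine hasDerivAt_of_glue (hA t₀ ht₀).1 ?_ hB0.symm hPA hPB
      have := hB t₀ ⟨le_rfl, le_max_left _ _⟩
      rwa [hB0] at this
    · have e : P =ᶠ[𝓝 t] B := by
        filter_upwards [lt_mem_nhds h] with r hr using hPB r hr
      rw [hPB t h]
      exact (hB t ⟨h.le, ht.2.le.trans (le_max_right _ _)⟩).congr_of_eventuallyEq e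
  · rw [hPA t ht.2.le]
    exact (hA t ⟨ht.1, ht.2.trans ht₀.2⟩).2

/-- Solutions on `(0, n + 1)` agree on overlaps by uniqueness from time zero, so `B ⌈t⌉₊ t` is
coherent. The bound `O(t)` comes from the first solution near zero and from compactness elsewhere.
-/
theorem exists_global_field_solution (hs : 1 ≤ s) (c : ℝ) (α : L2) :
    ∃ A : ℝ → L2, (∀ t, 0 < t → HasDerivAt A (field s c (mass s α) t (A t)) t) ∧
      ∀ T, 0 < T → ∃ C, ∀ t ∈ Ioo 0 T, ‖gauge s c α t (A t) - α‖ ≤ C * t := by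
  have hs' : 1 / 2 < s := by linarith
  choose T₀ C hT₀ B hB hBC using fun n : ℕ => exists_field_solution_of_lt hs c α (n + 1)
  have hB0 := fun n => tendsto_of_norm_sub_le (hT₀ n) (hBC n)
  have huniq : ∀ m n : ℕ, m ≤ n → ∀ t ∈ Ioo 0 ((m : ℝ) + 1), B n t = B m t := fun m n hmn t ht =>
    field_solution_unique hs' (fun r hr => hB n r ⟨hr.1, hr.2.trans_le (by gcongr)⟩) (hB m)
      (hB0 n) (hB0 m) ht
  set A : ℝ → L2 := fun t => B ⌈t⌉₊ t
  have hAB : ∀ n : ℕ, ∀ t ∈ Ioo 0 ((n : ℝ) + 1), A t = B n t := by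
    intro n t ht
    simp only [A]
    rcases le_total n ⌈t⌉₊ with h | h
    · exact huniq _ _ h t ht
    · exact (huniq _ _ h t ⟨ht.1, (Nat.le_ceil t).trans_lt (lt_add_one _)⟩).symm
  have hder : ∀ t, 0 < t → HasDerivAt A (field s c (mass s α) t (A t)) t := by
    intro t ht
    have ht' : t ∈ Ioo 0 ((⌈t⌉₊ : ℝ) + 1) := ⟨ht, (Nat.le_ceil t).trans_lt (lt_add_one _)⟩
    have e : A =ᶠ[𝓝 t] B ⌈t⌉₊ := by
      filter_upwards [isOpen_Ioo.mem_nhds ht'] with r hr using hAB _ r hr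
    exact (hB ⌈t⌉₊ t ht').congr_of_eventuallyEq e
  refine ⟨A, hder, fun T hT => ?_⟩
  have hnear : ∀ t ∈ Ioo 0 (min (T₀ 0) 1), ‖gauge s c α t (A t) - α‖ ≤ C 0 * t := fun t ht => by
    rw [hAB 0 t ⟨ht.1, by simpa using ht.2.trans_le (min_le_right _ _)⟩]
    exact hBC 0 t ⟨ht.1, ht.2.trans_le (min_le_left _ _)⟩
  set r := min (T₀ 0) 1 / 2
  have hr : 0 < min (T₀ 0) 1 := lt_min (hT₀ 0) one_pos
  have hr0 : 0 < r := half_pos hr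
  obtain ⟨K, hK⟩ := isCompact_Icc.exists_bound_of_continuousOn (f := A) (s := Icc r T)
    (fun t ht => (hder t (hr0.trans_le ht.1)).continuousAt.continuousWithinAt)
  -- For `t ≥ r` the crude bound `|K| + ‖α‖` becomes linear in `t` after division by `r`.
  refine ⟨max (C 0) ((|K| + ‖α‖) / r), fun t ht => ?_⟩
  rcases lt_or_ge t r with h | h
  · refine (hnear t ⟨ht.1, h.trans (half_lt_self hr)⟩).trans ?_
    have := ht.1
    gcongr
    exact le_max_left _ _
  · refine (norm_sub_le _ _).trans ?_
    rw [norm_gauge]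
    calc ‖A t‖ + ‖α‖ ≤ |K| + ‖α‖ := by
          gcongr
          exact (hK t ⟨h, ht.2.le⟩).trans (le_abs_self K)
      _ = (|K| + ‖α‖) / r * r := by field_simp
      _ ≤ max (C 0) ((|K| + ‖α‖) / r) * t := by
          gcongr
          exact le_max_right _ _

end DiracNLS

end

/-! ### From coefficients to functions: distributional solutions and the ansatz. -/

noncomputable section

namespace DiracNLS

open scoped ENNReal ComplexConjugate

variable {s : ℝ}

/-! ### The evolution of the Dirac masses -/

theorem four_pi_I_mul_ne_zero {t : ℝ} (ht : t ≠ 0) : (4 * Real.pi * Complex.I * t : ℂ) ≠ 0 := by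
  have h1 : (Real.pi : ℂ) ≠ 0 := by exact_mod_cast Real.pi_ne_zero
  have h2 : (t : ℂ) ≠ 0 := by exact_mod_cast ht
  have h3 := Complex.I_ne_zero
  have h4 : (4 : ℂ) ≠ 0 := by norm_num
  positivity

theorem cpow_half_sq {z : ℂ} (hz : z ≠ 0) : (z ^ (1 / 2 : ℂ)) ^ 2 = z := by
  rw [sq, ← Complex.cpow_add _ _ hz]; norm_num

theorem norm_exp_quadratic (x t : ℝ) : ‖Complex.exp (Complex.I * (x : ℂ) ^ 2 / (4 * t))‖ = 1 := by
  have : Complex.I * (x : ℂ) ^ 2 / (4 * t) = Complex.I * ((x ^ 2 / (4 * t) : ℝ) : ℂ) := by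
    push_cast; ring
  rw [this, norm_exp_I_mul_ofReal]

theorem norm_diracEvolution_sq {t : ℝ} (ht : t ≠ 0) (k : ℤ) (x : ℝ) :
    ‖diracEvolution k t x‖ ^ 2 = 1 / (4 * Real.pi * |t|) := by
  have h1 := norm_exp_quadratic (x - k) t
  push_cast at h1
  have h2 := congrArg norm (cpow_half_sq (four_pi_I_mul_ne_zero ht))
  rw [norm_pow] at h2
  rw [diracEvolution, norm_div, div_pow, h1, h2]
  simp [abs_of_pos Real.pi_pos]

/-- The modulus of the evolution of a Dirac mass. -/
def waveAmp (t : ℝ) : ℝ := √(1 / (4 * Real.pi * |t|))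

theorem waveAmp_nonneg (t : ℝ) : 0 ≤ waveAmp t := Real.sqrt_nonneg _

theorem norm_diracEvolution {t : ℝ} (ht : t ≠ 0) (k : ℤ) (x : ℝ) :
    ‖diracEvolution k t x‖ = waveAmp t := by
  rw [waveAmp, ← norm_diracEvolution_sq ht k x, Real.sqrt_sq (norm_nonneg _)]

/-- Since `i - l + j = k`, the quadratic phases combine: the terms in `x²` and `x` match those of
the wave at `k`, and the constant left over is `ω/4t`. The modulus of a wave does not depend on `x`,
which gives the prefactor. -/
theorem diracEvolution_mul {t : ℝ} (ht : t ≠ 0) (k i j : ℤ) (x : ℝ) :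
    diracEvolution i t x * conj (diracEvolution (i + j - k) t x) * diracEvolution j t x =
      ((1 / (4 * Real.pi * |t|) : ℝ) : ℂ) * (osc t k i j * diracEvolution k t x) := by
  set z := (4 * Real.pi * Complex.I * t : ℂ) ^ (1 / 2 : ℂ)
  have hz : z ≠ 0 := by
    intro h
    have := cpow_half_sq (four_pi_I_mul_ne_zero ht)
    rw [show (4 * Real.pi * Complex.I * t : ℂ) ^ (1 / 2 : ℂ) = z from rfl, h] at this
    exact four_pi_I_mul_ne_zero ht (by rw [← this]; ring)
  have hzz : (1 / (4 * Real.pi * |t|) : ℝ) * (z * conj z) = 1 := by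
    have h2 := congrArg norm (cpow_half_sq (four_pi_I_mul_ne_zero ht))
    rw [norm_pow] at h2
    rw [Complex.mul_conj, Complex.normSq_eq_norm_sq, h2]
    simp only [norm_mul, Complex.norm_I, Complex.norm_real, Complex.norm_ofNat, Real.norm_eq_abs,
      abs_of_pos Real.pi_pos, mul_one]
    have h3 := abs_pos.2 ht
    rw [← Complex.ofReal_mul]
    have := Real.pi_pos
    rw [one_div, inv_mul_cancel₀ (by positivity), Complex.ofReal_one]
  have hcz : conj z ≠ 0 := (map_ne_zero _).2 hz
  have hE : ∀ m : ℤ, diracEvolution m t x =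
      Complex.exp (Complex.I * (((x - m) ^ 2 / (4 * t) : ℝ) : ℂ)) / z := fun m => by
    rw [diracEvolution]
    congr 2
    push_cast
    ring
  have hexp : Complex.exp (Complex.I * (((x - i) ^ 2 / (4 * t) : ℝ) : ℂ)) *
      conj (Complex.exp (Complex.I * (((x - (i + j - k : ℤ)) ^ 2 / (4 * t) : ℝ) : ℂ))) *
      Complex.exp (Complex.I * (((x - j) ^ 2 / (4 * t) : ℝ) : ℂ)) =
      osc t k i j * Complex.exp (Complex.I * (((x - k) ^ 2 / (4 * t) : ℝ) : ℂ)) := by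
    rw [conj_exp_I_mul_ofReal, osc, ← Complex.exp_add, ← Complex.exp_add, ← Complex.exp_add,
      omega]
    congr 1
    push_cast
    ring
  rw [hE, hE, hE, hE, map_div₀]
  have h3 : ((1 / (4 * Real.pi * |t|) : ℝ) : ℂ) = 1 / (z * conj z) := by
    rw [eq_div_iff (mul_ne_zero hz hcz), hzz]
  rw [h3]
  field_simp
  exact hexp

/-- The function `∑ₖ aₖ e^{itΔ}δ_k`. -/
def synth (s t : ℝ) (A : L2) (x : ℝ) : ℂ := ∑' k, seq s A k * diracEvolution k t x

theorem norm_synthTerm {t : ℝ} (ht : t ≠ 0) (A : L2) (k : ℤ) (x : ℝ) :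
    ‖seq s A k * diracEvolution k t x‖ = waveAmp t * ‖seq s A k‖ := by
  rw [norm_mul, norm_diracEvolution ht, mul_comm]

theorem summable_norm_synth (hs : 1 / 2 < s) {t : ℝ} (ht : t ≠ 0) (A : L2) (x : ℝ) :
    Summable fun k => ‖seq s A k * diracEvolution k t x‖ := by
  simp only [norm_synthTerm ht]
  exact (summable_norm_seq hs A).mul_left _

theorem summable_synth (hs : 1 / 2 < s) {t : ℝ} (ht : t ≠ 0) (A : L2) (x : ℝ) :
    Summable fun k => seq s A k * diracEvolution k t x := (summable_norm_synth hs ht A x).of_norm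

theorem synth_sub (hs : 1 / 2 < s) {t : ℝ} (ht : t ≠ 0) (A B : L2) (x : ℝ) :
    synth s t (A - B) x = synth s t A x - synth s t B x := by
  rw [synth, synth, synth, ← (summable_synth hs ht A x).tsum_sub (summable_synth hs ht B x)]
  exact tsum_congr fun k => by rw [seq_sub]; ring

theorem synth_smul (t : ℝ) (z : ℂ) (A : L2) (x : ℝ) :
    synth s t (z • A) x = z * synth s t A x := by
  rw [synth, synth, ← tsum_mul_left]
  exact tsum_congr fun k => by rw [seq_smul]; ring

theorem norm_synth_le (hs : 1 / 2 < s) {t : ℝ} (ht : t ≠ 0) (A : L2) (x : ℝ) :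
    ‖synth s t A x‖ ≤ waveAmp t * l1 s A := by
  refine (norm_tsum_le_tsum_norm (summable_norm_synth hs ht A x)).trans (le_of_eq ?_)
  simp only [norm_synthTerm ht]
  exact tsum_mul_left

/-- The index change `(k, i, j) ↦ ((i, l), j)`, `i - l + j = k`. -/
def tripleEquiv : ℤ × ℤ × ℤ ≃ (ℤ × ℤ) × ℤ where
  toFun q := ((q.2.1, q.2.1 + q.2.2 - q.1), q.2.2)
  invFun p := (p.1.1 - p.1.2 + p.2, p.1.1, p.2)
  left_inv := fun ⟨k, i, j⟩ => by
    simp only [Prod.mk.injEq, and_true]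
    omega
  right_inv := fun ⟨⟨i, l⟩, j⟩ => by
    simp only [Prod.mk.injEq, and_true, true_and]
    omega

/-- The three series converge absolutely, so their product may be regrouped according to the output
frequency `k = i - l + j`. -/
theorem normSq_mul_synth (hs : 1 / 2 < s) {t : ℝ} (ht : t ≠ 0) (A : L2) (x : ℝ) :
    (‖synth s t A x‖ : ℂ) ^ 2 * synth s t A x =
      ((1 / (4 * Real.pi * |t|) : ℝ) : ℂ) * synth s t (trilin s (osc t) A A A) x := by
  set f : ℤ → ℂ := fun k => seq s A k * diracEvolution k t x
  have hf : Summable fun k => ‖f k‖ := summable_norm_synth hs ht A x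
  have hf' : Summable fun k => ‖conj (f k)‖ := hf.congr fun k => (RCLike.norm_conj _).symm
  have e1 : (‖synth s t A x‖ : ℂ) ^ 2 * synth s t A x = (∑' k, f k) * (∑' k, conj (f k)) *
      ∑' k, f k := by
    rw [← Complex.conj_tsum, Complex.mul_conj, Complex.normSq_eq_norm_sq]
    push_cast
    rfl
  have hff : Summable fun p : ℤ × ℤ => ‖f p.1 * conj (f p.2)‖ :=
    Summable.mul_norm (f := f) (g := fun k => conj (f k)) hf hf'
  have hfff : Summable fun p : (ℤ × ℤ) × ℤ => ‖f p.1.1 * conj (f p.1.2) * f p.2‖ :=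
    Summable.mul_norm (f := fun p : ℤ × ℤ => f p.1 * conj (f p.2)) (g := f) hff hf
  set F : (ℤ × ℤ) × ℤ → ℂ := fun p => f p.1.1 * conj (f p.1.2) * f p.2
  have hF : Summable (F ∘ tripleEquiv) := tripleEquiv.summable_iff.2 (Summable.of_norm hfff)
  have e2 : ∑' p, F p = ∑' k, ∑' p : ℤ × ℤ, F (tripleEquiv (k, p)) := by
    rw [← tripleEquiv.tsum_eq F]
    exact hF.tsum_prod
  have e3 : (∑' k, f k) * (∑' k, conj (f k)) * ∑' k, f k = ∑' p, F p := by
    rw [tsum_mul_tsum_of_summable_norm hf hf', tsum_mul_tsum_of_summable_norm hff hf]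
  have e4 : ∀ (k : ℤ) (p : ℤ × ℤ), F (tripleEquiv (k, p)) =
      ((1 / (4 * Real.pi * |t|) : ℝ) : ℂ) *
        (triTerm s (osc t) A A A k p * diracEvolution k t x) := by
    intro k p
    have h := diracEvolution_mul ht k p.1 p.2 x
    have e5 : F (tripleEquiv (k, p)) = (seq s A p.1 * diracEvolution p.1 t x) *
        conj (seq s A (p.1 + p.2 - k) * diracEvolution (p.1 + p.2 - k) t x) *
        (seq s A p.2 * diracEvolution p.2 t x) := rfl
    rw [e5, triTerm, map_mul]
    linear_combination (seq s A p.1 * conj (seq s A (p.1 + p.2 - k)) * seq s A p.2) * h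
  rw [e1, e3, e2, synth, ← tsum_mul_left]
  refine tsum_congr fun k => ?_
  rw [seq_trilin hs (osc_bound t), ← tsum_mul_right, ← tsum_mul_left]
  exact tsum_congr fun p => e4 k p

/-- The nonlinearity of the renormalized equation in terms of the coefficients. -/
theorem nonlinearity_synth (hs : 1 / 2 < s) {t : ℝ} (ht : t ≠ 0) (M : ℝ) (A : L2) (x : ℝ) :
    ((‖synth s t A x‖ : ℂ) ^ 2 - ((M / (2 * Real.pi * |t|) : ℝ) : ℂ)) * synth s t A x =
      ((1 / (4 * Real.pi * |t|) : ℝ) : ℂ) * synth s t (nonlin s M t A) x := by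
  have h3 : ((|t| : ℝ) : ℂ) ≠ 0 := by exact_mod_cast abs_ne_zero.2 ht
  have hpi : (Real.pi : ℂ) ≠ 0 := by exact_mod_cast Real.pi_ne_zero
  rw [sub_mul, normSq_mul_synth hs ht, nonlin, synth_sub hs ht, synth_smul]
  push_cast
  field_simp
  ring

/-! ### Uniqueness of Fourier coefficients -/

theorem integral_exp_int (n : ℤ) : ∫ ξ in (0 : ℝ)..2 * Real.pi, Complex.exp (Complex.I * n * ξ) =
    if n = 0 then 2 * Real.pi else 0 := by
  split_ifs with h
  · simp [h]
  · have h1 : Complex.I * (n : ℂ) ≠ 0 := mul_ne_zero Complex.I_ne_zero (by exact_mod_cast h)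
    rw [integral_exp_mul_complex h1]
    have : Complex.exp (Complex.I * n * ((2 * Real.pi : ℝ) : ℂ)) = 1 := by
      rw [Complex.exp_eq_one_iff]
      exact ⟨n, by push_cast; ring⟩
    rw [this]
    simp

theorem norm_exp_neg_I_mul (k : ℤ) (ξ : ℝ) : ‖Complex.exp (-(Complex.I * k * ξ))‖ = 1 := by
  have : -(Complex.I * k * ξ) = Complex.I * ((-(k * ξ) : ℝ) : ℂ) := by push_cast; ring
  rw [this, norm_exp_I_mul_ofReal]

/-- The Fourier coefficients of an absolutely convergent Fourier series. -/
theorem coeff_tsum {b : ℤ → ℂ} (hb : Summable fun k => ‖b k‖) (k : ℤ) :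
    coeff (fun ξ => ∑' j, b j * Complex.exp (-(Complex.I * j * ξ))) k = b k := by
  have hpi : (Real.pi : ℂ) ≠ 0 := by exact_mod_cast Real.pi_ne_zero
  have e : ∀ ξ : ℝ, (∑' j, b j * Complex.exp (-(Complex.I * j * ξ))) *
      Complex.exp (Complex.I * k * ξ) =
      ∑' j, b j * Complex.exp (Complex.I * (k - j : ℤ) * ξ) := by
    intro ξ
    rw [← tsum_mul_right]
    refine tsum_congr fun j => ?_
    rw [mul_assoc, ← Complex.exp_add]
    congr 2
    push_cast
    ring
  have hn : ∀ (j : ℤ) (ξ : ℝ), ‖b j * Complex.exp (Complex.I * (k - j : ℤ) * ξ)‖ = ‖b j‖ :=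
    fun j ξ => by
      have : Complex.I * (k - j : ℤ) * ξ = Complex.I * ((((k - j : ℤ) : ℝ) * ξ : ℝ) : ℂ) := by
        push_cast; ring
      rw [norm_mul, this, norm_exp_I_mul_ofReal, mul_one]
  rw [coeff]
  simp only [e]
  rw [← (intervalIntegral.hasSum_integral_of_dominated_convergence (μ := volume) (a := 0)
    (b := 2 * Real.pi) (F := fun j (ξ : ℝ) => b j * Complex.exp (Complex.I * (k - j : ℤ) * ξ))
    (fun j _ => ‖b j‖)
    (fun j => (by fun_prop : Continuous fun ξ : ℝ =>
      b j * Complex.exp (Complex.I * (k - j : ℤ) * ξ)).aestronglyMeasurable)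
    (fun j => Eventually.of_forall fun ξ _ => (hn j ξ).le)
    (Eventually.of_forall fun ξ _ => hb) intervalIntegrable_const
    (Eventually.of_forall fun ξ _ => (Summable.of_norm (by simpa only [hn] using hb)).hasSum)).tsum_eq]
  rw [tsum_eq_single k]
  · rw [intervalIntegral.integral_const_mul, integral_exp_int, if_pos (sub_self k)]
    push_cast
    field_simp
  · intro j hj
    rw [intervalIntegral.integral_const_mul, integral_exp_int, if_neg (sub_ne_zero.2 hj.symm),
      Complex.ofReal_zero, mul_zero]

theorem diracEvolution_eq (k : ℤ) {t : ℝ} (ht : t ≠ 0) (ξ : ℝ) :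
    diracEvolution k t (2 * t * ξ) = Complex.exp (Complex.I * t * ξ ^ 2) /
      (4 * Real.pi * Complex.I * t : ℂ) ^ (1 / 2 : ℂ) *
      (Complex.exp (Complex.I * k ^ 2 / (4 * t)) * Complex.exp (-(Complex.I * k * ξ))) := by
  have h2 : (t : ℂ) ≠ 0 := by exact_mod_cast ht
  rw [diracEvolution, div_mul_eq_mul_div, ← Complex.exp_add, ← Complex.exp_add]
  congr 2
  push_cast
  field_simp
  ring

/-- At `x = 2tξ` the sum is a nowhere vanishing factor times the Fourier series with coefficients
`A_k e^{ik²/4t}`, and an absolutely convergent Fourier series determines its coefficients. -/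
theorem synth_injective (hs : 1 / 2 < s) {t : ℝ} (ht : t ≠ 0) {A : L2}
    (h : ∀ x, synth s t A x = 0) : A = 0 := by
  set b : ℤ → ℂ := fun k => seq s A k * Complex.exp (Complex.I * k ^ 2 / (4 * t))
  have hE : ∀ k : ℤ, ‖Complex.exp (Complex.I * k ^ 2 / (4 * t))‖ = 1 := fun k => by
    have := norm_exp_quadratic k t
    simpa using this
  have hb : Summable fun k => ‖b k‖ := by
    simp only [b, norm_mul, hE, mul_one]
    exact summable_norm_seq hs A
  have hz : (4 * Real.pi * Complex.I * t : ℂ) ^ (1 / 2 : ℂ) ≠ 0 := by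
    intro h
    have := cpow_half_sq (four_pi_I_mul_ne_zero ht)
    rw [h] at this
    exact four_pi_I_mul_ne_zero ht (by rw [← this]; ring)
  have h0 : (fun ξ : ℝ => ∑' j, b j * Complex.exp (-(Complex.I * j * ξ))) = fun _ => 0 := by
    funext ξ
    have h1 := h (2 * t * ξ)
    rw [synth] at h1
    simp only [diracEvolution_eq _ ht] at h1
    have e : ∀ k : ℤ, seq s A k * (Complex.exp (Complex.I * t * ξ ^ 2) /
      (4 * Real.pi * Complex.I * t : ℂ) ^ (1 / 2 : ℂ) *
      (Complex.exp (Complex.I * k ^ 2 / (4 * t)) * Complex.exp (-(Complex.I * k * ξ)))) =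
      Complex.exp (Complex.I * t * ξ ^ 2) / (4 * Real.pi * Complex.I * t : ℂ) ^ (1 / 2 : ℂ) *
        (b k * Complex.exp (-(Complex.I * k * ξ))) := fun k => by
      simp only [b]; ring
    rw [tsum_congr e, tsum_mul_left] at h1
    exact (mul_eq_zero.1 h1).resolve_left (div_ne_zero (Complex.exp_ne_zero _) hz)
  refine seq_injective s fun k => ?_
  have h1 := coeff_tsum hb k
  rw [h0] at h1
  have h2 : b k = 0 := by
    rw [← h1, coeff]; simp
  rw [seq_zero]
  exact (mul_eq_zero.1 h2).resolve_right (Complex.exp_ne_zero _)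

end DiracNLS

end

noncomputable section

namespace DiracNLS

open scoped ENNReal ComplexConjugate

variable {s : ℝ}

/-! ### Test functions -/

theorem continuous_mul_of_tsupport_subset {X : Type*} [TopologicalSpace X] {Ω : Set X}
    (hΩ : IsOpen Ω) {f ψ : X → ℂ} (hf : ContinuousOn f Ω) (hψ : Continuous ψ)
    (hsupp : tsupport ψ ⊆ Ω) : Continuous fun p => f p * ψ p :=
  (hf.mul hψ.continuousOn).continuous_of_tsupport_subset hΩ
    ((tsupport_mul_subset_right (f := f) (g := ψ)).trans hsupp)

/-- The function `f` need be differentiable only in `Ω`: off the support of `ψ` the product vanishes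
locally along the slice, and so does the derivative of `ψ`. -/
theorem hasDerivAt_slice_mul {Ω : Set (ℝ × ℝ)} {f ψ : ℝ × ℝ → ℂ} (hsupp : tsupport ψ ⊆ Ω)
    {ι : ℝ → ℝ × ℝ} (hι : Continuous ι) {r : ℝ} {f' ψ' : ℂ}
    (hψ : HasDerivAt (fun r => ψ (ι r)) ψ' r)
    (hf : ι r ∈ Ω → HasDerivAt (fun r => f (ι r)) f' r) :
    HasDerivAt (fun r => f (ι r) * ψ (ι r)) (f' * ψ (ι r) + f (ι r) * ψ') r := by
  by_cases h : ι r ∈ tsupport ψ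
  · exact (hf (hsupp h)).mul hψ
  · have h1 : ∀ᶠ r' in 𝓝 r, ψ (ι r') = 0 :=
      hι.continuousAt.eventually (notMem_tsupport_iff_eventuallyEq.1 h)
    have h2 : ψ' = 0 := hψ.unique ((hasDerivAt_const r (0 : ℂ)).congr_of_eventuallyEq h1)
    rw [h1.self_of_nhds, h2, mul_zero, mul_zero, add_zero]
    refine (hasDerivAt_const r (0 : ℂ)).congr_of_eventuallyEq ?_
    filter_upwards [h1] with r' hr'
    rw [hr', mul_zero]

theorem hasCompactSupport_slice_left {F : ℝ × ℝ → ℂ} (hF : HasCompactSupport F) (x : ℝ) :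
    HasCompactSupport fun t => F (t, x) :=
  HasCompactSupport.intro (hF.isCompact.image continuous_fst) fun _ ht =>
    image_eq_zero_of_notMem_tsupport fun h => ht ⟨_, h, rfl⟩

theorem hasCompactSupport_slice_right {F : ℝ × ℝ → ℂ} (hF : HasCompactSupport F) (t : ℝ) :
    HasCompactSupport fun x => F (t, x) :=
  HasCompactSupport.intro (hF.isCompact.image continuous_snd) fun _ ht =>
    image_eq_zero_of_notMem_tsupport fun h => ht ⟨_, h, rfl⟩

theorem integral_fst_deriv_eq_zero {F F' : ℝ × ℝ → ℂ} (hF : Continuous F) (hF' : Continuous F')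
    (cF : HasCompactSupport F) (cF' : HasCompactSupport F')
    (h : ∀ p, HasDerivAt (fun t => F (t, p.2)) (F' p) p.1) : ∫ p, F' p = 0 := by
  have hi : Integrable F' (volume.prod volume) := hF'.integrable_of_hasCompactSupport cF'
  have e : ∀ x, ∫ t, F' (t, x) = 0 := fun x => integral_eq_zero_of_hasDerivAt_of_integrable
    (fun t => h (t, x))
    ((hF'.comp (by fun_prop)).integrable_of_hasCompactSupport (hasCompactSupport_slice_left cF' x))
    ((hF.comp (by fun_prop : Continuous fun t : ℝ => (t, x))).integrable_of_hasCompactSupport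
      (hasCompactSupport_slice_left cF x))
  rw [Measure.volume_eq_prod, integral_prod_symm _ hi]
  simp [e]

theorem integral_snd_deriv_eq_zero {F F' : ℝ × ℝ → ℂ} (hF : Continuous F) (hF' : Continuous F')
    (cF : HasCompactSupport F) (cF' : HasCompactSupport F')
    (h : ∀ p, HasDerivAt (fun x => F (p.1, x)) (F' p) p.2) : ∫ p, F' p = 0 := by
  have hi : Integrable F' (volume.prod volume) := hF'.integrable_of_hasCompactSupport cF'
  have e : ∀ t, ∫ x, F' (t, x) = 0 := fun t => integral_eq_zero_of_hasDerivAt_of_integrable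
    (fun x => h (t, x))
    ((hF'.comp (by fun_prop)).integrable_of_hasCompactSupport (hasCompactSupport_slice_right cF' t))
    ((hF.comp (by fun_prop : Continuous fun x : ℝ => (t, x))).integrable_of_hasCompactSupport
      (hasCompactSupport_slice_right cF t))
  rw [Measure.volume_eq_prod, integral_prod _ hi]
  simp [e]

/-- The partial derivatives of a test function. -/
structure TestPartials (φ : ℝ → ℝ → ℂ) (φt φx φxx : ℝ × ℝ → ℂ) : Prop where
  ht : ∀ p : ℝ × ℝ, HasDerivAt (fun t => φ t p.2) (φt p) p.1
  hx : ∀ p : ℝ × ℝ, HasDerivAt (fun x => φ p.1 x) (φx p) p.2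
  hxx : ∀ p : ℝ × ℝ, HasDerivAt (fun x => φx (p.1, x)) (φxx p) p.2
  ct : Continuous φt
  cx : Continuous φx
  cxx : Continuous φxx
  st : tsupport φt ⊆ tsupport (Function.uncurry φ)
  sx : tsupport φx ⊆ tsupport (Function.uncurry φ)
  sxx : tsupport φxx ⊆ tsupport (Function.uncurry φ)

theorem exists_testPartials {φ : ℝ → ℝ → ℂ} (h : ContDiff ℝ ∞ (Function.uncurry φ)) :
    ∃ φt φx φxx, TestPartials φ φt φx φxx := by
  set Φ := Function.uncurry φ
  have hd : ∀ (F : ℝ × ℝ → ℂ), ContDiff ℝ ∞ F → ∀ v : ℝ × ℝ,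
      ContDiff ℝ ∞ fun p => fderiv ℝ F p v := fun F hF v =>
    (hF.fderiv_right (m := ∞) (by simp)).clm_apply contDiff_const
  have hl : ∀ (F : ℝ × ℝ → ℂ), ContDiff ℝ ∞ F → ∀ p : ℝ × ℝ,
      HasDerivAt (fun t => F (t, p.2)) (fderiv ℝ F p (1, 0)) p.1 := fun F hF p => by
    have h1 : HasFDerivAt F (fderiv ℝ F p) (p.1, p.2) :=
      (hF.differentiable (by simp)).differentiableAt.hasFDerivAt
    exact h1.comp_hasDerivAt p.1 ((hasDerivAt_id p.1).prodMk (hasDerivAt_const p.1 p.2))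
  have hr : ∀ (F : ℝ × ℝ → ℂ), ContDiff ℝ ∞ F → ∀ p : ℝ × ℝ,
      HasDerivAt (fun x => F (p.1, x)) (fderiv ℝ F p (0, 1)) p.2 := fun F hF p => by
    have h1 : HasFDerivAt F (fderiv ℝ F p) (p.1, p.2) :=
      (hF.differentiable (by simp)).differentiableAt.hasFDerivAt
    exact h1.comp_hasDerivAt p.2 ((hasDerivAt_const p.2 p.1).prodMk (hasDerivAt_id p.2))
  have hsupp : ∀ (F : ℝ × ℝ → ℂ) (v : ℝ × ℝ), tsupport (fun p => fderiv ℝ F p v) ⊆ tsupport F :=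
    fun F v => tsupport_fderiv_apply_subset ℝ v
  have hx := hd Φ h (0, 1)
  exact ⟨fun p => fderiv ℝ Φ p (1, 0), fun p => fderiv ℝ Φ p (0, 1),
    fun p => fderiv ℝ (fun p => fderiv ℝ Φ p (0, 1)) p (0, 1),
    hl Φ h, hr Φ h, hr _ hx, (hd Φ h _).continuous, hx.continuous, (hd _ hx _).continuous,
    hsupp _ _, hsupp _ _, (hsupp _ _).trans (hsupp _ _)⟩

/-- Integration by parts for the Schrödinger operator. -/
theorem integral_schrodinger_by_parts {Ω : Set (ℝ × ℝ)} (hΩ : IsOpen Ω) {φ : ℝ → ℝ → ℂ}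
    {φt φx φxx f ft fx fxx : ℝ × ℝ → ℂ} (hφ : TestPartials φ φt φx φxx)
    (cφ : Continuous (Function.uncurry φ)) (kφ : HasCompactSupport (Function.uncurry φ))
    (sφ : tsupport (Function.uncurry φ) ⊆ Ω) (hf : ContinuousOn f Ω) (hft : ContinuousOn ft Ω)
    (hfx : ContinuousOn fx Ω) (hfxx : ContinuousOn fxx Ω)
    (dt : ∀ p ∈ Ω, HasDerivAt (fun t => f (t, p.2)) (ft p) p.1)
    (dx : ∀ p ∈ Ω, HasDerivAt (fun x => f (p.1, x)) (fx p) p.2)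
    (dxx : ∀ p ∈ Ω, HasDerivAt (fun x => fx (p.1, x)) (fxx p) p.2) :
    ∫ p, f p * (-(Complex.I * φt p) + φxx p) =
      ∫ p, (Complex.I * ft p + fxx p) * Function.uncurry φ p := by
  set Φ := Function.uncurry φ
  have kt : HasCompactSupport φt := kφ.mono' (subset_tsupport _ |>.trans hφ.st)
  have kx : HasCompactSupport φx := kφ.mono' (subset_tsupport _ |>.trans hφ.sx)
  have kxx : HasCompactSupport φxx := kφ.mono' (subset_tsupport _ |>.trans hφ.sxx)
  have st := hφ.st.trans sφ
  have sx := hφ.sx.trans sφ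
  have sxx := hφ.sxx.trans sφ
  have c1 := continuous_mul_of_tsupport_subset hΩ hf cφ sφ
  have c2 := continuous_mul_of_tsupport_subset hΩ hft cφ sφ
  have c3 := continuous_mul_of_tsupport_subset hΩ hf hφ.ct st
  have c4 := continuous_mul_of_tsupport_subset hΩ hf hφ.cx sx
  have c5 := continuous_mul_of_tsupport_subset hΩ hfx cφ sφ
  have c6 := continuous_mul_of_tsupport_subset hΩ hfx hφ.cx sx
  have c7 := continuous_mul_of_tsupport_subset hΩ hf hφ.cxx sxx
  have c8 := continuous_mul_of_tsupport_subset hΩ hfxx cφ sφ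
  have e1 : ∫ p, (ft p * Φ p + f p * φt p) = 0 :=
    integral_fst_deriv_eq_zero c1 (c2.add c3) kφ.mul_left (kφ.mul_left.add kt.mul_left) fun p =>
      hasDerivAt_slice_mul sφ (ι := fun t => (t, p.2)) (by fun_prop) (hφ.ht p) (dt p)
  have e2 : ∫ p, (fx p * φx p + f p * φxx p) = 0 :=
    integral_snd_deriv_eq_zero c4 (c6.add c7) kx.mul_left (kx.mul_left.add kxx.mul_left) fun p =>
      hasDerivAt_slice_mul sx (ι := fun x => (p.1, x)) (by fun_prop) (hφ.hxx p) (dx p)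
  have e3 : ∫ p, (fxx p * Φ p + fx p * φx p) = 0 :=
    integral_snd_deriv_eq_zero c5 (c8.add c6) kφ.mul_left (kφ.mul_left.add kx.mul_left) fun p =>
      hasDerivAt_slice_mul sφ (ι := fun x => (p.1, x)) (by fun_prop) (hφ.hx p) (dxx p)
  have i1 : Integrable fun p => ft p * Φ p + f p * φt p :=
    (c2.add c3).integrable_of_hasCompactSupport (kφ.mul_left.add kt.mul_left)
  have i2 : Integrable fun p => fx p * φx p + f p * φxx p :=
    (c6.add c7).integrable_of_hasCompactSupport (kx.mul_left.add kxx.mul_left)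
  have i3 : Integrable fun p => fxx p * Φ p + fx p * φx p :=
    (c8.add c6).integrable_of_hasCompactSupport (kφ.mul_left.add kx.mul_left)
  have i4 : Integrable fun p => (Complex.I * ft p + fxx p) * Φ p := by
    have : Continuous fun p => Complex.I * (ft p * Φ p) + fxx p * Φ p :=
      (continuous_const.mul c2).add c8
    refine (this.congr fun p => ?_).integrable_of_hasCompactSupport kφ.mul_left
    ring
  have i5 : Integrable fun p => -Complex.I * (ft p * Φ p + f p * φt p) := i1.const_mul _
  have i6 : Integrable fun p => -Complex.I * (ft p * Φ p + f p * φt p) +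
      (fx p * φx p + f p * φxx p) := i5.add i2
  have i7 : Integrable fun p => -Complex.I * (ft p * Φ p + f p * φt p) +
      (fx p * φx p + f p * φxx p) - (fxx p * Φ p + fx p * φx p) := i6.sub i3
  -- The two integrands of the claim differ by a combination of the `t`-derivative of `f Φ` and the
  -- `x`-derivatives of `f φx` and `fx Φ`, each of which has integral zero.
  have e4 : ∫ p, ((Complex.I * ft p + fxx p) * Φ p + (-Complex.I * (ft p * Φ p + f p * φt p) +
      (fx p * φx p + f p * φxx p) - (fxx p * Φ p + fx p * φx p))) =
      ∫ p, (Complex.I * ft p + fxx p) * Φ p := by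
    rw [integral_add i4 i7, integral_sub i6 i3, integral_add i5 i2, integral_const_mul, e1, e2, e3]
    simp
  rw [← e4]
  refine integral_congr_ae (Eventually.of_forall fun p => ?_)
  simp only
  ring

end DiracNLS

end

noncomputable section

namespace DiracNLS

open scoped ENNReal ComplexConjugate

variable {s : ℝ}

/-! ### The Schrödinger equation for the evolution of Dirac masses -/

theorem four_pi_I_mul_mem_slitPlane {t : ℝ} (ht : t ≠ 0) :
    (4 * Real.pi * Complex.I * t : ℂ) ∈ Complex.slitPlane := by
  rw [Complex.mem_slitPlane_iff]
  right
  have h := Real.pi_ne_zero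
  simp [ht]

theorem cpow_half_ne_zero {t : ℝ} (ht : t ≠ 0) :
    (4 * Real.pi * Complex.I * t : ℂ) ^ (1 / 2 : ℂ) ≠ 0 := by
  intro h
  have := cpow_half_sq (four_pi_I_mul_ne_zero ht)
  rw [h] at this
  exact four_pi_I_mul_ne_zero ht (by rw [← this]; ring)

theorem hasDerivAt_diracEvolution_time (k : ℤ) {t : ℝ} (ht : t ≠ 0) (x : ℝ) :
    HasDerivAt (fun t => diracEvolution k t x)
      (diracEvolution k t x * (-(Complex.I * (x - k) ^ 2 / (4 * t ^ 2)) - 1 / (2 * t))) t := by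
  have htc : (t : ℂ) ≠ 0 := by exact_mod_cast ht
  have hpi : (Real.pi : ℂ) ≠ 0 := by exact_mod_cast Real.pi_ne_zero
  have hI := Complex.I_ne_zero
  have h1 : HasDerivAt (fun z : ℂ => 4 * Real.pi * Complex.I * z) (4 * Real.pi * Complex.I) (t : ℂ) := by
    simpa using (hasDerivAt_id (t : ℂ)).const_mul (4 * Real.pi * Complex.I : ℂ)
  have h2 := h1.cpow_const (c := (1 / 2 : ℂ)) (four_pi_I_mul_mem_slitPlane ht)
  have h3 : HasDerivAt (fun z : ℂ => Complex.I * ((x : ℂ) - k) ^ 2 / (4 * z))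
      (-(Complex.I * (x - k) ^ 2 / (4 * t ^ 2))) (t : ℂ) := by
    have h4 : HasDerivAt (fun z : ℂ => 4 * z) 4 (t : ℂ) := by
      simpa using (hasDerivAt_id (t : ℂ)).const_mul (4 : ℂ)
    refine ((hasDerivAt_const (t : ℂ) (Complex.I * ((x : ℂ) - k) ^ 2)).div h4
      (mul_ne_zero (by norm_num) htc)).congr_deriv ?_
    field_simp
    ring
  have h5 := h3.cexp.div h2 (cpow_half_ne_zero ht)
  refine (h5.comp_ofReal).congr_deriv ?_
  rw [Complex.cpow_sub _ _ (four_pi_I_mul_ne_zero ht), Complex.cpow_one, diracEvolution]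
  have h6 := cpow_half_ne_zero ht
  set z := (4 * Real.pi * Complex.I * t : ℂ) ^ (1 / 2 : ℂ)
  field_simp

theorem hasDerivAt_diracEvolution_space (k : ℤ) (t x : ℝ) :
    HasDerivAt (fun x => diracEvolution k t x)
      (diracEvolution k t x * (Complex.I * (x - k) / (2 * t))) x := by
  have h1 : HasDerivAt (fun z : ℂ => Complex.I * (z - k) ^ 2 / (4 * t))
      (Complex.I * (x - k) / (2 * t)) (x : ℂ) := by
    have h2 := ((((hasDerivAt_id (x : ℂ)).sub_const (k : ℂ)).pow 2).const_mul Complex.I).div_const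
      (4 * (t : ℂ))
    refine h2.congr_deriv ?_
    simp only [id]
    push_cast
    by_cases ht : (t : ℂ) = 0
    · simp [ht]
    · field_simp
      ring
  refine ((h1.cexp.div_const ((4 * Real.pi * Complex.I * t : ℂ) ^ (1 / 2 : ℂ))).comp_ofReal
    ).congr_deriv ?_
  rw [diracEvolution]
  ring

theorem hasDerivAt_diracEvolution_space_two (k : ℤ) {t : ℝ} (ht : t ≠ 0) (x : ℝ) :
    HasDerivAt (fun x : ℝ => diracEvolution k t x * (Complex.I * (x - k) / (2 * t)))
      (diracEvolution k t x * (-((x - k) ^ 2 / (4 * t ^ 2)) + Complex.I / (2 * t))) x := by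
  have htc : (t : ℂ) ≠ 0 := by exact_mod_cast ht
  have h1 : HasDerivAt (fun x : ℝ => Complex.I * ((x : ℂ) - k) / (2 * t)) (Complex.I / (2 * t)) x := by
    have h2 := ((((hasDerivAt_id (x : ℂ)).sub_const (k : ℂ))).const_mul Complex.I).div_const
      (2 * (t : ℂ))
    refine h2.comp_ofReal.congr_deriv ?_
    ring
  refine ((hasDerivAt_diracEvolution_space k t x).mul h1).congr_deriv ?_
  have := Complex.I_sq
  field_simp
  linear_combination (4 * diracEvolution k t x * (x - k) ^ 2) * this

theorem continuousOn_diracEvolution (k : ℤ) :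
    ContinuousOn (fun p : ℝ × ℝ => diracEvolution k p.1 p.2) {p | p.1 ≠ 0} := by
  unfold diracEvolution
  refine ContinuousOn.div (Continuous.comp_continuousOn Complex.continuous_exp ?_) ?_
    fun p hp => cpow_half_ne_zero hp
  · refine ContinuousOn.div (by fun_prop) (by fun_prop) fun p hp => ?_
    exact mul_ne_zero (by norm_num) (Complex.ofReal_ne_zero.2 hp)
  · exact ContinuousOn.cpow_const (by fun_prop) fun p hp => four_pi_I_mul_mem_slitPlane hp

theorem continuousAt_waveAmp {t : ℝ} (ht : t ≠ 0) : ContinuousAt waveAmp t := by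
  unfold waveAmp
  refine Real.continuous_sqrt.continuousAt.comp (ContinuousAt.div (by fun_prop) (by fun_prop) ?_)
  exact mul_ne_zero (mul_ne_zero (by norm_num) Real.pi_ne_zero) (abs_ne_zero.2 ht)

theorem continuous_l1 (hs : 1 / 2 < s) : Continuous (l1 s) := by
  refine LipschitzWith.continuous (K := NNReal.mk (√(2 * wtConst s)) (Real.sqrt_nonneg _)) ?_
  refine LipschitzWith.of_le_add_mul _ fun x y => ?_
  have h1 : l1 s x ≤ l1 s y + l1 s (x - y) := by
    unfold l1
    rw [← (summable_norm_seq hs y).tsum_add (summable_norm_seq hs (x - y))]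
    refine (summable_norm_seq hs x).tsum_le_tsum (fun k => ?_)
      ((summable_norm_seq hs y).add (summable_norm_seq hs (x - y)))
    rw [seq_sub]
    refine (norm_add_le _ _).trans' (le_of_eq ?_)
    rw [add_sub_cancel]
  have h2 := l1_le hs (x - y)
  rw [dist_eq_norm]
  exact h1.trans (add_le_add le_rfl h2)

theorem continuous_seq (s : ℝ) (hs : 0 ≤ s) (k : ℤ) : Continuous fun x : L2 => seq s x k := by
  refine LipschitzWith.continuous (K := 1) (LipschitzWith.of_dist_le_mul fun x y => ?_)
  rw [dist_eq_norm, dist_eq_norm, ← seq_sub, NNReal.coe_one, one_mul]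
  exact norm_seq_le hs _ k

theorem continuousAt_synth (hs : 1 / 2 < s) {B : ℝ → L2} {t x : ℝ} (ht : t ≠ 0)
    (hB : ContinuousAt B t) : ContinuousAt (fun p : ℝ × ℝ => synth s p.1 (B p.1) p.2) (t, x) := by
  have hne : ∀ᶠ p : ℝ × ℝ in 𝓝 (t, x), p.1 ≠ 0 := continuousAt_fst.eventually_ne ht
  have h1 : Tendsto (fun p : ℝ × ℝ => synth s p.1 (B t) p.2) (𝓝 (t, x)) (𝓝 (synth s t (B t) x)) := by
    unfold synth
    refine tendsto_tsum_of_dominated_convergence (bound := fun k => (waveAmp t + 1) * ‖seq s (B t) k‖)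
      ((summable_norm_seq hs _).mul_left _) (fun k => ?_) ?_
    · exact (((continuousOn_diracEvolution k).continuousAt (x := (t, x)) hne).tendsto).const_mul _
    · have h2 : ∀ᶠ p : ℝ × ℝ in 𝓝 (t, x), waveAmp p.1 < waveAmp t + 1 :=
        ((continuousAt_waveAmp ht).comp' (x := (t, x)) continuousAt_fst).eventually_lt_const
          (by simp)
      filter_upwards [hne, h2] with p hp hp2 k
      rw [norm_synthTerm hp]
      gcongr
  have h2 : Tendsto (fun p : ℝ × ℝ => synth s p.1 (B p.1 - B t) p.2) (𝓝 (t, x)) (𝓝 0) := by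
    refine squeeze_zero_norm' (a := fun p : ℝ × ℝ => waveAmp p.1 * l1 s (B p.1 - B t)) ?_ ?_
    · filter_upwards [hne] with p hp using norm_synth_le hs hp _ _
    · have h3 : Tendsto (fun p : ℝ × ℝ => waveAmp p.1) (𝓝 (t, x)) (𝓝 (waveAmp t)) :=
        (continuousAt_waveAmp ht).comp' (x := (t, x)) continuousAt_fst
      have h4 : Tendsto (fun p : ℝ × ℝ => l1 s (B p.1 - B t)) (𝓝 (t, x)) (𝓝 (l1 s (B t - B t))) :=
        (continuous_l1 hs).continuousAt.tendsto.comp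
          ((hB.tendsto.comp (continuousAt_fst (p := (t, x)))).sub_const (B t))
      have h5 := h3.mul h4
      rw [sub_self, show l1 s (0 : L2) = 0 by simp [l1], mul_zero] at h5
      exact h5
  have h3 := h2.add h1
  rw [zero_add] at h3
  refine h3.congr' ?_
  filter_upwards [hne] with p hp
  rw [synth_sub hs hp, sub_add_cancel]

theorem continuousOn_synth (hs : 1 / 2 < s) {B : ℝ → L2} {T : ℝ} (hB : ContinuousOn B (Ioo 0 T)) :
    ContinuousOn (fun p : ℝ × ℝ => synth s p.1 (B p.1) p.2) (Ioo 0 T ×ˢ univ) := fun _ hp =>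
  (continuousAt_synth hs hp.1.1.ne' (hB.continuousAt (Ioo_mem_nhds hp.1.1 hp.1.2))).continuousWithinAt

/-- Termwise integration of `∑ₖ Bₖ(t) e^{itΔ}δ_k` against a test function. -/
theorem hasSum_integral_synth (hs : 1 / 2 < s) {B : ℝ → L2} {T : ℝ}
    (hB : ContinuousOn B (Ioo 0 T)) {ψ : ℝ × ℝ → ℂ} (hψ : Continuous ψ)
    (kψ : HasCompactSupport ψ) (sψ : tsupport ψ ⊆ Ioo 0 T ×ˢ univ) :
    HasSum (fun k => ∫ p : ℝ × ℝ, seq s (B p.1) k * diracEvolution k p.1 p.2 * ψ p)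
      (∫ p : ℝ × ℝ, synth s p.1 (B p.1) p.2 * ψ p) := by
  have hΩ : IsOpen (Ioo (0 : ℝ) T ×ˢ (univ : Set ℝ)) := isOpen_Ioo.prod isOpen_univ
  have hBp : ContinuousOn (fun p : ℝ × ℝ => B p.1) (Ioo 0 T ×ˢ univ) :=
    hB.comp continuousOn_fst fun _ hp => hp.1
  have hw : ∀ k, ContinuousOn (fun p : ℝ × ℝ => diracEvolution k p.1 p.2) (Ioo 0 T ×ˢ univ) :=
    fun k => (continuousOn_diracEvolution k).mono fun p hp => hp.1.1.ne'
  have hz : ∀ p, p ∉ Ioo (0 : ℝ) T ×ˢ (univ : Set ℝ) → ψ p = 0 := fun p hp =>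
    image_eq_zero_of_notMem_tsupport fun h => hp (sψ h)
  have hb : ContinuousOn (fun p : ℝ × ℝ => ((waveAmp p.1 * l1 s (B p.1) : ℝ) : ℂ))
      (Ioo 0 T ×ˢ univ) := by
    refine Complex.continuous_ofReal.comp_continuousOn (ContinuousOn.mul ?_
      ((continuous_l1 hs).comp_continuousOn hBp))
    exact fun p hp => ((continuousAt_waveAmp hp.1.1.ne').comp' continuousAt_fst).continuousWithinAt
  have hbi := (continuous_mul_of_tsupport_subset hΩ hb hψ sψ).integrable_of_hasCompactSupport
    (μ := volume) kψ.mul_left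
  refine hasSum_integral_of_dominated_convergence
    (fun k p => ‖seq s (B p.1) k * diracEvolution k p.1 p.2 * ψ p‖) (fun k => ?_)
    (fun k => Eventually.of_forall fun p => le_rfl) (Eventually.of_forall fun p => ?_) ?_
    (Eventually.of_forall fun p => ?_)
  · exact (continuous_mul_of_tsupport_subset hΩ (((continuous_seq s (by linarith) k).comp_continuousOn
      hBp).mul (hw k)) hψ sψ).aestronglyMeasurable
  · by_cases hp : p ∈ Ioo (0 : ℝ) T ×ˢ (univ : Set ℝ)
    · simp only [norm_mul _ (ψ p)]
      exact (summable_norm_synth hs hp.1.1.ne' _ _).mul_right _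
    · simp [hz p hp, summable_zero]
  · refine hbi.norm.congr (Eventually.of_forall fun p => ?_)
    by_cases hp : p ∈ Ioo (0 : ℝ) T ×ˢ (univ : Set ℝ)
    · simp only [norm_mul _ (ψ p), norm_synthTerm hp.1.1.ne', tsum_mul_right, tsum_mul_left]
      rw [Complex.norm_real, Real.norm_of_nonneg (mul_nonneg (waveAmp_nonneg _) (l1_nonneg _ _))]
      rfl
    · simp [hz p hp]
  · by_cases hp : p ∈ Ioo (0 : ℝ) T ×ˢ (univ : Set ℝ)
    · exact (summable_synth hs hp.1.1.ne' _ _).hasSum.mul_right _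
    · simp [hz p hp, hasSum_zero]

end DiracNLS

end

noncomputable section

namespace DiracNLS

open scoped ENNReal ComplexConjugate

variable {s : ℝ}

/-! ### The weak form of the equation -/

theorem hasDerivAt_seq (s : ℝ) {A : ℝ → L2} {A' : L2} {t : ℝ} (h : HasDerivAt A A' t) (k : ℤ) :
    HasDerivAt (fun t => seq s (A t) k) (seq s A' k) t :=
  HasDerivAt.div_const (((lp.evalCLM (𝕜 := ℂ) (fun _ : ℤ => ℂ) (p := 2)
    k).hasFDerivAt.restrictScalars ℝ).comp_hasDerivAt t h) _

/-- The series is integrated term by term and each term by parts. As `e^{itΔ}δ_k` solves the free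
equation, only the derivative of the coefficient remains. -/
theorem integral_weak_synth (hs : 1 / 2 < s) {A A' : ℝ → L2} {T : ℝ}
    (hA : ∀ t ∈ Ioo 0 T, HasDerivAt A (A' t) t) (hA' : ContinuousOn A' (Ioo 0 T))
    {φ : ℝ → ℝ → ℂ} {φt φx φxx : ℝ × ℝ → ℂ} (hφ : TestPartials φ φt φx φxx)
    (cφ : Continuous (Function.uncurry φ)) (kφ : HasCompactSupport (Function.uncurry φ))
    (sφ : tsupport (Function.uncurry φ) ⊆ Ioo 0 T ×ˢ univ) :
    ∫ p : ℝ × ℝ, synth s p.1 (A p.1) p.2 * (-(Complex.I * φt p) + φxx p) =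
      ∫ p : ℝ × ℝ, Complex.I * (synth s p.1 (A' p.1) p.2 * Function.uncurry φ p) := by
  set Φ := Function.uncurry φ
  have hs0 : 0 ≤ s := by linarith
  have hΩ : IsOpen (Ioo (0 : ℝ) T ×ˢ (univ : Set ℝ)) := isOpen_Ioo.prod isOpen_univ
  have hAc : ContinuousOn A (Ioo 0 T) := fun t ht => (hA t ht).continuousAt.continuousWithinAt
  have cψ : Continuous fun p => -(Complex.I * φt p) + φxx p :=
    ((continuous_const.mul hφ.ct).neg).add hφ.cxx
  have uψ : Function.support (fun p => -(Complex.I * φt p) + φxx p) ⊆ tsupport Φ := fun p hp => by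
    by_contra h
    refine hp ?_
    have h1 : φt p = 0 := image_eq_zero_of_notMem_tsupport fun h' => h (hφ.st h')
    have h2 : φxx p = 0 := image_eq_zero_of_notMem_tsupport fun h' => h (hφ.sxx h')
    simp [h1, h2]
  have kψ : HasCompactSupport fun p => -(Complex.I * φt p) + φxx p := kφ.mono' uψ
  have sψ : tsupport (fun p => -(Complex.I * φt p) + φxx p) ⊆ Ioo 0 T ×ˢ univ :=
    (closure_minimal uψ (isClosed_tsupport Φ)).trans sφ
  have e1 := (hasSum_integral_synth hs hAc cψ kψ sψ).tsum_eq
  have e2 := (hasSum_integral_synth hs hA' cφ kφ sφ).tsum_eq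
  rw [← e1, integral_const_mul, ← e2, ← tsum_mul_left]
  refine tsum_congr fun k => ?_
  have hw : ContinuousOn (fun p : ℝ × ℝ => diracEvolution k p.1 p.2) (Ioo 0 T ×ˢ univ) :=
    (continuousOn_diracEvolution k).mono fun p hp => hp.1.1.ne'
  have hp : ∀ {B : ℝ → L2}, ContinuousOn B (Ioo 0 T) →
      ContinuousOn (fun p : ℝ × ℝ => seq s (B p.1) k) (Ioo 0 T ×ˢ univ) := fun hB =>
    (continuous_seq s hs0 k).comp_continuousOn (hB.comp continuousOn_fst fun _ hp => hp.1)
  have htc : ∀ p ∈ Ioo (0 : ℝ) T ×ˢ (univ : Set ℝ), (p.1 : ℂ) ≠ 0 := fun p hp =>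
    Complex.ofReal_ne_zero.2 hp.1.1.ne'
  have hcoef : ∀ p ∈ Ioo (0 : ℝ) T ×ˢ (univ : Set ℝ), (4 * (p.1 : ℂ) ^ 2) ≠ 0 := fun p hp =>
    mul_ne_zero (by norm_num) (pow_ne_zero _ (htc p hp))
  have hcoef2 : ∀ p ∈ Ioo (0 : ℝ) T ×ˢ (univ : Set ℝ), (2 * (p.1 : ℂ)) ≠ 0 := fun p hp =>
    mul_ne_zero (by norm_num) (htc p hp)
  have e3 := integral_schrodinger_by_parts hΩ hφ cφ kφ sφ
    (f := fun p => seq s (A p.1) k * diracEvolution k p.1 p.2)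
    (ft := fun p => seq s (A' p.1) k * diracEvolution k p.1 p.2 + seq s (A p.1) k *
      (diracEvolution k p.1 p.2 * (-(Complex.I * (p.2 - k) ^ 2 / (4 * p.1 ^ 2)) - 1 / (2 * p.1))))
    (fx := fun p => seq s (A p.1) k *
      (diracEvolution k p.1 p.2 * (Complex.I * (p.2 - k) / (2 * p.1))))
    (fxx := fun p => seq s (A p.1) k * (diracEvolution k p.1 p.2 *
      (-((p.2 - k) ^ 2 / (4 * p.1 ^ 2)) + Complex.I / (2 * p.1))))
    ((hp hAc).mul hw)
    (((hp hA').mul hw).add ((hp hAc).mul (hw.mul (((ContinuousOn.div (by fun_prop) (by fun_prop)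
      hcoef).neg).sub (ContinuousOn.div (by fun_prop) (by fun_prop) hcoef2)))))
    ((hp hAc).mul (hw.mul (ContinuousOn.div (by fun_prop) (by fun_prop) hcoef2)))
    ((hp hAc).mul (hw.mul (((ContinuousOn.div (by fun_prop) (by fun_prop)
      hcoef).neg).add (ContinuousOn.div (by fun_prop) (by fun_prop) hcoef2))))
    (fun p hp => (hasDerivAt_seq s (hA p.1 hp.1) k).mul
      (hasDerivAt_diracEvolution_time k hp.1.1.ne' p.2))
    (fun p _ => (hasDerivAt_diracEvolution_space k p.1 p.2).const_mul (seq s (A p.1) k))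
    (fun p hp => (hasDerivAt_diracEvolution_space_two k hp.1.1.ne' p.2).const_mul
      (seq s (A p.1) k))
  refine e3.trans ?_
  rw [← integral_const_mul]
  refine integral_congr_ae (Eventually.of_forall fun p => ?_)
  have := Complex.I_sq
  simp only
  linear_combination (-(seq s (A p.1) k * diracEvolution k p.1 p.2 * (p.2 - k) ^ 2 / (4 * p.1 ^ 2))
    * Φ p) * this

/-- The weak form of the equation, in terms of the coefficients. -/
theorem integral_equation_synth (hs : 1 / 2 < s) {A A' : ℝ → L2} {T : ℝ}
    (hA : ∀ t ∈ Ioo 0 T, HasDerivAt A (A' t) t) (hA' : ContinuousOn A' (Ioo 0 T)) (σ M : ℝ)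
    {φ : ℝ → ℝ → ℂ} (dφ : ContDiff ℝ ∞ (Function.uncurry φ))
    (kφ : HasCompactSupport (Function.uncurry φ))
    (sφ : tsupport (Function.uncurry φ) ⊆ Ioo 0 T ×ˢ univ) {u : ℝ → ℝ → ℂ}
    (hu : ∀ t ∈ Ioo 0 T, ∀ x, u t x = synth s t (A t) x) :
    ∫ p : ℝ × ℝ,
      (u p.1 p.2 * (-(Complex.I * deriv (fun t => φ t p.2) p.1) + iteratedDeriv 2 (φ p.1) p.2) +
        (σ / 2) * (‖u p.1 p.2‖ ^ 2 - M / (2 * Real.pi * p.1)) * u p.1 p.2 * φ p.1 p.2) =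
    ∫ p : ℝ × ℝ, Complex.I * (synth s p.1
      (A' p.1 - field s (σ / (8 * Real.pi)) M p.1 (A p.1)) p.2 * Function.uncurry φ p) := by
  obtain ⟨φt, φx, φxx, hφ⟩ := exists_testPartials dφ
  set Φ := Function.uncurry φ
  have hΩ : IsOpen (Ioo (0 : ℝ) T ×ˢ (univ : Set ℝ)) := isOpen_Ioo.prod isOpen_univ
  have hAc : ContinuousOn A (Ioo 0 T) := fun t ht => (hA t ht).continuousAt.continuousWithinAt
  have hFc : ContinuousOn (fun t => field s (σ / (8 * Real.pi)) M t (A t)) (Ioo 0 T) := fun t ht =>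
    (continuousAt_field hs _ _ ht.1.ne' (hA t ht).continuousAt).continuousWithinAt
  have kt : HasCompactSupport φt := kφ.mono' (subset_tsupport _ |>.trans hφ.st)
  have kxx : HasCompactSupport φxx := kφ.mono' (subset_tsupport _ |>.trans hφ.sxx)
  have cA := continuousOn_synth hs hAc
  have c1 := continuous_mul_of_tsupport_subset hΩ cA hφ.ct (hφ.st.trans sφ)
  have c2 := continuous_mul_of_tsupport_subset hΩ cA hφ.cxx (hφ.sxx.trans sφ)
  have c3 := continuous_mul_of_tsupport_subset hΩ (continuousOn_synth hs hFc) dφ.continuous sφ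
  have c4 := continuous_mul_of_tsupport_subset hΩ (continuousOn_synth hs hA') dφ.continuous sφ
  have i1 : Integrable fun p : ℝ × ℝ =>
      synth s p.1 (A p.1) p.2 * (-(Complex.I * φt p) + φxx p) := by
    have h := ((c1.integrable_of_hasCompactSupport (μ := volume) kt.mul_left).const_mul
      (-Complex.I)).add (c2.integrable_of_hasCompactSupport (μ := volume) kxx.mul_left)
    refine h.congr (Eventually.of_forall fun p => ?_)
    simp only [Pi.add_apply]
    ring
  have i3 : Integrable fun p : ℝ × ℝ => Complex.I * (synth s p.1
      (field s (σ / (8 * Real.pi)) M p.1 (A p.1)) p.2 * Φ p) :=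
    (c3.integrable_of_hasCompactSupport kφ.mul_left).const_mul _
  have i4 : Integrable fun p : ℝ × ℝ => Complex.I * (synth s p.1 (A' p.1) p.2 * Φ p) :=
    (c4.integrable_of_hasCompactSupport kφ.mul_left).const_mul _
  have e1 : ∀ p : ℝ × ℝ,
      (u p.1 p.2 * (-(Complex.I * deriv (fun t => φ t p.2) p.1) + iteratedDeriv 2 (φ p.1) p.2) +
        (σ / 2) * (‖u p.1 p.2‖ ^ 2 - M / (2 * Real.pi * p.1)) * u p.1 p.2 * φ p.1 p.2) =
      synth s p.1 (A p.1) p.2 * (-(Complex.I * φt p) + φxx p) - Complex.I * (synth s p.1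
        (field s (σ / (8 * Real.pi)) M p.1 (A p.1)) p.2 * Φ p) := by
    intro p
    have d1 : deriv (fun t => φ t p.2) p.1 = φt p := (hφ.ht p).deriv
    have d2 : iteratedDeriv 2 (φ p.1) p.2 = φxx p := by
      rw [iteratedDeriv_succ, iteratedDeriv_one,
        show deriv (φ p.1) = fun x => φx (p.1, x) from funext fun x => (hφ.hx (p.1, x)).deriv]
      exact (hφ.hxx p).deriv
    rw [d1, d2]
    change _ + _ * Φ p = _
    by_cases hp : p ∈ Ioo (0 : ℝ) T ×ˢ (univ : Set ℝ)
    · have h1 := nonlinearity_synth hs hp.1.1.ne' M (A p.1) p.2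
      rw [hu p.1 hp.1, field, synth_smul]
      rw [abs_of_pos hp.1.1] at h1 ⊢
      have hpi : (Real.pi : ℂ) ≠ 0 := by exact_mod_cast Real.pi_ne_zero
      have h2 : (p.1 : ℂ) ≠ 0 := Complex.ofReal_ne_zero.2 hp.1.1.ne'
      have := Complex.I_sq
      push_cast at h1 ⊢
      -- The constant `c = σ/(8π)` of the coefficient equation is the product of the coupling `σ/2`
      -- and the amplitude `1/(4π)` of the cubic product.
      have h3 : (σ / 2 : ℂ) * (1 / (4 * Real.pi * p.1)) = σ / (8 * Real.pi) / p.1 := by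
        field_simp
        ring
      linear_combination (σ / 2 * Φ p) * h1 +
        (synth s p.1 (nonlin s M p.1 (A p.1)) p.2 * Φ p) * h3 +
        (σ / (8 * Real.pi) / p.1 * synth s p.1 (nonlin s M p.1 (A p.1)) p.2 * Φ p) * this
    · have h0 : p ∉ tsupport Φ := fun h => hp (sφ h)
      rw [image_eq_zero_of_notMem_tsupport h0,
        image_eq_zero_of_notMem_tsupport fun h' => h0 (hφ.st h'),
        image_eq_zero_of_notMem_tsupport fun h' => h0 (hφ.sxx h')]
      simp
  rw [integral_congr_ae (Eventually.of_forall e1), integral_sub i1 i3,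
    integral_weak_synth hs hA hA' hφ dφ.continuous kφ sφ, ← integral_sub i4 i3]
  refine integral_congr_ae (Eventually.of_forall fun p => ?_)
  by_cases hp : p ∈ Ioo (0 : ℝ) T ×ˢ (univ : Set ℝ)
  · simp only [synth_sub hs hp.1.1.ne']
    ring
  · have h0 : p ∉ tsupport Φ := fun h => hp (sφ h)
    simp only
    rw [image_eq_zero_of_notMem_tsupport h0]
    simp

theorem isDistributionalSolution_synth (hs : 1 / 2 < s) {A : ℝ → L2} {T σ M : ℝ}
    (hA : ∀ t ∈ Ioo 0 T, HasDerivAt A (field s (σ / (8 * Real.pi)) M t (A t)) t) {u : ℝ → ℝ → ℂ}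
    (hu : ∀ t ∈ Ioo 0 T, ∀ x, u t x = synth s t (A t) x) :
    IsDistributionalSolution σ M T u := by
  have hAc : ContinuousOn A (Ioo 0 T) := fun t ht => (hA t ht).continuousAt.continuousWithinAt
  have hFc : ContinuousOn (fun t => field s (σ / (8 * Real.pi)) M t (A t)) (Ioo 0 T) := fun t ht =>
    (continuousAt_field hs _ _ ht.1.ne' (hA t ht).continuousAt).continuousWithinAt
  refine ⟨(continuousOn_synth hs hAc).congr fun p hp => hu p.1 hp.1 p.2, fun φ dφ kφ sφ => ?_⟩
  rw [integral_equation_synth hs hA hFc σ M dφ kφ sφ hu]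
  simp [synth]

/-- Testing shows that the function synthesized from `A' - field` vanishes almost everywhere, hence
everywhere by continuity, and for each time its coefficients vanish by `synth_injective`. Real test
functions suffice. -/
theorem eq_field_of_isDistributionalSolution (hs : 1 / 2 < s) {A A' : ℝ → L2} {T σ M : ℝ}
    (hA : ∀ t ∈ Ioo 0 T, HasDerivAt A (A' t) t) (hA' : ContinuousOn A' (Ioo 0 T)) {u : ℝ → ℝ → ℂ}
    (hu : ∀ t ∈ Ioo 0 T, ∀ x, u t x = synth s t (A t) x)
    (hsol : IsDistributionalSolution σ M T u) :
    ∀ t ∈ Ioo 0 T, A' t = field s (σ / (8 * Real.pi)) M t (A t) := by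
  have hΩ : IsOpen (Ioo (0 : ℝ) T ×ˢ (univ : Set ℝ)) := isOpen_Ioo.prod isOpen_univ
  have hFc : ContinuousOn (fun t => field s (σ / (8 * Real.pi)) M t (A t)) (Ioo 0 T) := fun t ht =>
    (continuousAt_field hs _ _ ht.1.ne' (hA t ht).continuousAt).continuousWithinAt
  have hc := continuousOn_synth hs (hA'.sub hFc)
  have h0 := hΩ.ae_eq_zero_of_integral_contDiff_smul_eq_zero (μ := volume)
    (hc.locallyIntegrableOn hΩ.measurableSet) fun g dg kg sg => by
      have hsupp : tsupport (fun p => ((g p : ℝ) : ℂ)) ⊆ tsupport g :=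
        closure_mono fun p hp h => hp (by simp [h])
      have h1 := integral_equation_synth hs hA hA' σ M (φ := fun t x => ((g (t, x) : ℝ) : ℂ))
        (Complex.ofRealCLM.contDiff.comp dg) (kg.comp_left (g := ((↑) : ℝ → ℂ)) rfl)
        (hsupp.trans sg) hu
      rw [hsol.2 (fun t x => ((g (t, x) : ℝ) : ℂ)) (Complex.ofRealCLM.contDiff.comp dg) (kg.comp_left (g := ((↑) : ℝ → ℂ)) rfl)
        (hsupp.trans sg), integral_const_mul] at h1
      have h2 := (mul_eq_zero.1 h1.symm).resolve_left Complex.I_ne_zero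
      rw [← h2]
      refine integral_congr_ae (Eventually.of_forall fun p => ?_)
      simp only [Complex.real_smul]
      rw [mul_comm]
      rfl
  have h1 : EqOn (fun p : ℝ × ℝ => synth s p.1 (A' p.1 - field s (σ / (8 * Real.pi)) M p.1 (A p.1))
      p.2) (fun _ => 0) (Ioo 0 T ×ˢ univ) :=
    Measure.eqOn_open_of_ae_eq ((ae_restrict_iff' hΩ.measurableSet).2 h0) hΩ hc continuousOn_const
  intro t ht
  refine sub_eq_zero.1 (synth_injective hs ht.1.ne' fun x => ?_)
  exact h1 (x := (t, x)) ⟨ht, mem_univ _⟩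

end DiracNLS

end

noncomputable section

namespace DiracNLS

open scoped ENNReal ComplexConjugate

variable {s : ℝ}

/-! ### Weighted sequences and curves of sequences -/

theorem exists_seq_eq {a : ℤ → ℂ} (ha : MemL2s s a) : ∃ x : L2, ∀ k, seq s x k = a k := by
  have h : Memℓp (fun k => (wt s k : ℂ) * a k) 2 := by
    rw [memℓp_two_iff]
    refine ha.congr fun k => ?_
    rw [norm_mul, mul_pow, Complex.norm_real, Real.norm_of_nonneg (wt_pos s k).le, wt_sq]
  refine ⟨⟨_, h⟩, fun k => ?_⟩
  have hw : (wt s k : ℂ) ≠ 0 := by exact_mod_cast (wt_pos s k).ne'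
  exact mul_div_cancel_left₀ _ hw

theorem memL2s_seq (s : ℝ) (x : L2) : MemL2s s (seq s x) := by
  refine x.summable_sq.congr fun k => ?_
  rw [norm_apply_eq s, mul_pow, wt_sq]

theorem l2sNorm_seq (s : ℝ) (x : L2) : l2sNorm s (seq s x) = ‖x‖ := by
  rw [l2sNorm, ← Real.sqrt_sq (norm_nonneg x), L2.norm_sq]
  congr 1
  refine tsum_congr fun k => ?_
  rw [norm_apply_eq s, mul_pow, wt_sq]

theorem seq_eq_iff (s : ℝ) (x : L2) (k : ℤ) (z : ℂ) :
    x k = (((1 + |(k : ℝ)|) ^ s : ℝ) : ℂ) * z ↔ seq s x k = z := by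
  have hw : (wt s k : ℂ) ≠ 0 := by exact_mod_cast (wt_pos s k).ne'
  rw [seq, div_eq_iff hw, mul_comm]
  rfl

theorem isL2sCurve_zero_iff {R : ℝ → ℤ → ℂ} {I : Set ℝ} :
    IsL2sCurve 0 s R I ↔
      ∃ r : ℝ → L2, ContinuousOn r I ∧ ∀ t ∈ I, ∀ k, seq s (r t) k = R t k := by
  simp only [IsL2sCurve, seq_eq_iff]
  simp

theorem isL2sCurve_one_iff {R : ℝ → ℤ → ℂ} {I : Set ℝ} (hI : IsOpen I) :
    IsL2sCurve 1 s R I ↔ ∃ r r' : ℝ → L2, (∀ t ∈ I, HasDerivAt r (r' t) t) ∧ ContinuousOn r' I ∧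
      ∀ t ∈ I, ∀ k, seq s (r t) k = R t k := by
  simp only [IsL2sCurve, seq_eq_iff]
  constructor
  · rintro ⟨r, hr, h⟩
    have hr' := (contDiffOn_succ_iff_deriv_of_isOpen (n := 0) hI).1 (by simpa using hr)
    exact ⟨r, deriv r, fun t ht => (hr'.1.differentiableAt (hI.mem_nhds ht)).hasDerivAt,
      hr'.2.2.continuousOn, h⟩
  · rintro ⟨r, r', hr, hr', h⟩
    refine ⟨r, ?_, h⟩
    have h1 : ContDiffOn ℝ (0 + 1) r I := by
      refine (contDiffOn_succ_iff_deriv_of_isOpen (n := 0) hI).2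
        ⟨fun t ht => (hr t ht).differentiableAt.differentiableWithinAt, by simp, ?_⟩
      exact contDiffOn_zero.2 (hr'.congr fun t ht => (hr t ht).deriv)
    simpa using h1

/-! ### The ansatz -/

/-- As `log √t = (log t)/2`, the phase `σ|α_k|²/(4π) · log √t` of the ansatz is `c|α_k|² log t`,
exactly what the inverse gauge inserts. -/
theorem ansatz_eq_synth {σ : ℝ} {t : ℝ} (ht : 0 < t) (x : ℝ) {R : ℝ → ℤ → ℂ} {α r : L2}
    (hr : ∀ k, seq s r k = R t k) :
    ansatz σ (seq s α) R t x = synth s t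
      (diag (phase (modSq s α) (-(σ / (8 * Real.pi) * Real.log t))) (α + r)) x := by
  have hpi : (Real.pi : ℂ) ≠ 0 := by exact_mod_cast Real.pi_ne_zero
  refine tsum_congr fun k => ?_
  rw [seq_diag (norm_phase_le _ _), seq_add, hr, phase]
  congr 3
  rw [modSq, Real.log_sqrt ht.le]
  push_cast
  field_simp
  ring

theorem continuousOn_diag_phase {θ : ℤ → ℝ} {f : ℝ → ℝ} {x : ℝ → L2} {I : Set ℝ}
    (hf : ContinuousOn f I) (hx : ContinuousOn x I) :
    ContinuousOn (fun t => diag (phase θ (f t)) (x t)) I := fun t ht => by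
  refine tendsto_diag (B := 1) (Eventually.of_forall fun τ k => norm_phase_le _ _ k)
    (norm_phase_le _ _) (fun k => ?_) (hx t ht)
  exact (by unfold phase; fun_prop : Continuous fun r => phase θ r k).continuousAt.tendsto.comp
    (hf t ht)

/-- The remainder is `a - α`, with `a` the gauged solution. It is `O(t)`, better than `t^γ` because
`γ < 1`, and `t R'` is the gauged field, which is bounded on balls. -/
theorem isAnsatzSolution_of_field_solution {γ σ : ℝ} (hs : 1 / 2 < s) (hγ : γ < 1) {α : L2}
    {T C : ℝ} {A : ℝ → L2} (hT : 0 < T)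
    (hA : ∀ t ∈ Ioo 0 T, HasDerivAt A (field s (σ / (8 * Real.pi)) (mass s α) t (A t)) t)
    (hC : ∀ t ∈ Ioo 0 T, ‖gauge s (σ / (8 * Real.pi)) α t (A t) - α‖ ≤ C * t) :
    IsAnsatzSolution s γ σ (seq s α) T (fun t x => synth s t (A t) x)
      (fun t => seq s (gauge s (σ / (8 * Real.pi)) α t (A t) - α)) := by
  have hs0 : 0 ≤ s := by linarith
  set c := σ / (8 * Real.pi)
  have ha := fun t (ht : t ∈ Ioo 0 T) =>
    hasDerivAt_gauge_of_tendsto hs hA (tendsto_of_norm_sub_le hT hC) ht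
  have hr := fun t (ht : t ∈ Ioo 0 T) => (ha t ht).sub_const α
  refine ⟨isDistributionalSolution_synth hs hA fun _ _ _ => rfl, fun t ht x => ?_, ?_, ?_⟩
  · rw [ansatz_eq_synth ht.1 x fun _ => rfl, add_sub_cancel]
    congr 1
    refine gauge_injective s c α t ?_
    rw [gauge_symm]
  · refine (isL2sCurve_one_iff isOpen_Ioo).2 ⟨_, _, hr, fun t ht => ?_, fun _ _ _ => rfl⟩
    exact ((continuousAt_inv₀ ht.1.ne').smul (continuousAt_gfield hs c (abs_modSq_le hs0 α) ht.1.ne'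
      (ha t ht).continuousAt)).continuousWithinAt
  · obtain ⟨D, hD⟩ := exists_bddLip_gfield hs c (abs_modSq_le hs0 α)
      (K := ‖α‖ + |C| * T + 1) (by have := norm_nonneg α; have := abs_nonneg C; nlinarith)
    refine ⟨|C| * T ^ (1 - γ) + D, fun t ht => add_le_add ?_ ?_⟩
    · rw [l2sNorm_seq]
      calc t ^ (-γ) * ‖gauge s c α t (A t) - α‖ ≤ t ^ (-γ) * (|C| * t) := by
            have h1 := Real.rpow_nonneg ht.1.le (-γ)
            refine mul_le_mul_of_nonneg_left ((hC t ht).trans ?_) h1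
            exact mul_le_mul_of_nonneg_right (le_abs_self C) ht.1.le
        _ = |C| * t ^ (1 - γ) := by
            rw [show (1 : ℝ) - γ = -γ + 1 by ring, Real.rpow_add_one ht.1.ne']
            ring
        _ ≤ |C| * T ^ (1 - γ) := by
            refine mul_le_mul_of_nonneg_left ?_ (abs_nonneg C)
            exact Real.rpow_le_rpow ht.1.le ht.2.le (by linarith)
    · have e : (fun k => deriv (fun τ => seq s (gauge s c α τ (A τ) - α) k) t) =
          seq s (t⁻¹ • gfield s c (modSq s α) t (gauge s c α t (A t))) :=
        funext fun k => (hasDerivAt_seq s (hr t ht) k).deriv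
      rw [e, l2sNorm_seq, norm_smul, norm_inv, Real.norm_of_nonneg ht.1.le, ← mul_assoc,
        mul_inv_cancel₀ ht.1.ne', one_mul]
      refine (hD t).bound _ ?_
      have h1 : ‖gauge s c α t (A t)‖ ≤ ‖gauge s c α t (A t) - α‖ + ‖α‖ := by
        simpa using norm_add_le (gauge s c α t (A t) - α) α
      have h2 : C * t ≤ |C| * T :=
        mul_le_mul (le_abs_self C) ht.2.le ht.1.le (abs_nonneg C)
      linarith [hC t ht]

/-- The regularity of the remainder makes the coefficients continuously differentiable, so the weak
equation can be read off coefficientwise; `γ > 0` provides the initial value of the gauged solution.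
-/
theorem exists_field_solution_of_isAnsatzSolution {γ σ T : ℝ} (hs : 1 / 2 < s) (hγ : 0 < γ)
    (hT : 0 < T) {α : L2} {u : ℝ → ℝ → ℂ} {R : ℝ → ℤ → ℂ}
    (h : IsAnsatzSolution s γ σ (seq s α) T u R) :
    ∃ A : ℝ → L2,
      (∀ t ∈ Ioo 0 T, HasDerivAt A (field s (σ / (8 * Real.pi)) (mass s α) t (A t)) t) ∧
      Tendsto (fun t => gauge s (σ / (8 * Real.pi)) α t (A t)) (𝓝[>] 0) (𝓝 α) ∧
      ∀ t ∈ Ioo 0 T, u t = synth s t (A t) ∧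
        R t = seq s (gauge s (σ / (8 * Real.pi)) α t (A t) - α) := by
  have hs0 : 0 ≤ s := by linarith
  set c := σ / (8 * Real.pi)
  obtain ⟨r, r', hr, hr', hrR⟩ := (isL2sCurve_one_iff isOpen_Ioo).1 h.regular
  obtain ⟨C, hC⟩ := h.bounded
  have hθ := abs_modSq_le hs0 α
  set θ := modSq s α
  set A : ℝ → L2 := fun t => diag (phase θ (-(c * Real.log t))) (α + r t)
  have hA := fun t (ht : t ∈ Ioo 0 T) => hasDerivAt_diag_phase hθ
    (((Real.hasDerivAt_log ht.1.ne').const_mul c).neg) ((hr t ht).const_add α)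
  have hlog : ContinuousOn (fun t => -(c * Real.log t)) (Ioo 0 T) :=
    (continuousOn_const.mul (Real.continuousOn_log.mono fun t ht => ht.1.ne')).neg
  have hrc : ContinuousOn r (Ioo 0 T) := fun t ht => (hr t ht).continuousAt.continuousWithinAt
  have hAc : ContinuousOn A (Ioo 0 T) := continuousOn_diag_phase hlog (continuousOn_const.add hrc)
  have hu : ∀ t ∈ Ioo 0 T, ∀ x, u t x = synth s t (A t) x := fun t ht x => by
    rw [h.eq_ansatz t ht, ansatz_eq_synth ht.1 x (hrR t ht)]
  have hg : ∀ t, gauge s c α t (A t) = α + r t := fun t => gauge_symm s c α t _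
  have hc' : ContinuousOn (fun t : ℝ => (((-(c * t⁻¹) : ℝ) : ℂ) * Complex.I)) (Ioo 0 T) := by
    refine (Complex.continuous_ofReal.comp_continuousOn ?_).mul continuousOn_const
    exact (continuousOn_const.mul (continuousOn_inv₀.mono fun t ht => ht.1.ne')).neg
  have hA'c := (hc'.smul ((diagL (fun k => (θ k : ℂ)) (norm_ofReal_le hθ)).continuous.comp_continuousOn
    hAc)).add (continuousOn_diag_phase (θ := θ) hlog hr')
  have hfield := eq_field_of_isDistributionalSolution hs hA hA'c hu h.solves
  refine ⟨A, fun t ht => (hA t ht).congr_deriv (hfield t ht), ?_, fun t ht =>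
    ⟨funext (hu t ht), ?_⟩⟩
  · simp only [hg]
    have h1 : Tendsto r (𝓝[>] 0) (𝓝 0) := by
      refine squeeze_zero_norm' (a := fun t => C * t ^ γ) ?_ ?_
      · filter_upwards [Ioo_mem_nhdsGT hT] with t ht
        have h2 := hC t ht
        rw [← funext (hrR t ht), l2sNorm_seq] at h2
        have h3 : 0 ≤ t * l2sNorm s (fun k => deriv (fun τ => R τ k) t) :=
          mul_nonneg ht.1.le (Real.sqrt_nonneg _)
        have h4 : t ^ (-γ) * ‖r t‖ ≤ C := by linarith
        rw [Real.rpow_neg ht.1.le, inv_mul_le_iff₀ (Real.rpow_pos_of_pos ht.1 γ)] at h4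
        linarith
      · have h2 : Tendsto (fun t : ℝ => C * t ^ γ) (𝓝 0) (𝓝 (C * 0 ^ γ)) :=
          ((Real.continuousAt_rpow_const 0 γ (Or.inr hγ.le)).tendsto).const_mul C
        rw [Real.zero_rpow hγ.ne', mul_zero] at h2
        exact tendsto_nhdsWithin_of_tendsto_nhds h2
    simpa using h1.const_add α
  · rw [hg, add_sub_cancel_left, ← funext (hrR t ht)]

/-- The statement for general coefficients. -/
theorem wellPosed_ansatz {γ : ℝ} (hs : 1 / 2 < s) (hγ0 : 0 < γ) (hγ1 : γ < 1) (σ : ℝ)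
    (α : ℤ → ℂ) (hα : MemL2s s α) :
    (∃ T : ℝ, 0 < T ∧ ∃ (u : ℝ → ℝ → ℂ) (R : ℝ → ℤ → ℂ), IsAnsatzSolution s γ σ α T u R) ∧
    (∀ T : ℝ, 0 < T → ∀ (u₁ u₂ : ℝ → ℝ → ℂ) (R₁ R₂ : ℝ → ℤ → ℂ),
      IsAnsatzSolution s γ σ α T u₁ R₁ → IsAnsatzSolution s γ σ α T u₂ R₂ →
      ∀ t ∈ Ioo 0 T, u₁ t = u₂ t ∧ R₁ t = R₂ t) ∧
    (1 ≤ s → ∃ (u : ℝ → ℝ → ℂ) (R : ℝ → ℤ → ℂ),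
      ∀ T : ℝ, 0 < T → IsAnsatzSolution s γ σ α T u R) := by
  obtain ⟨x, hx⟩ := exists_seq_eq hα
  obtain rfl : seq s x = α := funext hx
  refine ⟨?_, ?_, ?_⟩
  · obtain ⟨T, C, hT, A, hA⟩ := exists_field_solution hs (σ / (8 * Real.pi)) x
    exact ⟨T, hT, _, _, isAnsatzSolution_of_field_solution hs hγ1 hT (fun t ht => (hA t ht).1)
      fun t ht => (hA t ht).2⟩
  · intro T hT u₁ u₂ R₁ R₂ h₁ h₂ t ht
    obtain ⟨A, hA, hA0, hAu⟩ := exists_field_solution_of_isAnsatzSolution hs hγ0 hT h₁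
    obtain ⟨B, hB, hB0, hBu⟩ := exists_field_solution_of_isAnsatzSolution hs hγ0 hT h₂
    rw [(hAu t ht).1, (hAu t ht).2, (hBu t ht).1, (hBu t ht).2,
      field_solution_unique hs hA hB hA0 hB0 ht]
    exact ⟨rfl, rfl⟩
  · intro hs1
    obtain ⟨A, hA, hC⟩ := exists_global_field_solution hs1 (σ / (8 * Real.pi)) x
    refine ⟨fun t x' => synth s t (A t) x',
      fun t => seq s (gauge s (σ / (8 * Real.pi)) x t (A t) - x), fun T hT => ?_⟩
    obtain ⟨C, hC⟩ := hC T hT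
    exact isAnsatzSolution_of_field_solution hs hγ1 hT (fun t ht => hA t ht.1) hC

end DiracNLS

end

/-! ### Part (ii): combs of Dirac masses, equal moduli, negative times, Duhamel's formula. -/

noncomputable section

namespace DiracNLS

open scoped ENNReal ComplexConjugate

variable {s : ℝ}

/-! ### The kernel of the Schrödinger group -/

theorem schrodingerGroup_neg_apply (t : ℝ) (v : 𝓢'(ℝ, ℂ)) :
    schrodingerGroup (-t) (schrodingerGroup t v) = v := by
  unfold schrodingerGroup
  rw [TemperedDistribution.fourierMultiplierCLM_fourierMultiplierCLM_apply
    (schrodingerSymbol_hasTemperateGrowth _) (schrodingerSymbol_hasTemperateGrowth _),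
    show schrodingerSymbol t * schrodingerSymbol (-t) = fun _ => 1 from ?_]
  · simp
  · funext ξ
    rw [Pi.mul_apply, schrodingerSymbol, schrodingerSymbol, ← Complex.exp_add]
    simp

theorem schrodingerGroup_apply_neg (t : ℝ) (v : 𝓢'(ℝ, ℂ)) :
    schrodingerGroup t (schrodingerGroup (-t) v) = v := by
  simpa using schrodingerGroup_neg_apply (-t) v

/-- The Fourier transform is symmetric. -/
theorem integral_fourier_mul_eq_flip {f g : ℝ → ℂ} (hf : Integrable f) (hg : Integrable g) :
    ∫ ξ, 𝓕 f ξ * g ξ = ∫ x, f x * 𝓕 g x := by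
  have h := VectorFourier.integral_fourierIntegral_smul_eq_flip (L := innerₗ ℝ)
    Real.continuous_fourierChar continuous_inner hf hg
  rw [flip_innerₗ] at h
  exact h

theorem norm_cexp_neg_pi_mul (b : ℂ) (hb : 0 ≤ b.re) (y v : ℝ) :
    ‖Complex.exp (-Real.pi * b * v ^ 2 + 2 * Real.pi * (Complex.I * y) * v)‖ ≤ 1 := by
  rw [Complex.norm_exp, Real.exp_le_one_iff]
  have e : (-Real.pi * b * v ^ 2 + 2 * Real.pi * (Complex.I * y) * v : ℂ) =
      ((-Real.pi * v ^ 2 : ℝ) : ℂ) * b + ((2 * Real.pi * y * v : ℝ) : ℂ) * Complex.I := by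
    push_cast; ring
  rw [e, Complex.add_re, Complex.re_ofReal_mul, Complex.re_ofReal_mul, Complex.I_re, mul_zero,
    add_zero]
  have h := mul_nonneg (mul_nonneg Real.pi_pos.le (sq_nonneg v)) hb
  linarith

theorem norm_cexp_neg_pi_div_mul {b : ℂ} (hb : 0 ≤ b.re) (y x : ℝ) :
    ‖Complex.exp (-Real.pi / b * (x + Complex.I * (Complex.I * y)) ^ 2)‖ ≤ 1 := by
  rw [Complex.norm_exp, Real.exp_le_one_iff]
  have e : (-Real.pi / b * (x + Complex.I * (Complex.I * y)) ^ 2 : ℂ) =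
      ((-(Real.pi * (x - y) ^ 2) : ℝ) : ℂ) * b⁻¹ := by
    have h := Complex.I_sq
    have : (x + Complex.I * (Complex.I * y) : ℂ) = x - y := by linear_combination (y : ℂ) * h
    rw [this]
    push_cast
    ring
  rw [e, Complex.re_ofReal_mul, Complex.inv_re]
  have h1 : 0 ≤ b.re / Complex.normSq b := div_nonneg hb (Complex.normSq_nonneg b)
  have h := mul_nonneg (mul_nonneg Real.pi_pos.le (sq_nonneg (x - y))) h1
  linarith

theorem integral_gaussian_mul_fourier {b : ℂ} (hb : 0 < b.re) (y : ℝ) (φ : 𝓢(ℝ, ℂ)) :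
    ∫ v : ℝ, 𝓕 (φ : ℝ → ℂ) v *
        Complex.exp (-Real.pi * b * v ^ 2 + 2 * Real.pi * (Complex.I * y) * v) =
      ∫ x : ℝ, φ x * (1 / b ^ (1 / 2 : ℂ) *
        Complex.exp (-Real.pi / b * (x + Complex.I * (Complex.I * y)) ^ 2)) := by
  have hpi := Real.pi_pos
  have h1 : Integrable fun v : ℝ =>
      Complex.exp (-Real.pi * b * v ^ 2 + 2 * Real.pi * (Complex.I * y) * v) := by
    have h2 := integrable_cexp_quadratic (b := Real.pi * b) (by simpa using mul_pos hpi hb)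
      (2 * Real.pi * (Complex.I * y)) 0
    refine h2.congr (Eventually.of_forall fun v => ?_)
    simp only
    congr 1
    ring
  rw [integral_fourier_mul_eq_flip φ.integrable h1, fourier_gaussian_pi' hb]

/-- The Gaussian identity is used with parameter `4πit + ε` and `ε → 0⁺`. Both exponentials have
modulus at most `1` when the real part is nonnegative, so the Schwartz functions dominate; the
square root is continuous because `4πit` avoids the branch cut. -/
theorem integral_schrodingerSymbol {t : ℝ} (ht : t ≠ 0) (y : ℝ) (φ : 𝓢(ℝ, ℂ)) :
    ∫ v : ℝ, 𝓕 (φ : ℝ → ℂ) v * Complex.exp (-Real.pi * (4 * Real.pi * Complex.I * t) * v ^ 2 +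
        2 * Real.pi * (Complex.I * y) * v) =
      ∫ x : ℝ, φ x * (1 / (4 * Real.pi * Complex.I * t : ℂ) ^ (1 / 2 : ℂ) *
        Complex.exp (-Real.pi / (4 * Real.pi * Complex.I * t) *
          (x + Complex.I * (Complex.I * y)) ^ 2)) := by
  set b : ℝ → ℂ := fun ε => 4 * Real.pi * Complex.I * t + ε
  have hb0 : b 0 = 4 * Real.pi * Complex.I * t := by simp [b]
  have hbre : ∀ ε, (b ε).re = ε := fun ε => by simp [b]
  have hbt : Tendsto b (𝓝[>] 0) (𝓝 (4 * Real.pi * Complex.I * t)) := by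
    rw [← hb0]
    exact tendsto_nhdsWithin_of_tendsto_nhds
      ((by fun_prop : Continuous b).tendsto 0)
  have hpow : Tendsto (fun ε => 1 / (b ε) ^ (1 / 2 : ℂ)) (𝓝[>] 0)
      (𝓝 (1 / (4 * Real.pi * Complex.I * t : ℂ) ^ (1 / 2 : ℂ))) := by
    refine Tendsto.div tendsto_const_nhds ?_ (cpow_half_ne_zero ht)
    exact (continuousAt_cpow_const (four_pi_I_mul_mem_slitPlane ht)).tendsto.comp hbt
  have hF : (𝓕 (φ : ℝ → ℂ)) = ((𝓕 φ : 𝓢(ℝ, ℂ)) : ℝ → ℂ) := (SchwartzMap.fourier_coe φ).symm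
  have hL : Tendsto (fun ε => ∫ v : ℝ, 𝓕 (φ : ℝ → ℂ) v *
      Complex.exp (-Real.pi * b ε * v ^ 2 + 2 * Real.pi * (Complex.I * y) * v)) (𝓝[>] 0)
      (𝓝 (∫ v : ℝ, 𝓕 (φ : ℝ → ℂ) v * Complex.exp (-Real.pi * (4 * Real.pi * Complex.I * t) * v ^ 2 +
        2 * Real.pi * (Complex.I * y) * v))) := by
    rw [hF]
    refine tendsto_integral_filter_of_dominated_convergence (fun v => ‖(𝓕 φ : 𝓢(ℝ, ℂ)) v‖)
      (Eventually.of_forall fun ε => ((𝓕 φ : 𝓢(ℝ, ℂ)).continuous.mul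
        (by fun_prop)).aestronglyMeasurable) ?_ (𝓕 φ : 𝓢(ℝ, ℂ)).integrable.norm
      (Eventually.of_forall fun v => ?_)
    · filter_upwards [self_mem_nhdsWithin] with ε hε
      refine Eventually.of_forall fun v => ?_
      rw [norm_mul]
      exact mul_le_of_le_one_right (norm_nonneg _)
        (norm_cexp_neg_pi_mul _ (by rw [hbre]; exact le_of_lt hε) y v)
    · refine Tendsto.const_mul _ ((Complex.continuous_exp.tendsto _).comp ?_)
      exact ((hbt.const_mul _).mul_const _).add_const _
  have hR : Tendsto (fun ε => ∫ x : ℝ, φ x * (1 / (b ε) ^ (1 / 2 : ℂ) *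
      Complex.exp (-Real.pi / b ε * (x + Complex.I * (Complex.I * y)) ^ 2))) (𝓝[>] 0)
      (𝓝 (∫ x : ℝ, φ x * (1 / (4 * Real.pi * Complex.I * t : ℂ) ^ (1 / 2 : ℂ) *
        Complex.exp (-Real.pi / (4 * Real.pi * Complex.I * t) *
          (x + Complex.I * (Complex.I * y)) ^ 2)))) := by
    set D := ‖1 / (4 * Real.pi * Complex.I * t : ℂ) ^ (1 / 2 : ℂ)‖ + 1
    refine tendsto_integral_filter_of_dominated_convergence (fun x => ‖φ x‖ * D)
      (Eventually.of_forall fun ε => (φ.continuous.mul (by fun_prop)).aestronglyMeasurable) ?_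
      (φ.integrable.norm.mul_const _) (Eventually.of_forall fun x => ?_)
    · filter_upwards [self_mem_nhdsWithin, hpow.norm.eventually_lt_const (lt_add_one _)] with ε hε hD
      refine Eventually.of_forall fun x => ?_
      rw [norm_mul, norm_mul _ (Complex.exp _)]
      refine mul_le_mul_of_nonneg_left ?_ (norm_nonneg _)
      have h1 := norm_cexp_neg_pi_div_mul (b := b ε) (by rw [hbre]; exact le_of_lt hε) y x
      exact (mul_le_of_le_one_right (norm_nonneg _) h1).trans hD.le
    · refine Tendsto.const_mul _ (hpow.mul ((Complex.continuous_exp.tendsto _).comp ?_))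
      exact (Tendsto.div tendsto_const_nhds hbt (four_pi_I_mul_ne_zero ht)).mul_const _
  refine tendsto_nhds_unique (hL.congr' ?_) hR
  filter_upwards [self_mem_nhdsWithin] with ε hε
  exact integral_gaussian_mul_fourier (by rw [hbre]; exact hε) y φ

/-- The kernel of the Schrödinger group, at integer points. -/
theorem fourier_schrodingerSymbol_apply {t : ℝ} (ht : t ≠ 0) (k : ℤ) (φ : 𝓢(ℝ, ℂ)) :
    (𝓕 (SchwartzMap.smulLeftCLM ℂ (schrodingerSymbol t) (𝓕⁻ φ)) : 𝓢(ℝ, ℂ)) (k : ℝ) =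
      ∫ x : ℝ, diracEvolution k t x * φ x := by
  have htc : (t : ℂ) ≠ 0 := by exact_mod_cast ht
  have hpi : (Real.pi : ℂ) ≠ 0 := by exact_mod_cast Real.pi_ne_zero
  have e1 : ∫ x : ℝ, diracEvolution k t x * φ x = ∫ x : ℝ, φ x *
      (1 / (4 * Real.pi * Complex.I * t : ℂ) ^ (1 / 2 : ℂ) *
        Complex.exp (-Real.pi / (4 * Real.pi * Complex.I * t) *
          (x + Complex.I * (Complex.I * (k : ℝ))) ^ 2)) := by
    refine integral_congr_ae (Eventually.of_forall fun x => ?_)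
    simp only [diracEvolution]
    have h := Complex.I_sq
    have e2 : (-Real.pi / (4 * Real.pi * Complex.I * t) *
        (x + Complex.I * (Complex.I * ((k : ℝ) : ℂ))) ^ 2 : ℂ) =
        Complex.I * (x - k) ^ 2 / (4 * t) := by
      have : (x + Complex.I * (Complex.I * ((k : ℝ) : ℂ)) : ℂ) = x - k := by
        push_cast
        linear_combination (k : ℂ) * h
      rw [this]
      have hI := Complex.I_ne_zero
      field_simp
      linear_combination (-((x : ℂ) - k) ^ 2) * h
    rw [e2]
    ring
  rw [e1, ← integral_schrodingerSymbol ht, SchwartzMap.fourier_coe,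
    Real.fourier_real_eq_integral_exp_smul, ← integral_neg_eq_self]
  refine integral_congr_ae (Eventually.of_forall fun v => ?_)
  simp only
  rw [SchwartzMap.smulLeftCLM_apply_apply (schrodingerSymbol_hasTemperateGrowth t),
    SchwartzMap.fourierInv_coe, Real.fourierInv_eq_fourier_neg, neg_neg, smul_eq_mul, smul_eq_mul,
    ← mul_assoc, schrodingerSymbol, ← Complex.exp_add, mul_comm]
  congr 2
  push_cast
  ring

/-! ### Combs of Dirac masses -/

/-- The distribution `∑ₖ aₖ δ_k`, for a summable sequence `a`. -/
def comb (a : ℤ → ℂ) : 𝓢'(ℝ, ℂ) :=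
  ContinuousLinearMap.toPointwiseConvergenceCLM _ _ _ _ <|
    (∑' k : ℤ, a k • BoundedContinuousFunction.evalCLM ℂ (k : ℝ)).comp
      (SchwartzMap.toBoundedContinuousFunctionCLM ℂ ℝ ℂ)

theorem hasSum_comb {a : ℤ → ℂ} (ha : Summable fun k => ‖a k‖) (φ : 𝓢(ℝ, ℂ)) :
    HasSum (fun k : ℤ => a k * φ k) (comb a φ) := by
  have h1 : Summable fun k : ℤ =>
      a k • (BoundedContinuousFunction.evalCLM ℂ (k : ℝ) : (BoundedContinuousFunction ℝ ℂ) →L[ℂ] ℂ) := by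
    refine Summable.of_norm_bounded ha fun k => ?_
    rw [norm_smul]
    refine mul_le_of_le_one_right (norm_nonneg _) ?_
    refine ContinuousLinearMap.opNorm_le_bound _ zero_le_one fun f => ?_
    rw [one_mul]
    exact f.norm_coe_le_norm _
  exact h1.hasSum.mapL (ContinuousLinearMap.apply ℂ ℂ
    (SchwartzMap.toBoundedContinuousFunctionCLM ℂ ℝ ℂ φ))

theorem schrodingerGroup_comb_apply {a : ℤ → ℂ} (ha : Summable fun k => ‖a k‖) {t : ℝ} (ht : t ≠ 0)
    (φ : 𝓢(ℝ, ℂ)) : schrodingerGroup t (comb a) φ =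
      ∫ x : ℝ, (∑' k, a k * diracEvolution k t x) * φ x := by
  have h1 : schrodingerGroup t (comb a) φ =
      comb a (𝓕 (SchwartzMap.smulLeftCLM ℂ (schrodingerSymbol t) (𝓕⁻ φ))) := rfl
  rw [h1, ← (hasSum_comb ha _).tsum_eq]
  simp only [fourier_schrodingerSymbol_apply ht]
  have hc : ∀ k, Continuous fun x => diracEvolution k t x := fun k => by
    unfold diracEvolution; fun_prop
  have h2 := hasSum_integral_of_dominated_convergence (μ := volume)
    (F := fun k (x : ℝ) => a k * diracEvolution k t x * φ x)
    (f := fun x => (∑' k, a k * diracEvolution k t x) * φ x)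
    (fun k x => ‖a k‖ * (waveAmp t * ‖φ x‖))
    (fun k => ((continuous_const.mul (hc k)).mul φ.continuous).aestronglyMeasurable)
    (fun k => Eventually.of_forall fun x => by
      rw [norm_mul, norm_mul, norm_diracEvolution ht, mul_assoc])
    (Eventually.of_forall fun x => ha.mul_right _)
    (by simp only [tsum_mul_right]; exact (φ.integrable.norm.const_mul _).const_mul _)
    (Eventually.of_forall fun x => ?_)
  · rw [← h2.tsum_eq]
    refine tsum_congr fun k => ?_
    rw [← integral_const_mul]
    simp only [mul_assoc]
  · refine HasSum.mul_right _ (Summable.hasSum (Summable.of_norm ?_))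
    simp only [norm_mul, norm_diracEvolution ht]
    exact ha.mul_right _

theorem fourier_comb_apply {a : ℤ → ℂ} (ha : Summable fun k => ‖a k‖) (φ : 𝓢(ℝ, ℂ)) :
    (𝓕 (comb a)) φ =
      ∫ ξ : ℝ, (∑' k, a k * Complex.exp (-(Complex.I * k * ((2 * Real.pi * ξ : ℝ) : ℂ)))) * φ ξ := by
  have h1 : (𝓕 (comb a)) φ = comb a (𝓕 φ) := rfl
  rw [h1, ← (hasSum_comb ha _).tsum_eq]
  have h2 := hasSum_integral_of_dominated_convergence (μ := volume)
    (F := fun k (ξ : ℝ) => a k * Complex.exp (-(Complex.I * k * ((2 * Real.pi * ξ : ℝ) : ℂ))) * φ ξ)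
    (f := fun ξ => (∑' k, a k * Complex.exp (-(Complex.I * k * ((2 * Real.pi * ξ : ℝ) : ℂ)))) * φ ξ)
    (fun k x => ‖a k‖ * ‖φ x‖)
    (fun k => ((continuous_const.mul (by fun_prop)).mul φ.continuous).aestronglyMeasurable)
    (fun k => Eventually.of_forall fun x => by
      rw [norm_mul, norm_mul, norm_exp_neg_I_mul, mul_one])
    (Eventually.of_forall fun x => ha.mul_right _)
    (by simp only [tsum_mul_right]; exact φ.integrable.norm.const_mul _)
    (Eventually.of_forall fun x => ?_)
  · rw [← h2.tsum_eq]
    refine tsum_congr fun k => ?_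
    rw [SchwartzMap.fourier_coe, Real.fourier_real_eq_integral_exp_smul, ← integral_const_mul]
    refine integral_congr_ae (Eventually.of_forall fun v => ?_)
    simp only [smul_eq_mul, mul_assoc]
    congr 3
    push_cast
    ring
  · refine HasSum.mul_right _ (Summable.hasSum (Summable.of_norm ?_))
    simp only [norm_mul, norm_exp_neg_I_mul, mul_one]
    exact ha

end DiracNLS

end

noncomputable section

namespace DiracNLS

open scoped ENNReal ComplexConjugate

variable {s c : ℝ}

/-! ### Change of the mass parameter -/

theorem trilin_smul_unimodular (hs : 1 / 2 < s) (t : ℝ) {z : ℂ} (hz : ‖z‖ = 1) (x : L2) :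
    trilin s (osc t) (z • x) (z • x) (z • x) = z • trilin s (osc t) x x x := by
  refine trilin_ext hs (osc_bound t) fun k => ?_
  rw [seq_smul, seq_trilin hs (osc_bound t), ← tsum_mul_left]
  refine tsum_congr fun p => ?_
  have h : z * conj z = 1 := by
    rw [Complex.mul_conj, Complex.normSq_eq_norm_sq, hz]; simp
  simp only [triTerm, seq_smul, map_mul]
  linear_combination (z * osc t k p.1 p.2 * seq s x p.1 * conj (seq s x (p.1 + p.2 - k)) *
    seq s x p.2) * h

/-- The phase factor that changes the mass parameter of the equation by `b`. -/
def massPhase (c b t : ℝ) : ℂ := Complex.exp (Complex.I * ((-(2 * b * c * Real.log t) : ℝ) : ℂ))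

theorem norm_massPhase (c b t : ℝ) : ‖massPhase c b t‖ = 1 := norm_exp_I_mul_ofReal _

theorem massPhase_neg_mul (c b t : ℝ) : massPhase c (-b) t * massPhase c b t = 1 := by
  rw [massPhase, massPhase, ← Complex.exp_add]
  simp

/-- The cubic term is equivariant under a global phase, so multiplication by `e^{-2ibc log t}` only
adds `-2ibc/t` times the solution, which is a shift of `M` by `b`. -/
theorem hasDerivAt_massPhase_smul (hs : 1 / 2 < s) {M : ℝ} (b : ℝ) {t : ℝ} (ht : 0 < t) {A : ℝ → L2}
    (hA : HasDerivAt A (field s c M t (A t)) t) :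
    HasDerivAt (fun τ => massPhase c b τ • A τ) (field s c (M + b) t (massPhase c b t • A t)) t := by
  have htc : (t : ℂ) ≠ 0 := by exact_mod_cast ht.ne'
  have h1 : HasDerivAt (massPhase c b)
      (massPhase c b t * (Complex.I * ((-(2 * b * c * t⁻¹) : ℝ) : ℂ))) t :=
    ((((Real.hasDerivAt_log ht.ne').const_mul (2 * b * c)).neg.ofReal_comp).const_mul
      Complex.I).cexp
  refine (h1.smul hA).congr_deriv ?_
  rw [field, field, nonlin, nonlin, trilin_smul_unimodular hs t (norm_massPhase c b t),
    abs_of_pos ht]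
  simp only [smul_sub, smul_smul, add_comm _ (_ • A t)]
  rw [add_sub_assoc', sub_eq_sub_iff_add_eq_add]
  refine seq_injective s fun k => ?_
  simp only [seq_add, seq_smul]
  push_cast
  field_simp
  ring

/-- If all nonzero entries of `α` have modulus `a`, the gauge transformation and the change of the
mass parameter by `a² / 2` combine to an isometry that fixes `α`. -/
theorem norm_gauge_massPhase_sub {a : ℝ} {α : L2}
    (hα : ∀ k, seq s α k = 0 ∨ ‖seq s α k‖ = a) (t : ℝ) (x : L2) :
    ‖gauge s c α t (massPhase c (a ^ 2 / 2) t • x) - α‖ = ‖x - α‖ := by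
  have h1 : gauge s c α t (massPhase c (a ^ 2 / 2) t • x) - α =
      gauge s c α t (massPhase c (a ^ 2 / 2) t • (x - α)) := by
    refine seq_injective s fun k => ?_
    rw [seq_sub, seq_gauge, seq_gauge, seq_smul, seq_smul, seq_sub]
    have h2 : phase (modSq s α) (c * Real.log t) k * (massPhase c (a ^ 2 / 2) t * seq s α k) =
        seq s α k := by
      rcases hα k with h | h
      · rw [h]; ring
      · rw [phase, massPhase, modSq, h, ← mul_assoc, ← Complex.exp_add]
        have e : Complex.I * ((a ^ 2 * (c * Real.log t) : ℝ) : ℂ) +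
            Complex.I * ((-(2 * (a ^ 2 / 2) * c * Real.log t) : ℝ) : ℂ) = 0 := by
          push_cast; ring
        rw [e, Complex.exp_zero, one_mul]
    linear_combination h2
  rw [h1, norm_gauge, norm_smul, norm_massPhase, one_mul]

theorem gauge_massPhase_solution (hs : 1 / 2 < s) {a T : ℝ} {α : L2} {A : ℝ → L2}
    (hA : ∀ t ∈ Ioo 0 T, HasDerivAt A (field s c (mass s α - a ^ 2 / 2) t (A t)) t) :
    ∀ t ∈ Ioo 0 T, HasDerivAt (fun τ => massPhase c (a ^ 2 / 2) τ • A τ)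
      (field s c (mass s α) t (massPhase c (a ^ 2 / 2) t • A t)) t := fun t ht => by
  have := hasDerivAt_massPhase_smul hs (a ^ 2 / 2) ht.1 (hA t ht)
  rwa [sub_add_cancel] at this

theorem solution_of_gauge_solution (hs : 1 / 2 < s) {a : ℝ} {α : L2}
    (hα : ∀ k, seq s α k = 0 ∨ ‖seq s α k‖ = a) {A : ℝ → L2} {t C : ℝ} (ht : 0 < t)
    (hA : HasDerivAt A (field s c (mass s α) t (A t)) t)
    (hC : ‖gauge s c α t (A t) - α‖ ≤ C) :
    HasDerivAt (fun τ => massPhase c (-(a ^ 2 / 2)) τ • A τ)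
      (field s c (mass s α - a ^ 2 / 2) t (massPhase c (-(a ^ 2 / 2)) t • A t)) t ∧
    ‖massPhase c (-(a ^ 2 / 2)) t • A t - α‖ ≤ C := by
  refine ⟨hasDerivAt_massPhase_smul hs (-(a ^ 2 / 2)) ht hA, ?_⟩
  rw [← norm_gauge_massPhase_sub (c := c) hα, smul_smul, mul_comm, massPhase_neg_mul, one_smul]
  exact hC

theorem half_line_solution_unique (hs : 1 / 2 < s) {a T : ℝ} {α : L2}
    (hα : ∀ k, seq s α k = 0 ∨ ‖seq s α k‖ = a) {A B : ℝ → L2}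
    (hA : ∀ t ∈ Ioo 0 T, HasDerivAt A (field s c (mass s α - a ^ 2 / 2) t (A t)) t)
    (hB : ∀ t ∈ Ioo 0 T, HasDerivAt B (field s c (mass s α - a ^ 2 / 2) t (B t)) t)
    (hA0 : Tendsto A (𝓝[>] 0) (𝓝 α)) (hB0 : Tendsto B (𝓝[>] 0) (𝓝 α)) {t : ℝ}
    (ht : t ∈ Ioo 0 T) : A t = B t := by
  have key : ∀ {X : ℝ → L2}, Tendsto X (𝓝[>] 0) (𝓝 α) →
      Tendsto (fun t => gauge s c α t (massPhase c (a ^ 2 / 2) t • X t)) (𝓝[>] 0) (𝓝 α) := by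
    intro X hX
    rw [tendsto_iff_norm_sub_tendsto_zero] at hX ⊢
    simpa only [norm_gauge_massPhase_sub hα] using hX
  have h := field_solution_unique hs (gauge_massPhase_solution hs hA)
    (gauge_massPhase_solution hs hB) (key hA0) (key hB0) ht
  have h2 := congrArg (fun x => massPhase c (-(a ^ 2 / 2)) t • x) h
  simpa only [smul_smul, massPhase_neg_mul, one_smul] using h2

/-! ### Time reversal -/

theorem seq_star (s : ℝ) (x : L2) (k : ℤ) : seq s (star x) k = conj (seq s x k) := by
  rw [seq, seq, map_div₀, Complex.conj_ofReal, lp.star_apply]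
  rfl

theorem mass_star (s : ℝ) (x : L2) : mass s (star x) = mass s x := by
  refine tsum_congr fun k => ?_
  rw [seq_star, RCLike.norm_conj]

/-- Conjugation turns `e^{iω/4(-t)}` into `e^{iω/4t}` and changes the sign of the prefactor `i`,
while `|t|` is even. Thus conjugating and reversing time maps solutions to solutions. -/
theorem star_field (hs : 1 / 2 < s) (M t : ℝ) (x : L2) :
    star (field s c M (-t) x) = -field s c M t (star x) := by
  have h1 : star (trilin s (osc (-t)) x x x) = trilin s (osc t) (star x) (star x) (star x) := by
    refine (trilin_ext hs (osc_bound t) fun k => ?_).symm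
    rw [seq_star, seq_trilin hs (osc_bound (-t)), Complex.conj_tsum]
    refine tsum_congr fun p => ?_
    simp only [triTerm, seq_star, map_mul]
    congr 1
    rw [osc, osc, conj_exp_I_mul_ofReal]
    congr 3
    rw [mul_neg, div_neg, neg_neg]
  refine seq_injective s fun k => ?_
  rw [seq_star, field, field, nonlin, nonlin, ← neg_smul, seq_smul, seq_smul, seq_sub, seq_sub,
    ← h1, seq_smul, seq_smul, seq_star, seq_star, abs_neg]
  simp only [map_mul, map_sub, Complex.conj_ofReal, Complex.conj_I]
  ring

theorem hasDerivAt_star_neg (hs : 1 / 2 < s) {M t : ℝ} {A : ℝ → L2}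
    (hA : HasDerivAt A (field s c M (-t) (A (-t))) (-t)) :
    HasDerivAt (fun τ => star (A (-τ))) (field s c M t (star (A (-t)))) t := by
  have h := (hA.scomp t (hasDerivAt_neg t)).star
  refine h.congr_deriv ?_
  rw [neg_smul, one_smul, star_neg, star_field hs, neg_neg]

/-! ### Solutions on both sides of the initial time -/

/-- `A` is a solution on `(-T, T)` of the coefficient equation with initial value `α`, and
`A t - α = O(t)`. -/
structure IsLineSolution (s c M T : ℝ) (α : L2) (A : ℝ → L2) : Prop where
  zero : A 0 = α
  deriv : ∀ t ∈ Ioo (-T) T, t ≠ 0 → HasDerivAt A (field s c M t (A t)) t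
  bound : ∃ C, ∀ t ∈ Ioo (-T) T, ‖A t - α‖ ≤ C * |t|

/-- The curve that is `A` for positive times, and the conjugate of the reflected `B` for negative
times. -/
def twoSided (α : L2) (A B : ℝ → L2) (t : ℝ) : L2 :=
  if 0 < t then A t else if t < 0 then star (B (-t)) else α

theorem isLineSolution_twoSided {M T C D : ℝ} (hs : 1 / 2 < s) {α : L2} {A B : ℝ → L2}
    (hA : ∀ t ∈ Ioo 0 T, HasDerivAt A (field s c M t (A t)) t ∧ ‖A t - α‖ ≤ C * t)
    (hB : ∀ t ∈ Ioo 0 T, HasDerivAt B (field s c M t (B t)) t ∧ ‖B t - star α‖ ≤ D * t) :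
    IsLineSolution s c M T α (twoSided α A B) := by
  have hp : ∀ t, 0 < t → twoSided α A B t = A t := fun t h => if_pos h
  have hn : ∀ t, t < 0 → twoSided α A B t = star (B (-t)) := fun t h => by
    rw [twoSided, if_neg h.not_gt, if_pos h]
  have h0 : twoSided α A B 0 = α := by simp [twoSided]
  refine ⟨h0, fun t ht ht0 => ?_, max C D, fun t ht => ?_⟩
  · rcases ht0.lt_or_gt with h | h
    · rw [hn t h]
      refine (hasDerivAt_star_neg hs (hB (-t) ⟨by linarith, by linarith [ht.1]⟩).1
        ).congr_of_eventuallyEq ?_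
      filter_upwards [Iio_mem_nhds h] with τ hτ using hn τ hτ
    · rw [hp t h]
      refine (hA t ⟨h, ht.2⟩).1.congr_of_eventuallyEq ?_
      filter_upwards [Ioi_mem_nhds h] with τ hτ using hp τ hτ
  · rcases lt_trichotomy t 0 with h | rfl | h
    · rw [hn t h, abs_of_neg h, show star (B (-t)) - α = star (B (-t) - star α) by
        rw [star_sub, star_star], norm_star]
      have ht' : -t ∈ Ioo 0 T := ⟨by linarith, by linarith [ht.1]⟩
      exact (hB (-t) ht').2.trans (mul_le_mul_of_nonneg_right (le_max_right _ _) ht'.1.le)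
    · simp [h0]
    · rw [hp t h, abs_of_pos h]
      exact (hA t ⟨h, ht.2⟩).2.trans (mul_le_mul_of_nonneg_right (le_max_left _ _) h.le)

theorem star_equimodular {a : ℝ} {α : L2} (hα : ∀ k, seq s α k = 0 ∨ ‖seq s α k‖ = a) (k : ℤ) :
    seq s (star α) k = 0 ∨ ‖seq s (star α) k‖ = a := by
  rw [seq_star, RCLike.norm_conj, map_eq_zero]
  exact hα k

theorem exists_line_solution (hs : 1 / 2 < s) (c : ℝ) {a : ℝ} {α : L2}
    (hα : ∀ k, seq s α k = 0 ∨ ‖seq s α k‖ = a) :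
    ∃ T, 0 < T ∧ ∃ A, IsLineSolution s c (mass s α - a ^ 2 / 2) T α A := by
  obtain ⟨T₁, C₁, hT₁, A, hA⟩ := exists_field_solution hs c α
  obtain ⟨T₂, C₂, hT₂, B, hB⟩ := exists_field_solution hs c (star α)
  rw [mass_star] at hB
  refine ⟨min T₁ T₂, lt_min hT₁ hT₂, _, isLineSolution_twoSided hs (C := C₁) (D := C₂)
    (fun t ht => solution_of_gauge_solution hs hα ht.1 (hA t ?_).1 (hA t ?_).2)
    (fun t ht => mass_star s α ▸ solution_of_gauge_solution hs (star_equimodular hα) ht.1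
      (mass_star s α ▸ (hB t ?_).1) (hB t ?_).2)⟩
  exacts [⟨ht.1, ht.2.trans_le (min_le_left _ _)⟩, ⟨ht.1, ht.2.trans_le (min_le_left _ _)⟩,
    ⟨ht.1, ht.2.trans_le (min_le_right _ _)⟩, ⟨ht.1, ht.2.trans_le (min_le_right _ _)⟩]

theorem exists_global_line_solution (hs : 1 ≤ s) (c : ℝ) {a : ℝ} {α : L2}
    (hα : ∀ k, seq s α k = 0 ∨ ‖seq s α k‖ = a) :
    ∃ A, ∀ T, 0 < T → IsLineSolution s c (mass s α - a ^ 2 / 2) T α A := by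
  have hs' : 1 / 2 < s := by linarith
  obtain ⟨A, hA, hAC⟩ := exists_global_field_solution hs c α
  obtain ⟨B, hB, hBC⟩ := exists_global_field_solution hs c (star α)
  rw [mass_star] at hB
  refine ⟨twoSided α (fun t => massPhase c (-(a ^ 2 / 2)) t • A t)
    (fun t => massPhase c (-(a ^ 2 / 2)) t • B t), fun T hT => ?_⟩
  obtain ⟨C₁, hC₁⟩ := hAC T hT
  obtain ⟨C₂, hC₂⟩ := hBC T hT
  exact isLineSolution_twoSided hs'
    (fun t ht => solution_of_gauge_solution hs' hα ht.1 (hA t ht.1) (hC₁ t ht))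
    (fun t ht => mass_star s α ▸ solution_of_gauge_solution hs' (star_equimodular hα) ht.1
      (mass_star s α ▸ hB t ht.1) (hC₂ t ht))

theorem line_solution_unique (hs : 1 / 2 < s) {a T : ℝ} {α : L2}
    (hα : ∀ k, seq s α k = 0 ∨ ‖seq s α k‖ = a) {A B : ℝ → L2}
    (hA : ∀ t ∈ Ioo (-T) T, t ≠ 0 → HasDerivAt A (field s c (mass s α - a ^ 2 / 2) t (A t)) t)
    (hB : ∀ t ∈ Ioo (-T) T, t ≠ 0 → HasDerivAt B (field s c (mass s α - a ^ 2 / 2) t (B t)) t)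
    (hA0 : Tendsto A (𝓝 0) (𝓝 α)) (hB0 : Tendsto B (𝓝 0) (𝓝 α)) {t : ℝ}
    (ht : t ∈ Ioo (-T) T) : A t = B t := by
  have hr : ∀ {τ : ℝ}, τ ∈ Ioo 0 T → τ ∈ Ioo (-T) T := fun hτ =>
    ⟨by linarith [hτ.1, hτ.2], hτ.2⟩
  have hl : ∀ {τ : ℝ}, τ ∈ Ioo 0 T → -τ ∈ Ioo (-T) T := fun hτ =>
    ⟨by linarith [hτ.2], by linarith [hτ.1, hτ.2]⟩
  rcases lt_trichotomy t 0 with h | rfl | h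
  · have key : ∀ {X : ℝ → L2}, Tendsto X (𝓝 0) (𝓝 α) →
        Tendsto (fun t => star (X (-t))) (𝓝[>] 0) (𝓝 (star α)) := fun hX => by
      refine ((continuous_star (R := L2)).tendsto α).comp (hX.comp ?_)
      have : Tendsto (fun t : ℝ => -t) (𝓝 0) (𝓝 (-0)) := continuous_neg.tendsto 0
      rw [neg_zero] at this
      exact tendsto_nhdsWithin_of_tendsto_nhds this
    have h1 := half_line_solution_unique hs (c := c) (T := T) (star_equimodular hα)
      (A := fun t => star (A (-t))) (B := fun t => star (B (-t)))
      (fun τ hτ => by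
        rw [mass_star]
        exact hasDerivAt_star_neg hs (hA _ (hl hτ) (neg_ne_zero.2 hτ.1.ne')))
      (fun τ hτ => by
        rw [mass_star]
        exact hasDerivAt_star_neg hs (hB _ (hl hτ) (neg_ne_zero.2 hτ.1.ne')))
      (key hA0) (key hB0) (t := -t) ⟨by linarith, by linarith [ht.1]⟩
    simpa using h1
  -- The limit is along the full neighbourhood filter, which contains the point `0`, so it
  -- determines the value there.
  · exact (tendsto_nhds_unique (tendsto_pure_nhds A 0) (hA0.mono_left (pure_le_nhds 0))).trans
      (tendsto_nhds_unique (tendsto_pure_nhds B 0) (hB0.mono_left (pure_le_nhds 0))).symm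
  · exact half_line_solution_unique hs hα (fun τ hτ => hA τ (hr hτ) hτ.1.ne')
      (fun τ hτ => hB τ (hr hτ) hτ.1.ne') (tendsto_nhdsWithin_of_tendsto_nhds hA0)
      (tendsto_nhdsWithin_of_tendsto_nhds hB0) ⟨h, ht.2⟩

end DiracNLS

end

noncomputable section

namespace DiracNLS

open scoped ENNReal ComplexConjugate

variable {s : ℝ}

/-! ### Periodic functions and their Fourier coefficients -/

/-- The Fourier series `∑ₖ aₖ e^{-ikξ}`. -/
def fourierSum (a : ℤ → ℂ) (ξ : ℝ) : ℂ := ∑' k, a k * Complex.exp (-(Complex.I * k * ξ))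

theorem continuous_fourierSum {a : ℤ → ℂ} (ha : Summable fun k => ‖a k‖) :
    Continuous (fourierSum a) :=
  continuous_tsum (fun k => by fun_prop) ha fun k ξ => by
    rw [norm_mul, norm_exp_neg_I_mul, mul_one]

theorem fourierSum_periodic (a : ℤ → ℂ) : Function.Periodic (fourierSum a) (2 * Real.pi) := by
  intro ξ
  refine tsum_congr fun k => ?_
  have e : -(Complex.I * k * ((ξ + 2 * Real.pi : ℝ) : ℂ)) =
      -(Complex.I * k * ξ) + (-k : ℤ) * (2 * Real.pi * Complex.I) := by
    push_cast; ring
  rw [e, Complex.exp_add, Complex.exp_int_mul_two_pi_mul_I, mul_one]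

theorem norm_fourierSum_le {a : ℤ → ℂ} (ha : Summable fun k => ‖a k‖) (ξ : ℝ) :
    ‖fourierSum a ξ‖ ≤ ∑' k, ‖a k‖ := by
  have h : ∀ k, ‖a k * Complex.exp (-(Complex.I * k * ξ))‖ = ‖a k‖ := fun k => by
    rw [norm_mul, norm_exp_neg_I_mul, mul_one]
  refine (norm_tsum_le_tsum_norm (by simpa only [h] using ha)).trans (le_of_eq ?_)
  simp only [h]

theorem memLp_fourierSum {a : ℤ → ℂ} (ha : Summable fun k => ‖a k‖) :
    MemLp (fourierSum a) 2 (volume.restrict (Ioc 0 (2 * Real.pi))) :=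
  MemLp.of_bound (continuous_fourierSum ha).aestronglyMeasurable _
    (Eventually.of_forall (norm_fourierSum_le ha))

theorem coeff_fourierSum {a : ℤ → ℂ} (ha : Summable fun k => ‖a k‖) :
    coeff (fourierSum a) = a := funext fun k => coeff_tsum ha k

theorem isHsPF_comb (hs : 1 / 2 < s) (x : L2) :
    IsHsPF s (comb (seq s x)) (fourierSum (seq s x)) where
  periodic := fourierSum_periodic _
  memLp := memLp_fourierSum (summable_norm_seq hs x)
  memL2s := by
    rw [coeff_fourierSum (summable_norm_seq hs x)]
    exact memL2s_seq s x
  fourier_eq φ := fourier_comb_apply (summable_norm_seq hs x) φ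

theorem coeff_sub {f g : ℝ → ℂ} (hf : MemLp f 2 (volume.restrict (Ioc 0 (2 * Real.pi))))
    (hg : MemLp g 2 (volume.restrict (Ioc 0 (2 * Real.pi)))) (k : ℤ) :
    coeff (fun ξ => f ξ - g ξ) k = coeff f k - coeff g k := by
  have hi : ∀ {h : ℝ → ℂ}, MemLp h 2 (volume.restrict (Ioc 0 (2 * Real.pi))) →
      IntervalIntegrable (fun ξ : ℝ => h ξ * Complex.exp (Complex.I * k * ξ)) volume 0
        (2 * Real.pi) := fun hh => by
    refine IntervalIntegrable.mul_continuousOn ?_ (by fun_prop)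
    exact (intervalIntegrable_iff_integrableOn_Ioc_of_le Real.two_pi_pos.le).2
      (hh.integrable (by norm_num))
  rw [coeff, coeff, coeff, ← mul_sub, ← intervalIntegral.integral_sub (hi hf) (hi hg)]
  simp only [sub_mul]

/-- Parseval's identity makes `f` vanish almost everywhere on one period, periodicity on the line,
and the dilation by `2π` preserves null sets. -/
theorem ae_eq_zero_of_coeff_eq_zero {f : ℝ → ℂ} (hp : Function.Periodic f (2 * Real.pi))
    (hf : MemLp f 2 (volume.restrict (Ioc 0 (2 * Real.pi)))) (h0 : ∀ k, coeff f k = 0) :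
    ∀ᵐ ξ : ℝ, f (2 * Real.pi * ξ) = 0 := by
  have hc : ∀ n, fourierCoeffOn Real.two_pi_pos f n = 0 := fun n => by
    have h1 := h0 (-n)
    rw [coeff] at h1
    have h2 := (mul_eq_zero.1 h1).resolve_left (by
      have : (Real.pi : ℂ) ≠ 0 := by exact_mod_cast Real.pi_ne_zero
      simp [this])
    rw [fourierCoeffOn_eq_integral]
    have e : ∫ x in (0 : ℝ)..2 * Real.pi,
        fourier (-n) (x : AddCircle (2 * Real.pi - 0)) • f x = 0 := by
      rw [← h2]
      refine intervalIntegral.integral_congr fun x _ => ?_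
      have hpi : (Real.pi : ℂ) ≠ 0 := by exact_mod_cast Real.pi_ne_zero
      simp only [fourier_coe_apply, smul_eq_mul]
      rw [mul_comm]
      congr 2
      push_cast
      field_simp
      ring
    rw [e, smul_zero]
  have h1 := tsum_sq_fourierCoeffOn Real.two_pi_pos hf
  simp only [hc, norm_zero, ne_eq, OfNat.ofNat_ne_zero, not_false_eq_true, zero_pow, tsum_zero,
    smul_eq_mul] at h1
  have h2 := (mul_eq_zero.1 h1.symm).resolve_left (by
    have := Real.pi_pos
    rw [sub_zero]
    positivity)
  rw [intervalIntegral.integral_of_le Real.two_pi_pos.le,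
    integral_eq_zero_iff_of_nonneg (fun _ => by positivity) (hf.integrable_norm_pow two_ne_zero)] at h2
  have h3 : volume ({ξ | f ξ ≠ 0} ∩ Ioc 0 (0 + 2 * Real.pi)) = 0 := by
    have h4 := (ae_restrict_iff' measurableSet_Ioc).1 h2
    refine measure_mono_null (fun ξ hξ => ?_) (ae_iff.1 h4)
    rw [zero_add] at hξ
    simp only [mem_ofPred_eq, Classical.not_imp]
    exact ⟨hξ.2, by simpa using hξ.1⟩
  have h5 : volume {ξ | f ξ ≠ 0} = 0 := by
    refine (isAddFundamentalDomain_Ioc Real.two_pi_pos 0).measure_zero_of_invariant _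
      (fun g => ?_) h3
    obtain ⟨_, n, rfl⟩ := g
    ext ξ
    rw [Set.mem_vadd_set_iff_neg_vadd_mem]
    have h6 : f (-(n • (2 * Real.pi)) + ξ) = f ξ := by
      have := hp.sub_zsmul_eq (x := ξ) n
      rwa [sub_eq_neg_add] at this
    change f (-(n • (2 * Real.pi)) + ξ) ≠ 0 ↔ f ξ ≠ 0
    rw [h6]
  have h7 := Real.volume_preimage_mul_left Real.two_pi_pos.ne' {ξ | f ξ ≠ 0}
  rw [h5, mul_zero] at h7
  exact ae_iff.2 h7

/-- A distribution of class `H^s_{pF}` is the comb of its Fourier coefficients. -/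
theorem eq_comb_of_isHsPF (hs : 1 / 2 < s) {v : 𝓢'(ℝ, ℂ)} {g : ℝ → ℂ} (h : IsHsPF s v g) {x : L2}
    (hx : ∀ k, seq s x k = coeff g k) : v = comb (seq s x) := by
  have hsum := summable_norm_seq hs x
  have h1 := ae_eq_zero_of_coeff_eq_zero (f := fun ξ => g ξ - fourierSum (seq s x) ξ)
    (fun ξ => by simp only [h.periodic ξ, fourierSum_periodic _ ξ])
    (h.memLp.sub (memLp_fourierSum hsum)) fun k => by
      rw [coeff_sub h.memLp (memLp_fourierSum hsum), coeff_fourierSum hsum, hx, sub_self]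
  have h2 : 𝓕 v = 𝓕 (comb (seq s x)) := by
    ext φ
    rw [h.fourier_eq, (isHsPF_comb hs x).fourier_eq]
    refine integral_congr_ae ?_
    filter_upwards [h1] with ξ hξ
    rw [sub_eq_zero.1 hξ]
  have h3 := congrArg (fun w : 𝓢'(ℝ, ℂ) => 𝓕⁻ w) h2
  simpa using h3

/-! ### Distributions given by functions -/

theorem IsGivenBy.eq_right {v : 𝓢'(ℝ, ℂ)} {f g : ℝ → ℂ} (hf : IsGivenBy v f)
    (hg : IsGivenBy v g) : f = g := by
  refine Measure.eq_of_ae_eq (μ := volume) ?_ hf.1 hg.1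
  refine ae_eq_of_integral_contDiff_smul_eq hf.1.locallyIntegrable hg.1.locallyIntegrable
    fun χ dχ kχ => ?_
  have d : ContDiff ℝ ∞ fun x => ((χ x : ℝ) : ℂ) := Complex.ofRealCLM.contDiff.comp dχ
  have k : HasCompactSupport fun x => ((χ x : ℝ) : ℂ) := kχ.comp_left (g := ((↑) : ℝ → ℂ)) rfl
  have h := (hf.2.2 (k.toSchwartzMap d)).symm.trans (hg.2.2 (k.toSchwartzMap d))
  simpa [mul_comm] using h

theorem IsGivenBy.eq_left {v w : 𝓢'(ℝ, ℂ)} {f : ℝ → ℂ} (hv : IsGivenBy v f)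
    (hw : IsGivenBy w f) : v = w := by
  ext φ
  rw [hv.2.2, hw.2.2]

theorem isGivenBy_synth (hs : 1 / 2 < s) {t : ℝ} (ht : t ≠ 0) (x : L2) :
    IsGivenBy (schrodingerGroup t (comb (seq s x))) (synth s t x) := by
  refine ⟨continuous_iff_continuousAt.2 fun y => ?_, ⟨_, fun y => norm_synth_le hs ht x y⟩,
    fun φ => schrodingerGroup_comb_apply (summable_norm_seq hs x) ht φ⟩
  exact (continuousAt_synth hs (B := fun _ => x) (x := y) ht continuousAt_const).comp
    (f := fun y : ℝ => (t, y)) (by fun_prop)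

theorem isGivenBy_zero : IsGivenBy 0 fun _ => 0 :=
  ⟨continuous_const, ⟨0, by simp⟩, fun φ => by simp⟩

/-- Evolved to time `1`, the comb is a continuous function that determines its coefficients. -/
theorem comb_seq_eq_zero (hs : 1 / 2 < s) {x : L2} (h : comb (seq s x) = 0) : x = 0 := by
  have h1 := isGivenBy_synth hs one_ne_zero x
  rw [h, map_zero] at h1
  exact synth_injective hs one_ne_zero fun y => congrFun (h1.eq_right isGivenBy_zero) y

/-- The value of a comb at a Schwartz function, as a functional of the coefficients. -/
def combL (hs : 1 / 2 < s) (φ : 𝓢(ℝ, ℂ)) : L2 →L[ℂ] ℂ :=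
  LinearMap.mkContinuous
    { toFun := fun x => comb (seq s x) φ
      map_add' := fun x y => by
        refine (hasSum_comb (summable_norm_seq hs _) φ).unique ?_
        have := (hasSum_comb (summable_norm_seq hs x) φ).add
          (hasSum_comb (summable_norm_seq hs y) φ)
        simpa only [seq_add, add_mul] using this
      map_smul' := fun c x => by
        refine (hasSum_comb (summable_norm_seq hs _) φ).unique ?_
        have := (hasSum_comb (summable_norm_seq hs x) φ).mul_left c
        simpa only [seq_smul, mul_assoc, RingHom.id_apply, smul_eq_mul] using this }
    (‖SchwartzMap.toBoundedContinuousFunction φ‖ * √(2 * wtConst s)) fun x => by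
      have hφ : ∀ y, ‖φ y‖ ≤ ‖SchwartzMap.toBoundedContinuousFunction φ‖ := fun y =>
        (SchwartzMap.toBoundedContinuousFunction φ).norm_coe_le_norm y
      have h1 : ∀ k : ℤ, ‖seq s x k * φ k‖ ≤
          ‖SchwartzMap.toBoundedContinuousFunction φ‖ * ‖seq s x k‖ := fun k => by
        rw [norm_mul, mul_comm]
        exact mul_le_mul_of_nonneg_right (hφ k) (norm_nonneg _)
      have h2 := tsum_of_norm_bounded ((summable_norm_seq hs x).mul_left _).hasSum h1
      rw [(hasSum_comb (summable_norm_seq hs x) φ).tsum_eq, tsum_mul_left] at h2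
      rw [mul_assoc]
      exact h2.trans (mul_le_mul_of_nonneg_left (l1_le hs x) (norm_nonneg _))

theorem combL_apply (hs : 1 / 2 < s) (φ : 𝓢(ℝ, ℂ)) (x : L2) :
    combL hs φ x = comb (seq s x) φ := rfl

theorem comb_sub (hs : 1 / 2 < s) (x y : L2) :
    comb (seq s (x - y)) = comb (seq s x) - comb (seq s y) := by
  ext φ
  exact map_sub (combL hs φ) x y

theorem comb_smul (hs : 1 / 2 < s) (z : ℂ) (x : L2) :
    comb (seq s (z • x)) = z • comb (seq s x) := by
  ext φ
  exact map_smul (combL hs φ) z x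

theorem comb_injective (hs : 1 / 2 < s) {x y : L2} (h : comb (seq s x) = comb (seq s y)) :
    x = y := by
  refine sub_eq_zero.1 (comb_seq_eq_zero hs ?_)
  rw [comb_sub hs, h, sub_self]

end DiracNLS

end

noncomputable section

namespace DiracNLS

open scoped ENNReal ComplexConjugate

variable {s σ M : ℝ}

/-! ### The Duhamel formulation -/

/-- Duhamel's formula carries the factor `σi/2`; its inverse `-2i/σ` converts the vector field into
the coefficients of the nonlinearity pulled back by the group. -/
theorem duhamel_const_mul (hσ : σ ≠ 0) : (σ * Complex.I / 2) * (-(2 * Complex.I / σ)) = 1 := by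
  have h1 : (σ : ℂ) ≠ 0 := by exact_mod_cast hσ
  have := Complex.I_sq
  field_simp
  linear_combination -this

theorem smul_field_eq (hσ : σ ≠ 0) (t : ℝ) (x : L2) :
    (-(2 * Complex.I / σ)) • field s (σ / (8 * Real.pi)) M t x =
      ((1 / (4 * Real.pi * |t|) : ℝ) : ℂ) • nonlin s M t x := by
  have h1 : (σ : ℂ) ≠ 0 := by exact_mod_cast hσ
  have := Complex.I_sq
  rw [field, smul_smul]
  congr 1
  push_cast
  by_cases h : ((|t| : ℝ) : ℂ) = 0
  · simp [h]
  have hpi : (Real.pi : ℂ) ≠ 0 := by exact_mod_cast Real.pi_ne_zero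
  field_simp
  linear_combination (-8 : ℂ) * this

/-- The nonlinearity, as the evolution of a comb. -/
theorem isGivenBy_nonlinearity (hs : 1 / 2 < s) (hσ : σ ≠ 0) {t : ℝ} (ht : t ≠ 0) (x : L2) :
    IsGivenBy (schrodingerGroup t
      (comb (seq s ((-(2 * Complex.I / σ)) • field s (σ / (8 * Real.pi)) M t x))))
      fun y => (‖synth s t x y‖ ^ 2 - M / (2 * Real.pi * |t|)) * synth s t x y := by
  have h := isGivenBy_synth hs ht ((-(2 * Complex.I / σ)) • field s (σ / (8 * Real.pi)) M t x)
  convert h using 1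
  funext y
  have h1 := nonlinearity_synth hs ht M x y
  rw [smul_field_eq hσ, synth_smul, ← h1]
  push_cast
  rfl

theorem IsLineSolution.continuousAt_zero {c T : ℝ} (hT : 0 < T) {α : L2} {A : ℝ → L2}
    (h : IsLineSolution s c M T α A) : Tendsto A (𝓝 0) (𝓝 α) := by
  obtain ⟨C, hC⟩ := h.bound
  rw [tendsto_iff_norm_sub_tendsto_zero]
  have h1 : Tendsto (fun t : ℝ => C * |t|) (𝓝 0) (𝓝 0) := by
    have : Tendsto (fun t : ℝ => C * |t|) (𝓝 0) (𝓝 (C * |0|)) :=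
      (by fun_prop : Continuous fun t : ℝ => C * |t|).tendsto 0
    rwa [abs_zero, mul_zero] at this
  refine squeeze_zero' (Eventually.of_forall fun _ => norm_nonneg _) ?_ h1
  filter_upwards [Ioo_mem_nhds (by linarith : -T < 0) hT] with t ht using hC t ht

/-- The segment between `ε t` and `t` stays in the punctured interval. -/
theorem mem_of_mem_uIcc {T t lam τ : ℝ} (ht : t ∈ Ioo (-T) T) (ht0 : t ≠ 0) (hl0 : 0 < lam)
    (hl1 : lam ≤ 1) (hτ : τ ∈ uIcc (lam * t) t) : τ ∈ Ioo (-T) T ∧ τ ≠ 0 := by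
  rcases ht0.lt_or_gt with h | h
  · have h1 : t ≤ lam * t := by nlinarith
    rw [uIcc_of_ge h1] at hτ
    have h2 : lam * t < 0 := mul_neg_of_pos_of_neg hl0 h
    exact ⟨⟨ht.1.trans_le hτ.1, by linarith [hτ.2, ht.1]⟩, (hτ.2.trans_lt h2).ne⟩
  · have h1 : lam * t ≤ t := by nlinarith
    rw [uIcc_of_le h1] at hτ
    have h2 : 0 < lam * t := mul_pos hl0 h
    exact ⟨⟨by linarith [hτ.1, ht.2], hτ.2.trans_lt ht.2⟩, (h2.trans_le hτ.1).ne'⟩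

/-- Tested against a Schwartz function, the pulled back nonlinearity is a multiple of `A'`. Its
integral over `[εt, t]` is a multiple of `A(t) - A(εt)`, and continuity of `A` at zero gives the
improper integral, although `A'` may be of size `1/|t|`. -/
theorem isDuhamelSolution_of_isLineSolution (hs : 1 / 2 < s) (hσ : σ ≠ 0) {T : ℝ} (hT : 0 < T)
    {α : L2} {A : ℝ → L2} (h : IsLineSolution s (σ / (8 * Real.pi)) M T α A) :
    IsDuhamelSolution s σ M T (comb (seq s α)) fun t => schrodingerGroup t (comb (seq s (A t))) := by
  set c := σ / (8 * Real.pi)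
  set z : ℂ := -(2 * Complex.I / σ)
  have hA0 := h.continuousAt_zero hT
  have hIoo : IsOpen (Ioo (-T) T \ {0}) := isOpen_Ioo.sdiff isClosed_singleton
  refine ⟨⟨fun τ => synth s τ (A τ), fun τ => schrodingerGroup τ
    (comb (seq s (z • field s c M τ (A τ)))), fun t => comb (seq s (z • (A t - α))),
    fun τ hτ => ⟨isGivenBy_synth hs hτ.2 _, isGivenBy_nonlinearity hs hσ hτ.2 _⟩,
    fun t ht => ⟨?_, ?_⟩⟩, fun t => fourierSum (seq s (A t)), fun t ht => ?_, ?_, ?_⟩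
  · intro φ
    simp only [schrodingerGroup_neg_apply]
    change (∀ ε ∈ Ioo (0 : ℝ) 1, IntervalIntegrable (fun τ => combL hs φ (z • field s c M τ (A τ)))
      volume (ε * t) t) ∧ Tendsto (fun ε : ℝ => ∫ τ in (ε * t)..t,
        combL hs φ (z • field s c M τ (A τ))) (𝓝[>] 0) (𝓝 (combL hs φ (z • (A t - α))))
    rcases eq_or_ne t 0 with rfl | ht0
    · simp [h.zero]
    have hcont : ∀ ε ∈ Ioo (0 : ℝ) 1, ContinuousOn
        (fun τ => combL hs φ (z • field s c M τ (A τ))) (uIcc (ε * t) t) := fun ε hε τ hτ => by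
      obtain ⟨h1, h2⟩ := mem_of_mem_uIcc ht ht0 hε.1 hε.2.le hτ
      exact ((combL hs φ).continuous.continuousAt.comp (((continuousAt_field hs c M h2
        (h.deriv τ h1 h2).continuousAt)).const_smul z)).continuousWithinAt
    refine ⟨fun ε hε => (hcont ε hε).intervalIntegrable, ?_⟩
    have h1 : ∀ ε ∈ Ioo (0 : ℝ) 1, combL hs φ (z • A t) - combL hs φ (z • A (ε * t)) =
        ∫ τ in (ε * t)..t, combL hs φ (z • field s c M τ (A τ)) := fun ε hε =>
      (intervalIntegral.integral_eq_sub_of_hasDerivAt (f := fun τ => combL hs φ (z • A τ))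
        (fun τ hτ => by
          obtain ⟨h1, h2⟩ := mem_of_mem_uIcc ht ht0 hε.1 hε.2.le hτ
          exact ((combL hs φ).restrictScalars ℝ).hasFDerivAt.comp_hasDerivAt τ
            ((h.deriv τ h1 h2).const_smul z)) (hcont ε hε).intervalIntegrable).symm
    rw [smul_sub, map_sub]
    refine Tendsto.congr' (f₁ := fun ε => combL hs φ (z • A t) - combL hs φ (z • A (ε * t))) ?_ ?_
    · filter_upwards [Ioo_mem_nhdsGT one_pos] with ε hε using h1 ε hε
    · have h2 : Tendsto (fun ε : ℝ => ε * t) (𝓝[>] 0) (𝓝 0) := by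
        have : Tendsto (fun ε : ℝ => ε * t) (𝓝 0) (𝓝 (0 * t)) :=
          (continuous_mul_const t).tendsto 0
        rw [zero_mul] at this
        exact tendsto_nhdsWithin_of_tendsto_nhds this
      exact Tendsto.const_sub _ (((combL hs φ).continuous.tendsto _).comp
        ((hA0.comp h2).const_smul z))
  · beta_reduce
    rw [comb_smul hs, ← map_smul, smul_smul, duhamel_const_mul hσ, one_smul, ← map_add, comb_sub hs,
      add_sub_cancel]
  · rw [schrodingerGroup_neg_apply]
    exact isHsPF_comb hs _
  · simp only [coeff_fourierSum (summable_norm_seq hs _)]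
    refine isL2sCurve_zero_iff.2 ⟨A, fun t ht => ?_, fun _ _ _ => rfl⟩
    rcases eq_or_ne t 0 with rfl | ht0
    · have : ContinuousAt A 0 := by rw [ContinuousAt, h.zero]; exact hA0
      exact this.continuousWithinAt
    · exact (h.deriv t ht ht0).continuousAt.continuousWithinAt
  · simp only [coeff_fourierSum (summable_norm_seq hs _)]
    refine (isL2sCurve_one_iff hIoo).2 ⟨A, _, fun t ht => h.deriv t ht.1 ht.2, fun t ht => ?_,
      fun _ _ _ => rfl⟩
    exact (continuousAt_field hs c M ht.2 (h.deriv t ht.1 ht.2).continuousAt).continuousWithinAt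

theorem hsPFNormLE_of_isLineSolution (hs : 1 / 2 < s) {c γ : ℝ} (hγ0 : 0 < γ) (hγ1 : γ < 1)
    {T : ℝ} {α : L2} {A : ℝ → L2} (h : IsLineSolution s c M T α A) :
    ∃ C : ℝ, ∀ t ∈ Ioo (-T) T, HsPFNormLE s (schrodingerGroup (-t)
      (schrodingerGroup t (comb (seq s (A t)))) - comb (seq s α)) (C * |t| ^ γ) := by
  obtain ⟨C, hC⟩ := h.bound
  refine ⟨|C| * T ^ (1 - γ), fun t ht => ⟨fourierSum (seq s (A t - α)), ?_, ?_⟩⟩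
  · rw [schrodingerGroup_neg_apply, ← comb_sub hs]
    exact isHsPF_comb hs _
  · have ht' : |t| ≤ T := (abs_lt.2 ht).le
    have h1 : |t| = |t| ^ (1 - γ) * |t| ^ γ := by
      rw [← Real.rpow_add_of_nonneg (abs_nonneg t) (by linarith) hγ0.le, sub_add_cancel,
        Real.rpow_one]
    rw [coeff_fourierSum (summable_norm_seq hs _), l2sNorm_seq]
    calc ‖A t - α‖ ≤ |C| * |t| := (hC t ht).trans
          (mul_le_mul_of_nonneg_right (le_abs_self C) (abs_nonneg t))
      _ = |C| * |t| ^ (1 - γ) * |t| ^ γ := by rw [mul_assoc, ← h1]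
      _ ≤ |C| * T ^ (1 - γ) * |t| ^ γ := by
          refine mul_le_mul_of_nonneg_right (mul_le_mul_of_nonneg_left ?_ (abs_nonneg C))
            (Real.rpow_nonneg (abs_nonneg t) γ)
          exact Real.rpow_le_rpow (abs_nonneg t) ht' (by linarith)

/-- A function whose improper integrals from `0` are given by `H` up to a constant has derivative
`h`. -/
theorem hasDerivAt_of_tendsto_integral {T : ℝ} {H h : ℝ → ℂ} {H₀ : ℂ}
    (hh : ∀ t ∈ Ioo (-T) T, t ≠ 0 → ContinuousAt h t)
    (hlim : ∀ t ∈ Ioo (-T) T, t ≠ 0 →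
      Tendsto (fun ε : ℝ => ∫ τ in (ε * t)..t, h τ) (𝓝[>] 0) (𝓝 (H t - H₀)))
    {t : ℝ} (ht : t ∈ Ioo (-T) T) (ht0 : t ≠ 0) : HasDerivAt H (h t) t := by
  have hint : ∀ t ∈ Ioo (-T) T, t ≠ 0 → ∀ lam, 0 < lam → lam ≤ 1 →
      IntervalIntegrable h volume (lam * t) t := fun t ht ht0 lam hl0 hl1 =>
    ContinuousOn.intervalIntegrable fun τ hτ => by
      obtain ⟨h1, h2⟩ := mem_of_mem_uIcc ht ht0 hl0 hl1 hτ
      exact (hh τ h1 h2).continuousWithinAt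
  have key : ∀ t ∈ Ioo (-T) T, t ≠ 0 → ∀ lam ∈ Ioo (0 : ℝ) 1,
      H t - H (lam * t) = ∫ τ in (lam * t)..t, h τ := by
    intro t ht ht0 lam hl
    have hlt0 : lam * t ≠ 0 := mul_ne_zero hl.1.ne' ht0
    have hlt := (mem_of_mem_uIcc ht ht0 hl.1 hl.2.le left_mem_uIcc).1
    have h1 := hlim t ht ht0
    have h2 : Tendsto (fun ε : ℝ => ∫ τ in (ε * t)..(lam * t), h τ) (𝓝[>] 0)
        (𝓝 (H (lam * t) - H₀)) := by
      -- The lower limit at the point `lam * t` is rescaled to `ε * t`, so that the two integrals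
      -- start at the same point and can be subtracted.
      have h3 : Tendsto (fun ε : ℝ => ε / lam) (𝓝[>] 0) (𝓝[>] 0) := by
        refine tendsto_nhdsWithin_iff.2 ⟨?_, ?_⟩
        · have : Tendsto (fun ε : ℝ => ε / lam) (𝓝 0) (𝓝 (0 / lam)) :=
            (by fun_prop : Continuous fun ε : ℝ => ε / lam).tendsto 0
          rw [zero_div] at this
          exact tendsto_nhdsWithin_of_tendsto_nhds this
        · filter_upwards [self_mem_nhdsWithin] with ε hε using div_pos hε hl.1
      refine ((hlim (lam * t) hlt hlt0).comp h3).congr fun ε => ?_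
      simp only [Function.comp]
      rw [← mul_assoc, div_mul_cancel₀ _ hl.1.ne']
    have h4 := h1.sub h2
    rw [sub_sub_sub_cancel_right] at h4
    refine tendsto_nhds_unique h4 (tendsto_const_nhds.congr' ?_)
    filter_upwards [Ioo_mem_nhdsGT hl.1] with ε hε
    have h5 := hint t ht ht0 ε hε.1 (hε.2.trans hl.2).le
    have h6 := hint t ht ht0 lam hl.1 hl.2.le
    rw [← intervalIntegral.integral_add_adjacent_intervals (h5.trans h6.symm) h6,
      add_sub_cancel_left]
  -- The base point lies on the same side of zero as `t`. For `r` near `t` it equals `lam * r` with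
  -- `lam = t₀ / r` near `1/2`.
  set t₀ := 2⁻¹ * t
  have ht₀ : t₀ ≠ 0 := mul_ne_zero (by norm_num) ht0
  have h1 : HasDerivAt (fun r => H t₀ + ∫ τ in t₀..r, h τ) (h t) t := by
    refine HasDerivAt.const_add _ (intervalIntegral.integral_hasDerivAt_right
      (hint t ht ht0 2⁻¹ (by norm_num) (by norm_num)) ?_ (hh t ht ht0))
    have hopen : IsOpen (Ioo (-T) T \ {0}) := isOpen_Ioo.sdiff isClosed_singleton
    exact ContinuousOn.stronglyMeasurableAtFilter hopen
      (fun τ hτ => (hh τ hτ.1 hτ.2).continuousWithinAt) t ⟨ht, ht0⟩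
  refine h1.congr_of_eventuallyEq ?_
  have h2 : ∀ᶠ r in 𝓝 t, t₀ / r ∈ Ioo (0 : ℝ) 1 := by
    have h3 : ContinuousAt (fun r : ℝ => t₀ / r) t := continuousAt_const.div continuousAt_id ht0
    refine h3.eventually_mem (Ioo_mem_nhds ?_ ?_)
    · simp only [t₀, mul_div_assoc, div_self ht0]; norm_num
    · simp only [t₀, mul_div_assoc, div_self ht0]; norm_num
  filter_upwards [h2, isOpen_Ioo.mem_nhds ht, isOpen_ne.mem_nhds ht0] with r hr hrT hr0
  have h3 := key r hrT hr0 _ hr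
  rw [div_mul_cancel₀ _ hr0] at h3
  rw [← h3, add_sub_cancel]

/-- The regularity hypothesis makes `e^{-itΔ}u(t)` a comb with coefficients `A(t)`. Uniqueness of
the representing functions identifies `U` and `G`, and Duhamel's formula identifies `D` with a
multiple of `A(t) - α`. Differentiating the tested formula and using injectivity of combs gives the
coefficient equation. -/
theorem exists_line_of_isDuhamelSolution (hs : 1 / 2 < s) (hσ : σ ≠ 0) {T : ℝ} (hT : 0 < T)
    {α : L2} {u : ℝ → 𝓢'(ℝ, ℂ)} (h : IsDuhamelSolution s σ M T (comb (seq s α)) u) :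
    ∃ A : ℝ → L2, (∀ t ∈ Ioo (-T) T, t ≠ 0 →
        HasDerivAt A (field s (σ / (8 * Real.pi)) M t (A t)) t) ∧
      Tendsto A (𝓝 0) (𝓝 α) ∧
      ∀ t ∈ Ioo (-T) T, u t = schrodingerGroup t (comb (seq s (A t))) := by
  set c := σ / (8 * Real.pi)
  set z : ℂ := -(2 * Complex.I / σ)
  have hz : z ≠ 0 := right_ne_zero_of_mul_eq_one (duhamel_const_mul hσ)
  obtain ⟨g, hg, hg0, hg1⟩ := h.regular
  obtain ⟨U, G, D, hUG, hD⟩ := h.duhamel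
  have hopen : IsOpen (Ioo (-T) T \ {0}) := isOpen_Ioo.sdiff isClosed_singleton
  obtain ⟨A, hAc, hA⟩ := isL2sCurve_zero_iff.1 hg0
  obtain ⟨r, r', hr, hr', hrg⟩ := (isL2sCurve_one_iff hopen).1 hg1
  have hAr : ∀ t ∈ Ioo (-T) T \ {0}, A t = r t := fun t ht =>
    seq_injective s fun k => by rw [hA t ht.1, hrg t ht]
  have hAd : ∀ t ∈ Ioo (-T) T \ {0}, HasDerivAt A (r' t) t := fun t ht => by
    refine (hr t ht).congr_of_eventuallyEq ?_
    filter_upwards [hopen.mem_nhds ht] with τ hτ using hAr τ hτ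
  have hcomb : ∀ t ∈ Ioo (-T) T, schrodingerGroup (-t) (u t) = comb (seq s (A t)) := fun t ht =>
    eq_comb_of_isHsPF hs (hg t ht) (hA t ht)
  have hu : ∀ t ∈ Ioo (-T) T, u t = schrodingerGroup t (comb (seq s (A t))) := fun t ht => by
    rw [← hcomb t ht, schrodingerGroup_apply_neg]
  have hG : ∀ t ∈ Ioo (-T) T \ {0},
      schrodingerGroup (-t) (G t) = comb (seq s (z • field s c M t (A t))) := fun t ht => by
    obtain ⟨h1, h2⟩ := hUG t ht
    rw [hu t ht.1] at h1
    have h3 : U t = synth s t (A t) := h1.eq_right (isGivenBy_synth hs ht.2 _)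
    rw [h3] at h2
    rw [h2.eq_left (isGivenBy_nonlinearity hs hσ ht.2 (A t)), schrodingerGroup_neg_apply]
  have hDt : ∀ t ∈ Ioo (-T) T, D t = comb (seq s (z • (A t - α))) := fun t ht => by
    have h1 := congrArg (schrodingerGroup (-t)) (hD t ht).2
    rw [hcomb t ht, map_add, map_smul, schrodingerGroup_neg_apply, schrodingerGroup_neg_apply] at h1
    rw [comb_smul hs, comb_sub hs, h1, add_sub_cancel_left, smul_smul, mul_comm,
      duhamel_const_mul hσ, one_smul]
  have h0 : (0 : ℝ) ∈ Ioo (-T) T := ⟨by linarith, hT⟩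
  -- At `t = 0` all the truncated integrals are over a point, so `D 0 = 0` and the initial value is
  -- attained.
  have hA0 : A 0 = α := by
    have h1 : D 0 = comb (seq s 0) := by
      ext φ
      have h2 := ((hD 0 h0).1 φ).2
      simp only [mul_zero, intervalIntegral.integral_same] at h2
      rw [tendsto_nhds_unique h2 tendsto_const_nhds, ← combL_apply hs, map_zero]
    rw [hDt 0 h0] at h1
    exact sub_eq_zero.1 ((smul_eq_zero.1 (comb_injective hs h1)).resolve_left hz)
  refine ⟨A, fun t ht ht0 => ?_, ?_, hu⟩
  · refine (hAd t ⟨ht, ht0⟩).congr_deriv (smul_right_injective L2 hz (comb_injective hs ?_))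
    ext φ
    have h1 : HasDerivAt (fun τ => combL hs φ (z • A τ)) (combL hs φ (z • r' t)) t :=
      ((combL hs φ).restrictScalars ℝ).hasFDerivAt.comp_hasDerivAt t
        ((hAd t ⟨ht, ht0⟩).const_smul z)
    have h2 : HasDerivAt (fun τ => combL hs φ (z • A τ))
        (combL hs φ (z • field s c M t (A t))) t := by
      refine hasDerivAt_of_tendsto_integral (T := T)
        (h := fun τ => combL hs φ (z • field s c M τ (A τ))) (H₀ := combL hs φ (z • α))
        (fun τ hτ hτ0 => ?_) (fun τ hτ hτ0 => ?_) ht ht0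
      · exact (combL hs φ).continuous.continuousAt.comp ((continuousAt_field hs c M hτ0
          (hAd τ ⟨hτ, hτ0⟩).continuousAt).const_smul z)
      · have h3 := ((hD τ hτ).1 φ).2
        rw [hDt τ hτ, smul_sub] at h3
        rw [← map_sub]
        refine h3.congr' ?_
        filter_upwards [Ioo_mem_nhdsGT one_pos] with ε hε
        refine intervalIntegral.integral_congr fun τ' hτ' => ?_
        obtain ⟨h4, h5⟩ := mem_of_mem_uIcc hτ hτ0 hε.1 hε.2.le hτ'
        rw [hG τ' ⟨h4, h5⟩, combL_apply]
    exact h1.unique h2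
  · have h1 := (hAc.continuousAt (Ioo_mem_nhds h0.1 h0.2)).tendsto
    rwa [hA0] at h1

theorem exists_diracSum_eq_comb (s : ℝ) (S : Finset ℤ) (α : ℤ → ℂ) {a : ℝ}
    (hα : ∀ k ∈ S, ‖α k‖ = a) :
    ∃ x : L2, diracSum S α = comb (seq s x) ∧ (∀ k, seq s x k = 0 ∨ ‖seq s x k‖ = a) ∧
      mass s x = S.card * a ^ 2 := by
  classical
  have h0 : ∀ k ∉ S, (if k ∈ S then α k else 0) = 0 := fun k hk => if_neg hk
  obtain ⟨x, hx⟩ := exists_seq_eq (s := s) (a := fun k => if k ∈ S then α k else 0)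
    (summable_of_ne_finset_zero (s := S) fun k hk => by simp [h0 k hk])
  refine ⟨x, ?_, fun k => ?_, ?_⟩
  · ext φ
    have h1 : Summable fun k => ‖seq s x k‖ :=
      summable_of_ne_finset_zero (s := S) fun k hk => by rw [hx, h0 k hk, norm_zero]
    rw [← (hasSum_comb h1 φ).tsum_eq, tsum_eq_sum (s := S) fun k hk => by rw [hx, h0 k hk, zero_mul]]
    have h2 : diracSum S α φ = ∑ k ∈ S, α k * φ k := by
      simp [diracSum]
    rw [h2]
    exact Finset.sum_congr rfl fun k hk => by rw [hx, if_pos hk]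
  · rw [hx]
    by_cases hk : k ∈ S
    · rw [if_pos hk]; exact Or.inr (hα k hk)
    · exact Or.inl (if_neg hk)
  · rw [mass, tsum_eq_sum (s := S) fun k hk => by rw [hx, h0 k hk]; simp]
    rw [Finset.sum_congr rfl fun k hk => by rw [hx, if_pos hk, hα k hk]]
    simp

/-- The statement for finitely many Dirac masses of equal modulus. -/
theorem wellPosed_diracSum {γ : ℝ} (hs : 1 / 2 < s) (hγ0 : 0 < γ) (hγ1 : γ < 1) (hσ : σ ≠ 0)
    (S : Finset ℤ) (α : ℤ → ℂ) {a : ℝ} (hα : ∀ k ∈ S, ‖α k‖ = a)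
    (hM : M = ((S.card : ℝ) - 1 / 2) * a ^ 2) :
    (∃ T : ℝ, 0 < T ∧ ∃ u : ℝ → 𝓢'(ℝ, ℂ),
      IsDuhamelSolution s σ M T (diracSum S α) u ∧
      ∃ C : ℝ, ∀ t ∈ Ioo (-T) T,
        HsPFNormLE s (schrodingerGroup (-t) (u t) - diracSum S α) (C * |t| ^ γ)) ∧
    (∀ T : ℝ, 0 < T → ∀ u₁ u₂ : ℝ → 𝓢'(ℝ, ℂ),
      IsDuhamelSolution s σ M T (diracSum S α) u₁ → IsDuhamelSolution s σ M T (diracSum S α) u₂ →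
      ∀ t ∈ Ioo (-T) T, u₁ t = u₂ t) ∧
    (1 ≤ s → ∃ u : ℝ → 𝓢'(ℝ, ℂ), ∀ T : ℝ, 0 < T →
      IsDuhamelSolution s σ M T (diracSum S α) u ∧
      ∃ C : ℝ, ∀ t ∈ Ioo (-T) T,
        HsPFNormLE s (schrodingerGroup (-t) (u t) - diracSum S α) (C * |t| ^ γ)) := by
  obtain ⟨x, hx, hxa, hxm⟩ := exists_diracSum_eq_comb s S α hα
  -- The mass is `N a²`, so the prescribed `M` is the mass lowered by `a²/2`, exactly the shift that
  -- absorbs the common logarithmic phase.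
  obtain rfl : M = mass s x - a ^ 2 / 2 := by rw [hM, hxm]; ring
  rw [hx]
  refine ⟨?_, fun T hT u₁ u₂ h₁ h₂ t ht => ?_, fun hs1 => ?_⟩
  · obtain ⟨T, hT, A, hA⟩ := exists_line_solution hs (σ / (8 * Real.pi)) hxa
    exact ⟨T, hT, _, isDuhamelSolution_of_isLineSolution hs hσ hT hA,
      hsPFNormLE_of_isLineSolution hs hγ0 hγ1 hA⟩
  · obtain ⟨A, hA, hA0, hAu⟩ := exists_line_of_isDuhamelSolution hs hσ hT h₁
    obtain ⟨B, hB, hB0, hBu⟩ := exists_line_of_isDuhamelSolution hs hσ hT h₂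
    rw [hAu t ht, hBu t ht, line_solution_unique hs hxa hA hB hA0 hB0 ht]
  · obtain ⟨A, hA⟩ := exists_global_line_solution hs1 (σ / (8 * Real.pi)) hxa
    exact ⟨_, fun T hT => ⟨isDuhamelSolution_of_isLineSolution hs hσ hT (hA T hT),
      hsPFNormLE_of_isLineSolution hs hγ0 hγ1 (hA T hT)⟩⟩

end DiracNLS

end

theorem theorem1p2 (s γ σ : ℝ) (hs : 1 / 2 < s) (hγ0 : 0 < γ) (hγ1 : γ < 1)
    (hσ : σ = 1 ∨ σ = -1) :
    -- general coefficients
    (∀ α : ℤ → ℂ, DiracNLS.MemL2s s α →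
      -- local existence
      (∃ T : ℝ, 0 < T ∧ ∃ (u : ℝ → ℝ → ℂ) (R : ℝ → ℤ → ℂ),
        DiracNLS.IsAnsatzSolution s γ σ α T u R) ∧
      -- uniqueness on every interval
      (∀ T : ℝ, 0 < T → ∀ (u₁ u₂ : ℝ → ℝ → ℂ) (R₁ R₂ : ℝ → ℤ → ℂ),
        DiracNLS.IsAnsatzSolution s γ σ α T u₁ R₁ →
        DiracNLS.IsAnsatzSolution s γ σ α T u₂ R₂ →
        ∀ t ∈ Set.Ioo 0 T, u₁ t = u₂ t ∧ R₁ t = R₂ t) ∧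
      -- global existence
      (1 ≤ s → ∃ (u : ℝ → ℝ → ℂ) (R : ℝ → ℤ → ℂ),
        ∀ T : ℝ, 0 < T → DiracNLS.IsAnsatzSolution s γ σ α T u R)) ∧
    -- finitely many Dirac masses of equal modulus
    (∀ (S : Finset ℤ) (α : ℤ → ℂ) (a M : ℝ), (∀ k ∈ S, ‖α k‖ = a) →
      M = ((S.card : ℝ) - 1 / 2) * a ^ 2 →
      -- local existence
      (∃ T : ℝ, 0 < T ∧ ∃ u : ℝ → 𝓢'(ℝ, ℂ),
        DiracNLS.IsDuhamelSolution s σ M T (DiracNLS.diracSum S α) u ∧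
        ∃ C : ℝ, ∀ t ∈ Set.Ioo (-T) T,
          DiracNLS.HsPFNormLE s (DiracNLS.schrodingerGroup (-t) (u t) - DiracNLS.diracSum S α)
            (C * |t| ^ γ)) ∧
      -- uniqueness on every interval
      (∀ T : ℝ, 0 < T → ∀ u₁ u₂ : ℝ → 𝓢'(ℝ, ℂ),
        DiracNLS.IsDuhamelSolution s σ M T (DiracNLS.diracSum S α) u₁ →
        DiracNLS.IsDuhamelSolution s σ M T (DiracNLS.diracSum S α) u₂ →
        ∀ t ∈ Set.Ioo (-T) T, u₁ t = u₂ t) ∧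
      -- global existence
      (1 ≤ s → ∃ u : ℝ → 𝓢'(ℝ, ℂ), ∀ T : ℝ, 0 < T →
        DiracNLS.IsDuhamelSolution s σ M T (DiracNLS.diracSum S α) u ∧
        ∃ C : ℝ, ∀ t ∈ Set.Ioo (-T) T,
          DiracNLS.HsPFNormLE s (DiracNLS.schrodingerGroup (-t) (u t) - DiracNLS.diracSum S α)
            (C * |t| ^ γ))) := by
  have hσ0 : σ ≠ 0 := by rcases hσ with rfl | rfl <;> norm_num
  exact ⟨fun α hα => DiracNLS.wellPosed_ansatz hs hγ0 hγ1 σ α hα,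
    fun S α a M hα hM => DiracNLS.wellPosed_diracSum hs hγ0 hγ1 hσ0 S α hα hM⟩
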